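/- Let $G$ be a finite simple graph on $n\ge 1$ vertices, and let $f:2^{V(G)}\to\mathbb{R}_{\ge 0}$ be monotone ($X\subseteq Y$ implies $f(X)\le f(Y)$). The $f$-width of a tree decomposition of $G$ is the maximum of $f$ over its bags; the $f$-tree-width $\mathrm{tw}_f(G)$ is the minimum $f$-width of a tree decomposition of $G$, and a tree decomposition that attains it is called $f$-optimal. A set $S$ is a minimal separator of $G$ if, for some non-adjacent vertices $u\neq v$, it is inclusion-minimal among the sets $X\subseteq V(G)\setminus\{u,v\}$ such that $u$ and $v$ lie in different components of $G-X$ (so $S=\emptyset$ is allowed if $G$ is disconnected). Let $\Delta_G$ be the set of minimal separators, and let $\Pi_G$ be the set of potential maximal cliques, i.e. of the maximal cliques of the inclusion-minimal chordal supergraphs of $G$ on $V(G)$. A full block is a pair $(S,C)$ with $S\in\Delta_G$ and $C$ a component of $G-S$ with $N(C)=S$; it is inclusion-minimal if $S\cup C$ does not properly contain $S'\cup C'$ for any full block $(S',C')$. For $\Omega\in\Pi_G$, the blocks associated with $\Omega$ are the pairs $(N(C_i),C_i)$ with $C_i$ a component of $G-\Omega$. A table of $f$ with respect to $G$ is a list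 of all inclusion-minimal full blocks $(S,C)$ and all potential maximal cliques $\Omega$ of $G$ together with the values $f(S\cup C)$ and $f(\Omega)$. Algorithm 1. Compute all full blocks and sort them by increasing $|S\cup C|$. For each full block $(S,C)$ in this order: set $A(S,C):=f(S\cup C)$ if $(S,C)$ is inclusion-minimal, and $A(S,C):=\infty$ otherwise; then for every $\Omega\in\Pi_G$ with $S\subsetneq\Omega\subseteq S\cup C$ set $$A(S,C):=\min\bigl\{A(S,C),\ \max\{f(\Omega),\ \max_i A(S_i,C_i)\}\bigr\},$$ where $(S_i,C_i)$ ranges over the full blocks associated with $\Omega$ such that $S_i\cup C_i\subseteq S\cup C$. Finally return $$\min_{S}\ \max_{C}\ A(S,C),$$ where $S$ ranges over the inclusion-minimal elements of $\Delta_G$ and $C$ over the components of $G-S$ with $N(C)=S$; if $\Delta_G=\emptyset$ (i.e. $G$ is complete), return $f(V(G))$ instead. Claim. For every ordering of the full blocks by increasing size, Algorithm 1 returns $\mathrm{tw}_f(G)$. Moreover, there are a constant $c$ and a single program for a random access machine with the following property. For all $n$, $G$ and $f$ as above, given $G$, lists (in any order) of $\Delta_G$ and of $\Pi_G$, and a table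 of $f$ with respect to $G$, the program halts after at most $$c\cdot\bigl(n^2\,|\Delta_G|+n^3\,|\Pi_G|\bigr)$$ steps, and it outputs the sorted list of full blocks with the final values $A(S,C)$ of Algorithm 1, the value returned by Algorithm 1, which equals $\mathrm{tw}_f(G)$, and an $f$-optimal tree decomposition of $G$. Here the machine works on natural numbers by addition, truncated subtraction, comparison and indirect addressing, at unit cost, and the numbers it stores are at most polynomial in $n^2|\Delta_G|+n^3|\Pi_G|$. Values of $f$ are held in separate cells, and the machine can only copy them, compare them and set cells to $\infty$, again at unit cost. Sets of vertices and the rows of the adjacency matrix are given as 0/1-vectors of length $n$. -/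

import Mathlib

open scoped NNReal ENNReal

noncomputable section

namespace FTW

/-! ### Separators, blocks and potential maximal cliques -/

section Graphs

variable {V : Type*} [Fintype V] [DecidableEq V]

/-- `L` lists every element of `s` exactly once. -/
def IsListing {α : Type*} (L : List α) (s : Set α) : Prop :=
  L.Nodup ∧ ∀ x, x ∈ L ↔ x ∈ s

open Classical in
/-- The neighborhood `N(C)` of a set `C` of vertices; it is disjoint from `C`. -/
def nbhd (G : SimpleGraph V) (C : Finset V) : Finset V :=
  Finset.univ.filter fun u => u ∉ C ∧ ∃ v ∈ C, G.Adj v u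

/-- `C` is (the vertex set of) a connected component of `G - X`. -/
def IsComp (G : SimpleGraph V) (X C : Finset V) : Prop :=
  ∃ D : G.ComponentCompl (X : Set V), D.supp = (C : Set V)

/-- `C` is a full component of `G - S`. -/
def IsFullComp (G : SimpleGraph V) (S C : Finset V) : Prop :=
  IsComp G S C ∧ nbhd G C = S

/-- The non-adjacent vertices `u`, `v` lie in different components of `G - S`. -/
def IsSeparator (G : SimpleGraph V) (u v : V) (S : Finset V) : Prop :=
  u ≠ v ∧ ¬ G.Adj u v ∧ ∃ (hu : u ∉ (S : Set V)) (hv : v ∉ (S : Set V)),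
    G.componentComplMk hu ≠ G.componentComplMk hv

/-- `S` is a minimal `u,v`-separator for some `u`, `v`. -/
def IsMinSep (G : SimpleGraph V) (S : Finset V) : Prop :=
  ∃ u v, IsSeparator G u v S ∧ ∀ S', S' ⊂ S → ¬ IsSeparator G u v S'

/-- Every cycle of length at least four has a chord. -/
def IsChordal (G : SimpleGraph V) : Prop :=
  ∀ (v : V) (w : G.Walk v v), w.IsCycle → 4 ≤ w.length →
    ∃ x ∈ w.support, ∃ y ∈ w.support, G.Adj x y ∧ s(x, y) ∉ w.edges

/-- `I` is an (inclusion-)minimal triangulation of `G`. -/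
def IsMinTriangulation (G I : SimpleGraph V) : Prop :=
  G ≤ I ∧ IsChordal I ∧ ∀ I' : SimpleGraph V, G ≤ I' → I' < I → ¬ IsChordal I'

/-- Potential maximal cliques. -/
def IsPMC (G : SimpleGraph V) (Ω : Finset V) : Prop :=
  ∃ I : SimpleGraph V, IsMinTriangulation G I ∧ Maximal I.IsClique (Ω : Set V)

/-- The set `Δ_G` of minimal separators. -/
def minSeps (G : SimpleGraph V) : Set (Finset V) := {S | IsMinSep G S}

/-- The set `Π_G` of potential maximal cliques. -/
def pmcs (G : SimpleGraph V) : Set (Finset V) := {Ω | IsPMC G Ω}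

/-- Full blocks `(S, C)`: `S` is a minimal separator and `C` a full component of `G - S`. -/
def fullBlocks (G : SimpleGraph V) : Set (Finset V × Finset V) :=
  {b | IsMinSep G b.1 ∧ IsFullComp G b.1 b.2}

/-- Full blocks `(S, C)` such that `S ∪ C` properly contains no `S' ∪ C'` for a full block
`(S', C')`. -/
def minFullBlocks (G : SimpleGraph V) : Set (Finset V × Finset V) :=
  {b | b ∈ fullBlocks G ∧ ∀ b' ∈ fullBlocks G, ¬ (b'.1 ∪ b'.2 ⊂ b.1 ∪ b.2)}

/-- `L` lists the full blocks `(S, C)` of `G`, in increasing order of `|S ∪ C|`. -/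
def IsBlockOrder (G : SimpleGraph V) (L : List (Finset V × Finset V)) : Prop :=
  IsListing L (fullBlocks G) ∧
    L.Pairwise fun b b' => (b.1 ∪ b.2).card ≤ (b'.1 ∪ b'.2).card

/-! ### Tree decompositions -/

/-- `(T, B)` is a tree decomposition of `G`. -/
structure IsTreeDecomp {ι : Type*} (G : SimpleGraph V) (T : SimpleGraph ι) (B : ι → Finset V) :
    Prop where
  isTree : T.IsTree
  cover : ∀ v, ∃ t, v ∈ B t
  edge : ∀ u v, G.Adj u v → ∃ t, u ∈ B t ∧ v ∈ B t
  subtree : ∀ v, (T.induce {t | v ∈ B t}).Connected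

/-- The largest value of `f` on a bag. -/
def width {ι : Type*} [Fintype ι] (f : Finset V → ℝ≥0) (B : ι → Finset V) : ℝ≥0 :=
  Finset.univ.sup fun t => f (B t)

/-- The `f`-tree-width of `G`: the least `f`-width of a tree decomposition of `G`. -/
def ftw (f : Finset V → ℝ≥0) (G : SimpleGraph V) : ℝ≥0 :=
  sInf {w | ∃ (k : ℕ) (T : SimpleGraph (Fin k)) (B : Fin k → Finset V),
    IsTreeDecomp G T B ∧ width f B = w}

/-! ### The dynamic program

A table `A` holds the current value for each full block; `∞` is `⊤ : ℝ≥0∞`. -/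

/-- `max_i {f(Ω), A(S_i, C_i)}` over the full blocks `(S_i, C_i) = (N(C_i), C_i)`
associated with `Ω` that satisfy `S_i ∪ C_i ⊆ S ∪ C`, where `b = (S, C)`. -/
def candidate (G : SimpleGraph V) (f : Finset V → ℝ≥0) (A : Finset V × Finset V → ℝ≥0∞)
    (b : Finset V × Finset V) (Ω : Finset V) : ℝ≥0∞ :=
  max (f Ω : ℝ≥0∞)
    (⨆ (C : Finset V) (_ : IsComp G Ω C ∧ (nbhd G C, C) ∈ fullBlocks G ∧
      nbhd G C ∪ C ⊆ b.1 ∪ b.2), A (nbhd G C, C))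

open Classical in
/-- The inner loop's body: the entry at `b = (S, C)` is improved if `S ⊂ Ω ⊆ S ∪ C`. -/
def innerStep (G : SimpleGraph V) (f : Finset V → ℝ≥0) (b : Finset V × Finset V)
    (A : Finset V × Finset V → ℝ≥0∞) (Ω : Finset V) : Finset V × Finset V → ℝ≥0∞ :=
  if b.1 ⊂ Ω ∧ Ω ⊆ b.1 ∪ b.2 then
    Function.update A b (min (A b) (candidate G f A b Ω))
  else A

open Classical in
/-- The outer loop's body: initialize the entry at `b`, then run through the list `P` of
potential maximal cliques. -/
def outerStep (G : SimpleGraph V) (f : Finset V → ℝ≥0) (P : List (Finset V))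
    (A : Finset V × Finset V → ℝ≥0∞) (b : Finset V × Finset V) :
    Finset V × Finset V → ℝ≥0∞ :=
  P.foldl (innerStep G f b)
    (Function.update A b (if b ∈ minFullBlocks G then (f (b.1 ∪ b.2) : ℝ≥0∞) else ⊤))

/-- The table after the outer loop has run through the ordered list `L` of full blocks. -/
def blockTable (G : SimpleGraph V) (f : Finset V → ℝ≥0) (P : List (Finset V))
    (L : List (Finset V × Finset V)) : Finset V × Finset V → ℝ≥0∞ :=
  L.foldl (outerStep G f P) fun _ => ⊤

/-- The value returned by the algorithm on the lists `D` of minimal separators, `P` of potential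
maximal cliques and `L` of full blocks: the minimum over the inclusion-minimal separators `S` of
the maximum of the table over the full components of `G - S`. A graph without minimal separators
is complete; the value is then that of the only potential maximal clique. -/
def algorithmValue (G : SimpleGraph V) (f : Finset V → ℝ≥0) (D P : List (Finset V))
    (L : List (Finset V × Finset V)) : ℝ≥0∞ :=
  if D = [] then (f Finset.univ : ℝ≥0∞)
  else ⨅ (S : Finset V) (_ : S ∈ D ∧ ∀ S' ∈ D, ¬ (S' ⊂ S)),
    ⨆ (C : Finset V) (_ : IsFullComp G S C), blockTable G f P L (S, C)

end Graphs

/-! ### A random access machine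

Programs are structured. A state has registers and a memory of natural numbers, and a memory of
values in `ℝ≥0∞`, which a program can only copy, compare and set to `∞`. The only arithmetic
on numbers is addition and truncated subtraction. Each node of an expression, each test and
each command costs one step. A program gets stuck if it stores a number or uses an address for
storing that is not below the word bound `W`. -/

structure State where
  reg : ℕ → ℕ
  mem : ℕ → ℕ
  val : ℕ → ℝ≥0∞

inductive Expr where
  | const (k : ℕ)
  | reg (x : ℕ)
  | add (a b : Expr)
  | sub (a b : Expr)
  | load (a : Expr)

def Expr.eval (s : State) : Expr → ℕ
  | .const k => k
  | .reg x => s.reg x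
  | .add a b => a.eval s + b.eval s
  | .sub a b => a.eval s - b.eval s
  | .load a => s.mem (a.eval s)

def Expr.cost : Expr → ℕ
  | .const _ => 1
  | .reg _ => 1
  | .add a b => a.cost + b.cost + 1
  | .sub a b => a.cost + b.cost + 1
  | .load a => a.cost + 1

inductive Test where
  | lt (a b : Expr)
  | eq (a b : Expr)
  /-- Compares the values stored at two addresses. -/
  | valLe (a b : Expr)
  | not (t : Test)
  | and (t u : Test)

def Test.Holds (s : State) : Test → Prop
  | .lt a b => a.eval s < b.eval s
  | .eq a b => a.eval s = b.eval s
  | .valLe a b => s.val (a.eval s) ≤ s.val (b.eval s)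
  | .not t => ¬ t.Holds s
  | .and t u => t.Holds s ∧ u.Holds s

def Test.cost : Test → ℕ
  | .lt a b => a.cost + b.cost + 1
  | .eq a b => a.cost + b.cost + 1
  | .valLe a b => a.cost + b.cost + 1
  | .not t => t.cost + 1
  | .and t u => t.cost + u.cost + 1

inductive Program where
  | skip
  /-- Store the number `e` in register `x`. -/
  | assign (x : ℕ) (e : Expr)
  /-- Store the number `e` at address `a`. -/
  | store (a e : Expr)
  /-- Copy the value at address `e` to address `a`. -/
  | valCopy (a e : Expr)
  /-- Store `∞` at address `a` of the value memory. -/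
  | valTop (a : Expr)
  | seq (p q : Program)
  | ite (t : Test) (p q : Program)
  | while (t : Test) (p : Program)

/-- `Exec W p s k s'`: with word bound `W`, the program `p` started in the state `s` halts after
`k` steps in the state `s'`. -/
inductive Exec (W : ℕ) : Program → State → ℕ → State → Prop where
  | skip (s : State) : Exec W .skip s 1 s
  | assign (s : State) (x : ℕ) (e : Expr) (he : e.eval s < W) :
      Exec W (.assign x e) s (e.cost + 1)
        { s with reg := Function.update s.reg x (e.eval s) }
  | store (s : State) (a e : Expr) (ha : a.eval s < W) (he : e.eval s < W) :
      Exec W (.store a e) s (a.cost + e.cost + 1)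
        { s with mem := Function.update s.mem (a.eval s) (e.eval s) }
  | valCopy (s : State) (a e : Expr) (ha : a.eval s < W) :
      Exec W (.valCopy a e) s (a.cost + e.cost + 1)
        { s with val := Function.update s.val (a.eval s) (s.val (e.eval s)) }
  | valTop (s : State) (a : Expr) (ha : a.eval s < W) :
      Exec W (.valTop a) s (a.cost + 1)
        { s with val := Function.update s.val (a.eval s) ⊤ }
  | seq {p q : Program} {s s' s'' : State} {k l : ℕ} (hp : Exec W p s k s')
      (hq : Exec W q s' l s'') : Exec W (.seq p q) s (k + l) s''
  | iteTrue {t : Test} {p : Program} (q : Program) {s s' : State} {k : ℕ} (ht : t.Holds s)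
      (hp : Exec W p s k s') : Exec W (.ite t p q) s (t.cost + k + 1) s'
  | iteFalse {t : Test} (p : Program) {q : Program} {s s' : State} {k : ℕ} (ht : ¬ t.Holds s)
      (hq : Exec W q s k s') : Exec W (.ite t p q) s (t.cost + k + 1) s'
  | whileFalse {t : Test} (p : Program) {s : State} (ht : ¬ t.Holds s) :
      Exec W (.while t p) s (t.cost + 1) s
  | whileTrue {t : Test} {p : Program} {s s' s'' : State} {k l : ℕ} (ht : t.Holds s)
      (hp : Exec W p s k s') (hw : Exec W (.while t p) s' l s'') :
      Exec W (.while t p) s (t.cost + k + l + 1) s''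

/-! ### Input and output -/

section InOut

variable {n : ℕ}

open Classical in
/-- A set of vertices as `n` numbers, `1` for the elements and `0` for the others. -/
def bits (S : Finset (Fin n)) : List ℕ :=
  List.ofFn fun i => if i ∈ S then 1 else 0

open Classical in
/-- The rows of the adjacency matrix. -/
def adjBits (G : SimpleGraph (Fin n)) : List ℕ :=
  (List.finRange n).flatMap fun i => bits (Finset.univ.filter fun j => G.Adj i j)

/-- The numbers of the input: `n`, the graph, the list `D` of minimal separators, the list `P` of
potential maximal cliques and the list `M` of inclusion-minimal full blocks, each list preceded
by its length. -/
def inputWords (G : SimpleGraph (Fin n)) (D P : List (Finset (Fin n)))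
    (M : List (Finset (Fin n) × Finset (Fin n))) : List ℕ :=
  [n] ++ adjBits G ++ [D.length] ++ D.flatMap bits ++ [P.length] ++ P.flatMap bits ++
    [M.length] ++ M.flatMap fun b => bits b.1 ++ bits b.2

/-- The values of the input: `f(Ω)` for `Ω` in `P`, then `f(S ∪ C)` for `(S, C)` in `M`. -/
def inputVals (f : Finset (Fin n) → ℝ≥0) (P : List (Finset (Fin n)))
    (M : List (Finset (Fin n) × Finset (Fin n))) : List ℝ≥0∞ :=
  P.map (fun Ω => (f Ω : ℝ≥0∞)) ++ M.map fun b => (f (b.1 ∪ b.2) : ℝ≥0∞)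

/-- The initial state: the two memories start with the input, everything else is `0`. -/
def initState (G : SimpleGraph (Fin n)) (f : Finset (Fin n) → ℝ≥0) (D P : List (Finset (Fin n)))
    (M : List (Finset (Fin n) × Finset (Fin n))) : State where
  reg := fun _ => 0
  mem := fun i => (inputWords G D P M).getD i 0
  val := fun i => (inputVals f P M).getD i 0

/-- The set of vertices written at the addresses `a, …, a + n - 1`. -/
def readSet (n : ℕ) (s : State) (a : ℕ) : Finset (Fin n) :=
  Finset.univ.filter fun v => s.mem (a + v) = 1

/-- The tree in the output: the number of nodes is in register `0`; register `1` holds the address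
of the array of parents, in which the entry of the root, node `0`, is ignored. -/
def outTree (s : State) : SimpleGraph (Fin (s.reg 0)) :=
  SimpleGraph.fromRel fun i j => 0 < i.val ∧ s.mem (s.reg 1 + i) = j

/-- The bags in the output; register `2` holds the address of their array. -/
def outBags (n : ℕ) (s : State) (t : Fin (s.reg 0)) : Finset (Fin n) :=
  readSet n s (s.reg 2 + t * n)

/-- The width in the output; register `3` holds its address. -/
def outValue (s : State) : ℝ≥0∞ := s.val (s.reg 3)

/-- The list of full blocks in the output: the length is in register `4`; register `5` holds the
address of the array, in which each block takes `2 * n` cells. -/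
def outBlocks (n : ℕ) (s : State) : List (Finset (Fin n) × Finset (Fin n)) :=
  (List.range (s.reg 4)).map fun i =>
    (readSet n s (s.reg 5 + 2 * i * n), readSet n s (s.reg 5 + (2 * i + 1) * n))

/-- The values of these blocks in the output; register `6` holds the address of their array. -/
def outBlockValues (s : State) : List ℝ≥0∞ :=
  (List.range (s.reg 4)).map fun i => s.val (s.reg 6 + i)

end InOut

end FTW

end

open FTW

/-!
The value of the recursion is compared with the tree-width in both directions, and a program that
evaluates the recursion is verified together with its running time.

*The value is at most the tree-width.* The bags of a tree decomposition, turned into cliques, give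
a chordal graph all of whose cliques lie in bags (`bagGraph_noHole`), and below it there is a minimal
triangulation `I` of `G` (`IsTreeDecomp.exists_isMinTriangulation`). No edge of `I` joins two
vertices that a clique of `I` separates in `G`, since removing such edges keeps the graph chordal
(`NoHole.cutEdges`, `IsMinTriangulation.not_adj`). Hence, if `S` is a clique of `I`, every full
block `(S, C)` contains a maximal clique `Ω` of `I` with `S ⊂ Ω ⊆ S ∪ C`: in a chordal graph, some
vertex of `C` is adjacent to all of `S` (`NoHole.exists_forall_adj`). The blocks associated with `Ω`
are full, smaller, and again have cliques of `I` as separators, so induction bounds the table at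
`(S, C)` by the width (`IsTable.le_of_isClique`), and `algorithmValue_le_ftw` follows. Chordality is
used in the form `NoHole`, which speaks of reachability and not of cycles.

*The value is attained.* The choices that attain the entries of the table, starting with a separator that
attains the outer minimum, grow a tree decomposition whose bags have at most the value returned.
`PartialTree` is the invariant: each node is responsible for a part of the vertices, these parts
partition the vertex set, and a node that receives a bag hands the components outside of its bag to
new nodes (`PartialTree.step`, `PartialTree.isTreeDecomp`). All parts except that of the root are
nonempty, so there are at most `n + 1` nodes. The same induction verifies the program that writes
the tree. The two inequalities make value, width and tree-width equal for the order the program computes;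
for the other orders, the recursion has only one solution (`IsTable.unique`).

*The program.* It is written in a language with named arrays and counting loops (`HCmd`), whose
semantics is a function on states and whose loops have the parameters of the input as their only
bounds. `HCmd.exec_compile` translates it to the machine. The translated program is fast because of
the nesting of its loops alone (`HCmd.nest`, `HCmd.cost_le`): a loop over the separators is nested
with at most two loops of length `n`, and one over the potential maximal cliques with at most three.
To stay within these limits,
* the components of `G - X` and their neighborhoods are found in `n²` steps, by inserting the
  vertices one by one and relabelling the components that meet (`run_labelsCmd`, `run_nbCmd`);
* the separator `N(D)` of a component `D` is looked up in `n` steps in a search tree for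
  0/1-vectors (`Trie`, `run_walkCmd`);
* a potential maximal clique `Ω` with `S ⊂ Ω ⊆ S ∪ C` belongs to a component `D` of `G - Ω` with
  `N(D) = S`, and `C` is then the component that contains `Ω \ S`; thus each `Ω` is tried for at
  most `n` blocks, each found from an entry for `D` (`PmcEntry`, `exists_entry_of_subset`);
* the blocks are handled by size, from `1` to `n`, in `n` passes over these at most `n |Π|` entries;
  an entry whose block has the right size costs `n` steps, for its candidate (`dpCmd`, `DPInv`).
-/

set_option linter.unusedSectionVars false
open scoped NNReal ENNReal
noncomputable section
namespace FTW

/-! ### Reachability inside a set of vertices -/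

section Reach

variable {V : Type*} {G H : SimpleGraph V} {A B : Set V} {u v w : V}

/-- `v` can be reached from `u` by a walk all of whose vertices, except possibly the first one,
lie in `A`. -/
def ReachIn (G : SimpleGraph V) (A : Set V) : V → V → Prop :=
  Relation.ReflTransGen fun a b => G.Adj a b ∧ b ∈ A

theorem ReachIn.refl (u : V) : ReachIn G A u u := Relation.ReflTransGen.refl

theorem ReachIn.trans (h : ReachIn G A u v) (h' : ReachIn G A v w) : ReachIn G A u w :=
  Relation.ReflTransGen.trans h h'

theorem ReachIn.step (h : ReachIn G A u v) (ha : G.Adj v w) (hw : w ∈ A) : ReachIn G A u w :=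
  Relation.ReflTransGen.tail h ⟨ha, hw⟩

theorem ReachIn.single (ha : G.Adj v w) (hw : w ∈ A) : ReachIn G A v w :=
  (ReachIn.refl v).step ha hw

theorem ReachIn.mono (hG : G ≤ H) (hA : A ⊆ B) (h : ReachIn G A u v) : ReachIn H B u v :=
  by
  induction h with
  | refl => exact .refl _
  | tail _ h ih => exact ih.step (hG h.1) (hA h.2)

theorem ReachIn.mono_compl {X Y : Finset V} (h : ReachIn G {x | x ∉ X} u v) (hXY : Y ⊆ X) :
    ReachIn G {x | x ∉ Y} u v :=
  h.mono le_rfl fun _ (hx : _ ∉ X) hy => hx (hXY hy)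

theorem ReachIn.mem (h : ReachIn G A u v) (hu : u ∈ A) : v ∈ A := by
  induction h with
  | refl => exact hu
  | tail _ h _ => exact h.2

theorem ReachIn.symm (h : ReachIn G A u v) (hu : u ∈ A) : ReachIn G A v u := by
  induction h with
  | refl => exact .refl _
  | @tail b c hb hbc ih => exact (ReachIn.single hbc.1.symm (ReachIn.mem hb hu)).trans ih

/-- A walk that starts in a set closed under adjacency inside `A` stays in that set. -/
theorem ReachIn.closed {C : Set V} (h : ReachIn G A u v) (hu : u ∈ C)
    (hC : ∀ a ∈ C, ∀ b ∈ A, G.Adj a b → b ∈ C) : v ∈ C := by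
  induction h with
  | refl => exact hu
  | tail _ h ih => exact hC _ ih _ h.2 h.1

theorem reachable_induce_iff (hu : u ∈ A) (hv : v ∈ A) :
    (G.induce A).Reachable ⟨u, hu⟩ ⟨v, hv⟩ ↔ ReachIn G A u v := by
  rw [SimpleGraph.reachable_iff_reflTransGen]
  constructor
  · intro h
    suffices ∀ y : A, Relation.ReflTransGen (G.induce A).Adj ⟨u, hu⟩ y → ReachIn G A u y from
      this _ h
    intro y h
    induction h with
    | refl => exact .refl _
    | @tail b c _ hbc ih => exact ih |>.step hbc c.2
  · intro h
    induction h with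
    | refl => exact .refl
    | @tail b c hb hbc ih =>
      exact (ih (ReachIn.mem hb hu)).tail (show G.Adj b c from hbc.1)

end Reach

/-! ### Components and minimal separators -/

section Components

variable {V : Type*} [Fintype V] [DecidableEq V] {G : SimpleGraph V} {X S S' C D : Finset V}
  {u v w : V}

open Classical in
/-- The vertices that can be reached from `v` by walks avoiding `X`: the component of `v` in
`G - X` if `v ∉ X`. -/
def compOf (G : SimpleGraph V) (X : Finset V) (v : V) : Finset V :=
  Finset.univ.filter fun u => ReachIn G {x | x ∉ X} v u

theorem mem_compOf : u ∈ compOf G X v ↔ ReachIn G {x | x ∉ X} v u := by simp [compOf]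

theorem self_mem_compOf : v ∈ compOf G X v := mem_compOf.2 (.refl v)

theorem mem_nbhd : u ∈ nbhd G C ↔ u ∉ C ∧ ∃ v ∈ C, G.Adj v u := by simp [nbhd]

theorem notMem_of_mem_compOf (hv : v ∉ X) (h : u ∈ compOf G X v) : u ∉ X :=
  (mem_compOf.1 h).mem hv

theorem compOf_eq_of_mem (hv : v ∉ X) (h : u ∈ compOf G X v) : compOf G X u = compOf G X v := by
  ext w
  rw [mem_compOf, mem_compOf]
  rw [mem_compOf] at h
  exact ⟨fun h' => h.trans h', fun h' => (h.symm hv).trans h'⟩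

theorem nbhd_compOf_subset : nbhd G (compOf G X v) ⊆ X := by
  intro x hx
  obtain ⟨hx, y, hy, hyx⟩ := mem_nbhd.1 hx
  by_contra hX
  exact hx (mem_compOf.2 ((mem_compOf.1 hy).step hyx hX))

theorem isComp_iff : IsComp G X C ↔ ∃ v ∉ X, C = compOf G X v := by
  have key : ∀ (v : V) (hv : v ∉ (X : Set V)),
      (G.componentComplMk hv).supp = (compOf G X v : Set V) := by
    intro v hv
    ext u
    simp only [SimpleGraph.ComponentCompl.supp, Set.mem_ofPred_eq, Finset.mem_coe, mem_compOf]
    constructor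
    · rintro ⟨hu, h⟩
      rw [SimpleGraph.ConnectedComponent.eq] at h
      exact (reachable_induce_iff (G := G) (A := (X : Set V)ᶜ) hv hu).1 h.symm
    · intro h
      have hu : u ∉ (X : Set V) := h.mem hv
      refine ⟨hu, ?_⟩
      rw [SimpleGraph.ConnectedComponent.eq]
      exact ((reachable_induce_iff (G := G) (A := (X : Set V)ᶜ) hv hu).2 h).symm
  constructor
  · rintro ⟨D, hD⟩
    obtain ⟨v, hv, rfl⟩ := SimpleGraph.ComponentCompl.exists_eq_mk D
    rw [key v hv] at hD
    exact ⟨v, hv, (Finset.coe_injective hD).symm⟩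
  · rintro ⟨v, hv, rfl⟩
    exact ⟨G.componentComplMk (K := (X : Set V)) hv, key v hv⟩

theorem isSeparator_iff :
    IsSeparator G u v S ↔ u ∉ S ∧ v ∉ S ∧ ¬ ReachIn G {x | x ∉ S} u v := by
  constructor
  · rintro ⟨_, _, hu, hv, h⟩
    refine ⟨hu, hv, fun hr => h ?_⟩
    rw [SimpleGraph.ConnectedComponent.eq]
    exact (reachable_induce_iff (G := G) (A := (S : Set V)ᶜ) hu hv).2 hr
  · rintro ⟨hu, hv, h⟩
    refine ⟨?_, ?_, hu, hv, fun he => h ?_⟩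
    · rintro rfl
      exact h (.refl _)
    · intro ha
      exact h (.single ha hv)
    · rw [SimpleGraph.ConnectedComponent.eq] at he
      exact (reachable_induce_iff (G := G) (A := (S : Set V)ᶜ) hu hv).1 he

/-- A nonempty connected set whose neighborhood lies in `X` is a component of `G - X`. -/
theorem compOf_eq_of_nbhd_subset (hX : nbhd G (compOf G S v) ⊆ X) (hd : ∀ x ∈ compOf G S v, x ∉ X) :
    compOf G X v = compOf G S v := by
  ext u
  constructor
  · intro h
    refine (mem_compOf.1 h).closed (C := (compOf G S v : Set V)) (Finset.mem_coe.2 self_mem_compOf)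
      fun a ha b hb hab => ?_
    by_contra hbC
    exact hb (hX (mem_nbhd.2 ⟨hbC, a, ha, hab⟩))
  · intro h
    have h' := mem_compOf.1 h
    rw [mem_compOf]
    clear h
    induction h' with
    | refl => exact .refl _
    | @tail b c hb hbc ih => exact ih.step hbc.1 (hd _ (mem_compOf.2 (ReachIn.step hb hbc.1 hbc.2)))

theorem IsComp.nbhd_subset (h : IsComp G X C) : nbhd G C ⊆ X := by
  obtain ⟨v, _, rfl⟩ := isComp_iff.1 h
  exact nbhd_compOf_subset

theorem IsComp.nonempty (h : IsComp G X C) : C.Nonempty := by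
  obtain ⟨v, _, rfl⟩ := isComp_iff.1 h
  exact ⟨v, self_mem_compOf⟩

theorem IsComp.notMem (h : IsComp G X C) (hu : u ∈ C) : u ∉ X := by
  obtain ⟨v, hv, rfl⟩ := isComp_iff.1 h
  exact notMem_of_mem_compOf hv hu

theorem IsComp.eq_compOf (h : IsComp G X C) (hu : u ∈ C) : C = compOf G X u := by
  obtain ⟨v, hv, rfl⟩ := isComp_iff.1 h
  exact (compOf_eq_of_mem hv hu).symm

theorem isComp_compOf (hv : v ∉ X) : IsComp G X (compOf G X v) := isComp_iff.2 ⟨v, hv, rfl⟩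

/-- A component of `G - X` is a component of `G - S` for every `S` that contains its neighborhood
and is disjoint from it. -/
theorem IsComp.of_nbhd_subset (h : IsComp G X C) (hS : nbhd G C ⊆ S) (hd : ∀ x ∈ C, x ∉ S) :
    IsComp G S C := by
  obtain ⟨v, hv, rfl⟩ := isComp_iff.1 h
  exact isComp_iff.2 ⟨v, hd _ self_mem_compOf,
    (compOf_eq_of_nbhd_subset hS hd).symm⟩

theorem IsComp.isFullComp_nbhd (h : IsComp G X C) : IsFullComp G (nbhd G C) C :=
  ⟨h.of_nbhd_subset subset_rfl fun _ hx hx' => (mem_nbhd.1 hx').1 hx, rfl⟩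

theorem IsComp.disjoint (h : IsComp G X C) (h' : IsComp G X D) (hne : C ≠ D) : u ∈ C → u ∉ D :=
  fun hu hu' => hne ((h.eq_compOf hu).trans (h'.eq_compOf hu').symm)

/-- Minimal separators are the sets with at least two full components. -/
theorem isMinSep_iff :
    IsMinSep G S ↔ ∃ C D, IsFullComp G S C ∧ IsFullComp G S D ∧ C ≠ D := by
  constructor
  · rintro ⟨u, v, hs, hmin⟩
    obtain ⟨hu, hv, hr⟩ := isSeparator_iff.1 hs
    refine ⟨compOf G S u, compOf G S v, ⟨isComp_compOf hu, ?_⟩, ⟨isComp_compOf hv, ?_⟩, ?_⟩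
    · by_contra hne
      have hss := (nbhd_compOf_subset (G := G) (X := S) (v := u)).ssubset_of_ne hne
      refine hmin _ hss (isSeparator_iff.2 ⟨fun h => hu (hss.1 h), fun h => hv (hss.1 h), ?_⟩)
      intro h
      rw [← mem_compOf, compOf_eq_of_nbhd_subset subset_rfl
        fun x hx hx' => (mem_nbhd.1 hx').1 hx] at h
      exact hr (mem_compOf.1 h)
    · by_contra hne
      have hss := (nbhd_compOf_subset (G := G) (X := S) (v := v)).ssubset_of_ne hne
      refine hmin _ hss (isSeparator_iff.2 ⟨fun h => hu (hss.1 h), fun h => hv (hss.1 h), ?_⟩)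
      intro h
      replace h := h.symm (fun h => hu (hss.1 h))
      rw [← mem_compOf, compOf_eq_of_nbhd_subset subset_rfl
        fun x hx hx' => (mem_nbhd.1 hx').1 hx] at h
      exact hr ((mem_compOf.1 h).symm hv)
    · intro h
      exact hr (mem_compOf.1 (h ▸ self_mem_compOf))
  · rintro ⟨C, D, ⟨hC, hCS⟩, ⟨hD, hDS⟩, hne⟩
    obtain ⟨u, hu⟩ := hC.nonempty
    obtain ⟨v, hv⟩ := hD.nonempty
    refine ⟨u, v, isSeparator_iff.2 ⟨hC.notMem hu, hD.notMem hv, fun hr => ?_⟩, ?_⟩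
    · rw [← mem_compOf, ← hC.eq_compOf hu] at hr
      exact hC.disjoint hD hne hr hv
    · intro S' hS' hsep
      obtain ⟨hu', hv', hr⟩ := isSeparator_iff.1 hsep
      obtain ⟨s, hs, hs'⟩ := Finset.exists_of_ssubset hS'
      have reach : ∀ {C : Finset V} {u : V}, IsComp G S C → nbhd G C = S → u ∈ C →
          ReachIn G {x | x ∉ S'} u s := by
        intro C u hC hCS hu
        rw [← hCS] at hs
        obtain ⟨_, y, hy, hys⟩ := mem_nbhd.1 hs
        rw [hC.eq_compOf hu] at hy
        exact ((mem_compOf.1 hy).mono_compl hS'.1).step hys hs'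
      exact hr ((reach hC hCS hu).trans ((reach hD hDS hv).symm hv'))

theorem IsMinSep.exists_ne (h : IsMinSep G S) (C : Finset V) : ∃ D, IsFullComp G S D ∧ D ≠ C := by
  obtain ⟨C₁, C₂, h₁, h₂, hne⟩ := isMinSep_iff.1 h
  by_cases h : C₁ = C
  · exact ⟨C₂, h₂, fun h' => hne (h.trans h'.symm)⟩
  · exact ⟨C₁, h₁, h⟩

/-- The neighborhood of a component of `G - S`, for a minimal separator `S`, is again a minimal
separator. -/
theorem IsMinSep.nbhd_isMinSep (h : IsMinSep G S) (hC : IsComp G S C) : IsMinSep G (nbhd G C) := by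
  obtain ⟨D, ⟨hD, hDS⟩, hne⟩ := h.exists_ne C
  obtain ⟨d, hd⟩ := hD.nonempty
  have hdN : d ∉ nbhd G C := fun hd' => hD.notMem hd (hC.nbhd_subset hd')
  refine isMinSep_iff.2 ⟨C, compOf G (nbhd G C) d, hC.isFullComp_nbhd, ⟨isComp_compOf hdN, ?_⟩, ?_⟩
  · refine nbhd_compOf_subset.antisymm fun x hx => ?_
    have hxS := hC.nbhd_subset hx
    rw [← hDS] at hxS
    obtain ⟨_, y, hy, hyx⟩ := mem_nbhd.1 hxS
    refine mem_nbhd.2 ⟨fun hx' => notMem_of_mem_compOf hdN hx' hx, y, ?_, hyx⟩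
    rw [hD.eq_compOf hd, mem_compOf] at hy
    exact mem_compOf.2 (hy.mono_compl hC.nbhd_subset)
  · intro he
    exact hD.disjoint hC hne hd (he ▸ self_mem_compOf)

/-- A minimal separator is inclusion-minimal if and only if all components are full. -/
theorem IsMinSep.minimal_iff (h : IsMinSep G S) :
    (∀ S', IsMinSep G S' → ¬ S' ⊂ S) ↔ ∀ C, IsComp G S C → nbhd G C = S := by
  constructor
  · intro hmin C hC
    by_contra hne
    exact hmin _ (h.nbhd_isMinSep hC) (hC.nbhd_subset.ssubset_of_ne hne)
  · rintro hfull S' ⟨u, v, hs, -⟩ hS'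
    obtain ⟨hu', hv', hr⟩ := isSeparator_iff.1 hs
    obtain ⟨s, hs, hs'⟩ := Finset.exists_of_ssubset hS'
    have reach : ∀ x ∉ S, ReachIn G {x | x ∉ S'} x s := by
      intro x hx
      have hxS := hs
      rw [← hfull _ (isComp_compOf hx)] at hxS
      obtain ⟨_, y, hy, hys⟩ := mem_nbhd.1 hxS
      exact ((mem_compOf.1 hy).mono_compl hS'.1).step hys hs'
    obtain ⟨C, _, ⟨hC, hCS⟩, -⟩ := isMinSep_iff.1 h
    have reach' : ∀ x ∉ S', ReachIn G {x | x ∉ S'} x s := by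
      intro x hx
      by_cases hxS : x ∈ S
      · rw [← hCS] at hxS
        obtain ⟨_, y, hy, hyx⟩ := mem_nbhd.1 hxS
        have hy' := hC.notMem hy
        exact (ReachIn.single (A := {x | x ∉ S'}) hyx.symm fun h => hy' (hS'.1 h)).trans (reach y hy')
      · exact reach x hxS
    exact hr ((reach' u hu').trans ((reach' v hv').symm hv'))

theorem exists_isMinSep_subset (h : u ∉ S ∧ v ∉ S ∧ ¬ ReachIn G {x | x ∉ S} u v) :
    ∃ S' ⊆ S, IsMinSep G S' := by
  induction S using Finset.strongInduction with
  | H S ih =>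
    by_cases hm : ∀ S', S' ⊂ S → ¬ IsSeparator G u v S'
    · exact ⟨S, subset_rfl, u, v, isSeparator_iff.2 h, hm⟩
    · push Not at hm
      obtain ⟨S', hS', hs⟩ := hm
      obtain ⟨S'', h'', hm⟩ := ih S' hS' (isSeparator_iff.1 hs)
      exact ⟨S'', h''.trans hS'.1, hm⟩

/-- A graph without minimal separators is complete. -/
theorem adj_of_forall_not_isMinSep (h : ∀ S, ¬ IsMinSep G S) (huv : u ≠ v) : G.Adj u v := by
  by_contra hn
  have hr : ¬ ReachIn G {x | x ∉ Finset.univ \ {u, v}} u v := fun hr => by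
    have : v ∈ ({u} : Set V) := hr.closed rfl (by
      rintro a rfl b hb hab
      simp only [Finset.mem_sdiff, Finset.mem_univ, Finset.mem_insert, Finset.mem_singleton,
        true_and, not_not, Set.mem_ofPred_eq] at hb
      rcases hb with rfl | rfl
      · rfl
      · exact absurd hab hn)
    exact huv this.symm
  obtain ⟨S', -, hS'⟩ := exists_isMinSep_subset ⟨by simp, by simp, hr⟩
  exact h S' hS'

end Components

/-! ### Chordal graphs -/

section Chordal

variable {V : Type*} {G H I : SimpleGraph V}

theorem mem_edges_iff_getVert {u v : V} (w : G.Walk u v) (e : Sym2 V) :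
    e ∈ w.edges ↔ ∃ k < w.length, e = s(w.getVert k, w.getVert (k + 1)) := by
  induction w with
  | nil => simp
  | @cons u v w h p ih =>
    rw [SimpleGraph.Walk.edges_cons, List.mem_cons, ih]
    constructor
    · rintro (rfl | ⟨k, hk, rfl⟩)
      · exact ⟨0, by simp, by simp⟩
      · exact ⟨k + 1, by simpa using hk, by simp⟩
    · rintro ⟨k, hk, rfl⟩
      cases k with
      | zero => left; simp
      | succ k => right; exact ⟨k, by simpa using hk, by simp⟩

/-- There are no neighbors `x ≠ y` of a vertex `a`, non-adjacent to each other, that are joined by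
a walk whose inner vertices are different from `a` and not adjacent to it. A shortest such walk
closes to an induced cycle through `a`. -/
def NoHole (H : SimpleGraph V) : Prop :=
  ∀ a x y z, H.Adj a x → H.Adj a y → x ≠ y → ¬ H.Adj x y →
    ReachIn H {b | b ≠ a ∧ ¬ H.Adj a b} x z → ¬ H.Adj z y

/-- A cycle of length at least four without chords is a hole at its first vertex. -/
theorem NoHole.isChordal (h : NoHole H) : IsChordal H := by
  intro v w hw h4
  by_contra! hc
  have hinj := hw.getVert_injOn'
  have hedge : ∀ i j, H.Adj (w.getVert i) (w.getVert j) →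
      ∃ k < w.length, s(w.getVert i, w.getVert j) = s(w.getVert k, w.getVert (k + 1)) :=
    fun i j hij => (mem_edges_iff_getVert w _).1 (hc _ (w.getVert_mem_support i) _
      (w.getVert_mem_support j) hij)
  have h0 : w.getVert w.length = w.getVert 0 := by simp
  -- Adjacent vertices of a cycle without chords are consecutive.
  have cons : ∀ i j, i < j → j < w.length → H.Adj (w.getVert i) (w.getVert j) →
      j = i + 1 ∨ (i = 0 ∧ j + 1 = w.length) := by
    intro i j hij hj hadj
    obtain ⟨k, hk, he⟩ := hedge i j hadj
    have inj : ∀ a b, a < w.length → b < w.length → w.getVert a = w.getVert b → a = b :=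
      fun a b ha hb hab => hinj (by simp only [Set.mem_ofPred_eq]; omega)
        (by simp only [Set.mem_ofPred_eq]; omega) hab
    rcases Nat.lt_or_ge (k + 1) w.length with hk1 | hk1
    · rcases Sym2.eq_iff.1 he with ⟨h1, h2⟩ | ⟨h1, h2⟩
      · have := inj _ _ (by omega) hk h1; have := inj _ _ hj hk1 h2; omega
      · have := inj _ _ (by omega) hk1 h1; have := inj _ _ hj hk h2; omega
    · have hkk : k + 1 = w.length := by omega
      rw [hkk, h0] at he
      rcases Sym2.eq_iff.1 he with ⟨h1, h2⟩ | ⟨h1, h2⟩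
      · have := inj _ _ (by omega) hk h1; have := inj _ _ hj (by omega) h2; omega
      · have := inj _ _ (by omega) (by omega) h1; have := inj _ _ hj hk h2; omega
  have hadj : ∀ i < w.length, H.Adj (w.getVert i) (w.getVert (i + 1)) :=
    fun i hi => w.adj_getVert_succ hi
  have reach : ∀ i, 1 ≤ i → i + 2 ≤ w.length →
      ReachIn H {b | b ≠ w.getVert 0 ∧ ¬ H.Adj (w.getVert 0) b} (w.getVert 1) (w.getVert i) := by
    intro i h1
    induction i, h1 using Nat.le_induction with
    | base => exact fun _ => .refl _
    | succ i h1 ih =>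
      intro hi
      refine (ih (by omega)).step (hadj i (by omega)) ⟨fun he => ?_, fun ha => ?_⟩
      · have : i + 1 = 0 := hinj (by simp only [Set.mem_ofPred_eq]; omega) (by simp) he
        omega
      · rcases cons 0 (i + 1) (by omega) (by omega) ha with h | h <;> omega
  have hlast := hadj (w.length - 1) (by omega)
  rw [show w.length - 1 + 1 = w.length by omega, h0] at hlast
  have hpen := hadj (w.length - 2) (by omega)
  rw [show w.length - 2 + 1 = w.length - 1 by omega] at hpen
  refine h (w.getVert 0) (w.getVert 1) (w.getVert (w.length - 1)) (w.getVert (w.length - 2))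
    (hadj 0 (by omega)) hlast.symm (fun he => ?_) (fun ha => ?_) (reach _ (by omega) (by omega)) hpen
  · have : 1 = w.length - 1 := hinj (by simp only [Set.mem_ofPred_eq]; omega)
      (by simp only [Set.mem_ofPred_eq]; omega) he
    omega
  · rcases cons 1 (w.length - 1) (by omega) (by omega) ha with h | h <;> omega

/-- A shortest walk has no chords. -/
theorem mem_edges_of_length_eq_dist {u v : V} (p : G.Walk u v) (hp : p.length = G.dist u v) {x y : V}
    (hx : x ∈ p.support) (hy : y ∈ p.support) (hxy : G.Adj x y) : s(x, y) ∈ p.edges := by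
  obtain ⟨i, rfl, hi⟩ := SimpleGraph.Walk.mem_support_iff_exists_getVert.1 hx
  obtain ⟨j, rfl, hj⟩ := SimpleGraph.Walk.mem_support_iff_exists_getVert.1 hy
  have key : ∀ i j, i < j → j ≤ p.length → G.Adj (p.getVert i) (p.getVert j) →
      s(p.getVert i, p.getVert j) ∈ p.edges := by
    intro i j hij hj hadj
    have := G.dist_le ((p.take i).append (SimpleGraph.Walk.cons hadj (p.drop j)))
    rw [SimpleGraph.Walk.length_append, SimpleGraph.Walk.length_cons, SimpleGraph.Walk.take_length,
      SimpleGraph.Walk.drop_length] at this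
    obtain rfl : j = i + 1 := by omega
    exact (mem_edges_iff_getVert p _).2 ⟨i, by omega, rfl⟩
  rcases lt_trichotomy i j with h | h | h
  · exact key i j h hj hxy
  · subst h; exact absurd hxy (SimpleGraph.irrefl _)
  · rw [Sym2.eq_swap]; exact key j i h hi hxy.symm

/-- A shortest walk from `x` to `y` whose inner vertices are different from `a` and not adjacent to
it closes, through `a`, to a cycle without chords. -/
theorem IsChordal.noHole (h : IsChordal H) : NoHole H := by
  intro a x y z hax hay hne hxy hr hzy
  set A : Set V := {b | b = y ∨ b = x ∨ b ≠ a ∧ ¬ H.Adj a b} with hA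
  have hxA : x ∈ A := Or.inr (Or.inl rfl)
  have hyA : y ∈ A := Or.inl rfl
  have hreach : ReachIn H A x y :=
    (hr.mono le_rfl fun b hb => Or.inr (Or.inr hb)).step hzy hyA
  have haA : a ∉ A := by
    rintro (rfl | rfl | h)
    · exact absurd hay (SimpleGraph.irrefl _)
    · exact absurd hax (SimpleGraph.irrefl _)
    · exact h.1 rfl
  obtain ⟨p, hp, hd⟩ := ((reachable_induce_iff hxA hyA).2 hreach).exists_path_of_dist
  obtain ⟨q, hqp, hql, hqsupp, hqe⟩ : ∃ q : H.Walk x y, q.IsPath ∧ q.length = p.length ∧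
      q.support = p.support.map Subtype.val ∧ q.edges = p.edges.map (Sym2.map Subtype.val) :=
    ⟨p.map (SimpleGraph.Embedding.induce (G := H) A).toHom, hp.map Subtype.val_injective,
      SimpleGraph.Walk.length_map _ _, SimpleGraph.Walk.support_map _ _,
      SimpleGraph.Walk.edges_map _ _⟩
  have hqs : ∀ b, b ∈ q.support → ∃ hb : b ∈ A, (⟨b, hb⟩ : A) ∈ p.support := by
    intro b hb
    rw [hqsupp, List.mem_map] at hb
    obtain ⟨c, hc, rfl⟩ := hb
    exact ⟨c.2, hc⟩
  have haq : a ∉ q.support := fun ha => haA (hqs a ha).1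
  have hlen : 2 ≤ q.length := by
    rw [hql, hd]
    by_contra hlt
    have hr := (reachable_induce_iff hxA hyA).2 hreach
    have := hr.one_lt_dist_of_ne_of_not_adj (fun he => hne (congrArg Subtype.val he)) hxy
    omega
  have hcyc : (SimpleGraph.Walk.cons hax (q.concat hay.symm)).IsCycle := by
    rw [SimpleGraph.Walk.cons_isCycle_iff]
    refine ⟨hqp.concat haq hay.symm, fun he => ?_⟩
    rw [SimpleGraph.Walk.edges_concat, List.concat_eq_append] at he
    rcases List.mem_append.1 he with he | he
    · exact haq (q.fst_mem_support_of_mem_edges he)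
    · rw [List.mem_singleton] at he
      rcases Sym2.eq_iff.1 he with ⟨h1, h2⟩ | ⟨h1, h2⟩
      · exact hne (h2.trans h1)
      · exact hne h2
  obtain ⟨b, hb, c, hc, hbc, hnot⟩ := h a _ hcyc (by
    rw [SimpleGraph.Walk.length_cons, SimpleGraph.Walk.length_concat]; omega)
  rw [SimpleGraph.Walk.edges_cons, SimpleGraph.Walk.edges_concat, List.concat_eq_append] at hnot
  have mem : ∀ b, b ∈ (SimpleGraph.Walk.cons hax (q.concat hay.symm)).support →
      b = a ∨ b ∈ q.support := by
    intro b hb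
    rw [SimpleGraph.Walk.support_cons, SimpleGraph.Walk.support_concat, List.mem_cons,
      List.mem_append, List.mem_singleton] at hb
    tauto
  have hcase : ∀ c, H.Adj a c → c ∈ q.support →
      s(a, c) ∈ s(a, x) :: (q.edges ++ [s(y, a)]) := by
    intro c hac hc
    obtain ⟨rfl | rfl | hcA, -⟩ := hqs c hc
    · simp [Sym2.eq_swap]
    · simp
    · exact absurd hac hcA.2
  rcases mem b hb with hba | hbq <;> rcases mem c hc with hca | hcq
  · exact H.irrefl (hba.trans hca.symm ▸ hbc)
  · subst hba; exact hnot (hcase c hbc hcq)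
  · subst hca; exact hnot ((Sym2.eq_swap : s(b, c) = s(c, b)) ▸ hcase b hbc.symm hbq)
  · obtain ⟨hbA, hb⟩ := hqs b hbq
    obtain ⟨hcA, hc⟩ := hqs c hcq
    have := mem_edges_of_length_eq_dist p hd hb hc hbc
    refine hnot (List.mem_cons_of_mem _ (List.mem_append.2 (Or.inl ?_)))
    rw [hqe, List.mem_map]
    exact ⟨_, this, rfl⟩

end Chordal

section CliqueSeparators

variable {V : Type*} {G H I : SimpleGraph V} {S C : Set V}

theorem ReachIn.eq_or_mem {A : Set V} {u v : V} (h : ReachIn G A u v) : u = v ∨ v ∈ A := by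
  cases h with
  | refl => exact Or.inl rfl
  | tail _ h => exact Or.inr h.2

/-- The graph `I` without the edges between `C` and the complement of `S ∪ C`. -/
def cutEdges (I : SimpleGraph V) (S C : Set V) : SimpleGraph V where
  Adj x y := I.Adj x y ∧ ¬ (x ∈ C ∧ y ∉ C ∧ y ∉ S) ∧ ¬ (y ∈ C ∧ x ∉ C ∧ x ∉ S)
  symm := ⟨fun _ _ h => ⟨h.1.symm, h.2.2, h.2.1⟩⟩
  loopless := ⟨fun _ h => I.irrefl h.1⟩

theorem cutEdges_le : cutEdges I S C ≤ I := fun _ _ h => h.1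

theorem cutEdges_compl (hd : ∀ x ∈ C, x ∉ S) : cutEdges I S (S ∪ C)ᶜ = cutEdges I S C := by
  ext x y
  have hx := hd x
  have hy := hd y
  simp only [cutEdges, Set.mem_compl_iff, Set.mem_union]
  tauto

/-- The case of a hole at a vertex of `C`; the complement of `S ∪ C` plays the same role as `C`. -/
theorem NoHole.cutEdges_aux (h : NoHole I) (hS : I.IsClique S) {a x y z : V}
    (haC : a ∈ C) (hax : (cutEdges I S C).Adj a x) (hay : (cutEdges I S C).Adj a y)
    (hne : x ≠ y) (hxy : ¬ (cutEdges I S C).Adj x y)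
    (hr : ReachIn (cutEdges I S C) {b | b ≠ a ∧ ¬ (cutEdges I S C).Adj a b} x z) :
    ¬ (cutEdges I S C).Adj z y := by
  intro hzy
  have side : ∀ b, (cutEdges I S C).Adj a b → b ∈ S ∨ b ∈ C := by
    intro b hb
    have := hb.2.1
    tauto
  have nadj : ∀ b, b ∈ S ∨ b ∈ C → ¬ (cutEdges I S C).Adj a b → ¬ I.Adj a b := by
    intro b hb hn ha
    refine hn ⟨ha, ?_, ?_⟩ <;> tauto
  have hxy' : ¬ I.Adj x y := by
    intro ha
    have hx := side x hax
    have hy := side y hay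
    refine hxy ⟨ha, ?_, ?_⟩ <;> tauto
  -- A detour outside `S ∪ C` starts and ends in the clique `S` and can be cut short.
  have key : (z ∈ S ∨ z ∈ C → ReachIn I {b | b ≠ a ∧ ¬ I.Adj a b} x z) ∧
      (¬ (z ∈ S ∨ z ∈ C) → ∃ s ∈ S, ReachIn I {b | b ≠ a ∧ ¬ I.Adj a b} x s) := by
    clear hzy
    induction hr with
    | refl => exact ⟨fun _ => .refl _, fun hn => absurd (side x hax) hn⟩
    | @tail b c _ hbc ih =>
      obtain ⟨⟨hIbc, h1, h2⟩, hca, hac⟩ := hbc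
      by_cases hb : b ∈ S ∨ b ∈ C <;> by_cases hc : c ∈ S ∨ c ∈ C
      · exact ⟨fun _ => (ih.1 hb).step hIbc ⟨hca, nadj c hc hac⟩, fun hn => absurd hc hn⟩
      · refine ⟨fun h => absurd h hc, fun _ => ⟨b, ?_, ih.1 hb⟩⟩
        tauto
      · refine ⟨fun _ => ?_, fun hn => absurd hc hn⟩
        obtain ⟨s, hs, hr⟩ := ih.2 hb
        have hcS : c ∈ S := by tauto
        by_cases hsc : s = c
        · exact hsc ▸ hr
        · exact hr.step (hS hs hcS hsc) ⟨hca, nadj c hc hac⟩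
      · exact ⟨fun h => absurd h hc, fun _ => ih.2 hb⟩
  by_cases hz : z ∈ S ∨ z ∈ C
  · exact h a x y z hax.1 hay.1 hne hxy' (key.1 hz) hzy.1
  · obtain ⟨s, hs, hr⟩ := key.2 hz
    have hyS : y ∈ S := by
      have := hzy.2.2
      have := side y hay
      tauto
    by_cases hsy : s = y
    · subst hsy
      rcases hr.eq_or_mem with h | h
      · exact hne h
      · exact h.2 hay.1
    · exact h a x y s hax.1 hay.1 hne hxy' hr (hS hs hyS hsy)

/-- Removing all edges across a clique separator keeps a graph chordal. -/
theorem NoHole.cutEdges (h : NoHole I) (hS : I.IsClique S) (hd : ∀ x ∈ C, x ∉ S) :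
    NoHole (cutEdges I S C) := by
  intro a x y z hax hay hne hxy hr
  by_cases haC : a ∈ C
  · exact h.cutEdges_aux hS haC hax hay hne hxy hr
  by_cases haS : a ∈ S
  · intro hzy
    have adj_iff : ∀ b, (FTW.cutEdges I S C).Adj a b ↔ I.Adj a b := fun b =>
      ⟨fun h => h.1, fun h => ⟨h, by tauto, by tauto⟩⟩
    by_cases hIxy : I.Adj x y
    · -- The walk avoids the neighborhood of `a`, hence `S`, and so it cannot leave its side.
      have hstep : ∀ b, b ≠ a ∧ ¬ (FTW.cutEdges I S C).Adj a b → b ∉ S := fun b hb hbS =>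
        hb.2 ((adj_iff b).2 (hS haS hbS hb.1.symm))
      by_cases hxC : x ∈ C
      · have hz : z ∈ C := hr.closed hxC fun b hb c hc hbc => by
          have := hbc.2.1
          have := hstep c hc
          tauto
        have h1 : ¬ (x ∈ C ∧ y ∉ C ∧ y ∉ S) := hzy.2.1 ∘ fun h => ⟨hz, h.2⟩
        refine hxy ⟨hIxy, h1, fun h => h.2.1 hxC⟩
      · by_cases hxS : x ∈ S
        · exact hxy ⟨hIxy, fun h => hxC h.1, fun h => h.2.2 hxS⟩
        have hz : z ∈ (S ∪ C)ᶜ := hr.closed (by simp [hxC, hxS]) fun b hb c hc hbc => by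
          have := hbc.2.2
          have := hstep c hc
          simp only [Set.mem_compl_iff, Set.mem_union] at hb ⊢
          tauto
        simp only [Set.mem_compl_iff, Set.mem_union] at hz
        refine hxy ⟨hIxy, fun h => hxC h.1, fun h => hzy.2.2 ⟨h.1, ?_⟩⟩
        tauto
    · exact h a x y z hax.1 hay.1 hne hIxy
        (hr.mono cutEdges_le fun b hb => ⟨hb.1, fun h => hb.2 ((adj_iff b).2 h)⟩) hzy.1
  · rw [← cutEdges_compl hd] at hax hay hxy hr ⊢
    exact h.cutEdges_aux hS (C := (S ∪ C)ᶜ) (by simp [haC, haS]) hax hay hne hxy hr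

/-- If a connected set `C` meets the neighborhood of every vertex of a clique `K` of a chordal
graph, then some vertex of `C` is adjacent to the whole of `K`. -/
theorem NoHole.exists_forall_adj (h : NoHole I) {K C : Finset V} (hK : I.IsClique (K : Set V))
    {c₀ : V} (hc₀ : c₀ ∈ C) (hC : ∀ c ∈ C, ReachIn I (C : Set V) c₀ c) (hd : ∀ c ∈ C, c ∉ K)
    (hadj : ∀ k ∈ K, ∃ c ∈ C, I.Adj c k) : ∃ c ∈ C, ∀ k ∈ K, I.Adj c k := by
  classical
  -- Take `c` in `C` with the most neighbors in `K`. If `k` is not among them, the first neighbor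
  -- `d` of `k` on a walk in `C` from `c` has all of them and `k` as neighbors, or there is a hole.
  obtain ⟨c, hc, hmax⟩ := Finset.exists_max_image C (fun c => (K.filter (I.Adj c)).card) ⟨c₀, hc₀⟩
  refine ⟨c, hc, ?_⟩
  by_contra! hk
  obtain ⟨k, hkK, hck⟩ := hk
  obtain ⟨d₀, hd₀, hd₀k⟩ := hadj k hkK
  have first : ∀ z, ReachIn I (C : Set V) c z →
      (∃ q d, ReachIn I {b | b ≠ k ∧ ¬ I.Adj k b} c q ∧ I.Adj q d ∧ d ∈ C ∧ I.Adj k d) ∨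
        (ReachIn I {b | b ≠ k ∧ ¬ I.Adj k b} c z ∧ ¬ I.Adj k z) := by
    intro z hz
    induction hz with
    | refl => exact Or.inr ⟨.refl _, fun h => hck h.symm⟩
    | @tail q d _ hqd ih =>
      rcases ih with ih | ⟨ih, hkq⟩
      · exact Or.inl ih
      · by_cases hkd : I.Adj k d
        · exact Or.inl ⟨q, d, ih, hqd.1, hqd.2, hkd⟩
        · refine Or.inr ⟨ih.step hqd.1 ⟨?_, hkd⟩, hkd⟩
          rintro rfl
          exact hd _ hqd.2 hkK
  rcases first d₀ (((hC c hc).symm hc₀).trans (hC d₀ hd₀)) with ⟨q, d, hq, hqd, hdC, hkd⟩ | hh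
  · have hlt : (K.filter (I.Adj c)).card < (K.filter (I.Adj d)).card := by
      refine Finset.card_lt_card ((Finset.ssubset_iff_of_subset ?_).2 ⟨k, ?_, ?_⟩)
      · intro k' hk'
        rw [Finset.mem_filter] at hk' ⊢
        refine ⟨hk'.1, ?_⟩
        by_contra hdk'
        have hne : k ≠ k' := by
          rintro rfl
          exact hck hk'.2
        have hcA : c ∈ {b | b ≠ k ∧ ¬ I.Adj k b} :=
          ⟨fun he => hd _ hc (he ▸ hkK), fun h => hck h.symm⟩
        exact h k k' d q (hK hkK hk'.1 hne) hkd (fun he => hd _ hdC (he ▸ hk'.1))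
          (fun h => hdk' h.symm) ((ReachIn.single hk'.2.symm hcA).trans hq) hqd
      · exact Finset.mem_filter.2 ⟨hkK, hkd.symm⟩
      · exact fun hk => hck (Finset.mem_filter.1 hk).2
    exact absurd (hmax d hdC) (not_le.2 hlt)
  · exact hh.2 hd₀k.symm

end CliqueSeparators

/-! ### Minimal triangulations and potential maximal cliques -/

section Triangulations

variable {V : Type*} [Fintype V] [DecidableEq V] {G H I : SimpleGraph V}
  {S C D Ω : Finset V}

theorem exists_isMinTriangulation_le (hG : G ≤ H) (hH : NoHole H) :
    ∃ I ≤ H, IsMinTriangulation G I := by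
  obtain ⟨I, hIH, hI⟩ := exists_minimal_le_of_wellFoundedLT
    (fun I : SimpleGraph V => G ≤ I ∧ IsChordal I) H ⟨hG, hH.isChordal⟩
  exact ⟨I, hIH, hI.1.1, hI.1.2, fun I' hG' hlt hc => hlt.not_ge (hI.2 ⟨hG', hc⟩ hlt.le)⟩

/-- A minimal triangulation has no edges across a set that it turns into a clique and that
separates the original graph. -/
theorem IsMinTriangulation.not_adj (hI : IsMinTriangulation G I) (hS : I.IsClique (S : Set V))
    (hC : nbhd G C ⊆ S) (hd : ∀ c ∈ C, c ∉ S) {c x : V} (hc : c ∈ C) (hxC : x ∉ C) (hxS : x ∉ S) :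
    ¬ I.Adj c x := by
  intro hcx
  refine hI.2.2 (cutEdges I (S : Set V) (C : Set V)) ?_ ?_
    (hI.2.1.noHole.cutEdges hS hd).isChordal
  · have key : ∀ {x y : V}, G.Adj x y → ¬ (x ∈ C ∧ y ∉ C ∧ y ∉ S) := fun hxy h =>
      h.2.2 (hC (mem_nbhd.2 ⟨h.2.1, _, h.1, hxy⟩))
    exact fun x y hxy => ⟨hI.1 hxy, key hxy, key hxy.symm⟩
  · exact lt_of_le_not_ge cutEdges_le fun hle => (hle hcx).2.1 ⟨hc, hxC, hxS⟩

theorem IsComp.reachIn (hC : IsComp G S C) {c d : V} (hc : c ∈ C) (hd : d ∈ C) :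
    ReachIn G (C : Set V) c d := by
  have hd' := hd
  rw [hC.eq_compOf hc, mem_compOf] at hd'
  have : ReachIn G (C : Set V) c d ∧ d ∈ C := by
    clear hd
    induction hd' with
    | refl => exact ⟨.refl _, hc⟩
    | @tail a b hca hab ih =>
      have hb : b ∈ C := by
        rw [hC.eq_compOf hc, mem_compOf]
        exact ReachIn.step hca hab.1 hab.2
      exact ⟨ih.1.step hab.1 hb, hb⟩
  exact this.1

/-- A component whose neighborhood is a clique of a chordal supergraph contains a vertex adjacent
in this supergraph to the whole neighborhood. -/
theorem IsComp.exists_forall_adj (hC : IsComp G S C) (hGI : G ≤ I) (hI : NoHole I)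
    (hN : I.IsClique (nbhd G C : Set V)) : ∃ c ∈ C, ∀ k ∈ nbhd G C, I.Adj c k := by
  obtain ⟨c₀, hc₀⟩ := hC.nonempty
  refine hI.exists_forall_adj hN hc₀ (fun c hc => (hC.reachIn hc₀ hc).mono hGI subset_rfl)
    (fun c hc hcN => (mem_nbhd.1 hcN).1 hc) fun k hk => ?_
  obtain ⟨_, c, hc, hck⟩ := mem_nbhd.1 hk
  exact ⟨c, hc, hGI hck⟩

/-- A potential maximal clique has no full components. -/
theorem IsPMC.nbhd_ssubset (h : IsPMC G Ω) (hD : IsComp G Ω D) : nbhd G D ⊂ Ω := by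
  obtain ⟨I, hI, hΩ⟩ := h
  refine hD.nbhd_subset.ssubset_of_ne fun he => ?_
  obtain ⟨c, hc, hadj⟩ := hD.exists_forall_adj hI.1 hI.2.1.noHole (he ▸ hΩ.1)
  have hins : I.IsClique (insert c (Ω : Set V)) :=
    hΩ.1.insert fun b hb _ => hadj b (he ▸ hb)
  exact hD.notMem hc (hΩ.2 hins (Set.subset_insert _ _) (Set.mem_insert _ _))

/-- If `D` is a component of `G - Ω` for a potential maximal clique `Ω`, then the part of `Ω`
outside `N(D)` lies in a single component of `G - N(D)`, and this component is full. -/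
theorem IsPMC.isFullComp_compOf (h : IsPMC G Ω) (hD : IsComp G Ω D) {ω : V} (hω : ω ∈ Ω)
    (hωD : ω ∉ nbhd G D) :
    IsFullComp G (nbhd G D) (compOf G (nbhd G D) ω) ∧ Ω ⊆ nbhd G D ∪ compOf G (nbhd G D) ω := by
  obtain ⟨I, hI, hΩ⟩ := h
  have hS : I.IsClique (nbhd G D : Set V) := hΩ.1.subset hD.nbhd_subset
  have hE := isComp_compOf (G := G) hωD
  refine ⟨⟨hE, nbhd_compOf_subset.antisymm fun s hs => ?_⟩, fun y hy => ?_⟩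
  · by_contra hsE
    -- If `s ∈ N(D)` is not in the neighborhood of the component of `ω`, then that neighborhood, a
    -- clique of `I`, separates `s` from `ω` in `G`; but both lie in `Ω`.
    refine hI.not_adj (S := nbhd G (compOf G (nbhd G D) ω)) (hS.subset hE.nbhd_subset) subset_rfl
      (fun c hc hcN => (mem_nbhd.1 hcN).1 hc) self_mem_compOf (fun hsE' => hE.notMem hsE' hs) hsE
      (hΩ.1 hω (hD.nbhd_subset hs) ?_)
    rintro rfl
    exact hωD hs
  · rw [Finset.mem_union]
    by_contra! hy'
    refine hI.not_adj hS nbhd_compOf_subset (fun c hc => hE.notMem hc) self_mem_compOf hy'.2 hy'.1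
      (hΩ.1 hω hy ?_)
    rintro rfl
    exact hy'.2 self_mem_compOf

/-- The blocks associated with a potential maximal clique are full blocks. -/
theorem IsPMC.mem_fullBlocks (h : IsPMC G Ω) (hD : IsComp G Ω D) :
    (nbhd G D, D) ∈ fullBlocks G := by
  obtain ⟨ω, hω, hωD⟩ := Finset.exists_of_ssubset (h.nbhd_ssubset hD)
  refine ⟨isMinSep_iff.2 ⟨D, _, hD.isFullComp_nbhd, (h.isFullComp_compOf hD hω hωD).1, ?_⟩,
    hD.isFullComp_nbhd⟩
  intro he
  exact hD.notMem (he ▸ self_mem_compOf) hω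

/-- If `(S, C)` is a full block with `S ⊂ Ω ⊆ S ∪ C`, then `S` is the neighborhood of a component
of `G - Ω`. -/
theorem exists_isComp_nbhd_eq (hb : (S, C) ∈ fullBlocks G) (hΩ : Ω ⊆ S ∪ C) (hS : S ⊆ Ω) :
    ∃ D, IsComp G Ω D ∧ nbhd G D = S := by
  obtain ⟨D, ⟨hD, hDS⟩, hne⟩ := hb.1.exists_ne C
  refine ⟨D, hD.of_nbhd_subset (hDS ▸ hS) fun x hx hxΩ => ?_, hDS⟩
  rcases Finset.mem_union.1 (hΩ hxΩ) with h | h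
  · exact hD.notMem hx h
  · exact hD.disjoint hb.2.1 hne hx h

/-- The blocks associated with `Ω` inside `(S, C)` are those whose component meets `C`. -/
theorem IsComp.nbhd_union_subset_iff (hD : IsComp G Ω D) (hC : IsComp G S C) (hΩ : Ω ⊆ S ∪ C)
    (hS : S ⊆ Ω) {r : V} (hr : r ∈ D) : nbhd G D ∪ D ⊆ S ∪ C ↔ r ∈ C := by
  constructor
  · intro h
    rcases Finset.mem_union.1 (h (Finset.mem_union_right _ hr)) with h | h
    · exact absurd (hS h) (hD.notMem hr)
    · exact h
  · intro h
    refine Finset.union_subset (hD.nbhd_subset.trans hΩ) fun x hx => Finset.mem_union_right _ ?_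
    rw [hC.eq_compOf h, mem_compOf]
    rw [hD.eq_compOf hr, mem_compOf] at hx
    exact hx.mono_compl hS

/-- The blocks associated with `Ω` inside a block that contains `Ω` are smaller than that block. -/
theorem IsPMC.card_lt (h : IsPMC G Ω) (hD : IsComp G Ω D) (hΩ : Ω ⊆ S ∪ C)
    (hDC : nbhd G D ∪ D ⊆ S ∪ C) : (nbhd G D ∪ D).card < (S ∪ C).card := by
  refine Finset.card_lt_card (hDC.ssubset_of_ne fun he => (h.nbhd_ssubset hD).2 fun x hx => ?_)
  rcases Finset.mem_union.1 (he ▸ hΩ hx) with h | h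
  · exact h
  · exact absurd hx (hD.notMem h)

end Triangulations

/-! ### From tree decompositions to triangulations -/

section BagGraph

variable {V : Type*}

/-- The graph in which two vertices are adjacent if they lie in a common bag. -/
def bagGraph {ι : Type*} (B : ι → Finset V) : SimpleGraph V where
  Adj u v := u ≠ v ∧ ∃ t, u ∈ B t ∧ v ∈ B t
  symm := ⟨fun _ _ h => ⟨h.1.symm, h.2.imp fun _ h => ⟨h.2, h.1⟩⟩⟩
  loopless := ⟨fun _ h => h.1 rfl⟩

theorem ReachIn.induce_compl_leaf {ι : Type*} {T : SimpleGraph ι} {A : Set ι} {t t' s z : ι}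
    (htt' : t' ≠ t) (hleaf : ∀ s, T.Adj t s → s = t') (hs : s ≠ t) (h : ReachIn T A s z) :
    (∀ hz : z ≠ t, ReachIn (T.induce {t}ᶜ) {x | (x : ι) ∈ A} ⟨s, hs⟩ ⟨z, hz⟩) ∧
      (z = t → ReachIn (T.induce {t}ᶜ) {x | (x : ι) ∈ A} ⟨s, hs⟩ ⟨t', htt'⟩) := by
  induction h with
  | refl => exact ⟨fun _ => .refl _, fun h => absurd h hs⟩
  | @tail b c _ hbc ih =>
    constructor
    · intro hc
      by_cases hb : b = t
      · obtain rfl := hleaf c (hb ▸ hbc.1)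
        exact ih.2 hb
      · exact (ih.1 hb).step hbc.1 hbc.2
    · rintro rfl
      obtain rfl := hleaf b hbc.1.symm
      exact ih.1 htt'

/-- Adding a bag that meets the earlier bags in a subset of one of them preserves chordality, and
every clique still lies in a bag. -/
theorem bagGraph_leaf {ι : Type*} {B : ι → Finset V} {t t' : ι} (htt' : t' ≠ t)
    (hB : ∀ v ∈ B t, ∀ s ≠ t, v ∈ B s → v ∈ B t')
    (h : NoHole (bagGraph fun s : ({t}ᶜ : Set ι) => B s))
    (hK : ∀ K : Set V, (bagGraph fun s : ({t}ᶜ : Set ι) => B s).IsClique K →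
      (∀ v ∈ K, ∃ s : ({t}ᶜ : Set ι), v ∈ B s) → ∃ s : ({t}ᶜ : Set ι), K ⊆ B s) :
    NoHole (bagGraph B) ∧
      ∀ K : Set V, (bagGraph B).IsClique K → (∀ v ∈ K, ∃ s, v ∈ B s) → ∃ s, K ⊆ B s := by
  set H := bagGraph B
  set H' := bagGraph fun s : ({t}ᶜ : Set ι) => B s
  have hH'H : H' ≤ H := fun u v ⟨hne, s, hs⟩ => ⟨hne, s, hs⟩
  -- The vertices that occur in the bag `B t` only are simplicial.
  set N : Set V := {v | v ∈ B t ∧ ∀ s ≠ t, v ∉ B s} with hN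
  have adjN : ∀ {u v}, u ∈ N → H.Adj u v → v ∈ B t := by
    rintro u v hu ⟨_, s, hus, hvs⟩
    by_cases hst : s = t
    · exact hst ▸ hvs
    · exact absurd hus (hu.2 s hst)
  have notN : ∀ {u}, u ∉ N → u ∈ B t → u ∈ B t' := by
    intro u hu hut
    by_contra hut'
    exact hu ⟨hut, fun s hs hus => hut' (hB u hut s hs hus)⟩
  have adjT : ∀ {u v}, u ≠ v → u ∈ B t → v ∈ B t → H.Adj u v := fun hne hu hv => ⟨hne, t, hu, hv⟩
  have adjT' : ∀ {u v}, u ≠ v → u ∉ N → v ∉ N → u ∈ B t → v ∈ B t → H'.Adj u v :=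
    fun hne hu hv hut hvt => ⟨hne, ⟨t', htt'⟩, notN hu hut, notN hv hvt⟩
  have adj' : ∀ {u v}, u ∉ N → v ∉ N → H.Adj u v → H'.Adj u v := by
    rintro u v hu hv ⟨hne, s, hus, hvs⟩
    by_cases hst : s = t
    · subst hst
      exact adjT' hne hu hv hus hvs
    · exact ⟨hne, ⟨s, hst⟩, hus, hvs⟩
  constructor
  · intro a x y z hax hay hne hxy hr hzy
    have haN : a ∉ N := fun ha => hxy (adjT hne (adjN ha hax) (adjN ha hay))
    have hxN : x ∉ N := by
      intro hx
      rcases Relation.ReflTransGen.cases_head hr with rfl | ⟨c, ⟨hxc, hca, hac⟩, -⟩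
      · exact hxy hzy
      · exact hac (adjT hca.symm (adjN hx hax.symm) (adjN hx hxc))
    have hyN : y ∉ N := by
      intro hy
      have hat := adjN hy hay.symm
      have hzt := adjN hy hzy.symm
      rcases hr.eq_or_mem with rfl | ⟨hza, haz⟩
      · exact hxy hzy
      · exact haz (adjT hza.symm hat hzt)
    have key : (z ∉ N → ReachIn H' {b | b ≠ a ∧ ¬ H'.Adj a b} x z) ∧
        (z ∈ N → ∃ p ∉ N, p ∈ B t ∧ ReachIn H' {b | b ≠ a ∧ ¬ H'.Adj a b} x p) := by
      clear hzy
      induction hr with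
      | refl => exact ⟨fun _ => .refl _, fun h => absurd h hxN⟩
      | @tail b c _ hbc ih =>
        have hcA : c ∈ {b | b ≠ a ∧ ¬ H'.Adj a b} := ⟨hbc.2.1, fun h => hbc.2.2 (hH'H h)⟩
        by_cases hb : b ∈ N <;> by_cases hc : c ∈ N
        · exact ⟨fun h => absurd hc h, fun _ => ih.2 hb⟩
        · obtain ⟨p, hp, hpt, hr⟩ := ih.2 hb
          refine ⟨fun _ => ?_, fun h => absurd h hc⟩
          by_cases hpc : p = c
          · exact hpc ▸ hr
          · exact hr.step (adjT' hpc hp hc hpt (adjN hb hbc.1)) hcA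
        · exact ⟨fun h => absurd hc h, fun _ => ⟨b, hb, adjN hc hbc.1.symm, ih.1 hb⟩⟩
        · exact ⟨fun _ => (ih.1 hb).step (adj' hb hc hbc.1) hcA, fun h => absurd h hc⟩
    have hax' := adj' haN hxN hax
    have hay' := adj' haN hyN hay
    have hxy' : ¬ H'.Adj x y := fun h => hxy (hH'H h)
    by_cases hz : z ∈ N
    · obtain ⟨p, hp, hpt, hr⟩ := key.2 hz
      have hyt := adjN hz hzy
      by_cases hpy : p = y
      · subst hpy
        rcases hr.eq_or_mem with h | h
        · exact hne h
        · exact h.2 hay'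
      · exact h a x y p hax' hay' hne hxy' hr (adjT' hpy hp hyN hpt hyt)
    · exact h a x y z hax' hay' hne hxy' (key.1 hz) (adj' hz hyN hzy)
  · intro K hKc hcov
    by_cases hKN : ∃ v ∈ K, v ∈ N
    · obtain ⟨v, hv, hvN⟩ := hKN
      refine ⟨t, fun u hu => ?_⟩
      by_cases huv : v = u
      · exact huv ▸ hvN.1
      · exact adjN hvN (hKc hv hu huv)
    · push Not at hKN
      obtain ⟨s, hs⟩ := hK K (fun u hu v hv hne => adj' (hKN u hu) (hKN v hv) (hKc hu hv hne)) (by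
        intro v hv
        obtain ⟨s, hs⟩ := hcov v hv
        by_cases hst : s = t
        · exact ⟨⟨t', htt'⟩, notN (hKN v hv) (hst ▸ hs)⟩
        · exact ⟨⟨s, hst⟩, hs⟩)
      exact ⟨s, hs⟩

/-- The graph of the bags of a tree is chordal and its cliques lie in bags (the Helly property of
subtrees), by removing leaves from the tree. -/
theorem bagGraph_noHole {ι : Type*} [Fintype ι] {T : SimpleGraph ι} (hT : T.IsTree)
    {B : ι → Finset V}
    (hB : ∀ v s s', v ∈ B s → v ∈ B s' → ReachIn T {t | v ∈ B t} s s') :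
    NoHole (bagGraph B) ∧
      ∀ K : Set V, (bagGraph B).IsClique K → (∀ v ∈ K, ∃ s, v ∈ B s) → ∃ s, K ⊆ B s := by
  classical
  induction hn : Fintype.card ι generalizing ι with
  | zero =>
    have := hT.connected.nonempty
    exact absurd hn Fintype.card_ne_zero
  | succ n ih =>
    rcases subsingleton_or_nontrivial ι with hsub | hnt
    · obtain ⟨t₀⟩ := hT.connected.nonempty
      constructor
      · rintro a x y z ⟨_, s, _, hx⟩ ⟨_, s', _, hy⟩ hne hxy
        exact absurd ⟨hne, s, hx, Subsingleton.elim s' s ▸ hy⟩ hxy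
      · intro K _ hcov
        refine ⟨t₀, fun v hv => ?_⟩
        obtain ⟨s, hs⟩ := hcov v hv
        exact Subsingleton.elim s t₀ ▸ hs
    · obtain ⟨t, ht⟩ := hT.exists_vert_degree_one_of_nontrivial
      obtain ⟨t', htt', hleaf⟩ := SimpleGraph.degree_eq_one_iff_existsUnique_adj.1 ht
      have hne : t' ≠ t := htt'.ne'
      have hT' : (T.induce {t}ᶜ).IsTree :=
        ⟨hT.connected.induce_compl_singleton_of_degree_eq_one ht, hT.isAcyclic.induce _⟩
      obtain ⟨h1, h2⟩ := ih (ι := ({t}ᶜ : Set ι)) hT' (B := fun s => B s)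
        (fun v s s' hs hs' =>
          ((hB v s s' hs hs').induce_compl_leaf hne hleaf s.2).1 s'.2)
        (by
          rw [Fintype.card_compl_set, hn]
          simp)
      refine bagGraph_leaf hne (fun v hv s hs hvs => ?_) h1 h2
      rcases Relation.ReflTransGen.cases_head (hB v t s hv hvs) with h | ⟨c, ⟨htc, hc⟩, -⟩
      · exact absurd h.symm hs
      · exact hleaf c htc ▸ hc

theorem IsTreeDecomp.reachIn {ι : Type*} {G : SimpleGraph V} {T : SimpleGraph ι}
    {B : ι → Finset V} (h : IsTreeDecomp G T B) {v : V} {s s' : ι} (hs : v ∈ B s)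
    (hs' : v ∈ B s') : ReachIn T {t | v ∈ B t} s s' :=
  (reachable_induce_iff (A := {t | v ∈ B t}) hs hs').1 ((h.subtree v).preconnected _ _)

/-- Every tree decomposition of `G` refines to a minimal triangulation: there is one all of whose
cliques lie in bags. -/
theorem IsTreeDecomp.exists_isMinTriangulation [Fintype V] [DecidableEq V] {ι : Type*} [Fintype ι]
    {G : SimpleGraph V} {T : SimpleGraph ι} {B : ι → Finset V} (h : IsTreeDecomp G T B) :
    ∃ I, IsMinTriangulation G I ∧ ∀ K : Finset V, I.IsClique (K : Set V) → ∃ t, K ⊆ B t := by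
  obtain ⟨h1, h2⟩ := bagGraph_noHole h.isTree fun v s s' => h.reachIn
  obtain ⟨I, hI, hmin⟩ := exists_isMinTriangulation_le (G := G) (H := bagGraph B)
    (fun u v huv => ⟨huv.ne, h.edge u v huv⟩) h1
  refine ⟨I, hmin, fun K hK => ?_⟩
  obtain ⟨t, ht⟩ := h2 K (hK.mono hI) fun v _ => h.cover v
  exact ⟨t, Finset.coe_subset.1 ht⟩

end BagGraph

/-! ### Tree decompositions given by parent pointers -/

section Parents

variable {V : Type*} {k : ℕ} {par : ℕ → ℕ}

/-- The graph on `0, …, k - 1` in which `i > 0` is joined to `par i`. -/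
def parentGraph (k : ℕ) (par : ℕ → ℕ) : SimpleGraph (Fin k) :=
  SimpleGraph.fromRel fun i j => 0 < i.val ∧ par i = j

theorem parentGraph_adj (hpar : ∀ i, 0 < i → i < k → par i < i) {i j : Fin k} (hi : 0 < i.val)
    (hj : par i = j) : (parentGraph k par).Adj i j := by
  refine ⟨?_, Or.inl ⟨hi, hj⟩⟩
  rintro rfl
  exact (hpar i hi i.2).ne hj

theorem parentGraph_isTree (hk : 0 < k) (hpar : ∀ i, 0 < i → i < k → par i < i) :
    (parentGraph k par).IsTree := by
  have hreach : ∀ i (hi : i < k), (parentGraph k par).Reachable ⟨i, hi⟩ ⟨0, hk⟩ := by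
    intro i
    induction i using Nat.strong_induction_on with
    | _ i ih =>
      intro hi
      rcases Nat.eq_zero_or_pos i with rfl | h0
      · exact .refl _
      · have hp := hpar i h0 hi
        exact (parentGraph_adj hpar (i := ⟨i, hi⟩) (j := ⟨par i, hp.trans hi⟩) h0
          rfl).reachable.trans
          (ih _ hp (hp.trans hi))
  have hconn : (parentGraph k par).Connected :=
    { preconnected := fun i j => (hreach i i.2).trans (hreach j j.2).symm
      nonempty := ⟨⟨0, hk⟩⟩ }
  rw [SimpleGraph.isTree_iff_connected_and_card]
  refine ⟨hconn, le_antisymm ?_ hconn.card_vert_le_card_edgeSet_add_one⟩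
  have hsurj : Function.Surjective (fun i : {i : Fin k // 0 < i.val} =>
      (⟨s(i.1, ⟨par i.1, (hpar _ i.2 i.1.2).trans i.1.2⟩), parentGraph_adj hpar i.2 rfl⟩ :
        (parentGraph k par).edgeSet)) := by
    rintro ⟨e, he⟩
    induction e using Sym2.ind with
    | _ i j =>
      rcases he with ⟨_, ⟨hi, hj⟩ | ⟨hj, hi⟩⟩
      · exact ⟨⟨i, hi⟩, Subtype.ext (Sym2.eq_iff.2 (Or.inl ⟨rfl, Fin.ext hj⟩))⟩
      · exact ⟨⟨j, hj⟩, Subtype.ext (Sym2.eq_iff.2 (Or.inr ⟨rfl, Fin.ext hi⟩))⟩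
  have hcard := Nat.card_le_card_of_surjective _ hsurj
  have hlt : Fintype.card {i : Fin k // 0 < i.val} < Fintype.card (Fin k) :=
    Fintype.card_subtype_lt (x := ⟨0, hk⟩) (by simp)
  rw [Nat.card_eq_fintype_card (α := {i : Fin k // 0 < i.val})] at hcard
  rw [Nat.card_eq_fintype_card (α := Fin k)]
  exact (Nat.add_le_add_right hcard 1).trans hlt

/-- A rooted family of bags is a tree decomposition if it covers all vertices and edges and every
vertex has only one topmost bag. -/
theorem isTreeDecomp_of_parent {G : SimpleGraph V} {B : Fin k → Finset V} (hk : 0 < k)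
    (hpar : ∀ i, 0 < i → i < k → par i < i) (hcov : ∀ v, ∃ t, v ∈ B t)
    (hedge : ∀ u v, G.Adj u v → ∃ t, u ∈ B t ∧ v ∈ B t)
    (htop : ∀ v (t t' : Fin k), v ∈ B t → v ∈ B t' →
      (∀ s : Fin k, 0 < t.val → par t = s → v ∉ B s) →
      (∀ s : Fin k, 0 < t'.val → par t' = s → v ∉ B s) → t = t') :
    IsTreeDecomp G (parentGraph k par) B where
  isTree := parentGraph_isTree hk hpar
  cover := hcov
  edge := hedge
  subtree v := by
    have hreach : ∀ i (hi : i < k), v ∈ B ⟨i, hi⟩ → ∃ t : Fin k, v ∈ B t ∧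
        (∀ s : Fin k, 0 < t.val → par t = s → v ∉ B s) ∧
        ReachIn (parentGraph k par) {t | v ∈ B t} ⟨i, hi⟩ t := by
      intro i
      induction i using Nat.strong_induction_on with
      | _ i ih =>
        intro hi hv
        by_cases h : ∀ s : Fin k, 0 < i → par i = s → v ∉ B s
        · exact ⟨_, hv, h, .refl _⟩
        · push Not at h
          obtain ⟨s, h0, hs, hvs⟩ := h
          have hp := hpar i h0 hi
          obtain ⟨t, ht, htop, hr⟩ := ih s (hs ▸ hp) s.2 hvs
          exact ⟨t, ht, htop,
            (ReachIn.single (A := {t | v ∈ B t}) (parentGraph_adj hpar (i := ⟨i, hi⟩) h0 hs)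
              hvs).trans hr⟩
    obtain ⟨t₀, ht₀⟩ := hcov v
    refine { preconnected := fun i j => ?_, nonempty := ⟨⟨t₀, ht₀⟩⟩ }
    obtain ⟨t, ht, htt, hr⟩ := hreach i.1 i.1.2 i.2
    obtain ⟨t', ht', htt', hr'⟩ := hreach j.1 j.1.2 j.2
    obtain rfl := htop v t t' ht ht' htt htt'
    exact (reachable_induce_iff (A := {t | v ∈ B t}) i.2 j.2).2 (hr.trans (hr'.symm j.2))

end Parents

/-! ### The recursion solved by the dynamic program -/

section Table

variable {V : Type*} [Fintype V] [DecidableEq V] {G : SimpleGraph V} {f : Finset V → ℝ≥0}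
  {D P : List (Finset V)} {L L' : List (Finset V × Finset V)}
  {A A' : Finset V × Finset V → ℝ≥0∞}

open Classical in
/-- The value with which the entry at the full block `b` is initialized. -/
def initVal (G : SimpleGraph V) (f : Finset V → ℝ≥0) (b : Finset V × Finset V) : ℝ≥0∞ :=
  if b ∈ minFullBlocks G then (f (b.1 ∪ b.2) : ℝ≥0∞) else ⊤

/-- `A` solves the recursion of the dynamic program: each entry is the minimum of the initial value
and of the candidates. -/
structure IsTable (G : SimpleGraph V) (f : Finset V → ℝ≥0) (A : Finset V × Finset V → ℝ≥0∞) :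
    Prop where
  le_init : ∀ b ∈ fullBlocks G, A b ≤ initVal G f b
  le_candidate : ∀ b ∈ fullBlocks G, ∀ Ω, IsPMC G Ω → b.1 ⊂ Ω → Ω ⊆ b.1 ∪ b.2 →
    A b ≤ candidate G f A b Ω
  attained : ∀ b ∈ fullBlocks G, A b = initVal G f b ∨
    ∃ Ω, IsPMC G Ω ∧ b.1 ⊂ Ω ∧ Ω ⊆ b.1 ∪ b.2 ∧ A b = candidate G f A b Ω

theorem candidate_congr {b : Finset V × Finset V} {Ω : Finset V} (hΩ : IsPMC G Ω)
    (hb : Ω ⊆ b.1 ∪ b.2)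
    (h : ∀ c ∈ fullBlocks G, (c.1 ∪ c.2).card < (b.1 ∪ b.2).card → A c = A' c) :
    candidate G f A b Ω = candidate G f A' b Ω := by
  unfold candidate
  congr 1
  refine iSup_congr fun C => iSup_congr fun hC => ?_
  exact h _ hC.2.1 (hΩ.card_lt hC.1 hb hC.2.2)

/-- The recursion has only one solution, as it refers to smaller blocks only. -/
theorem IsTable.unique (hA : IsTable G f A) (hA' : IsTable G f A') :
    ∀ b ∈ fullBlocks G, A b = A' b := by
  intro b
  induction hn : (b.1 ∪ b.2).card using Nat.strong_induction_on generalizing b with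
  | _ n ih =>
    intro hb
    have key : ∀ {A A'}, IsTable G f A → IsTable G f A' → (∀ Ω, IsPMC G Ω → Ω ⊆ b.1 ∪ b.2 →
        candidate G f A b Ω = candidate G f A' b Ω) → A b ≤ A' b := by
      intro A A' hA hA' hc
      rcases hA'.attained b hb with h | ⟨Ω, hΩ, h1, h2, h⟩
      · exact h ▸ hA.le_init b hb
      · rw [h, ← hc Ω hΩ h2]
        exact hA.le_candidate b hb Ω hΩ h1 h2
    have hc : ∀ Ω, IsPMC G Ω → Ω ⊆ b.1 ∪ b.2 →
        candidate G f A b Ω = candidate G f A' b Ω := fun Ω hΩ hb' =>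
      candidate_congr hΩ hb' fun c hc hlt => ih _ (hn ▸ hlt) c rfl hc
    exact (key hA hA' hc).antisymm (key hA' hA fun Ω hΩ h => (hc Ω hΩ h).symm)

theorem innerStep_of_ne {b c : Finset V × Finset V} (hc : c ≠ b) (Ω : Finset V) :
    innerStep G f b A Ω c = A c := by
  unfold innerStep
  split_ifs
  · rw [Function.update_of_ne hc]
  · rfl

theorem foldl_innerStep_of_ne {b c : Finset V × Finset V} (hc : c ≠ b) :
    P.foldl (innerStep G f b) A c = A c := by
  induction P generalizing A with
  | nil => rfl
  | cons Ω P ih => rw [List.foldl_cons, ih, innerStep_of_ne hc]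

theorem foldl_outerStep_of_notMem {c : Finset V × Finset V} (hc : c ∉ L) :
    L.foldl (outerStep G f P) A c = A c := by
  induction L generalizing A with
  | nil => rfl
  | cons b L ih =>
    rw [List.mem_cons, not_or] at hc
    rw [List.foldl_cons, ih hc.2, outerStep, foldl_innerStep_of_ne hc.1, Function.update_of_ne hc.1]

/-- The inner loop takes the minimum of the entry at `b` and its candidates. These read only smaller
blocks, where the table `A` agrees with the reference table `A'`. -/
theorem foldl_innerStep_spec {b : Finset V × Finset V} (hP : ∀ Ω ∈ P, IsPMC G Ω)
    (h : ∀ c ∈ fullBlocks G, (c.1 ∪ c.2).card < (b.1 ∪ b.2).card → A c = A' c) :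
    P.foldl (innerStep G f b) A b ≤ A b ∧
    (∀ Ω ∈ P, b.1 ⊂ Ω → Ω ⊆ b.1 ∪ b.2 → P.foldl (innerStep G f b) A b ≤ candidate G f A' b Ω) ∧
    (P.foldl (innerStep G f b) A b = A b ∨ ∃ Ω ∈ P, b.1 ⊂ Ω ∧ Ω ⊆ b.1 ∪ b.2 ∧
      P.foldl (innerStep G f b) A b = candidate G f A' b Ω) := by
  induction P generalizing A with
  | nil => simp
  | cons Ω P ih =>
    rw [List.foldl_cons]
    have hstep : ∀ c ∈ fullBlocks G, (c.1 ∪ c.2).card < (b.1 ∪ b.2).card →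
        innerStep G f b A Ω c = A' c := fun c hc hlt => by
      rw [innerStep_of_ne (by rintro rfl; exact lt_irrefl _ hlt), h c hc hlt]
    obtain ⟨h1, h2, h3⟩ := ih (fun Ω' h' => hP Ω' (List.mem_cons_of_mem _ h')) hstep
    have hval : (b.1 ⊂ Ω ∧ Ω ⊆ b.1 ∪ b.2 ∧
        innerStep G f b A Ω b = min (A b) (candidate G f A' b Ω)) ∨
        (¬ (b.1 ⊂ Ω ∧ Ω ⊆ b.1 ∪ b.2) ∧ innerStep G f b A Ω b = A b) := by
      unfold innerStep
      split_ifs with hg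
      · refine Or.inl ⟨hg.1, hg.2, ?_⟩
        rw [Function.update_self, candidate_congr (hP Ω List.mem_cons_self) hg.2 h]
      · exact Or.inr ⟨hg, rfl⟩
    have hle : innerStep G f b A Ω b ≤ A b := by
      rcases hval with ⟨_, _, h⟩ | ⟨_, h⟩
      · exact h ▸ min_le_left _ _
      · exact h.le
    refine ⟨h1.trans hle, ?_, ?_⟩
    · intro Ω' hΩ' hg1 hg2
      rcases List.mem_cons.1 hΩ' with rfl | hΩ'
      · rcases hval with ⟨_, _, h⟩ | ⟨hn, _⟩
        · exact h1.trans (h ▸ min_le_right _ _)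
        · exact absurd ⟨hg1, hg2⟩ hn
      · exact h2 Ω' hΩ' hg1 hg2
    · rcases h3 with h3 | ⟨Ω', hΩ', hg1, hg2, h3⟩
      · rcases hval with ⟨hg1, hg2, h⟩ | ⟨_, h⟩
        · rcases min_choice (A b) (candidate G f A' b Ω) with hm | hm
          · exact Or.inl (by rw [h3, h, hm])
          · exact Or.inr ⟨Ω, List.mem_cons_self, hg1, hg2, by rw [h3, h, hm]⟩
        · exact Or.inl (by rw [h3, h])
      · exact Or.inr ⟨Ω', List.mem_cons_of_mem _ hΩ', hg1, hg2, h3⟩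

/-- Processing the full blocks by increasing size solves the recursion. -/
theorem isTable_blockTable (hP : IsListing P (pmcs G)) (hL : IsBlockOrder G L) :
    IsTable G f (blockTable G f P L) := by
  have hP' : ∀ Ω ∈ P, IsPMC G Ω := fun Ω hΩ => (hP.2 Ω).1 hΩ
  have key : ∀ b ∈ fullBlocks G, ∃ A, A b = initVal G f b ∧
      blockTable G f P L b = P.foldl (innerStep G f b) A b ∧
      ∀ c ∈ fullBlocks G, (c.1 ∪ c.2).card < (b.1 ∪ b.2).card →
        A c = blockTable G f P L c := by
    intro b hb
    obtain ⟨L₁, L₂, rfl⟩ := List.append_of_mem ((hL.1.2 b).2 hb)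
    have hnd := (List.nodup_append.1 hL.1.1).2.1
    refine ⟨Function.update (L₁.foldl (outerStep G f P) fun _ => ⊤) b (initVal G f b),
      Function.update_self .., ?_, ?_⟩
    · rw [blockTable, List.foldl_append, List.foldl_cons,
        foldl_outerStep_of_notMem (List.nodup_cons.1 hnd).1]
      rfl
    · intro c _ hlt
      have hcb : c ≠ b := by
        rintro rfl
        exact lt_irrefl _ hlt
      have hcL : c ∉ L₂ := fun hc => by
        have := (List.pairwise_cons.1 (List.pairwise_append.1 hL.2).2.1).1 c hc
        omega
      rw [blockTable, List.foldl_append, List.foldl_cons, foldl_outerStep_of_notMem hcL, outerStep,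
        foldl_innerStep_of_ne hcb, Function.update_of_ne hcb, Function.update_of_ne hcb]
  refine ⟨fun b hb => ?_, fun b hb Ω hΩ h1 h2 => ?_, fun b hb => ?_⟩ <;>
    obtain ⟨A, hA, hbt, hc⟩ := key b hb <;>
    obtain ⟨g1, g2, g3⟩ := foldl_innerStep_spec (f := f) hP' hc
  · rw [hbt, ← hA]
    exact g1
  · rw [hbt]
    exact g2 Ω ((hP.2 Ω).2 hΩ) h1 h2
  · rcases g3 with g3 | ⟨Ω, hΩ, h1, h2, g3⟩
    · exact Or.inl (by rw [hbt, g3, hA])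
    · exact Or.inr ⟨Ω, hP' Ω hΩ, h1, h2, by rw [hbt, g3]⟩

/-- The value returned depends on the table only through its entries at full blocks. -/
theorem algorithmValue_eq (hD : IsListing D (minSeps G)) (hP : IsListing P (pmcs G))
    (hL : IsBlockOrder G L) (hA : IsTable G f A) :
    algorithmValue G f D P L = if D = [] then (f Finset.univ : ℝ≥0∞)
      else ⨅ (S : Finset V) (_ : S ∈ D ∧ ∀ S' ∈ D, ¬ (S' ⊂ S)),
        ⨆ (C : Finset V) (_ : IsFullComp G S C), A (S, C) := by
  unfold algorithmValue
  split_ifs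
  · rfl
  · refine iInf_congr fun S => iInf_congr fun hS => iSup_congr fun C => iSup_congr fun hC => ?_
    exact (isTable_blockTable hP hL).unique hA _ ⟨(hD.2 S).1 hS.1, hC⟩

end Table

/-! ### The value returned is at most the width of every tree decomposition -/

section UpperBound

variable {V : Type*} [Fintype V] [DecidableEq V] {G I : SimpleGraph V} {f : Finset V → ℝ≥0}
  {D P : List (Finset V)} {L : List (Finset V × Finset V)} {A : Finset V × Finset V → ℝ≥0∞}

theorem exists_maximal_isClique {K : Finset V} (hK : I.IsClique (K : Set V)) :
    ∃ Ω : Finset V, K ⊆ Ω ∧ Maximal I.IsClique (Ω : Set V) := by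
  classical
  obtain ⟨Ω, hle, hΩ⟩ := exists_maximal_ge_of_wellFoundedGT
    (fun s : Set V => I.IsClique s) (K : Set V) hK
  refine ⟨Ω.toFinset, fun x hx => Set.mem_toFinset.2 (hle hx), ?_⟩
  rwa [Set.coe_toFinset]

/-- Inside every full block whose separator is a clique of the minimal triangulation `I`, some
maximal clique of `I` properly contains the separator. -/
theorem IsMinTriangulation.exists_isPMC (hI : IsMinTriangulation G I)
    {b : Finset V × Finset V} (hb : b ∈ fullBlocks G) (hS : I.IsClique (b.1 : Set V)) :
    ∃ Ω, IsPMC G Ω ∧ I.IsClique (Ω : Set V) ∧ b.1 ⊂ Ω ∧ Ω ⊆ b.1 ∪ b.2 := by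
  obtain ⟨S, C⟩ := b
  obtain ⟨-, hC, hN⟩ := hb
  simp only at hC hN hS ⊢
  obtain ⟨c, hc, hcadj⟩ := hC.exists_forall_adj hI.1 hI.2.1.noHole (by rwa [hN])
  rw [hN] at hcadj
  have hcS := hC.notMem hc
  obtain ⟨Ω, hle, hΩ⟩ := exists_maximal_isClique (I := I) (K := insert c S) (by
    rw [Finset.coe_insert]
    exact hS.insert fun b hb _ => hcadj b hb)
  have hcΩ : c ∈ Ω := hle (Finset.mem_insert_self _ _)
  refine ⟨Ω, ⟨I, hI, hΩ⟩, hΩ.1, ?_, fun y hy => ?_⟩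
  · exact (Finset.ssubset_iff_of_subset ((Finset.subset_insert _ _).trans hle)).2 ⟨c, hcΩ, hcS⟩
  · rw [Finset.mem_union]
    by_contra! hy'
    refine hI.not_adj hS hN.subset (fun c hc => hC.notMem hc) hc hy'.2 hy'.1 (hΩ.1 hcΩ hy ?_)
    rintro rfl
    exact hy'.2 hc

/-- The table is bounded by `f` on the cliques of any minimal triangulation, as one of its maximal
cliques is an admissible choice at every block whose separator is a clique. -/
theorem IsTable.le_of_isClique (hA : IsTable G f A) (hI : IsMinTriangulation G I) {w : ℝ≥0}
    (hw : ∀ K : Finset V, I.IsClique (K : Set V) → f K ≤ w) :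
    ∀ b ∈ fullBlocks G, I.IsClique (b.1 : Set V) → A b ≤ w := by
  intro b
  induction hn : (b.1 ∪ b.2).card using Nat.strong_induction_on generalizing b with
  | _ n ih =>
    intro hb hS
    obtain ⟨Ω, hΩ, hΩc, h1, h2⟩ := hI.exists_isPMC hb hS
    refine (hA.le_candidate b hb Ω hΩ h1 h2).trans (max_le (by exact_mod_cast hw Ω hΩc) ?_)
    refine iSup₂_le fun C hC => ih _ (hn ▸ hΩ.card_lt hC.1 h2 hC.2.2) _ rfl hC.2.1 ?_
    exact hΩc.subset (by exact_mod_cast hC.1.nbhd_subset)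

/-- If `G` is not complete, then some inclusion-minimal separator of `G` is a clique of `I`. -/
theorem IsMinTriangulation.exists_isMinSep (hI : IsMinTriangulation G I)
    (hS : ∃ S, IsMinSep G S) :
    ∃ S, IsMinSep G S ∧ I.IsClique (S : Set V) ∧ ∀ S', IsMinSep G S' → ¬ S' ⊂ S := by
  obtain ⟨S, hS, hSI⟩ : ∃ S, IsMinSep G S ∧ I.IsClique (S : Set V) := by
    obtain ⟨S, hS⟩ := hS
    obtain ⟨Ω, -, hΩ⟩ := exists_maximal_isClique (I := I) (K := ∅) (by simp)
    by_cases hv : ∃ v, v ∉ Ω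
    · obtain ⟨v, hv⟩ := hv
      have hC := isComp_compOf (G := G) hv
      exact ⟨_, (IsPMC.mem_fullBlocks ⟨I, hI, hΩ⟩ hC).1,
        hΩ.1.subset (by exact_mod_cast hC.nbhd_subset)⟩
    · push Not at hv
      exact ⟨S, hS, hΩ.1.subset fun v _ => hv v⟩
  obtain ⟨S', hle, hmin⟩ := exists_minimal_le_of_wellFoundedLT (fun S => IsMinSep G S) S hS
  exact ⟨S', hmin.1, hSI.subset (by exact_mod_cast hle),
    fun S'' h hlt => hlt.2 (hmin.2 h hlt.1)⟩

theorem algorithmValue_le_width (hf : Monotone f) (hD : IsListing D (minSeps G))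
    (hP : IsListing P (pmcs G)) (hL : IsBlockOrder G L) {ι : Type*} [Fintype ι]
    {T : SimpleGraph ι} {B : ι → Finset V} (hT : IsTreeDecomp G T B) :
    algorithmValue G f D P L ≤ (width f B : ℝ≥0∞) := by
  obtain ⟨I, hI, hcl⟩ := hT.exists_isMinTriangulation
  have hw : ∀ K : Finset V, I.IsClique (K : Set V) → f K ≤ width f B := by
    intro K hK
    obtain ⟨t, ht⟩ := hcl K hK
    exact (hf ht).trans (Finset.le_sup (f := fun t => f (B t)) (Finset.mem_univ t))
  have hA := isTable_blockTable (f := f) hP hL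
  unfold algorithmValue
  split_ifs with h
  · have hno : ∀ S, ¬ IsMinSep G S := fun S hS => by
      have := (hD.2 S).2 hS
      simp [h] at this
    refine ENNReal.coe_le_coe.2 (hw _ fun u _ v _ hne => hI.1 (adj_of_forall_not_isMinSep hno hne))
  · obtain ⟨S₀, hS₀⟩ := List.exists_mem_of_ne_nil D h
    obtain ⟨S, hS, hSI, hmin⟩ := hI.exists_isMinSep ⟨S₀, (hD.2 S₀).1 hS₀⟩
    refine iInf₂_le_of_le S ⟨(hD.2 S).2 hS, fun S' hS' => hmin S' ((hD.2 S').1 hS')⟩ ?_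
    exact iSup₂_le fun C hC => hA.le_of_isClique hI hw (S, C) ⟨hS, hC⟩ hSI

/-- The tree decomposition with a single bag. -/
theorem isTreeDecomp_univ : IsTreeDecomp G (⊥ : SimpleGraph (Fin 1)) fun _ => Finset.univ where
  isTree := .of_subsingleton
  cover v := ⟨0, Finset.mem_univ v⟩
  edge u v _ := ⟨0, Finset.mem_univ u, Finset.mem_univ v⟩
  subtree v :=
    { preconnected := fun i j => by
        rw [Subsingleton.elim i j]
      nonempty := ⟨⟨0, Finset.mem_univ v⟩⟩ }

theorem algorithmValue_le_ftw (hf : Monotone f) (hD : IsListing D (minSeps G))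
    (hP : IsListing P (pmcs G)) (hL : IsBlockOrder G L) :
    algorithmValue G f D P L ≤ (ftw f G : ℝ≥0∞) := by
  have hle : ∀ w ∈ {w | ∃ (k : ℕ) (T : SimpleGraph (Fin k)) (B : Fin k → Finset V),
      IsTreeDecomp G T B ∧ width f B = w}, algorithmValue G f D P L ≤ (w : ℝ≥0∞) := by
    rintro w ⟨k, T, B, hT, rfl⟩
    exact algorithmValue_le_width hf hD hP hL hT
  have hmem : width f (fun _ : Fin 1 => Finset.univ) ∈ {w | ∃ (k : ℕ) (T : SimpleGraph (Fin k))
      (B : Fin k → Finset V), IsTreeDecomp G T B ∧ width f B = w} :=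
    ⟨1, _, _, isTreeDecomp_univ, rfl⟩
  lift algorithmValue G f D P L to ℝ≥0 using
    ne_top_of_le_ne_top ENNReal.coe_ne_top (hle _ hmem) with a
  exact ENNReal.coe_le_coe.2 (le_csInf ⟨_, hmem⟩ fun w hw => ENNReal.coe_le_coe.1 (hle w hw))

theorem ftw_le_width {k : ℕ} {T : SimpleGraph (Fin k)} {B : Fin k → Finset V}
    (hT : IsTreeDecomp G T B) : ftw f G ≤ width f B :=
  csInf_le (OrderBot.bddBelow _) ⟨k, T, B, hT, rfl⟩

/-- Every graph has a potential maximal clique. -/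
theorem exists_isPMC (G : SimpleGraph V) : ∃ Ω, IsPMC G Ω := by
  obtain ⟨I, hI, -⟩ := (isTreeDecomp_univ (G := G)).exists_isMinTriangulation
  obtain ⟨Ω, -, hΩ⟩ := exists_maximal_isClique (I := I) (K := ∅) (by simp)
  exact ⟨Ω, I, hI, hΩ⟩

/-- The only potential maximal clique of a complete graph is the set of all vertices. -/
theorem IsPMC.eq_univ {Ω : Finset V} (h : IsPMC G Ω) (hG : ∀ u v, u ≠ v → G.Adj u v) :
    Ω = Finset.univ := by
  obtain ⟨I, hI, hΩ⟩ := h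
  have := hΩ.2 (y := Set.univ) (fun u _ v _ hne => hI.1 (hG u v hne)) (Set.subset_univ _)
  exact Finset.eq_univ_of_forall fun v => this (Set.mem_univ v)

end UpperBound

/-! ### A language with arrays and counting loops -/

/-- The immutable parameters of a run: the number `n` of vertices, the lengths of the three lists
of the input and the addresses at which these lists start. -/
inductive Par | n | nD | nP | nM | pD | pP | pM
  deriving DecidableEq

/-- Registers. -/
inductive Reg
  | i | io | o | oo | j | jo | s | so | r | ro | v | vo | u | uo
  | node | q | cnt | allf | ful | sz | w | nblk | t | bi | nodes | obEnd | bagEnd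
  deriving DecidableEq

/-- Arrays of numbers. -/
inductive Arr
  | inp | xs | lab | mark | nb | labD | flag | size | mins | child | leaf | pf | tS | tR | cR
  | choice | bI | bR | ob | bag | par | qS | qR
  deriving DecidableEq

/-- Arrays of values. -/
inductive VArr | inp | tab | tmp | zero | best | out
  deriving DecidableEq

/-- The state of a program: registers, arrays of numbers and arrays of values. -/
@[ext]
structure HState where
  r : Reg → ℕ
  a : Arr → ℕ → ℕ
  v : VArr → ℕ → ℝ≥0∞

/-- The parameters and a bound on the numbers that may be stored. -/
structure Env where
  par : Par → ℕ
  bound : ℕ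

/-- Expressions for numbers; `ld k e` is the entry of the array `k` with index `e`. -/
inductive HExpr where
  | const (k : ℕ)
  | par (p : Par)
  | reg (x : Reg)
  | add (a b : HExpr)
  | sub (a b : HExpr)
  | ld (k : Arr) (e : HExpr)

def HExpr.eval (E : Env) (σ : HState) : HExpr → ℕ
  | .const k => k
  | .par p => E.par p
  | .reg x => σ.r x
  | .add a b => a.eval E σ + b.eval E σ
  | .sub a b => a.eval E σ - b.eval E σ
  | .ld k e => σ.a k (e.eval E σ)

/-- Tests; `vle` compares two entries of arrays of values. -/
inductive HTest where
  | lt (a b : HExpr)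
  | eq (a b : HExpr)
  | vle (k : VArr) (a : HExpr) (l : VArr) (b : HExpr)
  | not (t : HTest)
  | and (t u : HTest)

def HTest.Holds (E : Env) (σ : HState) : HTest → Prop
  | .lt a b => a.eval E σ < b.eval E σ
  | .eq a b => a.eval E σ = b.eval E σ
  | .vle k a l b => σ.v k (a.eval E σ) ≤ σ.v l (b.eval E σ)
  | .not t => ¬ t.Holds E σ
  | .and t u => t.Holds E σ ∧ u.Holds E σ

/-- Programs; `vcopy` copies a value and `vtop` sets an entry to `∞`. -/
inductive HCmd where
  | skip
  | assign (x : Reg) (e : HExpr)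
  | store (k : Arr) (i e : HExpr)
  | vcopy (k : VArr) (i : HExpr) (l : VArr) (e : HExpr)
  | vtop (k : VArr) (i : HExpr)
  | seq (p q : HCmd)
  | ite (t : HTest) (p q : HCmd)
  /-- `loop x y m p` runs `p` for `x = 0, …, m - 1`, with `y = x * n`. -/
  | loop (x y : Reg) (m : Par) (p : HCmd)

namespace HState

def setR (σ : HState) (x : Reg) (k : ℕ) : HState := { σ with r := Function.update σ.r x k }

def setA (σ : HState) (k : Arr) (i e : ℕ) : HState :=
  { σ with a := Function.update σ.a k (Function.update (σ.a k) i e) }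

def setV (σ : HState) (k : VArr) (i : ℕ) (e : ℝ≥0∞) : HState :=
  { σ with v := Function.update σ.v k (Function.update (σ.v k) i e) }

end HState

/-- The state after `i` iterations of a loop with body `g`. -/
def iterLoop (g : HState → HState) (x y : Reg) (n : ℕ) (σ : HState) : ℕ → HState
  | 0 => (σ.setR x 0).setR y 0
  | i + 1 => ((g (iterLoop g x y n σ i)).setR x (i + 1)).setR y ((i + 1) * n)

open Classical in
/-- The final state. An assignment of a number that is not below the bound, or to an array entry
whose index is not, has no effect. -/
def HCmd.run (E : Env) : HCmd → HState → HState
  | .skip, σ => σ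
  | .assign x e, σ => if e.eval E σ < E.bound then σ.setR x (e.eval E σ) else σ
  | .store k i e, σ =>
    if i.eval E σ < E.bound ∧ e.eval E σ < E.bound then σ.setA k (i.eval E σ) (e.eval E σ) else σ
  | .vcopy k i l e, σ =>
    if i.eval E σ < E.bound then σ.setV k (i.eval E σ) (σ.v l (e.eval E σ)) else σ
  | .vtop k i, σ => if i.eval E σ < E.bound then σ.setV k (i.eval E σ) ⊤ else σ
  | .seq p q, σ => q.run E (p.run E σ)
  | .ite t p q, σ => if t.Holds E σ then p.run E σ else q.run E σ
  | .loop x y m p, σ => iterLoop (p.run E) x y (E.par .n) σ (E.par m)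

/-- The registers that a program may write. -/
def HCmd.modR : HCmd → Reg → Bool
  | .assign x _, z => decide (z = x)
  | .seq p q, z => p.modR z || q.modR z
  | .ite _ p q, z => p.modR z || q.modR z
  | .loop x y _ p, z => decide (z = x) || decide (z = y) || p.modR z
  | _, _ => false

/-- The arrays of numbers that a program may write. -/
def HCmd.modA : HCmd → Arr → Bool
  | .store k _ _, z => decide (z = k)
  | .seq p q, z => p.modA z || q.modA z
  | .ite _ p q, z => p.modA z || q.modA z
  | .loop _ _ _ p, z => p.modA z
  | _, _ => false

/-- The arrays of values that a program may write. -/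
def HCmd.modV : HCmd → VArr → Bool
  | .vcopy k _ _ _, z => decide (z = k)
  | .vtop k _, z => decide (z = k)
  | .seq p q, z => p.modV z || q.modV z
  | .ite _ p q, z => p.modV z || q.modV z
  | .loop _ _ _ p, z => p.modV z
  | _, _ => false

/-- The bodies of loops do not write the loop counters. -/
def HCmd.wf : HCmd → Bool
  | .seq p q => p.wf && q.wf
  | .ite _ p q => p.wf && q.wf
  | .loop x y _ p => !decide (x = y) && !p.modR x && !p.modR y && p.wf
  | _ => true

/-- `τ` agrees with `σ` on everything that `p` does not write. -/
structure Frame (p : HCmd) (σ τ : HState) : Prop where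
  r : ∀ {x}, p.modR x = false → τ.r x = σ.r x
  a : ∀ {k}, p.modA k = false → τ.a k = σ.a k
  v : ∀ {k}, p.modV k = false → τ.v k = σ.v k

theorem Frame.refl (p : HCmd) (σ : HState) : Frame p σ σ :=
  ⟨fun _ => rfl, fun _ => rfl, fun _ => rfl⟩

/-- A program changes only the registers and arrays that it may write. -/
theorem HCmd.frame (E : Env) (p : HCmd) (σ : HState) : Frame p σ (p.run E σ) := by
  induction p generalizing σ with
  | skip => exact .refl _ σ
  | assign x e =>
    simp only [run]
    split_ifs
    · exact ⟨fun h => Function.update_of_ne (of_decide_eq_false h) _ _, fun _ => rfl, fun _ => rfl⟩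
    · exact .refl _ σ
  | store k i e =>
    simp only [run]
    split_ifs
    · exact ⟨fun _ => rfl, fun h => Function.update_of_ne (of_decide_eq_false h) _ _, fun _ => rfl⟩
    · exact .refl _ σ
  | vcopy k i l e =>
    simp only [run]
    split_ifs
    · exact ⟨fun _ => rfl, fun _ => rfl, fun h => Function.update_of_ne (of_decide_eq_false h) _ _⟩
    · exact .refl _ σ
  | vtop k i =>
    simp only [run]
    split_ifs
    · exact ⟨fun _ => rfl, fun _ => rfl, fun h => Function.update_of_ne (of_decide_eq_false h) _ _⟩
    · exact .refl _ σ
  | seq p q ihp ihq =>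
    refine ⟨fun {y} h => ?_, fun {y} h => ?_, fun {y} h => ?_⟩ <;>
      obtain ⟨h1, h2⟩ := (Bool.or_eq_false_iff).1 h
    · exact ((ihq _).r h2).trans ((ihp _).r h1)
    · exact ((ihq _).a h2).trans ((ihp _).a h1)
    · exact ((ihq _).v h2).trans ((ihp _).v h1)
  | ite t p q ihp ihq =>
    simp only [run]
    split_ifs
    · exact ⟨fun h => (ihp σ).r (Bool.or_eq_false_iff.1 h).1,
        fun h => (ihp σ).a (Bool.or_eq_false_iff.1 h).1,
        fun h => (ihp σ).v (Bool.or_eq_false_iff.1 h).1⟩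
    · exact ⟨fun h => (ihq σ).r (Bool.or_eq_false_iff.1 h).2,
        fun h => (ihq σ).a (Bool.or_eq_false_iff.1 h).2,
        fun h => (ihq σ).v (Bool.or_eq_false_iff.1 h).2⟩
  | loop x y m p ih =>
    simp only [run]
    induction E.par m with
    | zero =>
      refine ⟨fun {z} h => ?_, fun _ => rfl, fun _ => rfl⟩
      simp only [modR, Bool.or_eq_false_iff, decide_eq_false_iff_not] at h
      simp [iterLoop, HState.setR, Function.update_of_ne h.1.1, Function.update_of_ne h.1.2]
    | succ i ih' =>
      refine ⟨fun {z} h => ?_, fun h => ((ih _).a h).trans (ih'.a h),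
        fun h => ((ih _).v h).trans (ih'.v h)⟩
      have h' := h
      simp only [modR, Bool.or_eq_false_iff, decide_eq_false_iff_not] at h'
      simp only [iterLoop, HState.setR, Function.update_of_ne h'.1.1, Function.update_of_ne h'.1.2]
      exact ((ih _).r h'.2).trans (ih'.r h)

theorem HCmd.frame_of_eq {E : Env} {p : HCmd} {σ τ : HState} (h : p.run E σ = τ) : Frame p σ τ :=
  h ▸ p.frame E σ

/-- The invariant rule. The hypotheses on the state `τ` before an iteration record that everything
that the loop does not write is as in the initial state. -/
theorem HCmd.loop_inv {E : Env} {x y : Reg} {m : Par} {p : HCmd} {σ : HState}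
    (hwf : (HCmd.loop x y m p).wf = true) (I : ℕ → HState → Prop)
    (h0 : I 0 ((σ.setR x 0).setR y 0))
    (hs : ∀ i < E.par m, ∀ τ : HState, Frame (.loop x y m p) σ τ → τ.r x = i →
      τ.r y = i * E.par .n → I i τ →
        I (i + 1) (((p.run E τ).setR x (i + 1)).setR y ((i + 1) * E.par .n))) :
    I (E.par m) ((HCmd.loop x y m p).run E σ) := by
  simp only [wf, Bool.and_eq_true, Bool.not_eq_true', decide_eq_false_iff_not] at hwf
  have key : ∀ i ≤ E.par m, I i (iterLoop (p.run E) x y (E.par .n) σ i) ∧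
      Frame (.loop x y m p) σ (iterLoop (p.run E) x y (E.par .n) σ i) ∧
      (iterLoop (p.run E) x y (E.par .n) σ i).r x = i ∧
      (iterLoop (p.run E) x y (E.par .n) σ i).r y = i * E.par .n := by
    intro i
    induction i with
    | zero =>
      intro _
      refine ⟨h0, ⟨fun {z} h => ?_, fun _ => rfl, fun _ => rfl⟩, ?_, ?_⟩
      · simp only [modR, Bool.or_eq_false_iff, decide_eq_false_iff_not] at h
        simp [iterLoop, HState.setR, Function.update_of_ne h.1.1, Function.update_of_ne h.1.2]
      · simp [iterLoop, HState.setR, Function.update_of_ne hwf.1.1.1]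
      · simp [iterLoop, HState.setR]
    | succ i ih =>
      intro hi
      obtain ⟨h1, h2, h3, h4⟩ := ih (by omega)
      refine ⟨hs i (by omega) _ h2 h3 h4 h1, ⟨fun {z} h => ?_, fun h => ?_, fun h => ?_⟩, ?_, ?_⟩
      · have h' := h
        simp only [modR, Bool.or_eq_false_iff, decide_eq_false_iff_not] at h'
        simp only [iterLoop, HState.setR, Function.update_of_ne h'.1.1,
          Function.update_of_ne h'.1.2]
        exact ((p.frame E _).r h'.2).trans (h2.r h)
      · exact ((p.frame E _).a h).trans (h2.a h)
      · exact ((p.frame E _).v h).trans (h2.v h)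
      · simp [iterLoop, HState.setR, Function.update_of_ne hwf.1.1.1]
      · simp [iterLoop, HState.setR]
  exact (key _ le_rfl).1

/-! ### Compilation to the random access machine -/

/-- The machine registers that hold the parameters; `14` and `15` hold the base address of the
arrays and the bound, and `16` to `18` serve the prelude and the epilogue. -/
def Par.code : Par → ℕ
  | .n => 7 | .nD => 8 | .nP => 9 | .nM => 10 | .pD => 11 | .pP => 12 | .pM => 13

def Reg.code (x : Reg) : ℕ := 20 + x.ctorIdx

/-- The residue modulo `32` of the offsets at which the entries of the array are stored. -/
def Arr.code (k : Arr) : ℕ := k.ctorIdx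

def VArr.code (k : VArr) : ℕ := k.ctorIdx

theorem Reg.code_inj {x y : Reg} (h : x.code = y.code) : x = y := by
  have : x.ctorIdx = y.ctorIdx := by simpa [Reg.code] using h
  rw [← Reg.ofNat_ctorIdx x, ← Reg.ofNat_ctorIdx y, this]

theorem Arr.code_inj {x y : Arr} (h : x.code = y.code) : x = y := by
  rw [← Arr.ofNat_ctorIdx x, ← Arr.ofNat_ctorIdx y, show x.ctorIdx = y.ctorIdx from h]

theorem VArr.code_inj {x y : VArr} (h : x.code = y.code) : x = y := by
  rw [← VArr.ofNat_ctorIdx x, ← VArr.ofNat_ctorIdx y, show x.ctorIdx = y.ctorIdx from h]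

theorem Arr.code_lt (k : Arr) : k.code < 32 := by cases k <;> decide

theorem VArr.code_lt (k : VArr) : k.code < 32 := by cases k <;> decide

theorem Reg.code_ge (x : Reg) : 20 ≤ x.code := Nat.le_add_right _ _

theorem Par.code_le (p : Par) : 7 ≤ p.code ∧ p.code ≤ 13 := by cases p <;> decide

section Compile

/-- The expression for `32 * e`. -/
def Expr.mul32 (e : Expr) : Expr :=
  let d := fun e : Expr => e.add e
  d (d (d (d (d e))))

theorem Expr.eval_mul32 (s : State) (e : Expr) : e.mul32.eval s = 32 * e.eval s := by
  simp only [mul32, eval]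
  omega

/-- The address of the entry with index `i` of the array number `k`: the arrays are interleaved
above the address in register `14`. -/
def cellAddr (k : ℕ) (i : Expr) : Expr := .add (.reg 14) (.add i.mul32 (.const k))

def HExpr.compile : HExpr → Expr
  | .const k => .const k
  | .par p => .reg p.code
  | .reg x => .reg x.code
  | .add a b => .add a.compile b.compile
  | .sub a b => .sub a.compile b.compile
  | .ld k e => .load (cellAddr k.code e.compile)

def HTest.compile : HTest → Test
  | .lt a b => .lt a.compile b.compile
  | .eq a b => .eq a.compile b.compile
  | .vle k a l b => .valLe (cellAddr k.code a.compile) (cellAddr l.code b.compile)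
  | .not t => .not t.compile
  | .and t u => .and t.compile u.compile

/-- Register `15` holds the bound on the numbers that may be stored. -/
def HCmd.compile : HCmd → Program
  | .skip => .skip
  | .assign x e => .ite (.lt e.compile (.reg 15)) (.assign x.code e.compile) .skip
  | .store k i e => .ite (.and (.lt i.compile (.reg 15)) (.lt e.compile (.reg 15)))
      (.store (cellAddr k.code i.compile) e.compile) .skip
  | .vcopy k i l e => .ite (.lt i.compile (.reg 15))
      (.valCopy (cellAddr k.code i.compile) (cellAddr l.code e.compile)) .skip
  | .vtop k i => .ite (.lt i.compile (.reg 15)) (.valTop (cellAddr k.code i.compile)) .skip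
  | .seq p q => .seq p.compile q.compile
  | .ite t p q => .ite t.compile p.compile q.compile
  | .loop x y m p => .seq (.assign x.code (.const 0)) (.seq (.assign y.code (.const 0))
      (.while (.lt (.reg x.code) (.reg m.code)) (.seq p.compile
        (.seq (.assign x.code (.add (.reg x.code) (.const 1)))
          (.assign y.code (.add (.reg y.code) (.reg 7)))))))

/-- A bound on the running time of the compiled program. It depends on the parameters only, as the
parameters are the only bounds of loops. -/
def HCmd.cost (N : Par → ℕ) : HCmd → ℕ
  | .skip => 1
  | .assign _ e => 2 * e.compile.cost + 10
  | .store k i e => (cellAddr k.code i.compile).cost + i.compile.cost + 2 * e.compile.cost + 20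
  | .vcopy k i l e => (cellAddr k.code i.compile).cost + (cellAddr l.code e.compile).cost +
      i.compile.cost + 20
  | .vtop k i => (cellAddr k.code i.compile).cost + i.compile.cost + 20
  | .seq p q => p.cost N + q.cost N
  | .ite t p q => t.compile.cost + (p.cost N + q.cost N) + 1
  | .loop _ _ m p => N m * (p.cost N + 12) + 8

variable {E : Env} {B W : ℕ}

/-- The state of the array language represented by a state of the machine. -/
def State.view (B : ℕ) (s : State) : HState where
  r x := s.reg x.code
  a k i := s.mem (B + (32 * i + k.code))
  v k i := s.val (B + (32 * i + k.code))

/-- The parameters, the base address `B` of the arrays and the bound on the stored numbers are in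
their registers. -/
structure State.Holds (E : Env) (B : ℕ) (s : State) : Prop where
  base : s.reg 14 = B
  bound : s.reg 15 = E.bound
  par : ∀ p : Par, s.reg p.code = E.par p

/-- The word bound `W` is large enough for the addresses of the arrays and the loop counters. -/
structure Env.Fits (E : Env) (B W : ℕ) : Prop where
  arrays : B + 32 * E.bound ≤ W
  counter : ∀ m, E.par m < W
  product : ∀ m, E.par m * E.par .n < W

theorem eval_cellAddr {s : State} (h : s.Holds E B) (k : ℕ) (i : Expr) :
    (cellAddr k i).eval s = B + (32 * i.eval s + k) := by
  simp [cellAddr, Expr.eval, Expr.eval_mul32, h.base]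

theorem HExpr.eval_compile {s : State} (h : s.Holds E B) (e : HExpr) :
    e.compile.eval s = e.eval E (s.view B) := by
  induction e with
  | const k => rfl
  | par p => exact h.par p
  | reg x => rfl
  | add a b iha ihb => simp only [compile, Expr.eval, eval, iha, ihb]
  | sub a b iha ihb => simp only [compile, Expr.eval, eval, iha, ihb]
  | ld k e ih => simp only [compile, Expr.eval, eval, eval_cellAddr h, ih]; rfl

theorem HTest.holds_compile {s : State} (h : s.Holds E B) (t : HTest) :
    t.compile.Holds s ↔ t.Holds E (s.view B) := by
  induction t with
  | lt a b => simp only [compile, Test.Holds, Holds, HExpr.eval_compile h]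
  | eq a b => simp only [compile, Test.Holds, Holds, HExpr.eval_compile h]
  | vle k a l b =>
    simp only [compile, Test.Holds, Holds, HExpr.eval_compile h, eval_cellAddr h]; rfl
  | not t ih => simp only [compile, Test.Holds, Holds, ih]
  | and t u iht ihu => simp only [compile, Test.Holds, Holds, iht, ihu]

theorem State.Holds.setReg {s : State} (h : s.Holds E B) (x : Reg) (k : ℕ) :
    State.Holds E B { s with reg := Function.update s.reg x.code k } := by
  have hx := x.code_ge
  refine ⟨?_, ?_, fun p => ?_⟩
  · exact (Function.update_of_ne (by omega) _ _).trans h.base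
  · exact (Function.update_of_ne (by omega) _ _).trans h.bound
  · have := p.code_le
    exact (Function.update_of_ne (by omega) _ _).trans (h.par p)

theorem view_setReg (s : State) (x : Reg) (k : ℕ) :
    State.view B { s with reg := Function.update s.reg x.code k } = (s.view B).setR x k := by
  refine HState.ext (funext fun y => ?_) rfl rfl
  simp only [State.view, HState.setR]
  by_cases hy : y = x
  · subst hy
    simp
  · rw [Function.update_of_ne hy, Function.update_of_ne fun h => hy (Reg.code_inj h)]

/-- Writing a cell of the memory writes exactly one entry of one array. -/
theorem update_interleaved {κ α : Type*} [DecidableEq κ] {code : κ → ℕ} (hlt : ∀ k, code k < 32)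
    (hinj : ∀ {k l}, code k = code l → k = l) (m : ℕ → α) (k : κ) (i : ℕ) (e : α) :
    (fun l j => Function.update m (B + (32 * i + code k)) e (B + (32 * j + code l))) =
      Function.update (fun l j => m (B + (32 * j + code l))) k
        (Function.update (fun j => m (B + (32 * j + code k))) i e) := by
  funext l j
  have hk := hlt k
  have hl := hlt l
  by_cases hlk : l = k
  · subst hlk
    rw [Function.update_self]
    by_cases hj : j = i
    · subst hj
      simp
    · rw [Function.update_of_ne hj, Function.update_of_ne (by omega)]
  · have : code l ≠ code k := fun h => hlk (hinj h)
    rw [Function.update_of_ne hlk, Function.update_of_ne (by omega)]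

theorem view_setMem (s : State) (k : Arr) (i e : ℕ) :
    State.view B { s with mem := Function.update s.mem (B + (32 * i + k.code)) e } =
      (s.view B).setA k i e :=
  HState.ext rfl (update_interleaved Arr.code_lt Arr.code_inj s.mem k i e) rfl

theorem view_setVal (s : State) (k : VArr) (i : ℕ) (e : ℝ≥0∞) :
    State.view B { s with val := Function.update s.val (B + (32 * i + k.code)) e } =
      (s.view B).setV k i e :=
  HState.ext rfl rfl (update_interleaved VArr.code_lt VArr.code_inj s.val k i e)

theorem exec_assign {s : State} {x v : ℕ} {e : Expr} (he : e.eval s = v) (hv : v < W) :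
    Exec W (.assign x e) s (e.cost + 1) { s with reg := Function.update s.reg x v } := by
  subst he
  exact .assign s x e hv

/-- A guarded command of the array language. -/
theorem exec_guard {s : State} (hs : s.Holds E B) {t : Test} {p : Program} {g : Prop} [Decidable g]
    {c : ℕ} {τ : HState} (ht : t.Holds s ↔ g)
    (hp : g → ∃ k s', Exec W p s k s' ∧ t.cost + k < c ∧ s'.Holds E B ∧ s'.view B = τ)
    (hc : t.cost + 1 < c) :
    ∃ k s', Exec W (.ite t p .skip) s k s' ∧ k ≤ c ∧ s'.Holds E B ∧
      s'.view B = if g then τ else s.view B := by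
  split_ifs with h
  · obtain ⟨k, s', h1, h2, h3, h4⟩ := hp h
    exact ⟨_, s', .iteTrue _ (ht.2 h) h1, h2, h3, h4⟩
  · exact ⟨_, s, .iteFalse _ (fun h' => h (ht.1 h')) (.skip s), hc, hs, rfl⟩

/-- The compiled program simulates the program, within the stated time. -/
theorem HCmd.exec_compile (hE : E.Fits B W) (p : HCmd) (hp : p.wf = true) (s : State)
    (hs : s.Holds E B) :
    ∃ k s', Exec W p.compile s k s' ∧ k ≤ p.cost E.par ∧ s'.Holds E B ∧
      s'.view B = p.run E (s.view B) := by
  have harr := hE.arrays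
  have he {s : State} (hs : s.Holds E B) (e : HExpr) := HExpr.eval_compile hs e
  have ha {s : State} (hs : s.Holds E B) (k : ℕ) (e : HExpr) :
      (cellAddr k e.compile).eval s = B + (32 * e.eval E (s.view B) + k) := by
    rw [eval_cellAddr hs, he hs]
  induction p generalizing s with
  | skip => exact ⟨_, _, .skip s, le_rfl, hs, rfl⟩
  | assign x e =>
    refine exec_guard hs (by rw [Test.Holds, he hs, Expr.eval, hs.bound]) (fun h => ⟨_, _,
      exec_assign (he hs e) (by omega), ?_, hs.setReg _ _, view_setReg _ _ _⟩) ?_ <;>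
    · simp only [Test.cost, Expr.cost, cost]; omega
  | store k i e =>
    have hk := k.code_lt
    refine exec_guard hs (by simp only [Test.Holds, he hs, Expr.eval, hs.bound]) (fun h => ⟨_, _,
      .store s _ _ (by rw [ha hs]; omega) (by rw [he hs]; omega), ?_, ⟨hs.1, hs.2, hs.3⟩, by
        rw [ha hs, he hs, view_setMem]⟩) ?_ <;>
    · simp only [Test.cost, Expr.cost, cost]; omega
  | vcopy k i l e =>
    have hk := k.code_lt
    refine exec_guard hs (by rw [Test.Holds, he hs, Expr.eval, hs.bound]) (fun h => ⟨_, _,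
      .valCopy s _ _ (by rw [ha hs]; omega), ?_, ⟨hs.1, hs.2, hs.3⟩, by
        rw [ha hs, ha hs, view_setVal]; rfl⟩) ?_ <;>
    · simp only [Test.cost, Expr.cost, cost]; omega
  | vtop k i =>
    have hk := k.code_lt
    refine exec_guard hs (by rw [Test.Holds, he hs, Expr.eval, hs.bound]) (fun h => ⟨_, _,
      .valTop s _ (by rw [ha hs]; omega), ?_, ⟨hs.1, hs.2, hs.3⟩, by rw [ha hs, view_setVal]⟩) ?_ <;>
    · simp only [Test.cost, Expr.cost, cost]; omega
  | seq p q ihp ihq =>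
    simp only [wf, Bool.and_eq_true] at hp
    obtain ⟨k, s', h1, h2, h3, h4⟩ := ihp hp.1 s hs
    obtain ⟨l, s'', g1, g2, g3, g4⟩ := ihq hp.2 s' h3
    exact ⟨_, _, .seq h1 g1, add_le_add h2 g2, g3, by rw [g4, h4]; rfl⟩
  | ite t p q ihp ihq =>
    simp only [wf, Bool.and_eq_true] at hp
    by_cases h : t.Holds E (s.view B)
    · obtain ⟨k, s', h1, h2, h3, h4⟩ := ihp hp.1 s hs
      refine ⟨_, _, .iteTrue _ ((HTest.holds_compile hs t).2 h) h1, ?_, h3, ?_⟩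
      · simp only [cost]; omega
      · rw [h4, run, if_pos h]
    · obtain ⟨k, s', h1, h2, h3, h4⟩ := ihq hp.2 s hs
      refine ⟨_, _, .iteFalse _ (fun h' => h ((HTest.holds_compile hs t).1 h')) h1, ?_, h3, ?_⟩
      · simp only [cost]; omega
      · rw [h4, run, if_neg h]
  | loop x y m p ih =>
    have hwf := hp
    simp only [wf, Bool.and_eq_true, Bool.not_eq_true', decide_eq_false_iff_not] at hp
    obtain ⟨⟨⟨hxy, hx⟩, hy⟩, hp⟩ := hp
    have hcm := hE.counter m
    have hpm := hE.product m
    set n := E.par .n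
    set M := E.par m with hM
    -- The state after `i` iterations, run for the remaining `M - i` ones.
    have key : ∀ d i, i + d = M → ∀ s s₀ : State, s.Holds E B →
        s.view B = iterLoop (p.run E) x y n (s₀.view B) i → ∃ k s',
        Exec W (.while (.lt (.reg x.code) (.reg m.code)) (.seq p.compile
          (.seq (.assign x.code (.add (.reg x.code) (.const 1)))
          (.assign y.code (.add (.reg y.code) (.reg 7)))))) s k s' ∧
        k ≤ d * (p.cost E.par + 12) + 4 ∧ s'.Holds E B ∧
        s'.view B = iterLoop (p.run E) x y n (s₀.view B) M := by
      intro d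
      induction d with
      | zero =>
        intro i hi s s₀ hs hv
        have hxi : s.reg x.code = i := by
          change (s.view B).r x = i
          rw [hv]
          cases i <;> simp [iterLoop, HState.setR, Function.update_of_ne hxy]
        refine ⟨_, _, .whileFalse _ ?_, ?_, hs, ?_⟩
        · simp only [Test.Holds, Expr.eval, hs.par, hxi]
          omega
        · simp [Test.cost, Expr.cost]
        · rw [hv, ← hi, add_zero]
      | succ d ihd =>
        intro i hi s s₀ hs hv
        have hxi : s.reg x.code = i := by
          change (s.view B).r x = i
          rw [hv]
          cases i <;> simp [iterLoop, HState.setR, Function.update_of_ne hxy]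
        have hyi : s.reg y.code = i * n := by
          change (s.view B).r y = i * n
          rw [hv]
          cases i <;> simp [iterLoop, HState.setR]
        obtain ⟨k, s', h1, h2, h3, h4⟩ := ih hp s hs
        have hfr := p.frame E (s.view B)
        have hxi' : s'.reg x.code = i := by
          have := hfr.r hx
          rw [← h4] at this
          exact this.trans hxi
        have hyi' : s'.reg y.code = i * n := by
          have := hfr.r hy
          rw [← h4] at this
          exact this.trans hyi
        have hlt : (i + 1) * n ≤ M * n := Nat.mul_le_mul_right _ (by omega)
        have hxy' : y.code ≠ x.code := fun h => hxy (Reg.code_inj h).symm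
        have hx1 : (Expr.add (.reg x.code) (.const 1)).eval s' = i + 1 := by
          simp [Expr.eval, hxi']
        set s₁ : State := { s' with reg := Function.update s'.reg x.code (i + 1) } with hs₁
        have hs₁H : s₁.Holds E B := h3.setReg _ _
        have hy1 : (Expr.add (.reg y.code) (.reg 7)).eval s₁ = (i + 1) * n := by
          have h7 : s₁.reg 7 = n := hs₁H.par .n
          have hyr : s₁.reg y.code = i * n := (Function.update_of_ne hxy' _ _).trans hyi'
          simp only [Expr.eval, h7, hyr]
          ring
        have e1 := exec_assign (x := x.code) hx1 (show i + 1 < W by omega)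
        have e2 := exec_assign (x := y.code) hy1 (show (i + 1) * n < W by omega)
        obtain ⟨l, s'', g1, g2, g3, g4⟩ := ihd (i + 1) (by omega)
          { s₁ with reg := Function.update s₁.reg y.code ((i + 1) * n) } s₀ (hs₁H.setReg _ _) (by
            rw [view_setReg, view_setReg, h4, hv]
            rfl)
        refine ⟨_, _, .whileTrue ?_ (.seq h1 (.seq e1 e2)) g1, ?_, g3, g4⟩
        · simp only [Test.Holds, Expr.eval, hs.par, hxi]
          omega
        · simp only [Test.cost, Expr.cost]
          rw [Nat.succ_mul]
          omega
    have e1 := exec_assign (s := s) (x := x.code) (e := .const 0) rfl (show 0 < W by omega)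
    set s₁ : State := { s with reg := Function.update s.reg x.code 0 }
    have e2 := exec_assign (s := s₁) (x := y.code) (e := .const 0) rfl (show 0 < W by omega)
    obtain ⟨k, s', h1, h2, h3, h4⟩ := key M 0 (by omega)
      { s₁ with reg := Function.update s₁.reg y.code 0 } s ((hs.setReg x 0).setReg y 0) (by
        rw [view_setReg, view_setReg]
        rfl)
    refine ⟨_, _, .seq e1 (.seq e2 h1), ?_, h3, h4⟩
    simp only [cost, Expr.cost]
    rw [← hM]
    omega

end Compile

section Cost

/-- The nestings of loops that are admitted inside `a`, `d`, `q` and `m` loops of lengths `n`,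
`|Δ|`, `|Π|` and the number of inclusion-minimal full blocks. -/
def allowed (a d q m : ℕ) : Bool :=
  (d == 0 && q == 0 && m == 0 && a ≤ 3) || (d == 1 && q == 0 && m == 0 && a ≤ 2) ||
    (d == 0 && q == 1 && m == 0 && a ≤ 3) || (d == 0 && q == 0 && m == 1 && a ≤ 1)

/-- All loops of the program are nested in an admitted way. -/
def HCmd.nest : HCmd → ℕ → ℕ → ℕ → ℕ → Bool
  | .seq p p', a, d, q, m => p.nest a d q m && p'.nest a d q m
  | .ite _ p p', a, d, q, m => p.nest a d q m && p'.nest a d q m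
  | .loop _ _ .n p, a, d, q, m => allowed (a + 1) d q m && p.nest (a + 1) d q m
  | .loop _ _ .nD p, a, d, q, m => allowed a (d + 1) q m && p.nest a (d + 1) q m
  | .loop _ _ .nP p, a, d, q, m => allowed a d (q + 1) m && p.nest a d (q + 1) m
  | .loop _ _ .nM p, a, d, q, m => allowed a d q (m + 1) && p.nest a d q (m + 1)
  | .loop _ _ _ _, _, _, _, _ => false
  | _, _, _, _, _ => true

variable {N : Par → ℕ} {T : ℕ}

theorem allowed_le (hn : 0 < N .n) (hP : 0 < N .nP) (hM : N .nM ≤ N .n * N .nD)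
    (hT : T = N .n ^ 2 * N .nD + N .n ^ 3 * N .nP) {a d q m : ℕ} (h : allowed a d q m = true) :
    N .n ^ a * N .nD ^ d * N .nP ^ q * N .nM ^ m ≤ T := by
  simp only [allowed, Bool.or_eq_true, Bool.and_eq_true, beq_iff_eq, decide_eq_true_eq] at h
  have h3 : N .n ^ 3 * N .nP ≤ T := by omega
  have h2 : N .n ^ 2 * N .nD ≤ T := by omega
  rcases h with ((⟨⟨⟨rfl, rfl⟩, rfl⟩, ha⟩ | ⟨⟨⟨rfl, rfl⟩, rfl⟩, ha⟩) |
    ⟨⟨⟨rfl, rfl⟩, rfl⟩, ha⟩) | ⟨⟨⟨rfl, rfl⟩, rfl⟩, ha⟩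
  · calc _ = N .n ^ a * 1 := by simp
      _ ≤ N .n ^ 3 * N .nP := Nat.mul_le_mul (Nat.pow_le_pow_right hn ha) hP
      _ ≤ T := h3
  · calc _ = N .n ^ a * N .nD := by simp
      _ ≤ N .n ^ 2 * N .nD := Nat.mul_le_mul_right _ (Nat.pow_le_pow_right hn ha)
      _ ≤ T := h2
  · calc _ = N .n ^ a * N .nP := by simp
      _ ≤ N .n ^ 3 * N .nP := Nat.mul_le_mul_right _ (Nat.pow_le_pow_right hn ha)
      _ ≤ T := h3
  · calc _ = N .n ^ a * N .nM := by simp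
      _ ≤ N .n ^ 1 * (N .n * N .nD) := Nat.mul_le_mul (Nat.pow_le_pow_right hn ha) hM
      _ = N .n ^ 2 * N .nD := by ring
      _ ≤ T := h2

/-- The running time is linear in `T` if all loops are nested in an admitted way. -/
theorem HCmd.cost_le (hn : 0 < N .n) (hP : 0 < N .nP) (hM : N .nM ≤ N .n * N .nD)
    (hT : T = N .n ^ 2 * N .nD + N .n ^ 3 * N .nP) (p : HCmd) (hp : p.nest 0 0 0 0 = true) :
    p.cost N ≤ p.cost (fun _ => 1) * T := by
  have key : ∀ (p : HCmd) (a d q m : ℕ), allowed a d q m = true → p.nest a d q m = true →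
      N .n ^ a * N .nD ^ d * N .nP ^ q * N .nM ^ m * p.cost N ≤ p.cost (fun _ => 1) * T := by
    intro p
    have atom : ∀ (a d q m c : ℕ), allowed a d q m = true →
        N .n ^ a * N .nD ^ d * N .nP ^ q * N .nM ^ m * c ≤ c * T := fun a d q m c h => by
      rw [mul_comm]
      exact Nat.mul_le_mul_left _ (allowed_le hn hP hM hT h)
    have loop : ∀ (X X' Y c c' : ℕ), X' = X * Y → X ≤ T → X' ≤ T → X' * c ≤ c' * T →
        X * (Y * (c + 12) + 8) ≤ (1 * (c' + 12) + 8) * T := by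
      rintro X _ Y c c' rfl h1 h2 h3
      calc X * (Y * (c + 12) + 8) = X * Y * c + 12 * (X * Y) + 8 * X := by ring
        _ ≤ c' * T + 12 * T + 8 * T := by omega
        _ = _ := by ring
    induction p with
    | seq p p' ih ih' =>
      intro a d q m h hp
      simp only [nest, Bool.and_eq_true] at hp
      have h1 := ih a d q m h hp.1
      have h2 := ih' a d q m h hp.2
      simp only [cost]
      rw [mul_add, add_mul]
      omega
    | ite t p p' ih ih' =>
      intro a d q m h hp
      simp only [nest, Bool.and_eq_true] at hp
      have h1 := ih a d q m h hp.1
      have h2 := ih' a d q m h hp.2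
      have h3 := atom a d q m (t.compile.cost + 1) h
      simp only [cost]
      calc _ = N .n ^ a * N .nD ^ d * N .nP ^ q * N .nM ^ m * (t.compile.cost + 1) +
            (N .n ^ a * N .nD ^ d * N .nP ^ q * N .nM ^ m * p.cost N +
              N .n ^ a * N .nD ^ d * N .nP ^ q * N .nM ^ m * p'.cost N) := by ring
        _ ≤ _ := by
          refine (add_le_add h3 (add_le_add h1 h2)).trans (le_of_eq ?_)
          ring
    | loop x y b p ih =>
      intro a d q m h hp
      have hX := allowed_le hn hP hM hT h
      simp only [cost]
      cases b <;> simp only [nest, Bool.and_eq_true, Bool.false_eq_true] at hp <;>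
      exact loop _ _ _ _ _ (by ring) hX (allowed_le hn hP hM hT hp.1) (ih _ _ _ _ hp.1 hp.2)
    | _ =>
      intro a d q m h _
      exact atom a d q m _ h
  simpa using key p 0 0 0 0 rfl hp

end Cost

/-! ### The prelude and the epilogue -/

section LowLevel

/-- Sets register `dst` to the product of `a` and `b`, with register `16` as counter. -/
def mulProg (dst : ℕ) (a b : Expr) : Program :=
  .seq (.assign 16 (.const 0)) (.seq (.assign dst (.const 0))
    (.while (.lt (.reg 16) b) (.seq (.assign dst (.add (.reg dst) a))
      (.assign 16 (.add (.reg 16) (.const 1))))))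

/-- With word bound `W`, the program `p` sets register `x` to `v` in at most `K` steps; register
`16` is scratch space. -/
def Sets (W : ℕ) (p : Program) (s : State) (K x v : ℕ) : Prop :=
  ∃ k s', Exec W p s k s' ∧ k ≤ K ∧ s'.mem = s.mem ∧ s'.val = s.val ∧ s'.reg x = v ∧
    ∀ z, z ≠ 16 → z ≠ x → s'.reg z = s.reg z

theorem sets_assign {W x v : ℕ} {e : Expr} {s : State} (he : e.eval s = v) (hv : v < W) :
    Sets W (.assign x e) s (e.cost + 1) x v :=
  ⟨_, _, exec_assign he hv, le_rfl, rfl, rfl, by simp, fun _ _ h =>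
    Function.update_of_ne h _ _⟩

theorem sets_mul {W dst x y a b : ℕ} {s : State} (ha : s.reg x = a) (hb : s.reg y = b)
    (hW : a * b < W) (hW' : b < W) (hd : dst ≠ 16 := by decide) (hx : x ≠ 16 := by decide)
    (hy : y ≠ 16 := by decide) (hxd : x ≠ dst := by decide) (hyd : y ≠ dst := by decide) :
    Sets W (mulProg dst (.reg x) (.reg y)) s (12 * b + 8) dst (a * b) := by
  have key : ∀ d i, i + d = b → ∀ s₁ : State, s₁.mem = s.mem → s₁.val = s.val → s₁.reg 16 = i →
      s₁.reg dst = a * i → (∀ z, z ≠ 16 → z ≠ dst → s₁.reg z = s.reg z) →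
      ∃ k s', Exec W (.while (.lt (.reg 16) (.reg y)) (.seq (.assign dst (.add (.reg dst) (.reg x)))
        (.assign 16 (.add (.reg 16) (.const 1))))) s₁ k s' ∧ k ≤ 12 * d + 4 ∧
      s'.mem = s.mem ∧ s'.val = s.val ∧ s'.reg dst = a * b ∧
      ∀ z, z ≠ 16 → z ≠ dst → s'.reg z = s.reg z := by
    intro d
    induction d with
    | zero =>
      intro i hi s₁ h1 h2 h3 h4 h5
      obtain rfl : i = b := by omega
      refine ⟨_, _, .whileFalse _ ?_, ?_, h1, h2, h4, h5⟩
      · simp only [Test.Holds, Expr.eval, h3, h5 y hy hyd, hb]; omega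
      · simp [Test.cost, Expr.cost]
    | succ d ih =>
      intro i hi s₁ h1 h2 h3 h4 h5
      have hle : a * (i + 1) ≤ a * b := Nat.mul_le_mul_left _ (by omega)
      have hle' : a * (i + 1) = a * i + a := by ring
      have hxv : s₁.reg x = a := (h5 x hx hxd).trans ha
      have e1 := exec_assign (s := s₁) (x := dst) (e := .add (.reg dst) (.reg x))
        (show _ = a * i + a by simp only [Expr.eval, h4, hxv]) (show _ < W by omega)
      have e2 := exec_assign (s := { s₁ with reg := Function.update s₁.reg dst (a * i + a) })
        (x := 16) (e := .add (.reg 16) (.const 1)) (show _ = i + 1 by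
          simp only [Expr.eval, Function.update_of_ne hd.symm, h3]) (show _ < W by omega)
      obtain ⟨k, s', hk, hkd, g⟩ := ih (i + 1) (by omega)
        { s₁ with reg := Function.update (Function.update s₁.reg dst (a * i + a)) 16 (i + 1) } h1 h2
        (by simp) (by simp [Function.update_of_ne hd, hle']) (by
          intro z hz hzd
          simp only [Function.update_of_ne hz, Function.update_of_ne hzd, h5 z hz hzd])
      refine ⟨_, s', .whileTrue ?_ (.seq e1 e2) hk, ?_, g⟩
      · simp only [Test.Holds, Expr.eval, h3, h5 y hy hyd, hb]; omega
      · simp only [Test.cost, Expr.cost]; omega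
  have e1 := exec_assign (s := s) (x := 16) (e := .const 0) rfl (show 0 < W by omega)
  have e2 := exec_assign (s := { s with reg := Function.update s.reg 16 0 }) (x := dst)
    (e := .const 0) rfl (show 0 < W by omega)
  obtain ⟨k, s', hk, hkb, g⟩ := key b 0 (by omega)
    { s with reg := Function.update (Function.update s.reg 16 0) dst 0 } rfl rfl
    (by simp [Function.update_of_ne hd.symm]) (by simp)
    (fun z hz hzd => by simp [Function.update_of_ne hz, Function.update_of_ne hzd])
  exact ⟨_, s', .seq e1 (.seq e2 hk), by simp only [Expr.cost]; omega, g⟩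

/-- Copies `cnt` cells from address `src` on, in steps of `sk`, to address `dst` on, in steps of
`dk`; `mv` copies from the address in register `17` to the one in register `18`. -/
def copyProg (mv : Program) (src dst cnt : Expr) (sk dk : ℕ) : Program :=
  .seq (.assign 16 (.const 0)) (.seq (.assign 17 src) (.seq (.assign 18 dst)
    (.while (.lt (.reg 16) cnt) (.seq mv (.seq (.assign 17 (.add (.reg 17) (.const sk)))
      (.seq (.assign 18 (.add (.reg 18) (.const dk)))
        (.assign 16 (.add (.reg 16) (.const 1)))))))))

/-- Copying inside the memory of numbers. -/
def moveMem : Program := .store (.reg 18) (.load (.reg 17))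

/-- Copying inside the memory of values. -/
def moveVal : Program := .valCopy (.reg 18) (.reg 17)

section Copy

variable {W : ℕ} {s : State} {src dst : Expr} {y sk dk p₀ q₀ : ℕ} (hy : y < 16) (hdk : 0 < dk)
  (hsrc : ∀ ρ : ℕ → ℕ, (∀ x < 16, ρ x = s.reg x) → src.eval { s with reg := ρ } = p₀)
  (hdst : ∀ ρ : ℕ → ℕ, (∀ x < 16, ρ x = s.reg x) → dst.eval { s with reg := ρ } = q₀)
  (hpW : p₀ + sk * s.reg y < W) (hqW : q₀ + dk * s.reg y < W) (hyW : s.reg y < W)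
  (hne : ∀ j < s.reg y, ∀ j' < s.reg y, p₀ + sk * j ≠ q₀ + dk * j')

include hy hdk hsrc hdst hpW hqW hyW hne

/-- The copying loop, for either memory: `get` reads the memory that is written to and `oth` the
other one. -/
theorem exec_copyProg_aux {α β : Type*} {mv : Program} (get : State → ℕ → α)
    (oth : State → β) {ok : α → Prop}
    (hget : ∀ s ρ, get { s with reg := ρ } = get s) (hoth : ∀ s ρ, oth { s with reg := ρ } = oth s)
    (hmv : ∀ s : State, s.reg 18 < W → ok (get s (s.reg 17)) → ∃ k s', Exec W mv s k s' ∧ k ≤ 4 ∧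
      s'.reg = s.reg ∧ get s' = Function.update (get s) (s.reg 18) (get s (s.reg 17)) ∧
      oth s' = oth s)
    (hok : ∀ j < s.reg y, ok (get s (p₀ + sk * j))) :
    ∃ k s', Exec W (copyProg mv src dst (.reg y) sk dk) s k s' ∧
      k ≤ 21 * s.reg y + (src.cost + dst.cost + 8) ∧ oth s' = oth s ∧
      (∀ x, x < 16 ∨ 18 < x → s'.reg x = s.reg x) ∧
      (∀ j < s.reg y, get s' (q₀ + dk * j) = get s (p₀ + sk * j)) ∧
      ∀ x, (∀ j < s.reg y, x ≠ q₀ + dk * j) → get s' x = get s x := by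
  obtain ⟨m, hm⟩ : ∃ m, m = s.reg y := ⟨_, rfl⟩
  rw [← hm] at hpW hqW hok hne hyW ⊢
  have key : ∀ d i, i + d = m → ∀ s₁ : State, oth s₁ = oth s → s₁.reg 16 = i →
      s₁.reg 17 = p₀ + sk * i → s₁.reg 18 = q₀ + dk * i →
      (∀ x, x < 16 ∨ 18 < x → s₁.reg x = s.reg x) →
      (∀ j < i, get s₁ (q₀ + dk * j) = get s (p₀ + sk * j)) →
      (∀ x, (∀ j < i, x ≠ q₀ + dk * j) → get s₁ x = get s x) →
      ∃ k s', Exec W (.while (.lt (.reg 16) (.reg y)) (.seq mv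
          (.seq (.assign 17 (.add (.reg 17) (.const sk)))
          (.seq (.assign 18 (.add (.reg 18) (.const dk)))
          (.assign 16 (.add (.reg 16) (.const 1))))))) s₁ k s' ∧
        k ≤ 21 * d + 4 ∧ oth s' = oth s ∧ (∀ x, x < 16 ∨ 18 < x → s'.reg x = s.reg x) ∧
        (∀ j < m, get s' (q₀ + dk * j) = get s (p₀ + sk * j)) ∧
        ∀ x, (∀ j < m, x ≠ q₀ + dk * j) → get s' x = get s x := by
    intro d
    induction d with
    | zero =>
      intro i hi s₁ h1 h2 h3 h4 h5 h6 h7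
      obtain rfl : i = m := by omega
      refine ⟨_, _, .whileFalse _ ?_, ?_, h1, h5, h6, h7⟩
      · simp only [Test.Holds, Expr.eval, h2, h5 y (Or.inl hy)]; omega
      · simp [Test.cost, Expr.cost]
    | succ d ih =>
      intro i hi s₁ h1 h2 h3 h4 h5 h6 h7
      have hle : sk * (i + 1) ≤ sk * m := Nat.mul_le_mul_left _ (by omega)
      have hle' : sk * (i + 1) = sk * i + sk := by ring
      have hle2 : dk * (i + 1) ≤ dk * m := Nat.mul_le_mul_left _ (by omega)
      have hle2' : dk * (i + 1) = dk * i + dk := by ring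
      have hg : get s₁ (p₀ + sk * i) = get s (p₀ + sk * i) :=
        h7 _ fun j hj => hne i (by omega) j (by omega)
      obtain ⟨k₀, s₂, e0, hk₀, r0, g0, o0⟩ := hmv s₁ (by omega) (by rw [h3, hg]; exact hok i (by omega))
      have e1 := exec_assign (s := s₂) (x := 17) (e := .add (.reg 17) (.const sk))
        (show _ = p₀ + sk * i + sk by simp only [Expr.eval, r0, h3]) (show _ < W by omega)
      rw [r0] at e1
      have e2 := exec_assign (s := { s₂ with reg := Function.update s₁.reg 17 (p₀ + sk * i + sk) })
        (x := 18) (e := .add (.reg 18) (.const dk)) (show _ = q₀ + dk * i + dk by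
          simp [Expr.eval, h4]) (show _ < W by omega)
      obtain ⟨ρ, hρ⟩ : ∃ ρ, ρ = Function.update (Function.update s₁.reg 17 (p₀ + sk * i + sk))
        18 (q₀ + dk * i + dk) := ⟨_, rfl⟩
      simp only [← hρ] at e2
      have e3 := exec_assign (s := { s₂ with reg := ρ }) (x := 16) (e := .add (.reg 16) (.const 1))
        (show _ = i + 1 by simp [Expr.eval, hρ, h2]) (show _ < W by omega)
      obtain ⟨k, s', hk, hkd, g⟩ := ih (i + 1) (by omega)
        { s₂ with reg := Function.update ρ 16 (i + 1) }
        (by rw [hoth, o0, h1]) (by simp)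
        (by simp [hρ, hle', add_assoc])
        (by simp [hρ, hle2', add_assoc]) (by
          intro x hx
          have hx1 : x ≠ 16 := by omega
          have hx2 : x ≠ 17 := by omega
          have hx3 : x ≠ 18 := by omega
          simp only [hρ, Function.update_of_ne hx1, Function.update_of_ne hx2,
            Function.update_of_ne hx3, h5 x hx]) (by
          intro j hj
          rw [hget, g0, h4, h3, hg]
          rcases Nat.lt_succ_iff_lt_or_eq.1 hj with hj | rfl
          · rw [Function.update_of_ne, h6 j hj]
            intro h
            have : dk * j = dk * i := by omega
            have := Nat.eq_of_mul_eq_mul_left hdk this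
            omega
          · rw [Function.update_self]) (by
          intro x hx
          rw [hget, g0, h4, Function.update_of_ne (hx i (by omega)),
            h7 x fun j hj => hx j (by omega)])
      refine ⟨_, s', .whileTrue ?_ (.seq e0 (.seq e1 (.seq e2 e3))) hk, ?_, g⟩
      · simp only [Test.Holds, Expr.eval, h2, h5 y (Or.inl hy)]; omega
      · simp only [Test.cost, Expr.cost]; omega
  have e1 := exec_assign (s := s) (x := 16) (e := .const 0) rfl (show 0 < W by omega)
  have e2 := exec_assign (s := { s with reg := Function.update s.reg 16 0 }) (x := 17)
    (hsrc (Function.update s.reg 16 0) fun x hx => Function.update_of_ne (by omega) _ _)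
    (show _ < W by omega)
  have e3 := exec_assign (s := { s with reg := Function.update (Function.update s.reg 16 0) 17 p₀ })
    (x := 18) (hdst (Function.update (Function.update s.reg 16 0) 17 p₀) fun x hx => by
      rw [Function.update_of_ne (by omega), Function.update_of_ne (by omega)])
    (show _ < W by omega)
  obtain ⟨k, s', hk, hkb, g⟩ := key m 0 (by omega)
    { s with reg := Function.update (Function.update (Function.update s.reg 16 0) 17 p₀) 18 q₀ }
    (hoth _ _) (by simp) (by simp) (by simp) (by
      intro x hx
      have hx1 : x ≠ 16 := by omega
      have hx2 : x ≠ 17 := by omega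
      have hx3 : x ≠ 18 := by omega
      simp only [Function.update_of_ne hx1, Function.update_of_ne hx2, Function.update_of_ne hx3])
    (fun j hj => absurd hj (by omega)) (fun x _ => by rw [hget])
  exact ⟨_, s', .seq e1 (.seq e2 (.seq e3 hk)), by simp only [Expr.cost]; omega, g⟩

theorem exec_copyMem (hok : ∀ j < s.reg y, s.mem (p₀ + sk * j) < W) :
    ∃ k s', Exec W (copyProg moveMem src dst (.reg y) sk dk) s k s' ∧
      k ≤ 21 * s.reg y + (src.cost + dst.cost + 8) ∧ s'.val = s.val ∧
      (∀ x, x < 16 ∨ 18 < x → s'.reg x = s.reg x) ∧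
      (∀ j < s.reg y, s'.mem (q₀ + dk * j) = s.mem (p₀ + sk * j)) ∧
      ∀ x, (∀ j < s.reg y, x ≠ q₀ + dk * j) → s'.mem x = s.mem x :=
  exec_copyProg_aux hy hdk hsrc hdst hpW hqW hyW hne State.mem State.val (ok := (· < W))
    (fun _ _ => rfl) (fun _ _ => rfl)
    (fun s h1 h2 => ⟨_, _, .store s _ _ h1 h2, le_rfl, rfl, rfl, rfl⟩) hok

theorem exec_copyVal :
    ∃ k s', Exec W (copyProg moveVal src dst (.reg y) sk dk) s k s' ∧
      k ≤ 21 * s.reg y + (src.cost + dst.cost + 8) ∧ s'.mem = s.mem ∧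
      (∀ x, x < 16 ∨ 18 < x → s'.reg x = s.reg x) ∧
      (∀ j < s.reg y, s'.val (q₀ + dk * j) = s.val (p₀ + sk * j)) ∧
      ∀ x, (∀ j < s.reg y, x ≠ q₀ + dk * j) → s'.val x = s.val x :=
  exec_copyProg_aux hy hdk hsrc hdst hpW hqW hyW hne State.val State.mem (ok := fun _ => True)
    (fun _ _ => rfl) (fun _ _ => rfl)
    (fun s h1 _ => ⟨_, _, .valCopy s _ _ h1, by decide, rfl, rfl, rfl⟩) fun _ _ => trivial

end Copy

end LowLevel

/-! ### Labels of components -/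

section Labels

variable {n : ℕ} {G : SimpleGraph (Fin n)} {X : Finset (Fin n)} {lab lab' : ℕ → ℕ} {i : ℕ}
  {u v w : Fin n}

/-- `lab` assigns to every vertex outside of `X` a representative of its component of `G - X`, and
the number `n` to the elements of `X`. -/
structure Labels (G : SimpleGraph (Fin n)) (X : Finset (Fin n)) (lab : ℕ → ℕ) : Prop where
  out : ∀ v : Fin n, v ∈ X → lab v = n
  rep : ∀ v : Fin n, v ∉ X → ∃ w : Fin n, lab v = w ∧ lab w = w ∧ w ∈ compOf G X v
  eq_iff : ∀ u v : Fin n, u ∉ X → v ∉ X → (lab u = lab v ↔ u ∈ compOf G X v)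

/-- The labels after the vertices below `i` have been inserted one by one: adjacent vertices
have the same label, and all vertices with the same label lie in the same component. -/
structure PartLabels (G : SimpleGraph (Fin n)) (X : Finset (Fin n)) (i : ℕ) (lab : ℕ → ℕ) :
    Prop where
  out : ∀ v : Fin n, ¬ (v.val < i ∧ v ∉ X) → lab v = n
  rep : ∀ v : Fin n, v.val < i → v ∉ X → ∃ w : Fin n, w.val < i ∧ w ∉ X ∧ lab v = w ∧ lab w = w ∧
    ReachIn G {x | x ∉ X} v w
  adj : ∀ u v : Fin n, u.val < i → u ∉ X → v.val < i → v ∉ X → G.Adj u v → lab u = lab v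

theorem PartLabels.lt_iff (h : PartLabels G X i lab) : lab v < n ↔ v.val < i ∧ v ∉ X := by
  constructor
  · intro hv
    by_contra hn
    exact absurd (h.out v hn) hv.ne
  · rintro ⟨h1, h2⟩
    obtain ⟨w, -, -, hw, -⟩ := h.rep v h1 h2
    rw [hw]
    exact w.2

theorem PartLabels.reachIn (h : PartLabels G X i lab) (hu : lab u < n) (huv : lab u = lab v) :
    ReachIn G {x | x ∉ X} u v := by
  obtain ⟨hu1, hu2⟩ := h.lt_iff.1 hu
  obtain ⟨hv1, hv2⟩ := h.lt_iff.1 (huv ▸ hu)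
  obtain ⟨w, -, -, hw, -, hr⟩ := h.rep u hu1 hu2
  obtain ⟨w', -, -, hw', -, hr'⟩ := h.rep v hv1 hv2
  obtain rfl : w = w' := Fin.ext (by omega)
  exact hr.trans (hr'.symm hv2)

theorem PartLabels.succ_of_mem (h : PartLabels G X v.val lab) (hv : v ∈ X) :
    PartLabels G X (v.val + 1) lab := by
  have key : ∀ {u : Fin n}, u.val < v.val + 1 → u ∉ X → u.val < v.val := by
    intro u h1 h2
    have : u.val ≠ v.val := fun he => h2 (Fin.ext he ▸ hv)
    omega
  refine ⟨fun u hu => h.out u fun h' => hu ⟨by omega, h'.2⟩, fun u h1 h2 => ?_,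
    fun u w h1 h2 h3 h4 => h.adj u w (key h1 h2) h2 (key h3 h4) h4⟩
  obtain ⟨w, hw, h3⟩ := h.rep u (key h1 h2) h2
  exact ⟨w, by omega, h3⟩

/-- A new vertex `v` outside of `X` becomes the representative of itself and of all classes that
contain a neighbor of `v`. -/
theorem PartLabels.succ_of_notMem (h : PartLabels G X v.val lab) (hv : v ∉ X)
    (h1 : ∀ u : Fin n, (u = v ∨ lab u < n ∧ ∃ x : Fin n, lab x = lab u ∧ G.Adj v x) → lab' u = v)
    (h2 : ∀ u : Fin n, ¬ (u = v ∨ lab u < n ∧ ∃ x : Fin n, lab x = lab u ∧ G.Adj v x) →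
      lab' u = lab u) : PartLabels G X (v.val + 1) lab' := by
  have key : ∀ {u : Fin n}, u.val < v.val + 1 → u ≠ v → u.val < v.val := by
    intro u h1 h2
    have : u.val ≠ v.val := fun he => h2 (Fin.ext he)
    omega
  refine ⟨fun u hu => ?_, fun u hu huX => ?_, fun u w hu huX hw hwX huw => ?_⟩
  · have huv : u ≠ v := fun he => hu ⟨by rw [he]; omega, he ▸ hv⟩
    have hn := h.out u fun h' => hu ⟨by omega, h'.2⟩
    rw [h2 u (by rintro (h | ⟨h, -⟩) <;> [exact huv h; omega]), hn]
  · by_cases hc : u = v ∨ lab u < n ∧ ∃ x : Fin n, lab x = lab u ∧ G.Adj v x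
    · refine ⟨v, by omega, hv, h1 u hc, h1 v (Or.inl rfl), ?_⟩
      rcases hc with rfl | ⟨hu', x, hx, hvx⟩
      · exact .refl _
      · exact (h.reachIn hu' hx.symm).step hvx.symm hv
    · obtain ⟨w, hw, hwX, e1, e2, hr⟩ := h.rep u (key hu fun he => hc (Or.inl he)) huX
      refine ⟨w, by omega, hwX, (h2 u hc).trans e1, ?_, hr⟩
      rw [h2 w, e2]
      rw [e2, ← e1]
      rintro (rfl | hc')
      · omega
      · exact hc (Or.inr hc')
  · rcases eq_or_ne u v with rfl | huv
    · have hwu : w ≠ u := fun he => (he ▸ huw).ne rfl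
      rw [h1 u (Or.inl rfl), h1 w (Or.inr ⟨h.lt_iff.2 ⟨key hw hwu, hwX⟩, w, rfl, huw⟩)]
    · rcases eq_or_ne w v with rfl | hwv
      · rw [h1 w (Or.inl rfl), h1 u (Or.inr ⟨h.lt_iff.2 ⟨key hu huv, huX⟩, u, rfl, huw.symm⟩)]
      · have he := h.adj u w (key hu huv) huX (key hw hwv) hwX huw
        by_cases hc : lab u < n ∧ ∃ x : Fin n, lab x = lab u ∧ G.Adj v x
        · rw [h1 u (Or.inr hc), h1 w (Or.inr (he ▸ hc))]
        · rw [h2 u fun h => h.elim huv hc, h2 w fun h => h.elim hwv (he ▸ hc), he]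

theorem PartLabels.labels (h : PartLabels G X n lab) : Labels G X lab := by
  refine ⟨fun v hv => h.out v fun h' => h'.2 hv, fun v hv => ?_, fun u v hu hv => ?_⟩
  · obtain ⟨w, -, -, h1, h2, h3⟩ := h.rep v v.2 hv
    exact ⟨w, h1, h2, mem_compOf.2 h3⟩
  · rw [mem_compOf]
    constructor
    · intro he
      exact h.reachIn (h.lt_iff.2 ⟨v.2, hv⟩) he.symm
    · intro hr
      suffices lab u = lab v ∧ u ∉ X from this.1
      clear hu
      induction hr with
      | refl => exact ⟨rfl, hv⟩
      | @tail b c _ hbc ih =>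
        exact ⟨(h.adj b c b.2 ih.2 c.2 hbc.2 hbc.1).symm.trans ih.1, hbc.2⟩

theorem Labels.lt_iff (h : Labels G X lab) : lab v < n ↔ v ∉ X := by
  constructor
  · intro hv hX
    exact absurd (h.out v hX) hv.ne
  · intro hv
    obtain ⟨w, hw, -⟩ := h.rep v hv
    rw [hw]
    exact w.2

/-- A vertex has itself as label only if it does not lie in `X`. -/
theorem Labels.notMem (h : Labels G X lab) (hv : lab v = v) : v ∉ X :=
  h.lt_iff.1 (by rw [hv]; exact v.2)

theorem Labels.eq_val_iff (h : Labels G X lab) (hv : lab v = v) :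
    lab u = v ↔ u ∈ compOf G X v := by
  have hvX := h.notMem hv
  by_cases hu : u ∈ X
  · rw [h.out u hu]
    exact ⟨fun he => absurd v.2 (by omega), fun hm => absurd hu (notMem_of_mem_compOf hvX hm)⟩
  · rw [← h.eq_iff u v hu hvX, hv]

/-- Every component has exactly one vertex that is its own label. -/
theorem Labels.exists_rep (h : Labels G X lab) {C : Finset (Fin n)} (hC : IsComp G X C) :
    ∃ r : Fin n, lab r = r ∧ C = compOf G X r := by
  obtain ⟨v, hv, rfl⟩ := isComp_iff.1 hC
  obtain ⟨w, -, hw, hwv⟩ := h.rep v hv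
  exact ⟨w, hw, (compOf_eq_of_mem hv hwv).symm⟩

theorem Labels.rep_unique (h : Labels G X lab) (hu : lab u = u) (hv : lab v = v)
    (he : compOf G X u = compOf G X v) : u = v := by
  have := (h.eq_val_iff hv).2 (he ▸ self_mem_compOf (v := u))
  exact Fin.ext (hu.symm.trans this)

end Labels

/-! ### Rules for the language of loops -/

instance : OfNat HExpr k := ⟨.const k⟩
instance : Add HExpr := ⟨.add⟩
instance : Sub HExpr := ⟨.sub⟩

local prefix:max "#" => HExpr.reg
local infixr:20 " ⨾ " => HCmd.seq

section Rules

variable {E : Env} {σ : HState}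

@[simp] theorem eval_zero : (0 : HExpr).eval E σ = 0 := rfl
@[simp] theorem eval_one : (1 : HExpr).eval E σ = 1 := rfl
@[simp] theorem eval_two : (2 : HExpr).eval E σ = 2 := rfl
@[simp] theorem eval_const (k : ℕ) : (HExpr.const k).eval E σ = k := rfl
@[simp] theorem eval_add (a b : HExpr) : (a + b).eval E σ = a.eval E σ + b.eval E σ := rfl
@[simp] theorem eval_sub (a b : HExpr) : (a - b).eval E σ = a.eval E σ - b.eval E σ := rfl
@[simp] theorem eval_reg (x : Reg) : (#x).eval E σ = σ.r x := rfl
@[simp] theorem eval_par (m : Par) : (HExpr.par m).eval E σ = E.par m := rfl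
@[simp] theorem eval_ld (k : Arr) (e : HExpr) : (HExpr.ld k e).eval E σ = σ.a k (e.eval E σ) := rfl
@[simp] theorem holds_lt (a b : HExpr) :
    (HTest.lt a b).Holds E σ ↔ a.eval E σ < b.eval E σ := Iff.rfl
@[simp] theorem holds_eq (a b : HExpr) :
    (HTest.eq a b).Holds E σ ↔ a.eval E σ = b.eval E σ := Iff.rfl
@[simp] theorem holds_vle (k l : VArr) (a b : HExpr) :
    (HTest.vle k a l b).Holds E σ ↔ σ.v k (a.eval E σ) ≤ σ.v l (b.eval E σ) := Iff.rfl
@[simp] theorem holds_not (t : HTest) : (HTest.not t).Holds E σ ↔ ¬ t.Holds E σ := Iff.rfl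
@[simp] theorem holds_and (t u : HTest) :
    (HTest.and t u).Holds E σ ↔ t.Holds E σ ∧ u.Holds E σ := Iff.rfl

theorem run_seq (p q : HCmd) : (p ⨾ q).run E σ = q.run E (p.run E σ) := rfl
theorem run_skip : HCmd.skip.run E σ = σ := rfl

theorem run_ite_pos {t : HTest} {p q : HCmd} (h : t.Holds E σ) :
    (HCmd.ite t p q).run E σ = p.run E σ := if_pos h

theorem run_ite_neg {t : HTest} {p q : HCmd} (h : ¬ t.Holds E σ) :
    (HCmd.ite t p q).run E σ = q.run E σ := if_neg h

theorem run_assign {x : Reg} {e : HExpr} {a : ℕ} (he : e.eval E σ = a) (h : a < E.bound) :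
    (HCmd.assign x e).run E σ = σ.setR x a := by
  simp only [HCmd.run, he, if_pos h]

theorem run_store {k : Arr} {i e : HExpr} {a b : ℕ} (hi : i.eval E σ = a) (he : e.eval E σ = b)
    (ha : a < E.bound) (hb : b < E.bound) : (HCmd.store k i e).run E σ = σ.setA k a b := by
  simp only [HCmd.run, hi, he, if_pos (And.intro ha hb)]

theorem run_vcopy {k l : VArr} {i e : HExpr} {a b : ℕ} (hi : i.eval E σ = a)
    (he : e.eval E σ = b) (ha : a < E.bound) :
    (HCmd.vcopy k i l e).run E σ = σ.setV k a (σ.v l b) := by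
  simp only [HCmd.run, hi, he, if_pos ha]

theorem run_vtop {k : VArr} {i : HExpr} {a : ℕ} (hi : i.eval E σ = a) (ha : a < E.bound) :
    (HCmd.vtop k i).run E σ = σ.setV k a ⊤ := by
  simp only [HCmd.run, hi, if_pos ha]

@[simp] theorem setR_self (x : Reg) (k : ℕ) : (σ.setR x k).r x = k := Function.update_self ..
@[simp] theorem setR_of_ne {x y : Reg} (k : ℕ) (h : y ≠ x) : (σ.setR x k).r y = σ.r y :=
  Function.update_of_ne h ..
@[simp] theorem setR_a (x : Reg) (k : ℕ) : (σ.setR x k).a = σ.a := rfl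
@[simp] theorem setR_v (x : Reg) (k : ℕ) : (σ.setR x k).v = σ.v := rfl
@[simp] theorem setA_r (k : Arr) (i e : ℕ) : (σ.setA k i e).r = σ.r := rfl
@[simp] theorem setA_v (k : Arr) (i e : ℕ) : (σ.setA k i e).v = σ.v := rfl
@[simp] theorem setA_self (k : Arr) (i e : ℕ) :
    (σ.setA k i e).a k = Function.update (σ.a k) i e := Function.update_self ..
@[simp] theorem setA_of_ne {k l : Arr} (i e : ℕ) (h : l ≠ k) : (σ.setA k i e).a l = σ.a l :=
  Function.update_of_ne h ..
@[simp] theorem setV_r (k : VArr) (i : ℕ) (e : ℝ≥0∞) : (σ.setV k i e).r = σ.r := rfl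
@[simp] theorem setV_a (k : VArr) (i : ℕ) (e : ℝ≥0∞) : (σ.setV k i e).a = σ.a := rfl
@[simp] theorem setV_self (k : VArr) (i : ℕ) (e : ℝ≥0∞) :
    (σ.setV k i e).v k = Function.update (σ.v k) i e := Function.update_self ..
@[simp] theorem setV_of_ne {k l : VArr} (i : ℕ) (e : ℝ≥0∞) (h : l ≠ k) :
    (σ.setV k i e).v l = σ.v l := Function.update_of_ne h ..

/-- The invariant rule for invariants that do not mention the loop counters. -/
theorem HCmd.loop_rule {x y : Reg} {m : Par} {p : HCmd}
    (hwf : (HCmd.loop x y m p).wf = true) (I : ℕ → HState → Prop)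
    (hI : ∀ i τ k l, I i τ → I i ((τ.setR x k).setR y l)) (h0 : I 0 σ)
    (hs : ∀ i < E.par m, ∀ τ : HState, Frame (.loop x y m p) σ τ → τ.r x = i →
      τ.r y = i * E.par .n → I i τ → I (i + 1) (p.run E τ)) :
    I (E.par m) ((HCmd.loop x y m p).run E σ) :=
  HCmd.loop_inv hwf I (hI _ _ _ _ h0) fun i hi τ hF hx hy h => hI _ _ _ _ (hs i hi τ hF hx hy h)

/-- A loop that sets the entries `o, …, o + m - 1` of an array to `g 0, …, g (m - 1)`. -/
theorem run_fill {x y : Reg} {m : Par} {k : Arr} {ie e : HExpr} {o : ℕ} {g : ℕ → ℕ}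
    (hwf : (HCmd.loop x y m (.store k ie e)).wf = true)
    (he : ∀ i < E.par m, ∀ τ : HState, Frame (.loop x y m (.store k ie e)) σ τ → τ.r x = i →
      τ.r y = i * E.par .n → ie.eval E τ = o + i ∧ e.eval E τ = g i ∧ o + i < E.bound ∧
        g i < E.bound) :
    (∀ i < E.par m, ((HCmd.loop x y m (.store k ie e)).run E σ).a k (o + i) = g i) ∧
      ∀ j, (∀ i < E.par m, j ≠ o + i) →
        ((HCmd.loop x y m (.store k ie e)).run E σ).a k j = σ.a k j := by
  refine HCmd.loop_rule hwf (fun i τ => (∀ j < i, τ.a k (o + j) = g j) ∧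
    ∀ j, (∀ l < i, j ≠ o + l) → τ.a k j = σ.a k j) (fun _ _ _ _ h => h)
    ⟨fun _ h => absurd h (Nat.not_lt_zero _), fun _ _ => rfl⟩ fun i hi τ hF hx hy h => ?_
  obtain ⟨h1, h2, h3, h4⟩ := he i hi τ hF hx hy
  rw [run_store h1 h2 h3 h4, setA_self]
  refine ⟨fun j hj => ?_, fun j hj => ?_⟩
  · rcases Nat.lt_succ_iff_lt_or_eq.1 hj with hj | rfl
    · rw [Function.update_of_ne (by omega), h.1 j hj]
    · rw [Function.update_self]
  · rw [Function.update_of_ne (hj i (by omega)), h.2 j fun l hl => hj l (by omega)]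

end Rules

/-! ### Computing the components of a graph without a set of vertices -/

/-- Labels the components of `G - X`, where `X` is the set in the array `xs`. -/
def labelsCmd : HCmd :=
  .loop .v .vo .n (.store .lab #.v (.par .n)) ⨾
  .loop .v .vo .n (.ite (.eq (.ld .xs #.v) 0)
    (.store .lab #.v #.v ⨾
      .loop .u .uo .n (.store .mark #.u 0) ⨾
      .loop .u .uo .n (.ite (.and (.lt (.ld .lab #.u) (.par .n))
        (.eq (.ld .inp (1 + #.vo + #.u)) 1)) (.store .mark (.ld .lab #.u) 1) .skip) ⨾
      .loop .u .uo .n (.ite (.and (.lt (.ld .lab #.u) (.par .n))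
        (.eq (.ld .mark (.ld .lab #.u)) 1)) (.store .lab #.u #.v) .skip))
    .skip)

/-- Sets entry `v * n + r` of the array `nb` to `1` if `v` lies in `X` and has a neighbor with
label `r`, and to `0` otherwise. -/
def nbCmd : HCmd :=
  .loop .v .vo .n (.loop .u .uo .n (.store .nb (#.vo + #.u) 0)) ⨾
  .loop .v .vo .n (.ite (.eq (.ld .xs #.v) 1)
    (.loop .u .uo .n (.ite (.and (.lt (.ld .lab #.u) (.par .n))
      (.eq (.ld .inp (1 + #.vo + #.u)) 1)) (.store .nb (#.vo + .ld .lab #.u) 1) .skip))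
    .skip)

section

variable {n : ℕ} {G : SimpleGraph (Fin n)} {X : Finset (Fin n)} {E : Env} {σ : HState}

/-- The array `a` holds the set `X` as a 0/1-vector at the addresses from `o` on. -/
def IsBits (X : Finset (Fin n)) (a : ℕ → ℕ) (o : ℕ) : Prop :=
  ∀ v : Fin n, (v ∈ X → a (o + v) = 1) ∧ (v ∉ X → a (o + v) = 0)

theorem IsBits.eq_one_iff {a : ℕ → ℕ} {o : ℕ} (h : IsBits X a o) {v : Fin n} :
    a (o + v) = 1 ↔ v ∈ X := by
  by_cases hv : v ∈ X
  · simp [hv, (h v).1 hv]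
  · simp [hv, (h v).2 hv]

theorem IsBits.eq_zero_iff {a : ℕ → ℕ} {o : ℕ} (h : IsBits X a o) {v : Fin n} :
    a (o + v) = 0 ↔ v ∉ X := by
  by_cases hv : v ∈ X
  · simp [hv, (h v).1 hv]
  · simp [hv, (h v).2 hv]

/-- The array `a` holds the adjacency matrix of `G`, from address `1` on. -/
def IsAdj (G : SimpleGraph (Fin n)) (a : ℕ → ℕ) : Prop :=
  ∀ u v : Fin n, a (1 + u * n + v) = 1 ↔ G.Adj u v

theorem mul_add_lt {a b i r n : ℕ} (hi : i < a) (hr : r < n) (hb : a * n ≤ b) : i * n + r < b := by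
  calc i * n + r < i * n + n := by omega
    _ = (i + 1) * n := by ring
    _ ≤ a * n := Nat.mul_le_mul_right _ hi
    _ ≤ b := hb

theorem mul_add_self_le {i m n : ℕ} (h : i < m) : i * n + n ≤ m * n := by
  rw [← Nat.succ_mul]
  exact Nat.mul_le_mul_right _ h

theorem mul_add_inj {i j r q n : ℕ} (hr : r < n) (hq : q < n) (h : i * n + r = j * n + q) :
    i = j ∧ r = q := by
  have h1 : (i * n + r) / n = i := by
    rw [mul_comm, Nat.mul_add_div (by omega), Nat.div_eq_of_lt hr, add_zero]
  have h2 : (j * n + q) / n = j := by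
    rw [mul_comm, Nat.mul_add_div (by omega), Nat.div_eq_of_lt hq, add_zero]
  have : i = j := by rw [← h1, ← h2, h]
  subst this
  omega

theorem exists_val_lt_succ {p : Fin n → Prop} {v : Fin n} :
    (∃ u : Fin n, u.val < v.val + 1 ∧ p u) ↔ (∃ u : Fin n, u.val < v.val ∧ p u) ∨ p v := by
  constructor
  · rintro ⟨u, hu, h⟩
    rcases Nat.lt_succ_iff_lt_or_eq.1 hu with hu | hu
    exacts [Or.inl ⟨u, hu, h⟩, Or.inr (Fin.ext hu ▸ h)]
  · rintro (⟨u, hu, h⟩ | h)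
    exacts [⟨u, by omega, h⟩, ⟨v, by omega, h⟩]

theorem forall_val_lt_succ {p : Fin n → Prop} {v : Fin n} :
    (∀ u : Fin n, u.val < v.val + 1 → p u) ↔ (∀ u : Fin n, u.val < v.val → p u) ∧ p v := by
  constructor
  · exact fun h => ⟨fun u hu => h u (by omega), h v (by omega)⟩
  · rintro ⟨h1, h2⟩ u hu
    rcases Nat.lt_succ_iff_lt_or_eq.1 hu with hu | hu
    exacts [h1 u hu, Fin.ext hu ▸ h2]

theorem run_labelsCmd (hn : E.par .n = n) (hb : n < E.bound) (hadj : IsAdj G (σ.a .inp))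
    (hX : IsBits X (σ.a .xs) 0) : Labels G X ((labelsCmd.run E σ).a .lab) := by
  rw [labelsCmd, run_seq]
  obtain ⟨h1, -⟩ := run_fill (σ := σ) (x := .v) (y := .vo) (m := .n) (k := .lab) (ie := #.v)
    (e := .par .n) (o := 0) (g := fun _ => n) rfl fun i hi τ hF hx hy => by
      rw [hn] at hi; simp [hx, hn]; omega
  generalize hF : HCmd.run E (.loop _ _ _ _) σ = σ₁ at h1 ⊢
  replace hF := HCmd.frame_of_eq hF
  simp only [zero_add, hn] at h1
  have e1 : σ₁.a .inp = σ.a .inp := hF.a rfl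
  have e2 : σ₁.a .xs = σ.a .xs := hF.a rfl
  rw [← e1] at hadj
  rw [← e2] at hX
  clear hF e1 e2
  refine PartLabels.labels ?_
  conv => enter [3]; rw [← hn]
  refine HCmd.loop_rule rfl (fun i τ => PartLabels G X i (τ.a .lab)) (fun _ _ _ _ h => h)
    ⟨fun v _ => h1 v v.2, fun v hv => absurd hv (Nat.not_lt_zero _),
      fun v _ hv => absurd hv (Nat.not_lt_zero _)⟩ fun i hi τ hF hx hy h => ?_
  rw [hn] at hi hy
  obtain ⟨v, rfl⟩ : ∃ v : Fin n, v.val = i := ⟨⟨i, hi⟩, rfl⟩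
  have ei : τ.a .inp = σ₁.a .inp := hF.a rfl
  have ex : τ.a .xs = σ₁.a .xs := hF.a rfl
  have hXv : σ₁.a .xs v = 0 ↔ v ∉ X := by simpa using hX.eq_zero_iff (v := v)
  by_cases hv : v ∈ X
  · rw [run_ite_neg (by simpa [hx, ex, hXv] using hv)]
    exact h.succ_of_mem hv
  rw [run_ite_pos (by simpa [hx, ex, hXv] using hv)]
  simp only [run_seq]
  rw [run_store (a := v) (b := v) (by simp [hx]) (by simp [hx]) (by omega) (by omega)]
  -- The labels after the first step, before the classes are merged.
  obtain ⟨l₁, hl₁⟩ : ∃ l₁, l₁ = Function.update (τ.a .lab) v v := ⟨_, rfl⟩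
  obtain ⟨τ₁, hτ₁⟩ : ∃ τ₁, τ₁ = τ.setA .lab v v := ⟨_, rfl⟩
  have t1 : τ₁.a .lab = l₁ := by simp [hτ₁, hl₁]
  have t2 : τ₁.a .inp = σ₁.a .inp := by simp [hτ₁, ei]
  have t3 : τ₁.r .v = v := by simp [hτ₁, hx]
  have t4 : τ₁.r .vo = v * n := by simp [hτ₁, hy]
  rw [← hτ₁]
  clear hτ₁
  have hlv : l₁ v = v := by simp [hl₁]
  have hlu : ∀ u : Fin n, u ≠ v → l₁ u = τ.a .lab u := fun u hu => by
    rw [hl₁, Function.update_of_ne fun he => hu (Fin.ext he)]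
  obtain ⟨m1, -⟩ := run_fill (σ := τ₁) (x := .u) (y := .uo) (m := .n) (k := .mark)
    (ie := #.u) (e := 0) (o := 0) (g := fun _ => 0) rfl fun i hi τ hF hx hy => by
      rw [hn] at hi; simp [hx]; omega
  generalize hF1 : HCmd.run E (.loop _ _ _ _) τ₁ = τ₂ at m1 ⊢
  replace hF1 := HCmd.frame_of_eq hF1
  simp only [zero_add, hn] at m1
  have q1 : τ₂.a .lab = l₁ := (hF1.a rfl).trans t1
  have q2 : τ₂.a .inp = σ₁.a .inp := (hF1.a rfl).trans t2
  have q3 : τ₂.r .v = v := (hF1.r rfl).trans t3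
  have q4 : τ₂.r .vo = v * n := (hF1.r rfl).trans t4
  clear hF1 t1 t2 t3 t4
  -- Marking the labels of the neighbors of `v`.
  have m2 := HCmd.loop_rule (σ := τ₂) (x := .u) (y := .uo) (m := .n)
    (p := .ite (.and (.lt (.ld .lab #.u) (.par .n))
        (.eq (.ld .inp (1 + #.vo + #.u)) 1)) (.store .mark (.ld .lab #.u) 1) .skip) rfl
    (fun i τ => ∀ l < n, τ.a .mark l = 1 ↔ ∃ x : Fin n, x.val < i ∧ l₁ x = l ∧ G.Adj v x)
    (fun _ _ _ _ h => h) (fun l hl => by simp [m1 l hl]) (by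
      intro i hi τ' hF hx hy h l hl
      rw [hn] at hi
      obtain ⟨u, rfl⟩ : ∃ u : Fin n, u.val = i := ⟨⟨i, hi⟩, rfl⟩
      have s1 : τ'.a .lab = l₁ := (hF.a rfl).trans q1
      have s2 : τ'.a .inp = σ₁.a .inp := (hF.a rfl).trans q2
      have s4 : τ'.r .vo = v * n := (hF.r rfl).trans q4
      rw [exists_val_lt_succ (p := fun x => l₁ x = l ∧ G.Adj v x), ← h l hl]
      by_cases hc : l₁ u < n ∧ G.Adj v u
      · rw [run_ite_pos (by simpa [hx, s1, s2, s4, hn, hadj v u] using hc),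
          run_store (a := l₁ u) (b := 1) (by simp [s1, hx]) rfl (by omega) (by omega), setA_self]
        by_cases hlu : l = l₁ u
        · subst hlu; simp [hc.2]
        · rw [Function.update_of_ne hlu]
          simp [Ne.symm hlu]
      · rw [run_ite_neg (by simpa [hx, s1, s2, s4, hn, hadj v u] using hc), run_skip]
        constructor
        · exact Or.inl
        · rintro (h | ⟨rfl, h⟩)
          · exact h
          · exact absurd ⟨hl, h⟩ hc)
  rw [hn] at m2
  generalize hF2 : HCmd.run E (.loop _ _ _ _) τ₂ = τ₃ at m2 ⊢
  replace hF2 := HCmd.frame_of_eq hF2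
  have r1 : τ₃.a .lab = l₁ := (hF2.a rfl).trans q1
  have r3 : τ₃.r .v = v := (hF2.r rfl).trans q3
  clear hF2 q1 q2 q3 q4
  have m3 := HCmd.loop_rule (σ := τ₃) (x := .u) (y := .uo) (m := .n)
    (p := .ite (.and (.lt (.ld .lab #.u) (.par .n))
        (.eq (.ld .mark (.ld .lab #.u)) 1)) (.store .lab #.u #.v) .skip) rfl
    (fun i τ => ∀ u : Fin n, (u.val < i ∧ l₁ u < n ∧ τ₃.a .mark (l₁ u) = 1 → τ.a .lab u = v) ∧
      (¬ (u.val < i ∧ l₁ u < n ∧ τ₃.a .mark (l₁ u) = 1) → τ.a .lab u = l₁ u))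
    (fun _ _ _ _ h => h) (fun u => by simp [r1]) (by
      intro i hi τ' hF hx hy h x
      rw [hn] at hi
      obtain ⟨u, rfl⟩ : ∃ u : Fin n, u.val = i := ⟨⟨i, hi⟩, rfl⟩
      have s2 : τ'.a .mark = τ₃.a .mark := hF.a rfl
      have s3 : τ'.r .v = v := (hF.r rfl).trans r3
      have s4 : τ'.a .lab u = l₁ u := (h u).2 (by simp)
      by_cases hc : l₁ u < n ∧ τ₃.a .mark (l₁ u) = 1
      · rw [run_ite_pos (by simpa [hx, s2, s4, hn] using hc),
          run_store (a := u) (b := v) (by simp [hx]) (by simp [s3]) (by omega) (by omega), setA_self]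
        by_cases hxu : x = u
        · subst hxu; simp [hc]
        · have : x.val ≠ u.val := fun he => hxu (Fin.ext he)
          rw [Function.update_of_ne this, show x.val < u.val + 1 ↔ x.val < u.val by omega]
          exact h x
      · rw [run_ite_neg (by simpa [hx, s2, s4, hn] using hc), run_skip]
        by_cases hxu : x = u
        · subst hxu
          exact ⟨fun h' => absurd h'.2 hc, fun _ => s4⟩
        · have : x.val ≠ u.val := fun he => hxu (Fin.ext he)
          rw [show x.val < u.val + 1 ↔ x.val < u.val by omega]
          exact h x)
  rw [hn] at m3
  refine h.succ_of_notMem hv (fun u hu => ?_) fun u hu => ?_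
  · rcases eq_or_ne u v with rfl | huv
    · by_cases hc : (u.val < n ∧ l₁ u < n ∧ τ₃.a .mark (l₁ u) = 1)
      · exact (m3 u).1 hc
      · exact ((m3 u).2 hc).trans hlv
    · obtain ⟨h1, x, h2, h3⟩ := hu.resolve_left huv
      refine (m3 u).1 ⟨u.2, by rwa [hlu u huv], ?_⟩
      rw [hlu u huv, m2 _ h1]
      exact ⟨x, x.2, (hlu x fun he => (he ▸ h3).ne rfl).trans h2, h3⟩
  · have huv : u ≠ v := fun he => hu (Or.inl he)
    rw [(m3 u).2, hlu u huv]
    rw [hlu u huv]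
    rintro ⟨-, h1, h2⟩
    obtain ⟨x, -, hx, hvx⟩ := (m2 _ h1).1 h2
    exact hu (Or.inr ⟨h1, x, by rw [← hx, hlu x fun he => (he ▸ hvx).ne rfl], hvx⟩)

theorem run_nbCmd (hn : E.par .n = n) (hb : n * n + 1 < E.bound) (hadj : IsAdj G (σ.a .inp))
    (hX : IsBits X (σ.a .xs) 0) (v r : Fin n) :
    (v ∈ X ∧ (∃ u : Fin n, σ.a .lab u = r ∧ G.Adj v u) → (nbCmd.run E σ).a .nb (v * n + r) = 1) ∧
    (¬ (v ∈ X ∧ ∃ u : Fin n, σ.a .lab u = r ∧ G.Adj v u) →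
      (nbCmd.run E σ).a .nb (v * n + r) = 0) := by
  rw [nbCmd, run_seq]
  have h1 := HCmd.loop_rule (σ := σ) (x := .v) (y := .vo) (m := .n)
    (p := .loop .u .uo .n (.store .nb (#.vo + #.u) 0)) rfl
    (fun i τ => ∀ v < i, ∀ r < n, τ.a .nb (v * n + r) = 0)
    (fun _ _ _ _ h => h) (fun v hv => absurd hv (Nat.not_lt_zero _)) (by
      intro i hi τ hF hx hy h v hv r hr
      rw [hn] at hi hy
      obtain ⟨g1, g2⟩ := run_fill (x := .u) (y := .uo) (m := .n) (k := .nb)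
        (ie := #.vo + #.u) (e := 0) (o := i * n) (g := fun _ => 0) rfl fun j hj τ' hF' hx' hy' => by
          rw [hn] at hj
          have : i * n + j < n * n := mul_add_lt hi hj le_rfl
          have h2 : τ'.r .vo = i * n := (hF'.r rfl).trans hy
          simp [hx', h2]; omega
      rw [hn] at g1 g2
      rcases Nat.lt_succ_iff_lt_or_eq.1 hv with hv | rfl
      · rw [g2, h v hv r hr]
        intro j hj he
        exact absurd (mul_add_inj hr hj he).1 hv.ne
      · exact g1 r hr)
  rw [hn] at h1
  generalize hF : HCmd.run E (.loop _ _ _ _) σ = σ₁ at h1 ⊢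
  replace hF := HCmd.frame_of_eq hF
  have e1 : σ₁.a .inp = σ.a .inp := hF.a rfl
  have e2 : σ₁.a .xs = σ.a .xs := hF.a rfl
  have e3 : σ₁.a .lab = σ.a .lab := hF.a rfl
  rw [← e1] at hadj
  rw [← e2] at hX
  rw [← e3]
  clear hF e1 e2 e3
  have h2 := HCmd.loop_rule (σ := σ₁) (x := .v) (y := .vo) (m := .n)
    (p := .ite (.eq (.ld .xs #.v) 1)
      (.loop .u .uo .n (.ite (.and (.lt (.ld .lab #.u) (.par .n))
        (.eq (.ld .inp (1 + #.vo + #.u)) 1)) (.store .nb (#.vo + .ld .lab #.u) 1) .skip))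
      .skip) rfl
    (fun i τ => ∀ v r : Fin n, (v.val < i ∧ v ∈ X ∧ (∃ u : Fin n, σ₁.a .lab u = r ∧ G.Adj v u) →
      τ.a .nb (v * n + r) = 1) ∧ (¬ (v.val < i ∧ v ∈ X ∧ ∃ u : Fin n, σ₁.a .lab u = r ∧ G.Adj v u) →
      τ.a .nb (v * n + r) = 0))
    (fun _ _ _ _ h => h) (fun v r => by simp [h1 v v.2 r r.2]) (by
      intro i hi τ hF hx hy h
      rw [hn] at hi hy
      obtain ⟨v, rfl⟩ : ∃ v : Fin n, v.val = i := ⟨⟨i, hi⟩, rfl⟩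
      have ei : τ.a .inp = σ₁.a .inp := hF.a rfl
      have ex : τ.a .xs = σ₁.a .xs := hF.a rfl
      have el : τ.a .lab = σ₁.a .lab := hF.a rfl
      have hXv : σ₁.a .xs v = 1 ↔ v ∈ X := by simpa using hX.eq_one_iff (v := v)
      by_cases hv : v ∈ X
      · rw [run_ite_pos (by simpa [hx, ex, hXv] using hv)]
        have h3 := HCmd.loop_rule (x := .u) (y := .uo) (m := .n)
          (p := .ite (.and (.lt (.ld .lab #.u) (.par .n))
            (.eq (.ld .inp (1 + #.vo + #.u)) 1)) (.store .nb (#.vo + .ld .lab #.u) 1) .skip) rfl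
          (fun i τ => ∀ x r : Fin n,
            (x.val < v.val ∧ x ∈ X ∧ (∃ u : Fin n, σ₁.a .lab u = r ∧ G.Adj x u) ∨
              x = v ∧ (∃ u : Fin n, u.val < i ∧ σ₁.a .lab u = r ∧ G.Adj v u) →
              τ.a .nb (x * n + r) = 1) ∧
            (¬ (x.val < v.val ∧ x ∈ X ∧ (∃ u : Fin n, σ₁.a .lab u = r ∧ G.Adj x u) ∨
              x = v ∧ ∃ u : Fin n, u.val < i ∧ σ₁.a .lab u = r ∧ G.Adj v u) →
              τ.a .nb (x * n + r) = 0))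
          (fun _ _ _ _ h => h) (fun x r => by simpa using h x r) (by
            intro j hj τ' hF' hx' hy' h' x r
            rw [hn] at hj
            obtain ⟨u, rfl⟩ : ∃ u : Fin n, u.val = j := ⟨⟨j, hj⟩, rfl⟩
            have s1 : τ'.a .inp = σ₁.a .inp := (hF'.a rfl).trans ei
            have s2 : τ'.a .lab = σ₁.a .lab := (hF'.a rfl).trans el
            have s3 : τ'.r .vo = v * n := (hF'.r rfl).trans hy
            rw [exists_val_lt_succ (p := fun y => σ₁.a .lab y = r ∧ G.Adj v y)]
            have hxr := h' x r
            by_cases hc : σ₁.a .lab u < n ∧ G.Adj v u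
            · have hlt : v * n + σ₁.a .lab u < n * n := mul_add_lt v.2 hc.1 le_rfl
              rw [run_ite_pos (by simpa [hx', s1, s2, s3, hn, hadj v u] using hc),
                run_store (a := v * n + σ₁.a .lab u) (b := 1) (by simp [s2, s3, hx']) rfl
                (by omega) (by omega), setA_self]
              by_cases he : x = v ∧ σ₁.a .lab u = r
              · obtain ⟨rfl, he⟩ := he
                simp [he, hc.2]
              · rw [Function.update_of_ne fun h => he ?_]
                · have : (x = v ∧ ((∃ y : Fin n, y.val < u.val ∧ σ₁.a .lab y = r ∧ G.Adj v y) ∨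
                    σ₁.a .lab u = r ∧ G.Adj v u)) ↔
                    (x = v ∧ ∃ y : Fin n, y.val < u.val ∧ σ₁.a .lab y = r ∧ G.Adj v y) := by
                    rw [and_or_left]
                    exact or_iff_left fun h => he ⟨h.1, h.2.1⟩
                  rwa [this]
                · obtain ⟨h1, h2⟩ := mul_add_inj r.2 hc.1 h
                  exact ⟨Fin.ext h1, h2.symm⟩
            · rw [run_ite_neg (by simpa [hx', s1, s2, s3, hn, hadj v u] using hc), run_skip]
              have : ¬ (σ₁.a .lab u = r ∧ G.Adj v u) := fun h => hc ⟨h.1 ▸ r.2, h.2⟩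
              simpa [this] using hxr)
        rw [hn] at h3
        intro x r
        have hxr := h3 x r
        have hiff : (x.val < v.val ∧ x ∈ X ∧ (∃ u : Fin n, σ₁.a .lab u = r ∧ G.Adj x u) ∨
              x = v ∧ (∃ u : Fin n, u.val < n ∧ σ₁.a .lab u = r ∧ G.Adj v u)) ↔
            (x.val < v.val + 1 ∧ x ∈ X ∧ (∃ u : Fin n, σ₁.a .lab u = r ∧ G.Adj x u)) := by
          constructor
          · rintro (⟨h1, h2⟩ | ⟨rfl, u, -, h2⟩)
            · exact ⟨by omega, h2⟩
            · exact ⟨by omega, hv, u, h2⟩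
          · rintro ⟨h1, h2, h5⟩
            rcases Nat.lt_succ_iff_lt_or_eq.1 h1 with h1 | h1
            · exact Or.inl ⟨h1, h2, h5⟩
            · obtain rfl := Fin.ext h1
              obtain ⟨u, hu⟩ := h5
              exact Or.inr ⟨rfl, u, u.2, hu⟩
        rwa [hiff] at hxr
      · rw [run_ite_neg (by simpa [hx, ex, hXv] using hv), run_skip]
        intro x r
        have : (x.val < v.val + 1 ∧ x ∈ X ∧ (∃ u : Fin n, σ₁.a .lab u = r ∧ G.Adj x u)) ↔
            (x.val < v.val ∧ x ∈ X ∧ (∃ u : Fin n, σ₁.a .lab u = r ∧ G.Adj x u)) := by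
          constructor
          · rintro ⟨h1, h2⟩
            refine ⟨?_, h2⟩
            have : x.val ≠ v.val := fun he => hv (Fin.ext he ▸ h2.1)
            omega
          · rintro ⟨h1, h2⟩
            exact ⟨by omega, h2⟩
        rw [this]
        exact h x r)
  simpa [hn] using h2 v r

/-- Computes the components of `G - X` and their neighborhoods. -/
def compsCmd : HCmd := labelsCmd ⨾ nbCmd

/-- The arrays `lab` and `nb` hold the components of `G - X` and their neighborhoods. -/
structure Comps (G : SimpleGraph (Fin n)) (X : Finset (Fin n)) (lab nb : ℕ → ℕ) : Prop where
  labels : Labels G X lab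
  nbhds : ∀ r : Fin n, lab r = r → ∀ v : Fin n, (v ∈ nbhd G (compOf G X r) → nb (v * n + r) = 1) ∧
    (v ∉ nbhd G (compOf G X r) → nb (v * n + r) = 0)

theorem run_compsCmd (hn : E.par .n = n) (hb : n * n + 1 < E.bound) (hb' : n < E.bound)
    (hadj : IsAdj G (σ.a .inp)) (hX : IsBits X (σ.a .xs) 0) :
    Comps G X ((compsCmd.run E σ).a .lab) ((compsCmd.run E σ).a .nb) := by
  rw [compsCmd, run_seq]
  have h1 := run_labelsCmd hn hb' hadj hX
  have hF := labelsCmd.frame E σ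
  generalize labelsCmd.run E σ = σ₁ at h1 hF ⊢
  have e1 : σ₁.a .inp = σ.a .inp := hF.a rfl
  have e2 : σ₁.a .xs = σ.a .xs := hF.a rfl
  rw [← e1] at hadj
  rw [← e2] at hX
  have e3 : (nbCmd.run E σ₁).a .lab = σ₁.a .lab := (nbCmd.frame E σ₁).a rfl
  rw [e3]
  refine ⟨h1, fun r hr v => ?_⟩
  have h2 := run_nbCmd hn hb hadj hX v r
  have hiff : (v ∈ X ∧ ∃ u : Fin n, σ₁.a .lab u = r ∧ G.Adj v u) ↔ v ∈ nbhd G (compOf G X r) := by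
    rw [mem_nbhd]
    constructor
    · rintro ⟨hv, u, hu, hvu⟩
      exact ⟨fun hm => notMem_of_mem_compOf (h1.notMem hr) hm hv, u, (h1.eq_val_iff hr).1 hu,
        hvu.symm⟩
    · rintro ⟨hv, u, hu, huv⟩
      exact ⟨nbhd_compOf_subset (mem_nbhd.2 ⟨hv, u, hu, huv⟩), u, (h1.eq_val_iff hr).2 hu, huv.symm⟩
  rwa [hiff] at h2

/-! ### Full components and block sizes of the separators -/

/-- For a representative `r`, computes the size of the union of `X` and the component of `r`, and
whether the component is full. -/
def blockCmd : HCmd :=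
  .assign .ful 1 ⨾ .assign .sz 0 ⨾
  .loop .v .vo .n (.ite (.eq (.ld .xs #.v) 1)
    (.assign .sz (#.sz + 1) ⨾ .ite (.eq (.ld .nb (#.vo + #.r)) 0) (.assign .ful 0) .skip)
    (.ite (.eq (.ld .lab #.v) #.r) (.assign .sz (#.sz + 1)) .skip))

/-- Computes the blocks of the separator in the array `xs` and stores them in row `i`. -/
def sepRowCmd : HCmd :=
  .loop .v .vo .n (.store .labD (#.io + #.v) (.ld .lab #.v)) ⨾
  .assign .allf 1 ⨾
  .loop .r .ro .n (.ite (.eq (.ld .lab #.r) #.r)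
    (blockCmd ⨾ .ite (.eq #.ful 0) (.assign .allf 0) .skip ⨾
      .store .flag (#.io + #.r) #.ful ⨾ .store .size (#.io + #.r) #.sz)
    (.store .flag (#.io + #.r) 0)) ⨾
  .store .mins #.i #.allf

/-- Computes the rows of all separators. -/
def sepsCmd : HCmd :=
  .loop .i .io .nD
    (.loop .v .vo .n (.store .xs #.v (.ld .inp (.par .pD + #.io + #.v))) ⨾ compsCmd ⨾ sepRowCmd)

theorem card_filter_lt_succ (A : Finset (Fin n)) (v : Fin n) :
    (A.filter fun u => u.val < v.val + 1).card =
      (A.filter fun u => u.val < v.val).card + if v ∈ A then 1 else 0 := by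
  split_ifs with hv
  · rw [show (A.filter fun u => u.val < v.val + 1) =
      insert v (A.filter fun u => u.val < v.val) by
        ext u
        simp only [Finset.mem_filter, Finset.mem_insert, Nat.lt_succ_iff_lt_or_eq, Fin.val_inj]
        constructor
        · rintro ⟨h1, h2 | h2⟩
          · exact Or.inr ⟨h1, h2⟩
          · exact Or.inl h2
        · rintro (rfl | ⟨h1, h2⟩)
          · exact ⟨hv, Or.inr rfl⟩
          · exact ⟨h1, Or.inl h2⟩]
    rw [Finset.card_insert_of_notMem (by simp)]
  · congr 1
    ext u
    simp only [Finset.mem_filter, Nat.lt_succ_iff_lt_or_eq, Fin.val_inj]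
    constructor
    · rintro ⟨h1, h2 | rfl⟩
      · exact ⟨h1, h2⟩
      · exact absurd h1 hv
    · rintro ⟨h1, h2⟩
      exact ⟨h1, Or.inl h2⟩

theorem card_le_n (A : Finset (Fin n)) : A.card ≤ n := by
  simpa using Finset.card_le_univ A

theorem run_blockCmd (hn : E.par .n = n) (hb : n + 1 < E.bound) {r : Fin n}
    (hX : IsBits X (σ.a .xs) 0) (hC : Comps G X (σ.a .lab) (σ.a .nb)) (hr : σ.r .r = r)
    (hlr : σ.a .lab r = r) :
    (blockCmd.run E σ).r .sz = (X ∪ compOf G X r).card ∧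
      (nbhd G (compOf G X r) = X → (blockCmd.run E σ).r .ful = 1) ∧
      (nbhd G (compOf G X r) ≠ X → (blockCmd.run E σ).r .ful = 0) := by
  simp only [blockCmd, run_seq]
  rw [run_assign (σ := σ) (a := 1) rfl (by omega), run_assign (a := 0) rfl (by omega)]
  have h := HCmd.loop_rule (σ := (σ.setR .ful 1).setR .sz 0) (x := .v) (y := .vo) (m := .n)
    (p := .ite (.eq (.ld .xs #.v) 1)
      (.assign .sz (#.sz + 1) ⨾ .ite (.eq (.ld .nb (#.vo + #.r)) 0) (.assign .ful 0) .skip)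
      (.ite (.eq (.ld .lab #.v) #.r) (.assign .sz (#.sz + 1)) .skip)) rfl
    (fun i τ => τ.r .sz = ((X ∪ compOf G X r).filter fun u => u.val < i).card ∧
      ((∀ u : Fin n, u.val < i → u ∈ X → u ∈ nbhd G (compOf G X r)) → τ.r .ful = 1) ∧
      (¬ (∀ u : Fin n, u.val < i → u ∈ X → u ∈ nbhd G (compOf G X r)) → τ.r .ful = 0))
    (fun _ _ _ _ h => h) (by simp) (by
      intro i hi τ hF hx hy h
      rw [hn] at hi hy
      obtain ⟨v, rfl⟩ : ∃ v : Fin n, v.val = i := ⟨⟨i, hi⟩, rfl⟩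
      have e1 : τ.a .xs = σ.a .xs := hF.a rfl
      have e2 : τ.a .lab = σ.a .lab := hF.a rfl
      have e3 : τ.a .nb = σ.a .nb := hF.a rfl
      have e4 : τ.r .r = r := (hF.r rfl).trans hr
      have hXv : σ.a .xs v = 1 ↔ v ∈ X := by simpa using hX.eq_one_iff (v := v)
      have hnb := hC.nbhds r hlr v
      have hlab : σ.a .lab v = r ↔ v ∈ compOf G X r := hC.labels.eq_val_iff hlr
      have hcard := card_filter_lt_succ (X ∪ compOf G X r) v
      have hle := card_le_n ((X ∪ compOf G X r).filter fun u => u.val < v.val)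
      obtain ⟨h1, h2, h3⟩ := h
      rw [forall_val_lt_succ (p := fun u => u ∈ X → u ∈ nbhd G (compOf G X r))]
      by_cases hv : v ∈ X
      · rw [run_ite_pos (by simpa [hx, e1, hXv] using hv), run_seq,
          run_assign (a := τ.r .sz + 1) rfl (by omega)]
        rw [if_pos (Finset.mem_union_left _ hv)] at hcard
        by_cases hvN : v ∈ nbhd G (compOf G X r)
        · rw [run_ite_neg (by simp [hy, e4, e3, hnb.1 hvN]), run_skip]
          exact ⟨by rw [setR_self, h1, hcard], fun h => by simpa using h2 h.1,
            fun h => by simpa using h3 fun h' => h ⟨h', fun _ => hvN⟩⟩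
        · rw [run_ite_pos (by simp [hy, e4, e3, hnb.2 hvN]), run_assign (a := 0) rfl (by omega)]
          exact ⟨by rw [setR_of_ne _ (by decide), setR_self, h1, hcard],
            fun h => absurd (h.2 hv) hvN, fun _ => by simp⟩
      · rw [run_ite_neg (by simpa [hx, e1, hXv] using hv)]
        have hh : ((∀ u : Fin n, u.val < v.val → u ∈ X → u ∈ nbhd G (compOf G X r)) ∧
          (v ∈ X → v ∈ nbhd G (compOf G X r))) ↔
          ∀ u : Fin n, u.val < v.val → u ∈ X → u ∈ nbhd G (compOf G X r) := by
          simp [hv]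
        rw [hh]
        by_cases hvC : v ∈ compOf G X r
        · rw [run_ite_pos (by simpa [hx, e2, e4, hlab] using hvC),
            run_assign (a := τ.r .sz + 1) rfl (by omega)]
          rw [if_pos (Finset.mem_union_right _ hvC)] at hcard
          exact ⟨by rw [setR_self, h1, hcard], fun h => by simpa using h2 h,
            fun h => by simpa using h3 h⟩
        · rw [run_ite_neg (by simpa [hx, e2, e4, hlab] using hvC), run_skip]
          rw [if_neg (by simp [hv, hvC])] at hcard
          exact ⟨by rw [h1, hcard, add_zero], h2, h3⟩)
  obtain ⟨h1, h2, h3⟩ := h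
  rw [hn] at h1 h2 h3
  have hall : (∀ u : Fin n, u.val < n → u ∈ X → u ∈ nbhd G (compOf G X r)) ↔
      nbhd G (compOf G X r) = X := by
    constructor
    · exact fun h => nbhd_compOf_subset.antisymm fun u hu => h u u.2 hu
    · exact fun h u _ hu => h.symm ▸ hu
  rw [hall] at h2 h3
  refine ⟨h1.trans ?_, h2, h3⟩
  rw [Finset.filter_true_of_mem fun u _ => u.2]

/-- The rows of the tables of a separator `S` are correct: the labels of the components, the flags
of the full components, the sizes of the blocks and the mark `m` for inclusion-minimal
separators. -/
structure SepRow (G : SimpleGraph (Fin n)) (S : Finset (Fin n)) (o : ℕ) (labD flag size : ℕ → ℕ)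
    (m : ℕ) : Prop where
  labels : Labels G S fun v => labD (o + v)
  flag_one : ∀ r : Fin n, labD (o + r) = r → nbhd G (compOf G S r) = S → flag (o + r) = 1
  flag_zero : ∀ r : Fin n, ¬ (labD (o + r) = r ∧ nbhd G (compOf G S r) = S) → flag (o + r) = 0
  size_eq : ∀ r : Fin n, labD (o + r) = r → size (o + r) = (S ∪ compOf G S r).card
  mins_eq : m = 1 ↔ ∀ C, IsComp G S C → nbhd G C = S

theorem SepRow.congr {S : Finset (Fin n)} {o : ℕ} {labD flag size labD' flag' size' : ℕ → ℕ}
    {m m' : ℕ} (h : SepRow G S o labD flag size m) (h1 : ∀ v < n, labD' (o + v) = labD (o + v))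
    (h2 : ∀ v < n, flag' (o + v) = flag (o + v)) (h3 : ∀ v < n, size' (o + v) = size (o + v))
    (h4 : m' = m) : SepRow G S o labD' flag' size' m' := by
  refine ⟨?_, fun r hr hN => ?_, fun r hr => ?_, fun r hr => ?_, h4 ▸ h.mins_eq⟩
  · refine ⟨fun v hv => (h1 v v.2).trans (h.labels.out v hv), fun v hv => ?_, fun u v hu hv => ?_⟩
    · obtain ⟨w, e1, e2, e3⟩ := h.labels.rep v hv
      exact ⟨w, (h1 v v.2).trans e1, (h1 w w.2).trans e2, e3⟩
    · simp only [h1 u u.2, h1 v v.2]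
      exact h.labels.eq_iff u v hu hv
  · rw [h2 r r.2]
    exact h.flag_one r ((h1 r r.2) ▸ hr) hN
  · rw [h2 r r.2]
    exact h.flag_zero r (by rwa [h1 r r.2] at hr)
  · rw [h3 r r.2]
    exact h.size_eq r ((h1 r r.2) ▸ hr)

theorem run_sepRowCmd (hn : E.par .n = n) {i : ℕ} (hi : i < E.bound) (hb : n + 1 < E.bound)
    (hio : i * n + n ≤ E.bound) (hX : IsBits X (σ.a .xs) 0)
    (hC : Comps G X (σ.a .lab) (σ.a .nb)) (h1 : σ.r .i = i) (h2 : σ.r .io = i * n) :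
    SepRow G X (i * n) ((sepRowCmd.run E σ).a .labD) ((sepRowCmd.run E σ).a .flag)
        ((sepRowCmd.run E σ).a .size) ((sepRowCmd.run E σ).a .mins i) ∧
      (∀ j < i * n, (sepRowCmd.run E σ).a .labD j = σ.a .labD j ∧
        (sepRowCmd.run E σ).a .flag j = σ.a .flag j ∧
        (sepRowCmd.run E σ).a .size j = σ.a .size j) ∧
      ∀ j < i, (sepRowCmd.run E σ).a .mins j = σ.a .mins j := by
  simp only [sepRowCmd, run_seq]
  obtain ⟨g1, g2⟩ := run_fill (x := .v) (y := .vo) (m := .n) (k := .labD)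
    (ie := #.io + #.v) (e := .ld .lab #.v) (o := i * n) (g := fun v => σ.a .lab v) rfl
    fun j hj τ hF hx hy => by
      rw [hn] at hj
      have e1 : τ.r .io = i * n := (hF.r rfl).trans h2
      have e2 : τ.a .lab = σ.a .lab := hF.a rfl
      have : σ.a .lab j ≤ n := by
        by_cases hjX : (⟨j, hj⟩ : Fin n) ∈ X
        · exact (hC.labels.out _ hjX).le
        · exact (hC.labels.lt_iff.2 hjX).le
      simp [hx, e1, e2]; omega
  generalize hF : HCmd.run E (.loop _ _ _ _) σ = σ₁ at g1 g2 ⊢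
  replace hF := HCmd.frame_of_eq hF
  rw [hn] at g1 g2
  have e1 : σ₁.a .xs = σ.a .xs := hF.a rfl
  have e2 : σ₁.a .lab = σ.a .lab := hF.a rfl
  have e3 : σ₁.a .nb = σ.a .nb := hF.a rfl
  have e4 : σ₁.r .i = i := (hF.r rfl).trans h1
  have e5 : σ₁.r .io = i * n := (hF.r rfl).trans h2
  have e6 : σ₁.a .flag = σ.a .flag := hF.a rfl
  have e7 : σ₁.a .size = σ.a .size := hF.a rfl
  have e8 : σ₁.a .mins = σ.a .mins := hF.a rfl
  rw [← e1] at hX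
  rw [← e2, ← e3] at hC
  rw [← e2] at g1
  rw [← e6, ← e7, ← e8]
  clear hF e1 e2 e3 e6 e7 e8 h1 h2
  rw [run_assign (a := 1) rfl (by omega)]
  have h := HCmd.loop_rule (σ := σ₁.setR .allf 1) (x := .r) (y := .ro) (m := .n)
    (p := .ite (.eq (.ld .lab #.r) #.r)
      (blockCmd ⨾ .ite (.eq #.ful 0) (.assign .allf 0) .skip ⨾
      .store .flag (#.io + #.r) #.ful ⨾ .store .size (#.io + #.r) #.sz)
      (.store .flag (#.io + #.r) 0)) rfl
    (fun j τ => (∀ r : Fin n, r.val < j →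
        (σ₁.a .lab r = r → nbhd G (compOf G X r) = X → τ.a .flag (i * n + r) = 1) ∧
        (¬ (σ₁.a .lab r = r ∧ nbhd G (compOf G X r) = X) → τ.a .flag (i * n + r) = 0) ∧
        (σ₁.a .lab r = r → τ.a .size (i * n + r) = (X ∪ compOf G X r).card)) ∧
      ((∀ r : Fin n, r.val < j → σ₁.a .lab r = r → nbhd G (compOf G X r) = X) → τ.r .allf = 1) ∧
      (¬ (∀ r : Fin n, r.val < j → σ₁.a .lab r = r → nbhd G (compOf G X r) = X) →
        τ.r .allf = 0) ∧
      ∀ l < i * n, τ.a .flag l = σ₁.a .flag l ∧ τ.a .size l = σ₁.a .size l)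
    (fun _ _ _ _ h => h) (by simp) (by
      intro j hj τ hF hx hy ⟨a1, a2, a3, a4⟩
      rw [hn] at hj
      obtain ⟨r, rfl⟩ : ∃ r : Fin n, r.val = j := ⟨⟨j, hj⟩, rfl⟩
      have e1 : τ.a .xs = σ₁.a .xs := hF.a rfl
      have e2 : τ.a .lab = σ₁.a .lab := hF.a rfl
      have e3 : τ.a .nb = σ₁.a .nb := hF.a rfl
      have f5 : τ.r .io = i * n := (hF.r rfl).trans e5
      have hne : ∀ s : Fin n, s ≠ r → i * n + s ≠ i * n + r := fun s hs he =>
        hs (Fin.ext (by omega))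
      rw [forall_val_lt_succ (p := fun s => σ₁.a .lab s = s → nbhd G (compOf G X s) = X)]
      by_cases hr : σ₁.a .lab r = r
      · rw [run_ite_pos (by simpa [hx, e2] using hr)]
        simp only [run_seq]
        obtain ⟨b1, b2, b3⟩ := run_blockCmd (G := G) (σ := τ) hn hb (r := r)
          (by rwa [e1]) (by rwa [e2, e3]) hx (by rwa [e2])
        have hF' := blockCmd.frame E τ
        generalize blockCmd.run E τ = τ₁ at b1 b2 b3 hF' ⊢
        have c1 : τ₁.a = τ.a := by
          funext k
          exact hF'.a (by cases k <;> rfl)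
        have c2 : τ₁.r .io = i * n := (hF'.r rfl).trans f5
        have c3 : τ₁.r .r = r := (hF'.r rfl).trans hx
        have c4 : τ₁.r .allf = τ.r .allf := hF'.r rfl
        have hful : τ₁.r .ful ≤ 1 := by
          by_cases hN : nbhd G (compOf G X r) = X
          · rw [b2 hN]
          · rw [b3 hN]; omega
        have hsz : τ₁.r .sz ≤ n := b1 ▸ card_le_n _
        obtain ⟨τ₂, hτ₂⟩ : ∃ τ₂, τ₂ =
          (HCmd.ite (.eq #.ful 0) (.assign .allf 0) .skip).run E τ₁ := ⟨_, rfl⟩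
        have d1 : (nbhd G (compOf G X r) = X → τ₂.r .allf = τ.r .allf) ∧
            (nbhd G (compOf G X r) ≠ X → τ₂.r .allf = 0) := by
          constructor
          · intro hN
            rw [hτ₂, run_ite_neg (by simp [b2 hN]), run_skip, c4]
          · intro hN
            rw [hτ₂, run_ite_pos (by simp [b3 hN]), run_assign (a := 0) rfl (by omega)]
            simp
        have hF2 := (HCmd.ite (.eq #.ful 0) (.assign .allf 0) .skip).frame E τ₁
        rw [← hτ₂] at hF2 ⊢
        have d2 : τ₂.r .io = i * n := (hF2.r rfl).trans c2
        have d3 : τ₂.r .r = r := (hF2.r rfl).trans c3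
        have d4 : τ₂.r .ful = τ₁.r .ful := hF2.r rfl
        have d5 : τ₂.r .sz = τ₁.r .sz := hF2.r rfl
        have d6 : τ₂.a .flag = τ.a .flag := (hF2.a rfl).trans (by rw [c1])
        have d7 : τ₂.a .size = τ.a .size := (hF2.a rfl).trans (by rw [c1])
        rw [run_store (σ := τ₂) (a := i * n + r) (b := τ₁.r .ful) (by simp [d2, d3])
            (by simp [d4]) (by omega) (by omega),
          run_store (a := i * n + r) (b := τ₁.r .sz) (by simp [d2, d3]) (by simp [d5])
            (by omega) (by omega)]
        refine ⟨fun s hs => ?_, ?_, ?_, ?_⟩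
        · simp only [setA_self, ne_eq, reduceCtorEq, not_false_eq_true, setA_of_ne, d6, d7]
          by_cases hsr : s = r
          · subst hsr
            simp only [Function.update_self]
            exact ⟨fun _ hN => b2 hN, fun h => b3 fun hN => h ⟨hr, hN⟩, fun _ => b1⟩
          · have : s.val ≠ r.val := fun he => hsr (Fin.ext he)
            rw [Function.update_of_ne (hne s hsr), Function.update_of_ne (hne s hsr)]
            exact a1 s (by omega)
        · rintro ⟨h1, h2⟩
          rw [setA_r, setA_r, d1.1 (h2 hr), a2 h1]
        · intro h
          rw [setA_r, setA_r]
          by_cases hN : nbhd G (compOf G X r) = X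
          · rw [d1.1 hN, a3 fun h' => h ⟨h', fun _ => hN⟩]
          · exact d1.2 hN
        · intro l hl
          simp only [setA_self, ne_eq, reduceCtorEq, not_false_eq_true, setA_of_ne, d6, d7]
          rw [Function.update_of_ne (by omega), Function.update_of_ne (by omega)]
          exact a4 l hl
      · rw [run_ite_neg (by simpa [hx, e2] using hr),
          run_store (a := i * n + r) (b := 0) (by simp [f5, hx]) rfl (by omega) (by omega)]
        simp only [hr, false_imp_iff, and_true]
        refine ⟨fun s hs => ?_, a2, a3, fun l hl => ?_⟩
        · by_cases hsr : s = r
          · subst hsr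
            simp [hr]
          · have : s.val ≠ r.val := fun he => hsr (Fin.ext he)
            simp only [setA_self, ne_eq, reduceCtorEq, not_false_eq_true, setA_of_ne]
            rw [Function.update_of_ne (hne s hsr)]
            exact a1 s (by omega)
        · simp only [setA_self, ne_eq, reduceCtorEq, not_false_eq_true, setA_of_ne]
          rw [Function.update_of_ne (by omega)]
          exact a4 l hl)
  generalize hF : HCmd.run E (.loop _ _ _ _) (σ₁.setR .allf 1) = σ₂ at h ⊢
  replace hF := HCmd.frame_of_eq hF
  obtain ⟨a1, a2, a3, a4⟩ := h
  rw [hn] at a1 a2 a3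
  have k1 : σ₂.a .labD = σ₁.a .labD := hF.a rfl
  have k2 : σ₂.a .mins = σ₁.a .mins := hF.a rfl
  have k3 : σ₂.r .i = i := (hF.r rfl).trans e4
  have hallf : σ₂.r .allf ≤ 1 ∧ (σ₂.r .allf = 1 ↔
      (∀ r : Fin n, r.val < n → σ₁.a .lab r = r → nbhd G (compOf G X r) = X)) := by
    by_cases hh : (∀ r : Fin n, r.val < n → σ₁.a .lab r = r → nbhd G (compOf G X r) = X)
    · rw [a2 hh]; exact ⟨le_rfl, iff_of_true rfl hh⟩
    · rw [a3 hh]; exact ⟨by omega, iff_of_false (by omega) hh⟩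
  rw [run_store (a := i) (b := σ₂.r .allf) (by simp [k3]) rfl (by omega) (by omega)]
  simp only [setA_self, ne_eq, reduceCtorEq, not_false_eq_true, setA_of_ne, k1, k2,
    Function.update_self]
  refine ⟨⟨?_, fun r hr hN => ?_, fun r hr => ?_, fun r hr => ?_, ?_⟩, fun j hj => ?_,
    fun j hj => Function.update_of_ne (by omega) _ _⟩
  · have : Labels G X (σ₁.a .lab) := hC.labels
    refine ⟨fun v hv => (g1 v v.2).trans (this.out v hv), fun v hv => ?_, fun u v hu hv => ?_⟩
    · obtain ⟨w, q1, q2, q3⟩ := this.rep v hv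
      exact ⟨w, (g1 v v.2).trans q1, (g1 w w.2).trans q2, q3⟩
    · rw [g1 u u.2, g1 v v.2]
      exact this.eq_iff u v hu hv
  · rw [g1 r r.2] at hr
    exact (a1 r r.2).1 hr hN
  · rw [g1 r r.2] at hr
    exact (a1 r r.2).2.1 hr
  · rw [g1 r r.2] at hr
    exact (a1 r r.2).2.2 hr
  · rw [hallf.2]
    constructor
    · intro h C hCC
      obtain ⟨r, hr, rfl⟩ := hC.labels.exists_rep hCC
      exact h r r.2 hr
    · exact fun h r _ hr => h _ (isComp_compOf (hC.labels.notMem hr))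
  · exact ⟨g2 j fun l _ => by omega, a4 j hj⟩

variable {D P : List (Finset (Fin n))} {M : List (Finset (Fin n) × Finset (Fin n))}

/-- The parameters of a run on the lists `D`, `P` and `M`, with enough room for all tables. -/
structure Env.Suits (E : Env) (n : ℕ) (D P : List (Finset (Fin n)))
    (M : List (Finset (Fin n) × Finset (Fin n))) : Prop where
  n_pos : 0 < n
  par_n : E.par .n = n
  par_nD : E.par .nD = D.length
  par_nP : E.par .nP = P.length
  par_nM : E.par .nM = M.length
  bound_n : 2 * (n * n) + 2 * n + 8 ≤ E.bound
  bound_D : 2 * (n * (D.length * n)) + 4 * (D.length * n) + 8 ≤ E.bound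
  bound_P : P.length * n + 2 ≤ E.bound

/-- The array `a` holds the input. -/
structure IsInput (E : Env) (G : SimpleGraph (Fin n)) (D P : List (Finset (Fin n)))
    (M : List (Finset (Fin n) × Finset (Fin n))) (a : ℕ → ℕ) : Prop where
  adj : IsAdj G a
  sep : ∀ i < D.length, IsBits (D.getD i ∅) a (E.par .pD + i * n)
  pmc : ∀ o < P.length, IsBits (P.getD o ∅) a (E.par .pP + o * n)
  blockS : ∀ j < M.length, IsBits (M.getD j (∅, ∅)).1 a (E.par .pM + (j * n + j * n))
  blockC : ∀ j < M.length, IsBits (M.getD j (∅, ∅)).2 a (E.par .pM + (j * n + j * n) + n)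

theorem Env.Suits.D_lt (h : E.Suits n D P M) {i : ℕ} (hi : i < D.length) : i < E.bound := by
  have h1 := mul_add_lt hi h.n_pos (le_refl (D.length * n))
  have h2 := Nat.le_mul_of_pos_right i h.n_pos
  have h3 := h.bound_D
  omega

/-- The tables of all separators are correct. -/
def IsSepTable (G : SimpleGraph (Fin n)) (D : List (Finset (Fin n))) (a : Arr → ℕ → ℕ) : Prop :=
  ∀ i < D.length, SepRow G (D.getD i ∅) (i * n) (a .labD) (a .flag) (a .size) (a .mins i)

theorem run_loadBits (hn : E.par .n = n) (hb : n + 1 < E.bound) {e : HExpr} {o : ℕ}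
    (hX : IsBits X (σ.a .inp) o)
    (he : ∀ τ : HState, (∀ x, x ≠ .v → x ≠ .vo → τ.r x = σ.r x) → e.eval E τ = o) :
    IsBits X ((HCmd.run E (.loop .v .vo .n (.store .xs #.v (.ld .inp (e + #.v)))) σ).a .xs) 0 := by
  have hval : ∀ v : Fin n, σ.a .inp (o + v) ≤ 1 := fun v => by
    by_cases hv : v ∈ X
    · rw [(hX v).1 hv]
    · rw [(hX v).2 hv]; omega
  obtain ⟨g1, -⟩ := run_fill (x := .v) (y := .vo) (m := .n) (k := .xs)
    (ie := #.v) (e := .ld .inp (e + #.v)) (o := 0) (g := fun v => σ.a .inp (o + v)) rfl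
    fun j hj τ hF hx hy => by
      rw [hn] at hj
      have e2 : τ.a .inp = σ.a .inp := hF.a rfl
      have := hval ⟨j, hj⟩
      rw [eval_reg, hx, eval_ld, eval_add, eval_reg, hx, e2, he τ fun x h1 h2 => hF.r (by
        cases x <;> first | rfl | exact absurd rfl h1 | exact absurd rfl h2)]
      dsimp only at this ⊢
      omega
  rw [hn] at g1
  intro v
  rw [g1 v v.2]
  exact hX v

theorem run_sepsCmd (hE : E.Suits n D P M) (hI : IsInput E G D P M (σ.a .inp)) :
    IsSepTable G D (sepsCmd.run E σ).a := by
  have hb := hE.bound_n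
  have hD := hE.bound_D
  have h := HCmd.loop_rule (x := .i) (y := .io) (m := .nD)
    (p := .loop .v .vo .n (.store .xs #.v (.ld .inp (.par .pD + #.io + #.v))) ⨾ compsCmd ⨾ sepRowCmd)
    rfl (fun i τ => ∀ j < i, SepRow G (D.getD j ∅) (j * n) (τ.a .labD) (τ.a .flag) (τ.a .size)
      (τ.a .mins j)) (fun _ _ _ _ h => h) (fun j hj => absurd hj (Nat.not_lt_zero _)) (by
      intro i hi τ hF hx hy h
      rw [hE.par_nD] at hi
      rw [hE.par_n] at hy
      have e1 : τ.a .inp = σ.a .inp := hF.a rfl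
      simp only [run_seq]
      have hX := run_loadBits (σ := τ) (e := .par .pD + #.io) hE.par_n (by omega)
        (by rw [e1]; exact hI.sep i hi) fun τ' h' => by simp [h', hy]
      generalize hF1 : HCmd.run E (.loop _ _ _ _) τ = τ₁ at hX ⊢
      replace hF1 := HCmd.frame_of_eq hF1
      have hC := run_compsCmd (σ := τ₁) hE.par_n (by omega) (by omega)
        (by rw [hF1.a rfl, e1]; exact hI.adj) hX
      have hF2 := compsCmd.frame E τ₁
      generalize compsCmd.run E τ₁ = τ₂ at hC hF2 ⊢
      have f1 : τ₂.a .labD = τ.a .labD := (hF2.a rfl).trans (hF1.a rfl)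
      have f2 : τ₂.a .flag = τ.a .flag := (hF2.a rfl).trans (hF1.a rfl)
      have f3 : τ₂.a .size = τ.a .size := (hF2.a rfl).trans (hF1.a rfl)
      have f4 : τ₂.a .mins = τ.a .mins := (hF2.a rfl).trans (hF1.a rfl)
      have hin := mul_add_self_le (n := n) hi
      obtain ⟨g1, g2, g3⟩ := run_sepRowCmd (G := G) (X := D.getD i ∅) (σ := τ₂) hE.par_n
        (i := i) (hE.D_lt hi) (by omega) (by omega) (by rw [hF2.a rfl]; exact hX) hC
        ((hF2.r rfl).trans ((hF1.r rfl).trans hx)) ((hF2.r rfl).trans ((hF1.r rfl).trans hy))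
      intro j hj
      rcases Nat.lt_succ_iff_lt_or_eq.1 hj with hj | rfl
      · rw [f1, f2, f3] at g2
        rw [f4] at g3
        have hlt : ∀ v < n, j * n + v < i * n := fun v hv => mul_add_lt hj hv le_rfl
        exact (h j hj).congr (fun v hv => (g2 _ (hlt v hv)).1) (fun v hv => (g2 _ (hlt v hv)).2.1)
          (fun v hv => (g2 _ (hlt v hv)).2.2) (g3 j hj)
      · exact g1)
  rw [hE.par_nD] at h
  exact h

/-! ### A search tree for the separators -/

open Classical in
/-- The 0/1-vector of the set `X`. -/
def bit (X : Finset (Fin n)) (v : ℕ) : ℕ := if ∃ h : v < n, (⟨v, h⟩ : Fin n) ∈ X then 1 else 0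

theorem bit_le (X : Finset (Fin n)) (v : ℕ) : bit X v ≤ 1 := by
  unfold bit; split_ifs <;> omega

theorem bit_eq_one_iff {v : Fin n} : bit X v = 1 ↔ v ∈ X := by
  unfold bit; simp

theorem IsBits.eq_bit {a : ℕ → ℕ} {o : ℕ} (h : IsBits X a o) {v : ℕ} (hv : v < n) :
    a (o + v) = bit X v := by
  have := h ⟨v, hv⟩
  by_cases hX : (⟨v, hv⟩ : Fin n) ∈ X
  · rw [this.1 hX, (bit_eq_one_iff (v := ⟨v, hv⟩)).2 hX]
  · have h1 := (bit_eq_one_iff (v := ⟨v, hv⟩)).not.2 hX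
    have h2 := bit_le X v
    rw [this.2 hX]
    dsimp only at h1
    omega

theorem eq_of_bit {Y : Finset (Fin n)} (h : ∀ v < n, bit X v = bit Y v) : X = Y := by
  ext v
  rw [← bit_eq_one_iff, ← bit_eq_one_iff, h v v.2]

/-- The node at depth `v` on the path of the 0/1-vector `b` in the binary search tree in which
`child (2 * q + x)` is the child of the node `q` on side `x`; the root is `1`, and `0` stands for a
missing child. -/
def trieNode (child b : ℕ → ℕ) : ℕ → ℕ
  | 0 => 1
  | v + 1 => child (2 * trieNode child b v + b v)

/-- A path is not affected by adding children elsewhere. -/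
theorem trieNode_congr {child child' b : ℕ → ℕ} (hc : ∀ q, child q ≠ 0 → child' q = child q) {v : ℕ}
    (hb : ∀ w < v, child (2 * trieNode child b w + b w) ≠ 0) :
    trieNode child' b v = trieNode child b v := by
  induction v with
  | zero => rfl
  | succ v ih =>
    rw [trieNode, trieNode, ih fun w hw => hb w (by omega)]
    exact hc _ (hb v (by omega))

/-- In a tree, a node determines the path that leads to it. -/
theorem trieNode_inj {child b b' : ℕ → ℕ}
    (hinj : ∀ q q', child q ≠ 0 → child q = child q' → q = q') (hb : ∀ v, b v ≤ 1)
    (hb' : ∀ v, b' v ≤ 1) {v : ℕ} (hp : ∀ w < v, child (2 * trieNode child b w + b w) ≠ 0)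
    (h : trieNode child b v = trieNode child b' v) : ∀ w < v, b w = b' w := by
  induction v with
  | zero => exact fun w hw => absurd hw (Nat.not_lt_zero _)
  | succ v ih =>
    rw [trieNode, trieNode] at h
    have := hinj _ _ (hp v (by omega)) h
    have h1 := hb v
    have h2 := hb' v
    intro w hw
    rcases Nat.lt_succ_iff_lt_or_eq.1 hw with hw | rfl
    · exact ih (fun w hw => hp w (by omega)) (by omega) w hw
    · omega

/-- The arrays `child` and `leaf` describe a search tree for sets of vertices; the nodes are the
numbers below `cnt`. -/
structure TrieCore (cnt : ℕ) (child : ℕ → ℕ) : Prop where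
  two_le : 2 ≤ cnt
  child_lt : ∀ q, child q ≠ 0 → child q < cnt ∧ q < 2 * cnt
  inj : ∀ q q', child q ≠ 0 → child q = child q' → q = q'

/-- The search tree contains the sets `S 0, …, S (m - 1)`, and the leaf of `S i` carries `i`. -/
structure Trie (S : ℕ → Finset (Fin n)) (m cnt : ℕ) (child leaf : ℕ → ℕ) : Prop where
  core : TrieCore cnt child
  cnt_le : cnt ≤ 2 + m * n
  path : ∀ i < m, ∀ v < n, child (2 * trieNode child (bit (S i)) v + bit (S i) v) ≠ 0
  leaf_eq : ∀ i < m, leaf (trieNode child (bit (S i)) n) = i * n + 1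

theorem TrieCore.trieNode_lt {cnt : ℕ} {child b : ℕ → ℕ} (h : TrieCore cnt child) {v : ℕ}
    (hp : ∀ w < v, child (2 * trieNode child b w + b w) ≠ 0) : trieNode child b v < cnt := by
  cases v with
  | zero => exact h.two_le
  | succ v => exact (h.child_lt _ (hp v (by omega))).1

/-- Inserts the set in the array `xs` as the one that carries the row offset `io`. Leaves store the
offset plus `1`. -/
def trieInsertCmd : HCmd :=
  .assign .node 1 ⨾
  .loop .v .vo .n (.assign .q (#.node + #.node + .ld .xs #.v) ⨾
    .ite (.eq (.ld .child #.q) 0) (.store .child #.q #.cnt ⨾ .assign .cnt (#.cnt + 1)) .skip ⨾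
    .assign .node (.ld .child #.q)) ⨾
  .store .leaf #.node (#.io + 1)

theorem run_trieInsertCmd (hn : E.par .n = n) {m : ℕ} {S : ℕ → Finset (Fin n)}
    (hb : 4 * (m * n + n) + 8 ≤ E.bound) (hX : IsBits X (σ.a .xs) 0) (hio : σ.r .io = m * n)
    (hS : ∀ i < m, S i ≠ X) (hm : S m = X) (h : Trie S m (σ.r .cnt) (σ.a .child) (σ.a .leaf)) :
    Trie S (m + 1) ((trieInsertCmd.run E σ).r .cnt) ((trieInsertCmd.run E σ).a .child)
      ((trieInsertCmd.run E σ).a .leaf) := by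
  simp only [trieInsertCmd, run_seq]
  rw [run_assign (a := 1) rfl (by omega)]
  have hl := HCmd.loop_rule (σ := σ.setR .node 1) (x := .v) (y := .vo) (m := .n)
    (p := .assign .q (#.node + #.node + .ld .xs #.v) ⨾
      .ite (.eq (.ld .child #.q) 0) (.store .child #.q #.cnt ⨾ .assign .cnt (#.cnt + 1)) .skip ⨾
      .assign .node (.ld .child #.q)) rfl
    (fun v τ => (∀ q, σ.a .child q ≠ 0 → τ.a .child q = σ.a .child q) ∧
      TrieCore (τ.r .cnt) (τ.a .child) ∧ τ.r .cnt ≤ 2 + m * n + v ∧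
      τ.r .node = trieNode (τ.a .child) (bit X) v ∧
      ∀ w < v, τ.a .child (2 * trieNode (τ.a .child) (bit X) w + bit X w) ≠ 0)
    (fun _ _ _ _ h => h)
    ⟨fun _ _ => rfl, h.core, h.cnt_le, rfl, fun w hw => absurd hw (Nat.not_lt_zero _)⟩ (by
      intro v hv τ hF hx hy ⟨h1, h2, h3, h4, h5⟩
      rw [hn] at hv
      have e1 : τ.a .xs v = bit X v := by
        rw [show τ.a .xs = σ.a .xs from hF.a rfl, ← zero_add v]
        exact (hX.eq_bit hv).trans (by rw [zero_add])
      have hbit := bit_le X v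
      have hnode : τ.r .node < τ.r .cnt := h4 ▸ h2.trieNode_lt h5
      obtain ⟨q, hq⟩ : ∃ q, q = 2 * trieNode (τ.a .child) (bit X) v + bit X v := ⟨_, rfl⟩
      have hq' : q < 2 * τ.r .cnt := by omega
      simp only [run_seq]
      rw [run_assign (σ := τ) (a := q) (by simp [hx, e1]; omega) (by omega)]
      by_cases hc : τ.a .child q = 0
      · rw [run_ite_pos (by simpa using hc), run_seq,
          run_store (a := q) (b := τ.r .cnt) (by simp) (by simp) (by omega) (by omega),
          run_assign (σ := HState.setA _ _ _ _) (a := τ.r .cnt + 1) (by simp) (by omega),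
          run_assign (a := τ.r .cnt) (by simp) (by omega)]
        obtain ⟨c, hcd⟩ : ∃ c, c = Function.update (τ.a .child) q (τ.r .cnt) := ⟨_, rfl⟩
        have hext : ∀ p, τ.a .child p ≠ 0 → c p = τ.a .child p := fun p hp => by
          rw [hcd, Function.update_of_ne fun he : p = q => hp (he.symm ▸ hc)]
        have hcq : c q = τ.r .cnt := by rw [hcd, Function.update_self]
        have htn : ∀ w ≤ v, trieNode c (bit X) w = trieNode (τ.a .child) (bit X) w := fun w hw =>
          trieNode_congr hext fun x hx => h5 x (by omega)
        have hcne : ∀ p, p ≠ q → c p = τ.a .child p := fun p hp => by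
          rw [hcd, Function.update_of_ne hp]
        simp only [setR_a, setA_self, ne_eq, reduceCtorEq, not_false_eq_true, setR_of_ne, setR_self,
          ← hcd]
        have h2' := h2.two_le
        refine ⟨fun p hp => ?_, ⟨by omega, fun p hp => ?_, fun p p' hp hpp => ?_⟩, by omega, ?_,
          fun w hw => ?_⟩
        · rw [hext p (by rwa [h1 p hp]), h1 p hp]
        · by_cases hpq : p = q
          · subst hpq
            rw [hcq]
            omega
          · rw [hcne p hpq] at hp ⊢
            have := h2.child_lt p hp
            omega
        · by_cases hpq : p = q
          · by_cases hpq' : p' = q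
            · rw [hpq, hpq']
            · rw [hcne p' hpq', hpq, hcq] at hpp
              have := h2.child_lt p' (by omega)
              omega
          · rw [hcne p hpq] at hp hpp
            by_cases hpq' : p' = q
            · rw [hpq', hcq] at hpp
              have := h2.child_lt p hp
              omega
            · rw [hcne p' hpq'] at hpp
              exact h2.inj p p' hp hpp
        · rw [trieNode, htn v le_rfl, ← hq, hcq]
        · rw [htn w (by omega)]
          rcases Nat.lt_succ_iff_lt_or_eq.1 hw with hw | rfl
          · rw [hext _ (h5 w hw)]
            exact h5 w hw
          · rw [← hq, hcq]
            omega
      · have := h2.child_lt q hc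
        rw [run_ite_neg (by simpa using hc), run_skip,
          run_assign (a := τ.a .child q) (by simp) (by omega)]
        simp only [setR_a, ne_eq, reduceCtorEq, not_false_eq_true, setR_of_ne, setR_self]
        refine ⟨h1, h2, by omega, ?_, fun w hw => ?_⟩
        · rw [trieNode, ← hq]
        · rcases Nat.lt_succ_iff_lt_or_eq.1 hw with hw | rfl
          · exact h5 w hw
          · rw [← hq]
            exact hc)
  rw [hn] at hl
  generalize hF : HCmd.run E (.loop _ _ _ _) (σ.setR .node 1) = τ at hl ⊢
  replace hF := HCmd.frame_of_eq hF
  obtain ⟨h1, h2, h3, h4, h5⟩ := hl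
  have e1 : τ.r .io = m * n := (hF.r rfl).trans hio
  have e2 : τ.a .leaf = σ.a .leaf := hF.a rfl
  have hnode : τ.r .node < τ.r .cnt := h4 ▸ h2.trieNode_lt h5
  rw [run_store (a := τ.r .node) (b := m * n + 1) rfl (by simp [e1]) (by omega) (by omega)]
  simp only [setA_r, setA_self, ne_eq, reduceCtorEq, not_false_eq_true, setA_of_ne, e2]
  have htn : ∀ i < m, ∀ v ≤ n, trieNode (τ.a .child) (bit (S i)) v =
      trieNode (σ.a .child) (bit (S i)) v := fun i hi v hv =>
    trieNode_congr h1 fun w hw => h.path i hi w (by omega)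
  have hpath : ∀ i < m, ∀ v < n,
      τ.a .child (2 * trieNode (τ.a .child) (bit (S i)) v + bit (S i) v) ≠ 0 := fun i hi v hv => by
    rw [htn i hi v (by omega), h1 _ (h.path i hi v hv)]
    exact h.path i hi v hv
  refine ⟨h2, by rw [Nat.succ_mul]; omega, fun i hi v hv => ?_, fun i hi => ?_⟩
  · rcases Nat.lt_succ_iff_lt_or_eq.1 hi with hi | rfl
    · exact hpath i hi v hv
    · rw [hm]
      exact h5 v hv
  · rcases Nat.lt_succ_iff_lt_or_eq.1 hi with hi | rfl
    · rw [Function.update_of_ne, htn i hi n le_rfl, h.leaf_eq i hi]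
      rw [h4]
      exact fun he => hS i hi (eq_of_bit (trieNode_inj h2.inj (bit_le _) (bit_le _) (hpath i hi) he))
    · rw [hm, h4, Function.update_self]

/-- Inserts all separators; the nodes `0` and `1` are taken from the start. -/
def trieCmd : HCmd :=
  .assign .cnt 2 ⨾
  .loop .i .io .nD
    (.loop .v .vo .n (.store .xs #.v (.ld .inp (.par .pD + #.io + #.v))) ⨾ trieInsertCmd)

theorem run_trieCmd (hE : E.Suits n D P M) (hI : IsInput E G D P M (σ.a .inp)) (hD : D.Nodup)
    (hc : ∀ q, σ.a .child q = 0) : ∃ cnt, cnt < E.bound ∧ Trie (fun i => D.getD i ∅) D.length cnt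
      ((trieCmd.run E σ).a .child) ((trieCmd.run E σ).a .leaf) := by
  have hb := hE.bound_n
  have hbD := hE.bound_D
  rw [trieCmd, run_seq, run_assign (a := 2) rfl (by omega)]
  have h := HCmd.loop_rule (σ := σ.setR .cnt 2) (x := .i) (y := .io) (m := .nD)
    (p := .loop .v .vo .n (.store .xs #.v (.ld .inp (.par .pD + #.io + #.v))) ⨾ trieInsertCmd) rfl
    (fun i τ => Trie (fun i => D.getD i ∅) i (τ.r .cnt) (τ.a .child) (τ.a .leaf))
    (fun _ _ _ _ h => h)
    ⟨⟨by simp, fun q hq => absurd (hc q) hq, fun q _ hq => absurd (hc q) hq⟩, by simp,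
      fun i hi => absurd hi (Nat.not_lt_zero _), fun i hi => absurd hi (Nat.not_lt_zero _)⟩ (by
      intro i hi τ hF hx hy h
      rw [hE.par_nD] at hi
      rw [hE.par_n] at hy
      have e1 : τ.a .inp = σ.a .inp := hF.a rfl
      have hX := run_loadBits (e := .par .pD + #.io) hE.par_n (by omega)
        (by rw [e1]; exact hI.sep i hi) fun τ' h' => by simp [h', hy]
      have hF1 := (HCmd.loop .v .vo .n (.store .xs #.v (.ld .inp (.par .pD + #.io + #.v)))).frame E τ
      rw [run_seq]
      generalize (HCmd.loop .v .vo .n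
        (.store .xs #.v (.ld .inp (.par .pD + #.io + #.v)))).run E τ = τ₁ at hX hF1 ⊢
      have hin := mul_add_self_le (n := n) hi
      refine run_trieInsertCmd hE.par_n (by omega) hX ((hF1.r rfl).trans hy) (fun j hj he => ?_) rfl
        (by rw [hF1.r rfl, hF1.a rfl, hF1.a rfl]; exact h)
      rw [List.getD_eq_getElem _ _ (by omega), List.getD_eq_getElem _ _ hi] at he
      have := (List.Nodup.getElem_inj_iff hD).1 he
      omega)
  rw [hE.par_nD] at h
  exact ⟨_, by have := h.cnt_le; omega, h⟩

/-- Looks up the set whose 0/1-vector is given by the expression `e`; register `q` is set to the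
offset of its row. -/
def walkCmd (e : HExpr) : HCmd :=
  .assign .node 1 ⨾
  .loop .v .vo .n (.assign .node (.ld .child (#.node + #.node + e))) ⨾
  .assign .q (.ld .leaf #.node - 1)

theorem run_walkCmd (hn : E.par .n = n) {S : ℕ → Finset (Fin n)} {m cnt i : ℕ} (hm : 1 < E.bound)
    (hcnt : cnt < E.bound) (h : Trie S m cnt (σ.a .child) (σ.a .leaf)) (hi : i < m)
    (hib : i * n < E.bound) {e : HExpr}
    (he : ∀ v < n, ∀ τ : HState, (∀ x, x ≠ .node → x ≠ .q → x ≠ .v → x ≠ .vo → τ.r x = σ.r x) →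
      τ.a = σ.a → τ.r .v = v → τ.r .vo = v * n → e.eval E τ = bit (S i) v) :
    ((walkCmd e).run E σ).r .q = i * n := by
  simp only [walkCmd, run_seq]
  rw [run_assign (σ := σ) (a := 1) rfl hm]
  have hl := HCmd.loop_rule (σ := σ.setR .node 1) (x := .v) (y := .vo) (m := .n)
    (p := .assign .node (.ld .child (#.node + #.node + e))) rfl
    (fun v τ => τ.r .node = trieNode (σ.a .child) (bit (S i)) v) (fun _ _ _ _ h => h) rfl (by
      intro v hv τ hF hx hy h1
      rw [hn] at hv hy
      have ea : τ.a = σ.a := funext fun k => hF.a rfl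
      have hev := he v hv τ (fun x h1 h2 h3 h4 => (hF.r (x := x) (by
        simp [HCmd.modR, h1, h3, h4])).trans (setR_of_ne _ h1)) ea hx hy
      rw [run_assign (a := trieNode (σ.a .child) (bit (S i)) (v + 1))
        (by simp [ea, h1, hev, trieNode, two_mul])
        ((h.core.trieNode_lt fun w hw => h.path i hi w (by omega)).trans hcnt), setR_self])
  rw [hn] at hl
  generalize hF : HCmd.run E (.loop _ _ _ _) (σ.setR .node 1) = τ at hl ⊢
  replace hF := HCmd.frame_of_eq hF
  have e1 : τ.a .leaf = σ.a .leaf := hF.a rfl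
  rw [run_assign (a := i * n) (by simp [hl, e1, h.leaf_eq i hi]) hib, setR_self]

/-! ### Indices of blocks -/

variable {f : Finset (Fin n) → ℝ≥0} {a : Arr → ℕ → ℕ} {i j : ℕ} {r s : Fin n}

/-- The block of the separator number `i` of the list `D` and the component of the vertex `r`. -/
def blk (G : SimpleGraph (Fin n)) (D : List (Finset (Fin n))) (i : ℕ) (r : Fin n) :
    Finset (Fin n) × Finset (Fin n) :=
  (D.getD i ∅, compOf G (D.getD i ∅) r)

/-- The separator number `i` and the representative `r` of a component form a full block. -/
def IsIdx (D : List (Finset (Fin n))) (a : Arr → ℕ → ℕ) (i : ℕ) (r : Fin n) : Prop :=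
  i < D.length ∧ a .flag (i * n + r) = 1

theorem isListing_getD_mem {α : Type*} {L : List α} {s : Set α} (h : IsListing L s) {d : α}
    (hi : i < L.length) : L.getD i d ∈ s := by
  rw [List.getD_eq_getElem _ _ hi]
  exact (h.2 _).1 (List.getElem_mem hi)

theorem isListing_exists_getD {α : Type*} {L : List α} {s : Set α} (h : IsListing L s) {d x : α}
    (hx : x ∈ s) : ∃ i < L.length, L.getD i d = x := by
  obtain ⟨i, hi, rfl⟩ := List.getElem_of_mem ((h.2 x).2 hx)
  exact ⟨i, hi, List.getD_eq_getElem _ _ hi⟩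

theorem isListing_getD_inj {α : Type*} {L : List α} {s : Set α} (h : IsListing L s) {d : α}
    (hi : i < L.length) (hj : j < L.length) (he : L.getD i d = L.getD j d) : i = j := by
  rw [List.getD_eq_getElem _ _ hi, List.getD_eq_getElem _ _ hj] at he
  exact (List.Nodup.getElem_inj_iff h.1).1 he

theorem SepRow.flag_iff {S : Finset (Fin n)} {o m : ℕ} {labD flag size : ℕ → ℕ}
    (h : SepRow G S o labD flag size m) :
    flag (o + r) = 1 ↔ labD (o + r) = r ∧ nbhd G (compOf G S r) = S := by
  constructor
  · intro h1
    by_contra hn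
    have := h.flag_zero r hn
    omega
  · exact fun h1 => h.flag_one r h1.1 h1.2

section Table

variable (hT : IsSepTable G D a) (hD : IsListing D (minSeps G))

include hT

theorem IsIdx.labD (h : IsIdx D a i r) : a .labD (i * n + r) = r :=
  ((hT i h.1).flag_iff.1 h.2).1

theorem IsIdx.notMem (h : IsIdx D a i r) : r ∉ D.getD i ∅ :=
  (hT i h.1).labels.notMem (h.labD hT)

theorem IsIdx.isComp (h : IsIdx D a i r) : IsComp G (blk G D i r).1 (blk G D i r).2 :=
  isComp_compOf (h.notMem hT)

theorem IsIdx.nbhd_eq (h : IsIdx D a i r) : nbhd G (blk G D i r).2 = (blk G D i r).1 :=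
  ((hT i h.1).flag_iff.1 h.2).2

include hD

theorem IsIdx.mem_fullBlocks (h : IsIdx D a i r) : blk G D i r ∈ fullBlocks G :=
  ⟨isListing_getD_mem hD h.1, h.isComp hT, h.nbhd_eq hT⟩

theorem IsIdx.inj (h : IsIdx D a i r) (h' : IsIdx D a j s) (he : blk G D i r = blk G D j s) :
    i = j ∧ r = s := by
  obtain ⟨h1, h2⟩ := Prod.ext_iff.1 he
  obtain rfl := isListing_getD_inj hD h.1 h'.1 h1
  exact ⟨rfl, (hT i h.1).labels.rep_unique (h.labD hT) (h'.labD hT) h2⟩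

omit hD in
/-- The index of a full block, from any of the vertices of its component. -/
theorem exists_isIdx_of_mem (hi : i < D.length) {C : Finset (Fin n)}
    (hC : IsFullComp G (D.getD i ∅) C) {w : Fin n} (hw : w ∈ C) :
    ∃ r, IsIdx D a i r ∧ a .labD (i * n + w) = r ∧ blk G D i r = (D.getD i ∅, C) := by
  have hwD := hC.1.notMem hw
  obtain ⟨r, h1, h2, h3⟩ := (hT i hi).labels.rep w hwD
  have he : compOf G (D.getD i ∅) r = C := by
    rw [compOf_eq_of_mem hwD h3, ← hC.1.eq_compOf hw]
  exact ⟨r, ⟨hi, (hT i hi).flag_iff.2 ⟨h2, he ▸ hC.2⟩⟩, h1, by rw [blk, he]⟩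

theorem exists_isIdx {b : Finset (Fin n) × Finset (Fin n)} (hb : b ∈ fullBlocks G) :
    ∃ i r, IsIdx D a i r ∧ blk G D i r = b := by
  obtain ⟨i, hi, h1⟩ := isListing_exists_getD hD (d := ∅) hb.1
  obtain ⟨w, hw⟩ := hb.2.1.nonempty
  obtain ⟨r, h2, -, h3⟩ := exists_isIdx_of_mem hT hi (h1 ▸ hb.2) hw
  exact ⟨i, r, h2, h3.trans (by rw [h1])⟩

omit hD in
theorem IsSepTable.labD_le (hi : i < D.length) (v : Fin n) : a .labD (i * n + v) ≤ n := by
  by_cases h : v ∈ D.getD i ∅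
  · exact ((hT i hi).labels.out v h).le
  · obtain ⟨w, h1, -⟩ := (hT i hi).labels.rep v h
    have h1 : a .labD (i * n + v) = w := h1
    omega

omit hD in
theorem IsIdx.size_eq (h : IsIdx D a i r) :
    a .size (i * n + r) = ((blk G D i r).1 ∪ (blk G D i r).2).card :=
  (hT i h.1).size_eq r (h.labD hT)

omit hD in
/-- A vertex `v` lies in the component of a block if and only if it has the right label. -/
theorem IsIdx.labD_eq_iff (h : IsIdx D a i r) {v : Fin n} :
    a .labD (i * n + v) = r ↔ v ∈ (blk G D i r).2 :=
  (hT i h.1).labels.eq_val_iff (h.labD hT)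

end Table

/-! ### The blocks associated with the potential maximal cliques -/

/-- Sets register `w` to some vertex that passes the test `t`. -/
def someCmd (t : HTest) : HCmd :=
  .assign .w 0 ⨾ .loop .v .vo .n (.ite t (.assign .w #.v) .skip)

theorem run_someCmd (hn : E.par .n = n) (hb : n < E.bound) {t : HTest} {Q : Fin n → Prop}
    (ht : ∀ v : Fin n, ∀ τ : HState, (∀ x, x ≠ .w → x ≠ .v → x ≠ .vo → τ.r x = σ.r x) →
      τ.a = σ.a → τ.r .v = v → τ.r .vo = v * n → (t.Holds E τ ↔ Q v)) (hQ : ∃ v, Q v) :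
    ∃ w, Q w ∧ ((someCmd t).run E σ).r .w = w := by
  rw [someCmd, run_seq, run_assign (a := 0) rfl (by omega)]
  have h := HCmd.loop_rule (σ := σ.setR .w 0) (x := .v) (y := .vo) (m := .n)
    (p := .ite t (.assign .w #.v) .skip) rfl
    (fun i τ => (∃ v : Fin n, v.val < i ∧ Q v) → ∃ w, Q w ∧ τ.r .w = w)
    (fun _ _ _ _ h => h) (fun ⟨v, hv, _⟩ => absurd hv (Nat.not_lt_zero _)) (by
      intro i hi τ hF hx hy h ⟨v, hv, hvQ⟩
      rw [hn] at hi hy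
      obtain ⟨u, rfl⟩ : ∃ u : Fin n, u.val = i := ⟨⟨i, hi⟩, rfl⟩
      have htu := ht u τ (fun x h1 h2 h3 => (hF.r (x := x) (by
        simp [HCmd.modR, h1, h2, h3])).trans (setR_of_ne _ h1)) (funext fun k => hF.a rfl) hx hy
      by_cases hu : Q u
      · rw [run_ite_pos (htu.2 hu),
          run_assign (a := u) (by rw [eval_reg, hx]) (by omega)]
        exact ⟨u, hu, setR_self _ _⟩
      · rw [run_ite_neg (htu.not.2 hu), run_skip]
        refine h ⟨v, ?_, hvQ⟩
        have : v.val ≠ u.val := fun he => hu (Fin.ext he ▸ hvQ)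
        omega)
  obtain ⟨v, hv⟩ := hQ
  exact h ⟨v, by rw [hn]; exact v.2, hv⟩

/-- The entry for the component of `Ω` that is represented by `r`: it stores the index of its
block, the block `(N(D), D)`, and that of the block on the other side of `N(D)`, whose component
contains the rest of `Ω`. -/
def pmcEntryCmd : HCmd :=
  walkCmd (.ld .nb (#.vo + #.r)) ⨾
  someCmd (.and (.eq (.ld .xs #.v) 1) (.eq (.ld .nb (#.vo + #.r)) 0)) ⨾
  .store .pf (#.oo + #.r) 1 ⨾
  .store .tS (#.oo + #.r) #.q ⨾
  .store .cR (#.oo + #.r) (.ld .labD (#.q + #.r)) ⨾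
  .store .tR (#.oo + #.r) (.ld .labD (#.q + #.w))

/-- Computes the entries of all potential maximal cliques; `pf` marks the representatives of
components. -/
def pmcsCmd : HCmd :=
  .loop .o .oo .nP
    (.loop .v .vo .n (.store .xs #.v (.ld .inp (.par .pP + #.oo + #.v))) ⨾ compsCmd ⨾
      .loop .r .ro .n (.ite (.eq (.ld .lab #.r) #.r) pmcEntryCmd (.store .pf (#.oo + #.r) 0)))

/-- The entry number `k` belongs to the component of the vertex `r` of `G - Ω`. -/
structure PmcEntry (G : SimpleGraph (Fin n)) (D : List (Finset (Fin n))) (Ω : Finset (Fin n))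
    (labD tS cR tR : ℕ → ℕ) (k : ℕ) (r : Fin n) : Prop where
  notMem : r ∉ Ω
  exists_idx : ∃ i < D.length, D.getD i ∅ = nbhd G (compOf G Ω r) ∧ tS k = i * n ∧
    cR k = labD (i * n + r) ∧
    ∃ w ∈ Ω, w ∉ nbhd G (compOf G Ω r) ∧ tR k = labD (i * n + w)

/-- The entries from `o` on describe the components of `G - Ω`. -/
structure PmcRow (G : SimpleGraph (Fin n)) (D : List (Finset (Fin n))) (Ω : Finset (Fin n)) (o : ℕ)
    (labD pf tS cR tR : ℕ → ℕ) : Prop where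
  entry : ∀ r : Fin n, pf (o + r) = 1 → PmcEntry G D Ω labD tS cR tR (o + r) r
  exists_rep : ∀ C, IsComp G Ω C → ∃ r : Fin n, pf (o + r) = 1 ∧ C = compOf G Ω r
  rep_unique : ∀ r s : Fin n, pf (o + r) = 1 → pf (o + s) = 1 → compOf G Ω r = compOf G Ω s → r = s

theorem run_pmcEntryCmd (hE : E.Suits n D P M) (hD : IsListing D (minSeps G))
    {Ω : Finset (Fin n)} (hΩ : IsPMC G Ω) {o : ℕ} (ho : o + n ≤ E.bound) {cnt : ℕ}
    (hcnt : cnt < E.bound)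
    (hT : IsSepTable G D σ.a) (hX : IsBits Ω (σ.a .xs) 0) (hC : Comps G Ω (σ.a .lab) (σ.a .nb))
    (htr : Trie (fun i => D.getD i ∅) D.length cnt (σ.a .child) (σ.a .leaf))
    {r : Fin n} (hr : σ.r .r = r) (hlr : σ.a .lab r = r) (hoo : σ.r .oo = o) :
    (pmcEntryCmd.run E σ).a .pf (o + r) = 1 ∧
    PmcEntry G D Ω (σ.a .labD) ((pmcEntryCmd.run E σ).a .tS)
        ((pmcEntryCmd.run E σ).a .cR) ((pmcEntryCmd.run E σ).a .tR) (o + r) r ∧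
      ∀ l, l ≠ o + r → (pmcEntryCmd.run E σ).a .pf l = σ.a .pf l ∧
        (pmcEntryCmd.run E σ).a .tS l = σ.a .tS l ∧ (pmcEntryCmd.run E σ).a .cR l = σ.a .cR l ∧
        (pmcEntryCmd.run E σ).a .tR l = σ.a .tR l := by
  have hb := hE.bound_n
  have hbD := hE.bound_D
  have hrΩ := hC.labels.notMem hlr
  have hcomp := isComp_compOf (G := G) hrΩ
  obtain ⟨i, hi, hiN⟩ : ∃ i < D.length, D.getD i ∅ = nbhd G (compOf G Ω r) :=
    isListing_exists_getD hD (hΩ.mem_fullBlocks hcomp).1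
  have hnb := hC.nbhds r hlr
  have hin := mul_add_self_le (n := n) hi
  have hr2 := r.2
  simp only [pmcEntryCmd, run_seq]
  -- Column `r` of the array `nb` is the 0/1-vector of `N(D)`, for the component `D` of `r`.
  have hq := run_walkCmd hE.par_n (by omega) hcnt htr hi (by omega)
    (e := .ld .nb (#.vo + #.r)) (fun v hv τ h1 h2 h3 h4 => by
      have hr' : τ.r .r = r := (h1 .r (by decide) (by decide) (by decide) (by decide)).trans hr
      rw [eval_ld, eval_add, eval_reg, eval_reg, h4, hr', h2, hiN]
      have := hnb ⟨v, hv⟩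
      have h5 := bit_eq_one_iff (X := nbhd G (compOf G Ω r)) (v := ⟨v, hv⟩)
      have h6 := bit_le (nbhd G (compOf G Ω r)) v
      by_cases hm : (⟨v, hv⟩ : Fin n) ∈ nbhd G (compOf G Ω r)
      · rw [this.1 hm, h5.2 hm]
      · have h7 := h5.not.2 hm
        rw [this.2 hm]
        dsimp only at h7
        omega)
  have hF := (walkCmd (.ld .nb (#.vo + #.r))).frame E σ
  generalize (walkCmd (.ld .nb (#.vo + #.r))).run E σ = σ₁ at hq hF ⊢
  have ea : σ₁.a = σ.a := funext fun k => hF.a rfl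
  have e1 : σ₁.r .r = r := (hF.r rfl).trans hr
  have e2 : σ₁.r .oo = o := (hF.r rfl).trans hoo
  obtain ⟨w, ⟨hw1, hw2⟩, hw⟩ := run_someCmd hE.par_n (by omega)
    (t := .and (.eq (.ld .xs #.v) 1) (.eq (.ld .nb (#.vo + #.r)) 0))
    (Q := fun v => v ∈ Ω ∧ v ∉ nbhd G (compOf G Ω r)) (fun v τ h1 h2 h3 h4 => by
      have hr' : τ.r .r = r := (h1 .r (by decide) (by decide) (by decide)).trans e1
      have hX' : σ.a .xs v = 1 ↔ v ∈ Ω := by simpa using hX.eq_one_iff (v := v)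
      have hN' : σ.a .nb (v * n + r) = 0 ↔ v ∉ nbhd G (compOf G Ω r) := by
        by_cases hm : v ∈ nbhd G (compOf G Ω r)
        · simp [(hnb v).1 hm, hm]
        · simp [(hnb v).2 hm, hm]
      simp [h2, ea, h3, h4, hr', hX', hN'])
    (Finset.exists_of_ssubset (hΩ.nbhd_ssubset hcomp))
  have hF' := (someCmd (.and (.eq (.ld .xs #.v) 1) (.eq (.ld .nb (#.vo + #.r)) 0))).frame E σ₁
  generalize (someCmd (.and (.eq (.ld .xs #.v) 1) (.eq (.ld .nb (#.vo + #.r)) 0))).run E σ₁ = σ₂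
    at hw hF' ⊢
  have fa : σ₂.a = σ.a := (funext fun k => hF'.a rfl : σ₂.a = σ₁.a).trans ea
  have f1 : σ₂.r .r = r := (hF'.r rfl).trans e1
  have f2 : σ₂.r .oo = o := (hF'.r rfl).trans e2
  have f3 : σ₂.r .q = i * n := (hF'.r rfl).trans hq
  have hl1 := hT.labD_le hi r
  have hl2 := hT.labD_le hi w
  rw [run_store (σ := σ₂) (a := o + r) (b := 1) (by simp [f1, f2]) rfl (by omega) (by omega),
    run_store (σ := σ₂.setA _ _ _) (a := o + r) (b := i * n) (by simp [f1, f2]) (by simp [f3])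
      (by omega) (by omega),
    run_store (σ := (σ₂.setA _ _ _).setA _ _ _) (a := o + r) (b := σ.a .labD (i * n + r))
      (by simp [f1, f2]) (by simp [f3, f1, fa]) (by omega) (by omega),
    run_store (a := o + r) (b := σ.a .labD (i * n + w))
      (by simp [f1, f2]) (by simp [f3, hw, fa]) (by omega) (by omega)]
  simp only [setA_self, ne_eq, reduceCtorEq, not_false_eq_true, setA_of_ne, fa]
  refine ⟨Function.update_self .., ⟨hrΩ, i, hi, hiN, ?_, ?_, w, hw1, hw2, ?_⟩, fun l hl => ?_⟩
  · rw [Function.update_self]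
  · rw [Function.update_self]
  · rw [Function.update_self]
  · simp only [Function.update_of_ne hl, true_and]

theorem run_pmcsCmd (hE : E.Suits n D P M) (hD : IsListing D (minSeps G))
    (hP : IsListing P (pmcs G)) (hI : IsInput E G D P M (σ.a .inp)) {cnt : ℕ} (hcnt : cnt < E.bound)
    (hT : IsSepTable G D σ.a)
    (htr : Trie (fun i => D.getD i ∅) D.length cnt (σ.a .child) (σ.a .leaf)) :
    ∀ o < P.length, PmcRow G D (P.getD o ∅) (o * n) ((pmcsCmd.run E σ).a .labD)
      ((pmcsCmd.run E σ).a .pf) ((pmcsCmd.run E σ).a .tS) ((pmcsCmd.run E σ).a .cR)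
      ((pmcsCmd.run E σ).a .tR) := by
  have hb := hE.bound_n
  have hbP := hE.bound_P
  have hlab : (pmcsCmd.run E σ).a .labD = σ.a .labD := (pmcsCmd.frame E σ).a rfl
  rw [hlab]
  have h := HCmd.loop_rule (x := .o) (y := .oo) (m := .nP)
    (p := .loop .v .vo .n (.store .xs #.v (.ld .inp (.par .pP + #.oo + #.v))) ⨾ compsCmd ⨾
      .loop .r .ro .n (.ite (.eq (.ld .lab #.r) #.r) pmcEntryCmd (.store .pf (#.oo + #.r) 0))) rfl
    (fun i τ => ∀ o < i, PmcRow G D (P.getD o ∅) (o * n) (σ.a .labD) (τ.a .pf) (τ.a .tS) (τ.a .cR)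
      (τ.a .tR)) (fun _ _ _ _ h => h) (fun o ho => absurd ho (Nat.not_lt_zero _)) (by
      intro o ho τ hF hx hy h
      rw [hE.par_nP] at ho
      rw [hE.par_n] at hy
      have hΩ : IsPMC G (P.getD o ∅) := isListing_getD_mem hP ho
      have hon := mul_add_self_le (n := n) ho
      simp only [run_seq]
      have hX := run_loadBits (e := .par .pP + #.oo) hE.par_n (by omega)
        (by rw [hF.a rfl]; exact hI.pmc o ho) fun τ' h' => by simp [h', hy]
      generalize hF1 : HCmd.run E (.loop _ _ _ _) τ = τ₁ at hX ⊢
      replace hF1 := HCmd.frame_of_eq hF1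
      have hC := run_compsCmd (σ := τ₁) hE.par_n (by omega) (by omega)
        (by rw [hF1.a rfl, hF.a rfl]; exact hI.adj) hX
      have hF2 := compsCmd.frame E τ₁
      generalize compsCmd.run E τ₁ = τ₂ at hC hF2 ⊢
      have fx : τ₂.a .xs = τ₁.a .xs := hF2.a rfl
      rw [← fx] at hX
      have f1 : τ₂.a .pf = τ.a .pf := (hF2.a rfl).trans (hF1.a rfl)
      have f2 : τ₂.a .tS = τ.a .tS := (hF2.a rfl).trans (hF1.a rfl)
      have f3 : τ₂.a .cR = τ.a .cR := (hF2.a rfl).trans (hF1.a rfl)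
      have f4 : τ₂.a .tR = τ.a .tR := (hF2.a rfl).trans (hF1.a rfl)
      have f5 : τ₂.a .labD = σ.a .labD := (hF2.a rfl).trans ((hF1.a rfl).trans (hF.a rfl))
      have f6 : τ₂.a .flag = σ.a .flag := (hF2.a rfl).trans ((hF1.a rfl).trans (hF.a rfl))
      have f7 : τ₂.a .size = σ.a .size := (hF2.a rfl).trans ((hF1.a rfl).trans (hF.a rfl))
      have f8 : τ₂.a .mins = σ.a .mins := (hF2.a rfl).trans ((hF1.a rfl).trans (hF.a rfl))
      have f9 : τ₂.a .child = σ.a .child := (hF2.a rfl).trans ((hF1.a rfl).trans (hF.a rfl))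
      have f10 : τ₂.a .leaf = σ.a .leaf := (hF2.a rfl).trans ((hF1.a rfl).trans (hF.a rfl))
      have f11 : τ₂.r .oo = o * n := (hF2.r rfl).trans ((hF1.r rfl).trans hy)
      have hl := HCmd.loop_rule (σ := τ₂) (x := .r) (y := .ro) (m := .n)
        (p := .ite (.eq (.ld .lab #.r) #.r) pmcEntryCmd (.store .pf (#.oo + #.r) 0)) rfl
        (fun i τ' => (∀ r : Fin n, r.val < i → (τ'.a .pf (o * n + r) = 1 → τ₂.a .lab r = r ∧
            PmcEntry G D (P.getD o ∅) (σ.a .labD) (τ'.a .tS) (τ'.a .cR) (τ'.a .tR) (o * n + r) r) ∧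
            (τ₂.a .lab r = r → τ'.a .pf (o * n + r) = 1)) ∧
          ∀ l < o * n, τ'.a .pf l = τ.a .pf l ∧ τ'.a .tS l = τ.a .tS l ∧ τ'.a .cR l = τ.a .cR l ∧
            τ'.a .tR l = τ.a .tR l) (fun _ _ _ _ h => h)
        ⟨fun r hr => absurd hr (Nat.not_lt_zero _), fun l _ => by rw [f1, f2, f3, f4]; simp⟩ (by
          intro i hi τ' hF' hx' hy' ⟨k1, k2⟩
          rw [hE.par_n] at hi
          obtain ⟨r, rfl⟩ : ∃ r : Fin n, r.val = i := ⟨⟨i, hi⟩, rfl⟩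
          have gl : τ'.a .lab = τ₂.a .lab := hF'.a rfl
          have go : τ'.r .oo = o * n := (hF'.r rfl).trans f11
          have hne : ∀ s : Fin n, s ≠ r → o * n + s ≠ o * n + r := fun s hs he =>
            hs (Fin.ext (by omega))
          by_cases hlr : τ₂.a .lab r = r
          · rw [run_ite_pos (by simpa [hx', gl] using hlr)]
            have g5 : τ'.a .labD = σ.a .labD := (hF'.a rfl).trans f5
            have g6 : τ'.a .flag = σ.a .flag := (hF'.a rfl).trans f6
            have g7 : τ'.a .size = σ.a .size := (hF'.a rfl).trans f7
            have g8 : τ'.a .mins = σ.a .mins := (hF'.a rfl).trans f8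
            have hT' : IsSepTable G D τ'.a := fun i hi => by
              rw [g5, g6, g7, g8]; exact hT i hi
            obtain ⟨p1, p2, p3⟩ := run_pmcEntryCmd (σ := τ') (o := o * n) hE hD hΩ
              (by omega) hcnt hT'
              (by rw [hF'.a rfl]; exact hX) (by rw [gl, hF'.a rfl]; exact hC)
              (by rw [hF'.a rfl, f9, hF'.a rfl, f10]; exact htr) hx' (by rw [gl]; exact hlr) go
            rw [g5] at p2
            refine ⟨fun s hs => ?_, fun l hl => ?_⟩
            · by_cases hsr : s = r
              · subst hsr
                exact ⟨fun _ => ⟨hlr, p2⟩, fun _ => p1⟩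
              · have : s.val ≠ r.val := fun he => hsr (Fin.ext he)
                obtain ⟨q1, q2, q3, q4⟩ := p3 _ (hne s hsr)
                obtain ⟨m1, m2⟩ := k1 s (by omega)
                rw [q1]
                refine ⟨fun hs => ⟨(m1 hs).1, ?_⟩, m2⟩
                obtain ⟨n1, n2⟩ := (m1 hs).2
                exact ⟨n1, by rwa [q2, q3, q4]⟩
            · obtain ⟨q1, q2, q3, q4⟩ := p3 l (by omega)
              rw [q1, q2, q3, q4]
              exact k2 l hl
          · rw [run_ite_neg (by simpa [hx', gl] using hlr),
              run_store (a := o * n + r) (b := 0) (by simp [go, hx']) rfl (by omega) (by omega)]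
            simp only [setA_self, ne_eq, reduceCtorEq, not_false_eq_true, setA_of_ne]
            refine ⟨fun s hs => ?_, fun l hl => ?_⟩
            · by_cases hsr : s = r
              · subst hsr
                simp [hlr]
              · have : s.val ≠ r.val := fun he => hsr (Fin.ext he)
                rw [Function.update_of_ne (hne s hsr)]
                exact k1 s (by omega)
            · rw [Function.update_of_ne (by omega)]
              exact k2 l hl)
      rw [hE.par_n] at hl
      generalize HCmd.run E _ τ₂ = τ₃ at hl ⊢
      obtain ⟨k1, k2⟩ := hl
      intro o' ho'
      rcases Nat.lt_succ_iff_lt_or_eq.1 ho' with ho' | rfl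
      · have hlt : ∀ v : Fin n, o' * n + v < o * n := fun v => mul_add_lt ho' v.2 le_rfl
        obtain ⟨m1, m2, m3⟩ := h o' ho'
        refine ⟨fun r hr => ?_, fun C hCC => ?_, fun r s hr hs => ?_⟩
        · obtain ⟨q1, q2, q3, q4⟩ := k2 _ (hlt r)
          rw [q1] at hr
          obtain ⟨n1, n2⟩ := m1 r hr
          exact ⟨n1, by rwa [q2, q3, q4]⟩
        · obtain ⟨r, hr, hr'⟩ := m2 C hCC
          exact ⟨r, (k2 _ (hlt r)).1.trans hr, hr'⟩
        · rw [(k2 _ (hlt r)).1] at hr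
          rw [(k2 _ (hlt s)).1] at hs
          exact m3 r s hr hs
      · refine ⟨fun r hr => ((k1 r r.2).1 hr).2, fun C hCC => ?_, fun r s hr hs he => ?_⟩
        · obtain ⟨r, hr, hr'⟩ := hC.labels.exists_rep hCC
          exact ⟨r, (k1 r r.2).2 hr, hr'⟩
        · exact hC.labels.rep_unique ((k1 r r.2).1 hr).1 ((k1 s s.2).1 hs).1 he)
  rw [hE.par_nP] at h
  exact h

variable {o : ℕ} {u : Fin n}

/-! ### Initial values of the blocks -/

/-- The array `v` holds the values of the input. -/
structure IsInputVal (f : Finset (Fin n) → ℝ≥0) (P : List (Finset (Fin n)))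
    (M : List (Finset (Fin n) × Finset (Fin n))) (v : ℕ → ℝ≥0∞) : Prop where
  pmc : ∀ o < P.length, v o = f (P.getD o ∅)
  block : ∀ j < M.length, v (P.length + j) =
    f ((M.getD j (∅, ∅)).1 ∪ (M.getD j (∅, ∅)).2)

/-- Sets the entry of the inclusion-minimal full block number `j` to its value in the input. -/
def initEntryCmd : HCmd :=
  walkCmd (.ld .inp (.par .pM + (#.jo + #.jo) + #.v)) ⨾
  someCmd (.eq (.ld .inp (.par .pM + (#.jo + #.jo) + .par .n + #.v)) 1) ⨾
  .vcopy .tab (#.q + .ld .labD (#.q + #.w)) .inp (.par .nP + #.j)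

/-- Sets all entries of the table to `∞`, then those of the inclusion-minimal blocks to their
values. -/
def initTabCmd : HCmd :=
  .loop .i .io .nD (.loop .r .ro .n (.vtop .tab (#.io + #.r))) ⨾
  .loop .j .jo .nM initEntryCmd

theorem run_initTabCmd (hE : E.Suits n D P M) (hD : IsListing D (minSeps G))
    (hM : IsListing M (minFullBlocks G)) (hI : IsInput E G D P M (σ.a .inp))
    (hV : IsInputVal f P M (σ.v .inp)) {cnt : ℕ} (hcnt : cnt < E.bound)
    (hT : IsSepTable G D σ.a)
    (htr : Trie (fun i => D.getD i ∅) D.length cnt (σ.a .child) (σ.a .leaf)) :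
    ∀ i r, IsIdx D σ.a i r →
      (initTabCmd.run E σ).v .tab (i * n + r) = initVal G f (blk G D i r) := by
  have hb := hE.bound_n
  have hbD := hE.bound_D
  rw [initTabCmd, run_seq]
  have h1 := HCmd.loop_rule (σ := σ) (x := .i) (y := .io) (m := .nD)
    (p := .loop .r .ro .n (.vtop .tab (#.io + #.r))) rfl
    (fun i τ => ∀ j < i, ∀ r < n, τ.v .tab (j * n + r) = ⊤)
    (fun _ _ _ _ h => h) (fun v hv => absurd hv (Nat.not_lt_zero _)) (by
      intro i hi τ hF hx hy h
      rw [hE.par_n] at hy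
      rw [hE.par_nD] at hi
      have hin := mul_add_self_le (n := n) hi
      have hl := HCmd.loop_rule (x := .r) (y := .ro) (m := .n)
        (p := .vtop .tab (#.io + #.r)) rfl
        (fun l τ' => (∀ j < i, ∀ r < n, τ'.v .tab (j * n + r) = ⊤) ∧
          ∀ r < l, τ'.v .tab (i * n + r) = ⊤)
        (fun _ _ _ _ h => h) ⟨h, fun v hv => absurd hv (Nat.not_lt_zero _)⟩ (by
          intro l hl τ' hF' hx' hy' ⟨k1, k2⟩
          rw [hE.par_n] at hl
          have go : τ'.r .io = i * n := (hF'.r rfl).trans hy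
          rw [run_vtop (a := i * n + l) (by simp [go, hx']) (by omega), setV_self]
          refine ⟨fun j hj r hr => ?_, fun r hr => ?_⟩
          · rw [Function.update_apply, k1 j hj r hr, ite_self]
          · rcases Nat.lt_succ_iff_lt_or_eq.1 hr with hr | rfl
            · rw [Function.update_apply, k2 r hr, ite_self]
            · rw [Function.update_self])
      rw [hE.par_n] at hl
      intro j hj
      rcases Nat.lt_succ_iff_lt_or_eq.1 hj with hj | rfl
      · exact hl.1 j hj
      · exact hl.2)
  rw [hE.par_nD] at h1
  generalize hF : HCmd.run E (.loop _ _ _ _) σ = σ₁ at h1 ⊢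
  replace hF := HCmd.frame_of_eq hF
  have ea : σ₁.a = σ.a := funext fun k => hF.a rfl
  have ev : σ₁.v .inp = σ.v .inp := hF.v rfl
  rw [← ev] at hV
  rw [← ea] at hT hI htr ⊢
  have h2 := HCmd.loop_rule (x := .j) (y := .jo) (m := .nM)
    (p := initEntryCmd) rfl
    (fun j τ => ∀ i r, IsIdx D σ₁.a i r →
      ((∃ l < j, M.getD l (∅, ∅) = blk G D i r) →
        τ.v .tab (i * n + r) = f ((blk G D i r).1 ∪ (blk G D i r).2)) ∧
      (¬ (∃ l < j, M.getD l (∅, ∅) = blk G D i r) → τ.v .tab (i * n + r) = ⊤))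
    (fun _ _ _ _ h => h) (fun i r hir => ⟨fun ⟨l, hl, _⟩ => absurd hl (Nat.not_lt_zero _),
      fun _ => h1 i hir.1 r r.2⟩) (by
      intro j hj τ hF hx hy h
      rw [hE.par_nM] at hj
      rw [hE.par_n] at hy
      have fa : τ.a = σ₁.a := funext fun k => hF.a (by cases k <;> rfl)
      have fv : τ.v .inp = σ₁.v .inp := hF.v rfl
      obtain ⟨hfull, hmin⟩ := isListing_getD_mem hM (d := (∅, ∅)) hj
      obtain ⟨i₀, hi₀, hS⟩ : ∃ i < D.length, D.getD i ∅ = (M.getD j (∅, ∅)).1 :=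
        isListing_exists_getD hD hfull.1
      have hin := mul_add_self_le (n := n) hi₀
      rw [initEntryCmd, run_seq, run_seq]
      have hq := run_walkCmd hE.par_n (by omega) hcnt (by rw [fa]; exact htr) hi₀
        (by omega) (e := .ld .inp (.par .pM + (#.jo + #.jo) + #.v)) (fun v hv τ' h1 h2 h3 h4 => by
          have hjo : τ'.r .jo = j * n :=
            (h1 .jo (by decide) (by decide) (by decide) (by decide)).trans hy
          rw [hS, ← (hI.blockS j hj).eq_bit hv]
          simp [h2, fa, hjo, h3])
      have hF1 := (walkCmd (.ld .inp (.par .pM + (#.jo + #.jo) + #.v))).frame E τ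
      generalize (walkCmd (.ld .inp (.par .pM + (#.jo + #.jo) + #.v))).run E τ = τ₁ at hq hF1 ⊢
      have ga : τ₁.a = σ₁.a := (funext fun k => hF1.a rfl : τ₁.a = τ.a).trans fa
      have gv : τ₁.v = τ.v := funext fun k => hF1.v rfl
      have g1 : τ₁.r .jo = j * n := (hF1.r rfl).trans hy
      obtain ⟨w, hwC, hw⟩ := run_someCmd (σ := τ₁) hE.par_n (by omega)
        (t := .eq (.ld .inp (.par .pM + (#.jo + #.jo) + .par .n + #.v)) 1)
        (Q := fun v => v ∈ (M.getD j (∅, ∅)).2) (fun v τ' h1 h2 h3 h4 => by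
          have hjo : τ'.r .jo = j * n := (h1 .jo (by decide) (by decide) (by decide)).trans g1
          rw [← (hI.blockC j hj).eq_one_iff]
          simp [h2, ga, hjo, h3, hE.par_n]) hfull.2.1.nonempty
      have hF2 := (someCmd (.eq (.ld .inp (.par .pM + (#.jo + #.jo) + .par .n + #.v)) 1)).frame E τ₁
      generalize (someCmd (.eq (.ld .inp (.par .pM + (#.jo + #.jo) + .par .n + #.v)) 1)).run E τ₁ =
        τ₂ at hw hF2 ⊢
      have ka : τ₂.a = σ₁.a := (funext fun k => hF2.a rfl : τ₂.a = τ₁.a).trans ga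
      have kv : τ₂.v = τ.v := (funext fun k => hF2.v rfl : τ₂.v = τ₁.v).trans gv
      have k1 : τ₂.r .q = i₀ * n := (hF2.r rfl).trans hq
      have k2 : τ₂.r .j = j := (hF2.r rfl).trans ((hF1.r rfl).trans hx)
      obtain ⟨r₀, hidx, hlab, hblk⟩ := exists_isIdx_of_mem hT hi₀ (hS ▸ hfull.2) hwC
      have hblk' : blk G D i₀ r₀ = M.getD j (∅, ∅) := by rw [hblk, hS]
      have hr₀ := r₀.2
      rw [run_vcopy (a := i₀ * n + r₀) (b := P.length + j) (by simp [k1, hw, ka, hlab])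
        (by simp [k2, hE.par_nP]) (by omega), setV_self, kv, fv, hV.block j hj]
      intro i r hir
      have hex : (∃ l < j + 1, M.getD l (∅, ∅) = blk G D i r) ↔
          (∃ l < j, M.getD l (∅, ∅) = blk G D i r) ∨ M.getD j (∅, ∅) = blk G D i r := by
        constructor
        · rintro ⟨l, hl, h'⟩
          rcases Nat.lt_succ_iff_lt_or_eq.1 hl with hl | rfl
          · exact Or.inl ⟨l, hl, h'⟩
          · exact Or.inr h'
        · rintro (⟨l, hl, h⟩ | h)
          · exact ⟨l, by omega, h⟩
          · exact ⟨j, by omega, h⟩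
      rw [hex]
      by_cases he : M.getD j (∅, ∅) = blk G D i r
      · obtain ⟨rfl, rfl⟩ := hidx.inj hT hD hir (hblk'.trans he)
        rw [Function.update_self, he]
        exact ⟨fun _ => rfl, fun h => absurd (Or.inr rfl) h⟩
      · rw [Function.update_of_ne]
        · rw [or_iff_left he]
          exact h i r hir
        · intro h'
          obtain ⟨rfl, hr⟩ := mul_add_inj r.2 r₀.2 h'
          exact he ((Fin.ext hr : r = r₀) ▸ hblk'.symm))
  rw [hE.par_nM] at h2
  intro i r hir
  have hmem : (∃ l < M.length, M.getD l (∅, ∅) = blk G D i r) ↔ blk G D i r ∈ minFullBlocks G := by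
    constructor
    · rintro ⟨l, hl, h⟩
      exact h ▸ isListing_getD_mem hM hl
    · exact fun h => isListing_exists_getD hM h
  obtain ⟨k1, k2⟩ := h2 i r hir
  unfold initVal
  split_ifs with h
  · exact k1 (hmem.2 h)
  · exact k2 (hmem.not.2 h)

/-! ### The recursion -/

/-- All entries for potential maximal cliques are correct. -/
def IsPmcTable (G : SimpleGraph (Fin n)) (D P : List (Finset (Fin n))) (a : Arr → ℕ → ℕ) : Prop :=
  ∀ o < P.length, PmcRow G D (P.getD o ∅) (o * n) (a .labD) (a .pf) (a .tS) (a .cR) (a .tR)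

/-- The entry `(o, u)` is a child of the block `(i, r)`: the component of `G - Ω` represented by
`u`, where `Ω` is number `o`, lies in the component of the block. -/
def IsChild (a : Arr → ℕ → ℕ) (n i : ℕ) (r : ℕ) (o : ℕ) (u : ℕ) : Prop :=
  a .pf (o * n + u) = 1 ∧ a .labD (i * n + u) = r

section Entries

variable (hT : IsSepTable G D a) (hD : IsListing D (minSeps G)) (hP : IsListing P (pmcs G))
  (hQ : IsPmcTable G D P a) (ho : o < P.length)

include hT hQ ho

theorem exists_child_idx (hu : a .pf (o * n + u) = 1) :
    ∃ i r, IsIdx D a i r ∧ a .tS (o * n + u) = i * n ∧ a .cR (o * n + u) = r ∧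
      blk G D i r = (nbhd G (compOf G (P.getD o ∅) u), compOf G (P.getD o ∅) u) := by
  obtain ⟨h1, i, hi, h2, h3, h4, -⟩ := (hQ o ho).entry u hu
  obtain ⟨r, h5, h6, h7⟩ := exists_isIdx_of_mem (a := a) (w := u) hT hi
    (h2 ▸ (isComp_compOf h1).isFullComp_nbhd) self_mem_compOf
  exact ⟨i, r, h5, h3, h4.trans h6, h7.trans (by rw [h2])⟩

include hP in
theorem exists_target_idx (hr : a .pf (o * n + r) = 1) :
    ∃ i s, IsIdx D a i s ∧ a .tS (o * n + r) = i * n ∧ a .tR (o * n + r) = s ∧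
      (blk G D i s).1 ⊂ P.getD o ∅ ∧ P.getD o ∅ ⊆ (blk G D i s).1 ∪ (blk G D i s).2 := by
  obtain ⟨h1, i, hi, h2, h3, -, w, hw, hwN, h4⟩ := (hQ o ho).entry r hr
  have hΩ : IsPMC G (P.getD o ∅) := isListing_getD_mem hP ho
  have hc := isComp_compOf (G := G) h1
  obtain ⟨h5, h6⟩ := hΩ.isFullComp_compOf hc hw hwN
  obtain ⟨s, h7, h8, h9⟩ := exists_isIdx_of_mem (a := a) (w := w) hT hi (h2 ▸ h5) self_mem_compOf
  refine ⟨i, s, h7, h3, h4.trans h8, ?_, ?_⟩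
  · rw [h9, h2]
    exact hΩ.nbhd_ssubset hc
  · rw [h9, h2]
    exact h6

include hD in
theorem exists_entry_of_subset (hi : IsIdx D a i s) (h1 : (blk G D i s).1 ⊂ P.getD o ∅)
    (h2 : P.getD o ∅ ⊆ (blk G D i s).1 ∪ (blk G D i s).2) :
    ∃ r : Fin n, a .pf (o * n + r) = 1 ∧ a .tS (o * n + r) = i * n ∧ a .tR (o * n + r) = s := by
  obtain ⟨K, hK, hKS⟩ := exists_isComp_nbhd_eq (S := (blk G D i s).1) (C := (blk G D i s).2)
    (hi.mem_fullBlocks hT hD) h2 h1.1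
  obtain ⟨r, hr, rfl⟩ := (hQ o ho).exists_rep K hK
  obtain ⟨-, i', hi', h3, h4, -, w, hw, hwN, h5⟩ := (hQ o ho).entry r hr
  obtain rfl : i' = i := isListing_getD_inj hD hi' hi.1 (h3.trans hKS)
  refine ⟨r, hr, h4, h5.trans ((hi.labD_eq_iff hT).2 ?_)⟩
  rcases Finset.mem_union.1 (h2 hw) with h | h
  · exact absurd (hKS ▸ h) hwN
  · exact h

theorem isChild_iff (hi : IsIdx D a i s) (h1 : (blk G D i s).1 ⊂ P.getD o ∅)
    (h2 : P.getD o ∅ ⊆ (blk G D i s).1 ∪ (blk G D i s).2) (hu : a .pf (o * n + u) = 1) :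
    IsChild a n i s o u ↔ nbhd G (compOf G (P.getD o ∅) u) ∪ compOf G (P.getD o ∅) u ⊆
      (blk G D i s).1 ∪ (blk G D i s).2 := by
  have hc := isComp_compOf (G := G) ((hQ o ho).entry u hu).notMem
  rw [hc.nbhd_union_subset_iff (hi.isComp hT) h2 h1.1 self_mem_compOf, ← hi.labD_eq_iff hT]
  exact and_iff_right hu

include hP in
/-- The candidate, as a maximum over the entries of `Ω`. -/
theorem candidate_eq (hi : IsIdx D a i s) (h1 : (blk G D i s).1 ⊂ P.getD o ∅)
    (h2 : P.getD o ∅ ⊆ (blk G D i s).1 ∪ (blk G D i s).2)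
    (W : Finset (Fin n) × Finset (Fin n) → ℝ≥0∞) :
    candidate G f W (blk G D i s) (P.getD o ∅) = max (f (P.getD o ∅) : ℝ≥0∞)
      (⨆ (u : Fin n) (_ : IsChild a n i s o u),
        W (nbhd G (compOf G (P.getD o ∅) u), compOf G (P.getD o ∅) u)) := by
  have hΩ : IsPMC G (P.getD o ∅) := isListing_getD_mem hP ho
  unfold candidate
  congr 1
  refine le_antisymm (iSup₂_le fun C hC => ?_) (iSup₂_le fun u hu => ?_)
  · obtain ⟨u, hu, rfl⟩ := (hQ o ho).exists_rep C hC.1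
    exact le_iSup₂_of_le (f := fun (u : Fin n) (_ : IsChild a n i s o u) =>
      W (nbhd G (compOf G (P.getD o ∅) u), compOf G (P.getD o ∅) u)) u
      ((isChild_iff hT hQ ho hi h1 h2 hu).2 hC.2.2) le_rfl
  · have hc := isComp_compOf (G := G) ((hQ o ho).entry u hu.1).notMem
    exact le_iSup₂_of_le (f := fun (C : Finset (Fin n)) (_ : IsComp G (P.getD o ∅) C ∧
      (nbhd G C, C) ∈ fullBlocks G ∧ nbhd G C ∪ C ⊆ (blk G D i s).1 ∪ (blk G D i s).2) =>
      W (nbhd G C, C)) _ ⟨hc, hΩ.mem_fullBlocks hc, (isChild_iff hT hQ ho hi h1 h2 hu.1).1 hu⟩ le_rfl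

end Entries

theorem iSup_lt_succ (Q : Fin n → Prop) (g : Fin n → ℝ≥0∞) (v : Fin n) :
    (⨆ (u : Fin n) (_ : u.val < v.val + 1 ∧ Q u), g u) =
      max (⨆ (u : Fin n) (_ : u.val < v.val ∧ Q u), g u) (⨆ (_ : Q v), g v) := by
  refine le_antisymm (iSup₂_le fun u hu => ?_) (max_le (iSup₂_le fun u hu => ?_)
    (iSup_le fun hv => ?_))
  · rcases Nat.lt_succ_iff_lt_or_eq.1 hu.1 with h | h
    · exact le_max_of_le_left (le_iSup₂_of_le (f := fun (u : Fin n) (_ : u.val < v.val ∧ Q u) => g u)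
        u ⟨h, hu.2⟩ le_rfl)
    · obtain rfl := Fin.ext h
      exact le_max_of_le_right (le_iSup_of_le hu.2 le_rfl)
  · exact le_iSup₂_of_le (f := fun (u : Fin n) (_ : u.val < v.val + 1 ∧ Q u) => g u)
      u ⟨by omega, hu.2⟩ le_rfl
  · exact le_iSup₂_of_le (f := fun (u : Fin n) (_ : u.val < v.val + 1 ∧ Q u) => g u)
      v ⟨by omega, hv⟩ le_rfl

/-- Computes the candidate of the entry `(o, r)` for the block on the other side. -/
def candidateCmd : HCmd :=
  .vcopy .tmp 0 .inp #.o ⨾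
  .loop .u .uo .n
    (.ite (.and (.eq (.ld .pf (#.oo + #.u)) 1)
        (.eq (.ld .labD (.ld .tS (#.oo + #.r) + #.u)) (.ld .tR (#.oo + #.r))))
      (.ite (.vle .tmp 0 .tab (.ld .tS (#.oo + #.u) + .ld .cR (#.oo + #.u)))
        (.vcopy .tmp 0 .tab (.ld .tS (#.oo + #.u) + .ld .cR (#.oo + #.u))) .skip)
      .skip)

theorem run_candidateCmd (hE : E.Suits n D P M) (hP : IsListing P (pmcs G))
    (hV : IsInputVal f P M (σ.v .inp)) (hT : IsSepTable G D σ.a) (hQ : IsPmcTable G D P σ.a)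
    (ho : o < P.length) (hi : IsIdx D σ.a i s) (h1 : (blk G D i s).1 ⊂ P.getD o ∅)
    (h2 : P.getD o ∅ ⊆ (blk G D i s).1 ∪ (blk G D i s).2)
    {W : Finset (Fin n) × Finset (Fin n) → ℝ≥0∞}
    (hW : ∀ j r, IsIdx D σ.a j r → ((blk G D j r).1 ∪ (blk G D j r).2).card <
      ((blk G D i s).1 ∪ (blk G D i s).2).card → σ.v .tab (j * n + r) = W (blk G D j r))
    (r1 : σ.r .o = o) (r2 : σ.r .oo = o * n) {r : ℕ} (r3 : σ.r .r = r)
    (r4 : σ.a .tS (o * n + r) = i * n) (r5 : σ.a .tR (o * n + r) = s) :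
    (candidateCmd.run E σ).v .tmp 0 = candidate G f W (blk G D i s) (P.getD o ∅) := by
  have hb := hE.bound_n
  have hΩ : IsPMC G (P.getD o ∅) := isListing_getD_mem hP ho
  rw [candidate_eq hT hP hQ ho hi h1 h2, candidateCmd, run_seq,
    run_vcopy (a := 0) (b := o) rfl (by simp [r1]) (by omega), hV.pmc o ho]
  have h := HCmd.loop_rule (σ := σ.setV .tmp 0 (f (P.getD o ∅))) (x := .u) (y := .uo)
    (m := .n) (p := .ite (.and (.eq (.ld .pf (#.oo + #.u)) 1)
        (.eq (.ld .labD (.ld .tS (#.oo + #.r) + #.u)) (.ld .tR (#.oo + #.r))))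
      (.ite (.vle .tmp 0 .tab (.ld .tS (#.oo + #.u) + .ld .cR (#.oo + #.u)))
        (.vcopy .tmp 0 .tab (.ld .tS (#.oo + #.u) + .ld .cR (#.oo + #.u))) .skip)
      .skip) rfl
    (fun l τ => τ.v .tmp 0 = max (f (P.getD o ∅) : ℝ≥0∞)
      (⨆ (u : Fin n) (_ : u.val < l ∧ IsChild σ.a n i s o u),
        W (nbhd G (compOf G (P.getD o ∅) u), compOf G (P.getD o ∅) u)))
    (fun _ _ _ _ h => h) (by simp) (by
      intro l hl τ hF hx hy h
      rw [hE.par_n] at hl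
      obtain ⟨u, rfl⟩ : ∃ u : Fin n, u.val = l := ⟨⟨l, hl⟩, rfl⟩
      have fa : τ.a = σ.a := funext fun k => hF.a rfl
      have f1 : τ.r .oo = o * n := (hF.r rfl).trans r2
      have f2 : τ.r .r = r := (hF.r rfl).trans r3
      have f3 : τ.v .tab = σ.v .tab := hF.v rfl
      rw [iSup_lt_succ, ← max_assoc, ← h]
      by_cases hu : IsChild σ.a n i s o u
      · rw [run_ite_pos (by simpa [fa, f1, f2, hx, r4, r5, IsChild] using hu)]
        obtain ⟨j, t, k1, k2, k3, k4⟩ := exists_child_idx hT hQ ho hu.1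
        have hval : σ.v .tab (j * n + t) =
            W (nbhd G (compOf G (P.getD o ∅) u), compOf G (P.getD o ∅) u) := by
          rw [hW j t k1, k4]
          rw [k4]
          exact hΩ.card_lt (isComp_compOf ((hQ o ho).entry u hu.1).notMem) h2
            ((isChild_iff hT hQ ho hi h1 h2 hu.1).1 hu)
        rw [iSup_pos hu, ← hval]
        have hev : (HExpr.ld .tS (#.oo + #.u) + HExpr.ld .cR (#.oo + #.u)).eval E τ = j * n + t := by
          simp [fa, f1, hx, k2, k3]
        by_cases hle : τ.v .tmp 0 ≤ σ.v .tab (j * n + t)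
        · rw [run_ite_pos (by rw [holds_vle, hev, f3]; exact hle),
            run_vcopy (a := 0) (b := j * n + t) rfl hev (by omega), setV_self, Function.update_self,
            f3, max_eq_right hle]
        · rw [run_ite_neg (by rw [holds_vle, hev, f3]; exact hle), run_skip,
            max_eq_left (le_of_not_ge hle)]
      · rw [run_ite_neg (by simpa [fa, f1, f2, hx, r4, r5, IsChild] using hu), run_skip, iSup_neg hu]
        exact (max_eq_left bot_le).symm)
  rw [hE.par_n] at h
  rw [h]
  congr 1
  exact iSup_congr fun u => by simp

variable {a' : Arr → ℕ → ℕ} {t : ℕ}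

/-- The arrays `a` and `a'` agree on the tables of separators and of potential maximal cliques. -/
structure SameTables (a a' : Arr → ℕ → ℕ) : Prop where
  labD : a' .labD = a .labD
  flag : a' .flag = a .flag
  size : a' .size = a .size
  mins : a' .mins = a .mins
  pf : a' .pf = a .pf
  tS : a' .tS = a .tS
  tR : a' .tR = a .tR
  cR : a' .cR = a .cR

theorem SameTables.isSepTable (h : SameTables a a') (hT : IsSepTable G D a) : IsSepTable G D a' :=
  fun i hi => by
    rw [h.labD, h.flag, h.size, h.mins]
    exact hT i hi

theorem SameTables.isPmcTable (h : SameTables a a') (hQ : IsPmcTable G D P a) :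
    IsPmcTable G D P a' := fun o ho => by
  rw [h.labD, h.pf, h.tS, h.cR, h.tR]
  exact hQ o ho

theorem SameTables.isIdx_iff (h : SameTables a a') : IsIdx D a' i r ↔ IsIdx D a i r := by
  unfold IsIdx
  rw [h.flag]

/-- Improves the entry of the block on the other side of the entry `(o, r)`, if that block has size
`s + 1`. -/
def dpEntryCmd : HCmd :=
  .ite (.and (.eq (.ld .pf (#.oo + #.r)) 1)
      (.eq (.ld .size (.ld .tS (#.oo + #.r) + .ld .tR (#.oo + #.r))) (#.s + 1)))
    (candidateCmd ⨾
      .ite (.vle .tab (.ld .tS (#.oo + #.r) + .ld .tR (#.oo + #.r)) .tmp 0) .skip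
        (.vcopy .tab (.ld .tS (#.oo + #.r) + .ld .tR (#.oo + #.r)) .tmp 0 ⨾
          .store .choice (.ld .tS (#.oo + #.r) + .ld .tR (#.oo + #.r)) (#.oo + 1)))
    .skip

/-- Treats the blocks of size `s + 1`, for `s = 0, …, n - 1`. Each pass reads final values only, as
the blocks in a candidate are smaller. -/
def dpCmd : HCmd :=
  .loop .s .so .n (.loop .o .oo .nP (.loop .r .ro .n dpEntryCmd))

/-- The value of the block `(i, s)` is the initial value or the candidate for the potential maximal
clique that the array `choice` names. -/
def IsAttained (G : SimpleGraph (Fin n)) (f : Finset (Fin n) → ℝ≥0) (D P : List (Finset (Fin n)))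
    (W : Finset (Fin n) × Finset (Fin n) → ℝ≥0∞) (tab : ℕ → ℝ≥0∞) (choice : ℕ → ℕ) (i : ℕ)
    (s : Fin n) : Prop :=
  (choice (i * n + s) = 0 ∧ tab (i * n + s) = initVal G f (blk G D i s)) ∨
    ∃ o < P.length, choice (i * n + s) = o * n + 1 ∧ (blk G D i s).1 ⊂ P.getD o ∅ ∧
      P.getD o ∅ ⊆ (blk G D i s).1 ∪ (blk G D i s).2 ∧
      tab (i * n + s) = candidate G f W (blk G D i s) (P.getD o ∅)

/-- The invariant of the dynamic program: the blocks of size at most `t` have their final values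
in `W`; for those of size `t + 1`, the entries in `done` have been taken into account. -/
structure DPInv (G : SimpleGraph (Fin n)) (f : Finset (Fin n) → ℝ≥0) (D P : List (Finset (Fin n)))
    (W : Finset (Fin n) × Finset (Fin n) → ℝ≥0∞) (a : Arr → ℕ → ℕ) (t : ℕ) (done : ℕ → ℕ → Prop)
    (tab : ℕ → ℝ≥0∞) (choice : ℕ → ℕ) : Prop where
  final : ∀ i s, IsIdx D a i s → a .size (i * n + s) ≤ t → tab (i * n + s) = W (blk G D i s)
  le_init : ∀ i s, IsIdx D a i s → tab (i * n + s) ≤ initVal G f (blk G D i s)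
  le_cand : ∀ i s, IsIdx D a i s → a .size (i * n + s) = t + 1 → ∀ o < P.length, ∀ r : Fin n,
    done o r → a .pf (o * n + r) = 1 → a .tS (o * n + r) = i * n → a .tR (o * n + r) = s →
    tab (i * n + s) ≤ candidate G f W (blk G D i s) (P.getD o ∅)
  attained : ∀ i s, IsIdx D a i s → IsAttained G f D P W tab choice i s

theorem DPInv.mono {W : Finset (Fin n) × Finset (Fin n) → ℝ≥0∞} {done done' : ℕ → ℕ → Prop}
    {tab : ℕ → ℝ≥0∞} {choice : ℕ → ℕ} (h : DPInv G f D P W a t done tab choice)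
    (hd : ∀ o < P.length, ∀ r : Fin n, done' o r → done o r) :
    DPInv G f D P W a t done' tab choice :=
  ⟨h.final, h.le_init, fun i s hi hs o ho r hr => h.le_cand i s hi hs o ho r (hd o ho r hr),
    h.attained⟩

/-- When all entries have been taken into account, the values of the blocks of size `t + 1` are
final. -/
theorem DPInv.succ {W : Finset (Fin n) × Finset (Fin n) → ℝ≥0∞} {done : ℕ → ℕ → Prop}
    {tab : ℕ → ℝ≥0∞} {choice : ℕ → ℕ} (h : DPInv G f D P W a t done tab choice)
    (hW : IsTable G f W) (hD : IsListing D (minSeps G)) (hP : IsListing P (pmcs G))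
    (hT : IsSepTable G D a) (hQ : IsPmcTable G D P a)
    (hd : ∀ o < P.length, ∀ r : Fin n, done o r) :
    DPInv G f D P W a (t + 1) (fun _ _ => False) tab choice := by
  refine ⟨fun i s hi hs => ?_, h.le_init, fun _ _ _ _ _ _ _ h => h.elim, h.attained⟩
  rcases Nat.lt_succ_iff_lt_or_eq.1 (Nat.lt_succ_iff.2 hs) with hs | hs
  · exact h.final i s hi (by omega)
  have hb := hi.mem_fullBlocks hT hD
  refine le_antisymm ?_ ?_
  · rcases hW.attained _ hb with he | ⟨Ω, hΩ, h1, h2, he⟩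
    · rw [he]
      exact h.le_init i s hi
    · obtain ⟨o, ho, rfl⟩ := isListing_exists_getD hP (d := ∅) hΩ
      obtain ⟨r, k1, k2, k3⟩ := exists_entry_of_subset hT hD hQ ho hi h1 h2
      rw [he]
      exact h.le_cand i s hi hs o ho r (hd o ho r) k1 k2 k3
  · rcases h.attained i s hi with ⟨-, he⟩ | ⟨o, ho, -, h1, h2, he⟩
    · rw [he]
      exact hW.le_init _ hb
    · rw [he]
      exact hW.le_candidate _ hb _ (isListing_getD_mem hP ho) h1 h2

theorem run_dpEntryCmd (hE : E.Suits n D P M) (hP : IsListing P (pmcs G))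
    (hV : IsInputVal f P M (σ.v .inp)) (hT : IsSepTable G D a) (hQ : IsPmcTable G D P a)
    (hs : SameTables a σ.a) (ho : o < P.length) {W : Finset (Fin n) × Finset (Fin n) → ℝ≥0∞}
    {done done' : ℕ → ℕ → Prop} (h : DPInv G f D P W a t done (σ.v .tab) (σ.a .choice))
    (r1 : σ.r .o = o) (r2 : σ.r .oo = o * n) (r3 : σ.r .r = r) (r4 : σ.r .s = t)
    (hd : ∀ o' < P.length, ∀ r' : Fin n, done' o' r' → done o' r' ∨ o' = o ∧ r' = r) :
    DPInv G f D P W a t done' ((dpEntryCmd.run E σ).v .tab) ((dpEntryCmd.run E σ).a .choice) := by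
  have hb := hE.bound_n
  have hbD := hE.bound_D
  have hbP := hE.bound_P
  have hev : (HTest.and (.eq (.ld .pf (#.oo + #.r)) 1)
      (.eq (.ld .size (.ld .tS (#.oo + #.r) + .ld .tR (#.oo + #.r))) (#.s + 1))).Holds E σ ↔
      a .pf (o * n + r) = 1 ∧ a .size (a .tS (o * n + r) + a .tR (o * n + r)) = t + 1 := by
    simp [hs.pf, hs.size, hs.tS, hs.tR, r2, r3, r4]
  by_cases hc : a .pf (o * n + r) = 1 ∧ a .size (a .tS (o * n + r) + a .tR (o * n + r)) = t + 1
  swap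
  · rw [dpEntryCmd, run_ite_neg (hev.not.2 hc), run_skip]
    refine ⟨h.final, h.le_init, fun i s hi hsz o' ho' r' hdo hpf htS htR => ?_, h.attained⟩
    rcases hd o' ho' r' hdo with hd | ⟨rfl, rfl⟩
    · exact h.le_cand i s hi hsz o' ho' r' hd hpf htS htR
    · exact absurd ⟨hpf, by rw [htS, htR, hsz]⟩ hc
  obtain ⟨hpf, hsz⟩ := hc
  obtain ⟨i, s, hi, htS, htR, h1, h2⟩ := exists_target_idx hT hP hQ ho hpf
  rw [htS, htR] at hsz
  rw [dpEntryCmd, run_ite_pos (hev.2 ⟨hpf, by rw [htS, htR, hsz]⟩), run_seq]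
  have hcand := run_candidateCmd (W := W) hE hP hV (hs.isSepTable hT)
    (hs.isPmcTable hQ) ho (hs.isIdx_iff.2 hi) h1 h2 (fun j r' hj hlt => by
      have hj' := hs.isIdx_iff.1 hj
      refine h.final j r' hj' ?_
      rw [hj'.size_eq hT]
      rw [hi.size_eq hT] at hsz
      omega) r1 r2 r3 (by rw [hs.tS, htS]) (by rw [hs.tR, htR])
  have hF := candidateCmd.frame E σ
  generalize candidateCmd.run E σ = τ at hcand hF ⊢
  have fa : τ.a = σ.a := funext fun k => hF.a rfl
  have f1 : τ.r .oo = o * n := (hF.r rfl).trans r2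
  have f2 : τ.r .r = r := (hF.r rfl).trans r3
  have f3 : τ.v .tab = σ.v .tab := hF.v rfl
  have hk : (HExpr.ld .tS (#.oo + #.r) + HExpr.ld .tR (#.oo + #.r)).eval E τ = i * n + s := by
    simp [fa, f1, f2, hs.tS, hs.tR, htS, htR]
  have hlt : i * n + s < D.length * n := mul_add_lt hi.1 s.2 le_rfl
  have hon : o * n < P.length * n := by simpa using mul_add_lt ho hE.n_pos le_rfl
  -- The entry `(o, r)` concerns the block `(i, s)` only.
  have huniq : ∀ i' s', IsIdx D a i' s' → a .tS (o * n + r) = i' * n → a .tR (o * n + r) = s' →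
      i' = i ∧ s' = s := fun i' s' _ e1 e2 =>
    ⟨Nat.eq_of_mul_eq_mul_right hE.n_pos (e1.symm.trans htS), Fin.ext (e2.symm.trans htR)⟩
  by_cases hle : σ.v .tab (i * n + s) ≤ candidate G f W (blk G D i s) (P.getD o ∅)
  · rw [run_ite_pos (by rw [holds_vle, hk, f3, eval_zero, hcand]; exact hle), run_skip, f3, fa]
    refine ⟨h.final, h.le_init, fun i' s' hi' hsz' o' ho' r' hdo hpf' htS' htR' => ?_, h.attained⟩
    rcases hd o' ho' r' hdo with hd | ⟨rfl, rfl⟩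
    · exact h.le_cand i' s' hi' hsz' o' ho' r' hd hpf' htS' htR'
    · obtain ⟨rfl, rfl⟩ := huniq i' s' hi' htS' htR'
      exact hle
  · rw [run_ite_neg (by rw [holds_vle, hk, f3, eval_zero, hcand]; exact hle), run_seq,
      run_vcopy (σ := τ) (a := i * n + s) (b := 0) hk rfl (by omega),
      run_store (a := i * n + s) (b := o * n + 1) (by exact hk) (by simp [f1]) (by omega)
        (by omega)]
    simp only [setA_v, setV_self, setA_self, setV_a, f3, fa, hcand]
    have hne : ∀ i' s', ¬ (i' = i ∧ s' = s) → i' * n + s'.val ≠ i * n + s.val := fun i' s' hn he =>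
      hn ⟨(mul_add_inj s'.2 s.2 he).1, Fin.ext (mul_add_inj s'.2 s.2 he).2⟩
    refine ⟨fun i' s' hi' hsz' => ?_, fun i' s' hi' => ?_,
      fun i' s' hi' hsz' o' ho' r' hdo hpf' htS' htR' => ?_, fun i' s' hi' => ?_⟩
    · rw [Function.update_of_ne]
      · exact h.final i' s' hi' hsz'
      · refine hne _ _ ?_
        rintro ⟨rfl, rfl⟩
        omega
    · by_cases he : i' = i ∧ s' = s
      · obtain ⟨rfl, rfl⟩ := he
        rw [Function.update_self]
        exact (le_of_not_ge hle).trans (h.le_init i' s' hi')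
      · rw [Function.update_of_ne (hne _ _ he)]
        exact h.le_init i' s' hi'
    · by_cases he : i' = i ∧ s' = s
      · obtain ⟨rfl, rfl⟩ := he
        rw [Function.update_self]
        rcases hd o' ho' r' hdo with hd | ⟨rfl, rfl⟩
        · exact (le_of_not_ge hle).trans (h.le_cand i' s' hi' hsz' o' ho' r' hd hpf' htS' htR')
        · exact le_rfl
      · rw [Function.update_of_ne (hne _ _ he)]
        rcases hd o' ho' r' hdo with hd | ⟨rfl, rfl⟩
        · exact h.le_cand i' s' hi' hsz' o' ho' r' hd hpf' htS' htR'
        · exact absurd (huniq i' s' hi' htS' htR') he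
    · by_cases he : i' = i ∧ s' = s
      · obtain ⟨rfl, rfl⟩ := he
        exact Or.inr ⟨o, ho, Function.update_self .., h1, h2, Function.update_self ..⟩
      · unfold IsAttained
        rw [Function.update_of_ne (hne _ _ he), Function.update_of_ne (hne _ _ he)]
        exact h.attained i' s' hi'

theorem run_dpCmd (hE : E.Suits n D P M) (hD : IsListing D (minSeps G))
    (hP : IsListing P (pmcs G)) (hV : IsInputVal f P M (σ.v .inp)) (hT : IsSepTable G D σ.a)
    (hQ : IsPmcTable G D P σ.a) {W : Finset (Fin n) × Finset (Fin n) → ℝ≥0∞}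
    (hW : IsTable G f W)
    (hinit : ∀ i r, IsIdx D σ.a i r → σ.v .tab (i * n + r) = initVal G f (blk G D i r))
    (hch : ∀ k, σ.a .choice k = 0) :
    ∀ i r, IsIdx D σ.a i r → (dpCmd.run E σ).v .tab (i * n + r) = W (blk G D i r) ∧
      IsAttained G f D P W ((dpCmd.run E σ).v .tab) ((dpCmd.run E σ).a .choice) i r := by
  have hsame : ∀ {p : HCmd} {τ : HState}, Frame p σ τ → p.modA .labD = false →
      p.modA .flag = false → p.modA .size = false → p.modA .mins = false → p.modA .pf = false →
      p.modA .tS = false → p.modA .tR = false → p.modA .cR = false → SameTables σ.a τ.a :=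
    fun hF h1 h2 h3 h4 h5 h6 h7 h8 =>
      ⟨hF.a h1, hF.a h2, hF.a h3, hF.a h4, hF.a h5, hF.a h6, hF.a h7, hF.a h8⟩
  have h := HCmd.loop_rule (x := .s) (y := .so) (m := .n)
    (p := .loop .o .oo .nP (.loop .r .ro .n dpEntryCmd)) rfl
    (fun t τ => DPInv G f D P W σ.a t (fun _ _ => False) (τ.v .tab) (τ.a .choice))
    (fun _ _ _ _ h => h)
    ⟨fun i s hi hs => by
        rw [hi.size_eq hT, Nat.le_zero, Finset.card_eq_zero, Finset.union_eq_empty] at hs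
        exact absurd hs.2 (hi.isComp hT).nonempty.ne_empty,
      fun i s hi => (hinit i s hi).le, fun _ _ _ _ _ _ _ h => h.elim,
      fun i s hi => Or.inl ⟨hch _, hinit i s hi⟩⟩ (by
      intro t ht τ hF hx hy h
      have hV1 : IsInputVal f P M (τ.v .inp) := by rw [hF.v rfl]; exact hV
      have hS1 : SameTables σ.a τ.a := hsame hF rfl rfl rfl rfl rfl rfl rfl rfl
      have h2 := HCmd.loop_rule (σ := τ) (x := .o) (y := .oo) (m := .nP)
        (p := .loop .r .ro .n dpEntryCmd) rfl
        (fun o τ' => DPInv G f D P W σ.a t (fun o' _ => o' < o) (τ'.v .tab) (τ'.a .choice))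
        (fun _ _ _ _ h => h) (h.mono fun _ _ _ h => absurd h (Nat.not_lt_zero _)) (by
          intro o ho τ₁ hF1 hx1 hy1 h1
          rw [hE.par_nP] at ho
          rw [hE.par_n] at hy1
          have hV2 : IsInputVal f P M (τ₁.v .inp) := by rw [hF1.v rfl]; exact hV1
          have hS2 : SameTables σ.a τ₁.a :=
            ⟨(hF1.a rfl).trans hS1.1, (hF1.a rfl).trans hS1.2, (hF1.a rfl).trans hS1.3,
              (hF1.a rfl).trans hS1.4, (hF1.a rfl).trans hS1.5, (hF1.a rfl).trans hS1.6,
              (hF1.a rfl).trans hS1.7, (hF1.a rfl).trans hS1.8⟩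
          have hs1 : τ₁.r .s = t := (hF1.r rfl).trans hx
          have h3 := HCmd.loop_rule (σ := τ₁) (x := .r) (y := .ro) (m := .n)
            (p := dpEntryCmd) rfl
            (fun r τ' => DPInv G f D P W σ.a t (fun o' r' => o' < o ∨ o' = o ∧ r' < r) (τ'.v .tab)
              (τ'.a .choice))
            (fun _ _ _ _ h => h)
            (h1.mono fun _ _ _ h => h.resolve_right fun h => absurd h.2 (Nat.not_lt_zero _)) (by
              intro r hr τ₂ hF2 hx2 hy2 h2
              rw [hE.par_n] at hr
              obtain ⟨r, rfl⟩ : ∃ r' : Fin n, r'.val = r := ⟨⟨r, hr⟩, rfl⟩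
              refine run_dpEntryCmd (σ := τ₂) (r := r) (o := o) hE hP
                (by rw [hF2.v rfl]; exact hV2) hT hQ
                ⟨(hF2.a rfl).trans hS2.1, (hF2.a rfl).trans hS2.2, (hF2.a rfl).trans hS2.3,
                  (hF2.a rfl).trans hS2.4, (hF2.a rfl).trans hS2.5, (hF2.a rfl).trans hS2.6,
                  (hF2.a rfl).trans hS2.7, (hF2.a rfl).trans hS2.8⟩ ho h2
                ((hF2.r rfl).trans hx1) ((hF2.r rfl).trans hy1) hx2 ((hF2.r rfl).trans hs1) ?_
              rintro o' ho' r' (h | ⟨rfl, h⟩)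
              · exact Or.inl (Or.inl h)
              · rcases Nat.lt_succ_iff_lt_or_eq.1 h with h | h
                · exact Or.inl (Or.inr ⟨rfl, h⟩)
                · exact Or.inr ⟨rfl, Fin.ext h⟩)
          rw [hE.par_n] at h3
          refine h3.mono fun o' _ r' h => ?_
          rcases Nat.lt_succ_iff_lt_or_eq.1 h with h | h
          · exact Or.inl h
          · exact Or.inr ⟨h, r'.2⟩)
      rw [hE.par_nP] at h2
      exact h2.succ hW hD hP hT hQ fun o ho _ => ho)
  rw [hE.par_n] at h
  intro i r hi
  refine ⟨h.final i r hi ?_, h.attained i r hi⟩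
  rw [hi.size_eq hT]
  exact card_le_n _

/-! ### The sorted list of full blocks -/

/-- Collects the full blocks by increasing size. -/
def orderCmd : HCmd :=
  .assign .nblk 0 ⨾
  .loop .s .so .n (.loop .i .io .nD (.loop .r .ro .n
    (.ite (.and (.eq (.ld .flag (#.io + #.r)) 1) (.eq (.ld .size (#.io + #.r)) (#.s + 1)))
      (.store .bI #.nblk #.io ⨾ .store .bR #.nblk #.r ⨾ .assign .nblk (#.nblk + 1)) .skip)))

/-- The arrays `bI` and `bR` hold the list `L` of indices. -/
structure HoldsList (n : ℕ) (L : List (ℕ × Fin n)) (nblk : ℕ) (bI bR : ℕ → ℕ) : Prop where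
  length_eq : nblk = L.length
  entry : ∀ k (hk : k < L.length), bI k = L[k].1 * n ∧ bR k = L[k].2

/-- `L` lists the indices of the full blocks with the property `done`, by increasing size. -/
structure IsIdxList (D : List (Finset (Fin n))) (a : Arr → ℕ → ℕ) (done : ℕ → Fin n → Prop)
    (L : List (ℕ × Fin n)) : Prop where
  nodup : L.Nodup
  mem_iff : ∀ i r, (i, r) ∈ L ↔ IsIdx D a i r ∧ done i r
  sorted : L.Pairwise fun p q => a .size (p.1 * n + p.2) ≤ a .size (q.1 * n + q.2)

theorem IsIdxList.length_le {done : ℕ → Fin n → Prop} {L : List (ℕ × Fin n)}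
    (h : IsIdxList D a done L) : L.length ≤ D.length * n := by
  have hnd : (L.map fun p => p.1 * n + p.2.val).Nodup := by
    refine h.nodup.map fun p q he => ?_
    obtain ⟨h1, h2⟩ := mul_add_inj p.2.2 q.2.2 he
    exact Prod.ext h1 (Fin.ext h2)
  have hsub : (L.map fun p => p.1 * n + p.2.val) ⊆ List.range (D.length * n) := by
    intro x hx
    obtain ⟨p, hp, rfl⟩ := List.mem_map.1 hx
    exact List.mem_range.2 (mul_add_lt ((h.mem_iff p.1 p.2).1 hp).1.1 p.2.2 le_rfl)
  simpa using (hnd.subperm hsub).length_le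

theorem IsIdxList.congr {done done' : ℕ → Fin n → Prop} {L : List (ℕ × Fin n)}
    (h : IsIdxList D a done L) (hd : ∀ i r, IsIdx D a i r → (done' i r ↔ done i r)) :
    IsIdxList D a done' L :=
  ⟨h.nodup, fun i r => (h.mem_iff i r).trans ⟨fun h => ⟨h.1, (hd i r h.1).2 h.2⟩,
    fun h => ⟨h.1, (hd i r h.1).1 h.2⟩⟩, h.sorted⟩

theorem run_orderCmd (hE : E.Suits n D P M) (hT : IsSepTable G D σ.a) :
    ∃ L, IsIdxList D σ.a (fun _ _ => True) L ∧
      HoldsList n L ((orderCmd.run E σ).r .nblk) ((orderCmd.run E σ).a .bI)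
        ((orderCmd.run E σ).a .bR) := by
  have hb := hE.bound_n
  have hbD := hE.bound_D
  -- The blocks that have been collected before round `(t, i, r)`.
  let done : ℕ → ℕ → ℕ → ℕ → Fin n → Prop := fun t i r i' r' => σ.a .size (i' * n + r') ≤ t ∨
    σ.a .size (i' * n + r') = t + 1 ∧ (i' < i ∨ i' = i ∧ r'.val < r)
  let I : ℕ → ℕ → ℕ → HState → Prop := fun t i r τ => ∃ L, IsIdxList D σ.a (done t i r) L ∧
    HoldsList n L (τ.r .nblk) (τ.a .bI) (τ.a .bR)
  have hI : ∀ {t i r t' i' r' : ℕ} {τ : HState}, I t i r τ → (∀ j s, IsIdx D σ.a j s →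
      (done t' i' r' j s ↔ done t i r j s)) → I t' i' r' τ := by
    rintro t i r t' i' r' τ ⟨L, h1, h2⟩ hd
    exact ⟨L, h1.congr hd, h2⟩
  rw [orderCmd, run_seq, run_assign (a := 0) rfl (by omega)]
  have h := HCmd.loop_rule (σ := σ.setR .nblk 0) (x := .s) (y := .so) (m := .n)
    (p := .loop .i .io .nD (.loop .r .ro .n
      (.ite (.and (.eq (.ld .flag (#.io + #.r)) 1) (.eq (.ld .size (#.io + #.r)) (#.s + 1)))
      (.store .bI #.nblk #.io ⨾ .store .bR #.nblk #.r ⨾ .assign .nblk (#.nblk + 1)) .skip))) rfl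
    (fun t τ => I t 0 0 τ) (fun _ _ _ _ h => h) (by
      refine ⟨[], ⟨List.nodup_nil, fun i r => ⟨fun h => absurd h (List.not_mem_nil), ?_⟩,
        List.Pairwise.nil⟩, by simp, fun k hk => absurd hk (Nat.not_lt_zero _)⟩
      rintro ⟨h, h1 | ⟨_, h1⟩⟩
      · rw [h.size_eq hT, Nat.le_zero, Finset.card_eq_zero, Finset.union_eq_empty] at h1
        exact absurd h1.2 (h.isComp hT).nonempty.ne_empty
      · omega) (by
      intro t ht τ hF hx hy h
      have e1 : τ.a .flag = σ.a .flag := hF.a rfl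
      have e2 : τ.a .size = σ.a .size := hF.a rfl
      have h2 := HCmd.loop_rule (σ := τ) (x := .i) (y := .io) (m := .nD)
        (p := .loop .r .ro .n
          (.ite (.and (.eq (.ld .flag (#.io + #.r)) 1) (.eq (.ld .size (#.io + #.r)) (#.s + 1)))
          (.store .bI #.nblk #.io ⨾ .store .bR #.nblk #.r ⨾ .assign .nblk (#.nblk + 1)) .skip)) rfl
        (fun i τ => I t i 0 τ) (fun _ _ _ _ h => h) h (by
          intro i hi τ₁ hF1 hx1 hy1 h1
          rw [hE.par_nD] at hi
          rw [hE.par_n] at hy1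
          have f1 : τ₁.a .flag = σ.a .flag := (hF1.a rfl).trans e1
          have f2 : τ₁.a .size = σ.a .size := (hF1.a rfl).trans e2
          have f3 : τ₁.r .s = t := (hF1.r rfl).trans hx
          have h3 := HCmd.loop_rule (σ := τ₁) (x := .r) (y := .ro) (m := .n)
            (p := .ite (.and (.eq (.ld .flag (#.io + #.r)) 1)
              (.eq (.ld .size (#.io + #.r)) (#.s + 1)))
              (.store .bI #.nblk #.io ⨾ .store .bR #.nblk #.r ⨾ .assign .nblk (#.nblk + 1)) .skip)
            rfl (fun r τ => I t i r τ) (fun _ _ _ _ h => h) h1 (by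
              intro r hr τ₂ hF2 hx2 hy2 h2
              rw [hE.par_n] at hr
              obtain ⟨r, rfl⟩ : ∃ r' : Fin n, r'.val = r := ⟨⟨r, hr⟩, rfl⟩
              have g1 : τ₂.a .flag = σ.a .flag := (hF2.a rfl).trans f1
              have g2 : τ₂.a .size = σ.a .size := (hF2.a rfl).trans f2
              have g3 : τ₂.r .s = t := (hF2.r rfl).trans f3
              have g4 : τ₂.r .io = i * n := (hF2.r rfl).trans hy1
              have hsucc : ∀ j s, done t i (r + 1) j s ↔
                  done t i r j s ∨ σ.a .size (j * n + s) = t + 1 ∧ j = i ∧ s = r := by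
                intro j s
                simp only [done, Nat.lt_succ_iff_lt_or_eq, Fin.val_inj]
                tauto
              have hev : (HTest.and (.eq (.ld .flag (#.io + #.r)) 1)
                  (.eq (.ld .size (#.io + #.r)) (#.s + 1))).Holds E τ₂ ↔
                  σ.a .flag (i * n + r) = 1 ∧ σ.a .size (i * n + r) = t + 1 := by
                simp [g1, g2, g3, g4, hx2]
              by_cases hc : σ.a .flag (i * n + r) = 1 ∧ σ.a .size (i * n + r) = t + 1
              · obtain ⟨L, l1, l2⟩ := h2
                have hnot : ¬ done t i r i r := by
                  simp only [done]
                  omega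
                have l3 : IsIdxList D σ.a (done t i (r + 1)) (L ++ [(i, r)]) := by
                  refine ⟨?_, fun j s => ?_, ?_⟩
                  · rw [List.nodup_append]
                    refine ⟨l1.nodup, List.nodup_singleton _, fun p hp q hq he => ?_⟩
                    rw [List.mem_singleton.1 hq] at he
                    exact hnot ((l1.mem_iff i r).1 (he ▸ hp)).2
                  · rw [List.mem_append, List.mem_singleton, l1.mem_iff, hsucc, Prod.mk_inj]
                    constructor
                    · rintro (⟨h1, h2⟩ | ⟨rfl, rfl⟩)
                      · exact ⟨h1, Or.inl h2⟩
                      · exact ⟨⟨hi, hc.1⟩, Or.inr ⟨hc.2, rfl, rfl⟩⟩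
                    · rintro ⟨h1, h2 | ⟨-, h2⟩⟩
                      · exact Or.inl ⟨h1, h2⟩
                      · exact Or.inr h2
                  · rw [List.pairwise_append]
                    refine ⟨l1.sorted, List.pairwise_singleton _ _, fun p hp q hq => ?_⟩
                    rw [List.mem_singleton.1 hq, hc.2]
                    have := ((l1.mem_iff p.1 p.2).1 hp).2
                    simp only [done] at this
                    omega
                have hlen := l3.length_le
                rw [List.length_append, List.length_singleton] at hlen
                have hin : i * n < D.length * n := by simpa using mul_add_lt hi hE.n_pos le_rfl
                have hk := l2.length_eq
                rw [run_ite_pos (hev.2 hc), run_seq, run_seq,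
                  run_store (σ := τ₂) (a := L.length) (b := i * n) (by simp [hk]) (by simp [g4])
                    (by omega) (by omega),
                  run_store (a := L.length) (b := r) (by simp [hk]) (by simp [hx2])
                    (by omega) (by omega),
                  run_assign (a := L.length + 1) (by simp [hk]) (by omega)]
                refine ⟨L ++ [(i, r)], l3, by simp, fun k hk' => ?_⟩
                simp only [setR_a, setA_self, ne_eq, reduceCtorEq, not_false_eq_true, setA_of_ne]
                rw [List.length_append, List.length_singleton] at hk'
                rcases Nat.lt_succ_iff_lt_or_eq.1 hk' with hk' | rfl
                · rw [List.getElem_append_left hk', Function.update_of_ne (by omega),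
                    Function.update_of_ne (by omega)]
                  exact l2.entry k hk'
                · rw [Function.update_self, Function.update_self]
                  simp
              · rw [run_ite_neg (hev.not.2 hc), run_skip]
                refine hI h2 fun j s hjs => (hsucc j s).trans (or_iff_left ?_)
                rintro ⟨h5, rfl, rfl⟩
                exact hc ⟨hjs.2, h5⟩)
          rw [hE.par_n] at h3
          refine hI h3 fun j s hjs => ?_
          have := s.2
          simp only [done]
          omega)
      rw [hE.par_nD] at h2
      refine hI h2 fun j s hjs => ?_
      have := hjs.1
      simp only [done]
      omega)
  rw [hE.par_n] at h
  obtain ⟨L, h1, h2⟩ := h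
  refine ⟨L, h1.congr fun i r hi => iff_of_true trivial (Or.inl ?_), h2⟩
  rw [hi.size_eq hT]
  exact card_le_n _

/-- The indices in order give an ordering of the full blocks. -/
theorem IsIdxList.isBlockOrder {L : List (ℕ × Fin n)} (h : IsIdxList D a (fun _ _ => True) L)
    (hD : IsListing D (minSeps G)) (hT : IsSepTable G D a) :
    IsBlockOrder G (L.map fun p => blk G D p.1 p.2) := by
  have hidx : ∀ p ∈ L, IsIdx D a p.1 p.2 := fun p hp => ((h.mem_iff p.1 p.2).1 hp).1
  refine ⟨⟨?_, fun b => ?_⟩, ?_⟩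
  · refine List.Nodup.map_on (fun p hp q hq he => ?_) h.nodup
    exact Prod.ext_iff.2 ((hidx p hp).inj hT hD (hidx q hq) he)
  · rw [List.mem_map]
    constructor
    · rintro ⟨p, hp, rfl⟩
      exact (hidx p hp).mem_fullBlocks hT hD
    · intro hb
      obtain ⟨i, r, hi, rfl⟩ := exists_isIdx hT hD hb
      exact ⟨(i, r), (h.mem_iff i r).2 ⟨hi, trivial⟩, rfl⟩
  · rw [List.pairwise_map]
    refine h.sorted.imp_of_mem fun {p q} hp hq hpq => ?_
    rwa [(hidx p hp).size_eq hT, (hidx q hq).size_eq hT] at hpq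

/-- Writes the block number `t` and its value to the output. -/
def writeCmd : HCmd :=
  .loop .v .vo .n (.store .ob (#.obEnd + #.v) (.ld .inp (.par .pD + .ld .bI #.t + #.v))) ⨾
  .loop .v .vo .n (.store .ob (#.obEnd + .par .n + #.v)
    (1 - ((.ld .labD (.ld .bI #.t + #.v) - .ld .bR #.t) +
      (.ld .bR #.t - .ld .labD (.ld .bI #.t + #.v))))) ⨾
  .vcopy .out #.t .tab (.ld .bI #.t + .ld .bR #.t) ⨾
  .assign .obEnd (#.obEnd + .par .n + .par .n) ⨾
  .assign .t (#.t + 1)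

/-- Writes all blocks. There are at most `|Δ| n` of them, and the two loops run that often. -/
def outCmd : HCmd :=
  .assign .obEnd 0 ⨾ .assign .t 0 ⨾
  .loop .i .io .nD (.loop .r .ro .n (.ite (.lt #.t #.nblk) writeCmd .skip))

/-- The first `t` blocks of the list `L` have been written. -/
structure Written (G : SimpleGraph (Fin n)) (D : List (Finset (Fin n))) (L : List (ℕ × Fin n))
    (tab : ℕ → ℝ≥0∞) (t : ℕ) (τ : HState) : Prop where
  reg_t : τ.r .t = t
  obEnd : τ.r .obEnd = 2 * t * n
  sep : ∀ k (hk : k < L.length), k < t → IsBits (blk G D L[k].1 L[k].2).1 (τ.a .ob) (2 * k * n)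
  comp : ∀ k (hk : k < L.length), k < t →
    IsBits (blk G D L[k].1 L[k].2).2 (τ.a .ob) ((2 * k + 1) * n)
  out : ∀ k (hk : k < L.length), k < t → τ.v .out k = tab (L[k].1 * n + L[k].2)

theorem run_writeCmd (hE : E.Suits n D P M) (hI : IsInput E G D P M (σ.a .inp))
    (hT : IsSepTable G D σ.a) {L : List (ℕ × Fin n)} (hL : IsIdxList D σ.a (fun _ _ => True) L)
    (hH : HoldsList n L (σ.r .nblk) (σ.a .bI) (σ.a .bR)) (ht : t < L.length)
    (h : Written G D L (σ.v .tab) t σ) : Written G D L (σ.v .tab) (t + 1) (writeCmd.run E σ) := by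
  have hb := hE.bound_n
  have hbD := hE.bound_D
  have hlen := hL.length_le
  have hidx : IsIdx D σ.a L[t].1 L[t].2 := ((hL.mem_iff L[t].1 L[t].2).1 (List.getElem_mem ht)).1
  obtain ⟨hbI, hbR⟩ := hH.entry t ht
  have ht1 := h.reg_t
  have ht2 := h.obEnd
  have hlt : L[t].1 * n + L[t].2 < D.length * n := mul_add_lt hidx.1 L[t].2.2 le_rfl
  have htn : 2 * t * n + 2 * n ≤ 2 * (n * (D.length * n)) := by
    calc 2 * t * n + 2 * n = 2 * (n * (t + 1)) := by ring
      _ ≤ 2 * (n * (D.length * n)) := Nat.mul_le_mul_left _ (Nat.mul_le_mul_left _ (by omega))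
  have htn' : (2 * t + 1) * n = 2 * t * n + n := by ring
  have htn2 : 2 * (t + 1) * n = 2 * t * n + n + n := by ring
  have hbit : ∀ v < n, σ.a .inp (E.par .pD + L[t].1 * n + v) = bit (D.getD L[t].1 ∅) v :=
    fun v hv => (hI.sep _ hidx.1).eq_bit hv
  simp only [writeCmd, run_seq]
  obtain ⟨g1, g2⟩ := run_fill (x := .v) (y := .vo) (m := .n) (k := .ob)
    (ie := #.obEnd + #.v) (e := .ld .inp (.par .pD + .ld .bI #.t + #.v)) (o := 2 * t * n)
    (g := bit (D.getD L[t].1 ∅)) rfl fun v hv τ hF hx hy => by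
      rw [hE.par_n] at hv
      have e1 : τ.r .obEnd = 2 * t * n := (hF.r rfl).trans ht2
      have e2 : τ.a .inp = σ.a .inp := hF.a rfl
      have e3 : τ.a .bI = σ.a .bI := hF.a rfl
      have e4 : τ.r .t = t := (hF.r rfl).trans ht1
      have := bit_le (D.getD L[t].1 ∅) v
      refine ⟨by simp [e1, hx], ?_, by omega, by omega⟩
      simp only [eval_ld, eval_add, eval_par, eval_reg, hx, e2, e3, e4, hbI]
      exact hbit v hv
  rw [hE.par_n] at g1 g2
  generalize hF : HCmd.run E (.loop _ _ _ _) σ = σ₁ at g1 g2 ⊢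
  replace hF := HCmd.frame_of_eq hF
  have e1 : σ₁.r .obEnd = 2 * t * n := (hF.r rfl).trans ht2
  have e2 : σ₁.a .labD = σ.a .labD := hF.a rfl
  have e3 : σ₁.a .bI = σ.a .bI := hF.a rfl
  have e4 : σ₁.a .bR = σ.a .bR := hF.a rfl
  have e5 : σ₁.r .t = t := (hF.r rfl).trans ht1
  have e6 : σ₁.v = σ.v := funext fun k => hF.v rfl
  have hcomp : ∀ v < n, 1 - ((σ.a .labD (L[t].1 * n + v) - L[t].2) +
      (L[t].2 - σ.a .labD (L[t].1 * n + v))) = bit (blk G D L[t].1 L[t].2).2 v := fun v hv => by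
    have h1 := hidx.labD_eq_iff hT (v := ⟨v, hv⟩)
    have h2 := bit_eq_one_iff (X := (blk G D L[t].1 L[t].2).2) (v := ⟨v, hv⟩)
    have h3 := bit_le (blk G D L[t].1 L[t].2).2 v
    dsimp only at h1 h2
    rw [← h1] at h2
    omega
  obtain ⟨k1, k2⟩ := run_fill (x := .v) (y := .vo) (m := .n) (k := .ob)
    (ie := #.obEnd + .par .n + #.v) (e := 1 - ((.ld .labD (.ld .bI #.t + #.v) - .ld .bR #.t) +
      (.ld .bR #.t - .ld .labD (.ld .bI #.t + #.v)))) (o := 2 * t * n + n)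
    (g := bit (blk G D L[t].1 L[t].2).2) rfl fun v hv τ hF hx hy => by
      rw [hE.par_n] at hv
      have f1 : τ.r .obEnd = 2 * t * n := (hF.r rfl).trans e1
      have f2 : τ.a .labD = σ.a .labD := (hF.a rfl).trans e2
      have f3 : τ.a .bI = σ.a .bI := (hF.a rfl).trans e3
      have f4 : τ.a .bR = σ.a .bR := (hF.a rfl).trans e4
      have f5 : τ.r .t = t := (hF.r rfl).trans e5
      have := bit_le (blk G D L[t].1 L[t].2).2 v
      refine ⟨by simp [f1, hx, hE.par_n], ?_, by omega, by omega⟩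
      rw [← hcomp v hv]
      simp [f2, f3, f4, f5, hx, hbI, hbR]
  rw [hE.par_n] at k1 k2
  generalize hF' : HCmd.run E (.loop _ _ _ _) σ₁ = σ₂ at k1 k2 ⊢
  replace hF' := HCmd.frame_of_eq hF'
  have f1 : σ₂.r .obEnd = 2 * t * n := (hF'.r rfl).trans e1
  have f3 : σ₂.a .bI = σ.a .bI := (hF'.a rfl).trans e3
  have f4 : σ₂.a .bR = σ.a .bR := (hF'.a rfl).trans e4
  have f5 : σ₂.r .t = t := (hF'.r rfl).trans e5
  have f6 : σ₂.v = σ.v := (funext fun k => hF'.v rfl : σ₂.v = σ₁.v).trans e6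
  rw [run_vcopy (σ := σ₂) (a := t) (b := L[t].1 * n + L[t].2) (by simp [f5])
      (by simp [f3, f4, f5, hbI, hbR]) (by omega),
    run_assign (σ := σ₂.setV _ _ _) (a := 2 * (t + 1) * n) (by simp [f1, hE.par_n]; omega)
      (by omega),
    run_assign (a := t + 1) (by simp [f5]) (by omega)]
  have hob1 : ∀ j < 2 * t * n, σ₂.a .ob j = σ.a .ob j := fun j hj => by
    rw [k2 j fun l _ => by omega, g2 j fun l _ => by omega]
  have hob2 : ∀ v < n, σ₂.a .ob (2 * t * n + v) = bit (D.getD L[t].1 ∅) v := fun v hv => by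
    rw [k2 _ fun l _ => by omega, g1 v hv]
  have hbits : ∀ {X : Finset (Fin n)} {o : ℕ}, (∀ v < n, σ₂.a .ob (o + v) = bit X v) →
      IsBits X (σ₂.a .ob) o := by
    intro X o hX v
    rw [hX v v.2]
    refine ⟨fun hv => bit_eq_one_iff.2 hv, fun hv => ?_⟩
    have h1 := bit_eq_one_iff.not.2 hv
    have h2 := bit_le X v
    omega
  have hkt : ∀ {k}, k < t → (2 * k + 1) * n + n ≤ 2 * t * n := fun {k} hk => by
    calc (2 * k + 1) * n + n = 2 * (k + 1) * n := by ring
      _ ≤ 2 * t * n := Nat.mul_le_mul_right _ (Nat.mul_le_mul_left _ hk)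
  have hk1 : ∀ k, (2 * k + 1) * n = 2 * k * n + n := fun k => by ring
  refine ⟨by simp, by simp, fun k hk hkt' => ?_, fun k hk hkt' => ?_, fun k hk hkt' => ?_⟩
  · simp only [setR_a, setV_a]
    rcases Nat.lt_succ_iff_lt_or_eq.1 hkt' with hkt' | rfl
    · intro v
      have := hkt hkt'
      have := hk1 k
      rw [hob1 _ (by omega)]
      exact h.sep k hk hkt' v
    · exact hbits hob2
  · simp only [setR_a, setV_a]
    rcases Nat.lt_succ_iff_lt_or_eq.1 hkt' with hkt' | rfl
    · intro v
      have := hkt hkt'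
      rw [hob1 _ (by omega)]
      exact h.comp k hk hkt' v
    · refine hbits fun v hv => ?_
      rw [htn', k1 v hv]
  · simp only [setR_v, setV_self, f6]
    rcases Nat.lt_succ_iff_lt_or_eq.1 hkt' with hkt' | rfl
    · rw [Function.update_of_ne (by omega)]
      exact h.out k hk hkt'
    · rw [Function.update_self]

theorem run_outCmd (hE : E.Suits n D P M) (hI : IsInput E G D P M (σ.a .inp))
    (hT : IsSepTable G D σ.a) {L : List (ℕ × Fin n)} (hL : IsIdxList D σ.a (fun _ _ => True) L)
    (hH : HoldsList n L (σ.r .nblk) (σ.a .bI) (σ.a .bR)) :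
    Written G D L (σ.v .tab) L.length (outCmd.run E σ) := by
  have hb := hE.bound_n
  have hlen := hL.length_le
  rw [outCmd, run_seq, run_seq, run_assign (a := 0) rfl (by omega),
    run_assign (a := 0) rfl (by omega)]
  have h := HCmd.loop_rule (σ := (σ.setR .obEnd 0).setR .t 0) (x := .i) (y := .io)
    (m := .nD) (p := .loop .r .ro .n (.ite (.lt #.t #.nblk) writeCmd .skip)) rfl
    (fun i τ => Written G D L (σ.v .tab) (min L.length (i * n)) τ)
    (fun _ _ _ _ h => ⟨h.1, h.2, h.3, h.4, h.5⟩)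
    ⟨by simp, by simp, fun _ _ h => absurd h (by simp), fun _ _ h => absurd h (by simp),
      fun _ _ h => absurd h (by simp)⟩ (by
      intro i hi τ hF hx hy h
      have h2 := HCmd.loop_rule (σ := τ) (x := .r) (y := .ro)
        (m := .n) (p := .ite (.lt #.t #.nblk) writeCmd .skip) rfl
        (fun r τ => Written G D L (σ.v .tab) (min L.length (i * n + r)) τ)
        (fun _ _ _ _ h => ⟨h.1, h.2, h.3, h.4, h.5⟩) h (by
          intro r hr τ₁ hF1 hx1 hy1 h1
          have e1 : τ₁.r .nblk = σ.r .nblk := (hF1.r rfl).trans (hF.r rfl)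
          have e2 : τ₁.v .tab = σ.v .tab := (hF1.v rfl).trans (hF.v rfl)
          have ea : ∀ k, k ≠ .ob → τ₁.a k = σ.a k := fun k hk => by
            have : HCmd.modA (.loop .i .io .nD
              (.loop .r .ro .n (.ite (.lt #.t #.nblk) writeCmd .skip))) k = false := by
              cases k <;> first | rfl | exact absurd rfl hk
            exact (hF1.a this).trans (hF.a this)
          have hS : SameTables σ.a τ₁.a := ⟨ea _ (by decide), ea _ (by decide), ea _ (by decide),
            ea _ (by decide), ea _ (by decide), ea _ (by decide), ea _ (by decide), ea _ (by decide)⟩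
          by_cases hc : i * n + r < L.length
          · rw [run_ite_pos (by simp [h1.reg_t, e1, hH.length_eq, hc])]
            rw [min_eq_right (by omega)] at h1
            rw [min_eq_right (by omega), ← add_assoc, ← e2]
            rw [← e2] at h1
            refine run_writeCmd hE (by rw [ea _ (by decide)]; exact hI) (hS.isSepTable hT)
              ⟨hL.nodup, fun i r => by rw [hS.isIdx_iff]; exact hL.mem_iff i r, ?_⟩
              (by rw [e1, ea _ (by decide), ea _ (by decide)]; exact hH) hc h1
            rw [hS.size]
            exact hL.sorted
          · rw [run_ite_neg (by simp [h1.reg_t, e1, hH.length_eq]; omega), run_skip]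
            rw [min_eq_left (by omega)] at h1 ⊢
            exact h1)
      rw [hE.par_n, ← Nat.succ_mul] at h2
      exact h2)
  rw [hE.par_nD, min_eq_left hlen] at h
  exact h

end

/-! ### Growing a tree decomposition -/

section Grow

variable {V : Type*} [Fintype V] [DecidableEq V] {G : SimpleGraph V} {f : Finset V → ℝ≥0}
  {A : Finset V × Finset V → ℝ≥0∞} {w : ℝ≥0∞} {t m m' : ℕ} {par par' : ℕ → ℕ}
  {b b' : ℕ → Finset V × Finset V} {B B' : ℕ → Finset V} {Ω : Finset V}

/-- The vertices for which node `k` is responsible when the first `t` nodes have bags: those that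
its bag adds to the separator of its block, or all of the component if the bag is missing. -/
def ownPart (t : ℕ) (b : ℕ → Finset V × Finset V) (B : ℕ → Finset V) (k : ℕ) : Finset V :=
  if k < t then B k \ (b k).1 else (b k).2

/-- A rooted tree with `m` nodes, of which the first `t` have bags. Node `k` carries the block `b k`
that the subtree below it has to decompose; the root carries `(∅, V)`. -/
structure PartialTree (G : SimpleGraph V) (f : Finset V → ℝ≥0) (A : Finset V × Finset V → ℝ≥0∞)
    (w : ℝ≥0∞) (t m : ℕ) (par : ℕ → ℕ) (b : ℕ → Finset V × Finset V) (B : ℕ → Finset V) :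
    Prop where
  le : t ≤ m
  root : (b 0).1 = ∅
  par_lt : ∀ k, 0 < k → k < m → par k < k ∧ par k < t
  subset_par : ∀ k, 0 < k → k < m → (b k).1 ⊆ B (par k)
  nbhd_subset : ∀ k < m, nbhd G (b k).2 ⊆ (b k).1
  disj : ∀ k < m, Disjoint (b k).1 (b k).2
  cover : ∀ v, ∃ k < m, v ∈ ownPart t b B k
  unique : ∀ v k k', k < m → k' < m → v ∈ ownPart t b B k → v ∈ ownPart t b B k' → k = k'
  nonempty : ∀ k, 0 < k → k < m → (ownPart t b B k).Nonempty
  edge : ∀ u v, G.Adj u v → (∃ k < t, u ∈ B k ∧ v ∈ B k) ∨ ∃ k, t ≤ k ∧ k < m ∧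
    (u ∈ (b k).2 ∨ v ∈ (b k).2)
  full : ∀ k, 0 < k → k < m → b k ∈ fullBlocks G ∧ A (b k) ≤ w
  bag_le : ∀ k < t, (f (B k) : ℝ≥0∞) ≤ w

theorem partialTree_zero (hb : b 0 = (∅, Finset.univ)) : PartialTree G f A w 0 1 par b B where
  le := by omega
  root := by rw [hb]
  par_lt k h h' := by omega
  subset_par k h h' := by omega
  nbhd_subset k hk v hv := by
    obtain rfl : k = 0 := by omega
    exact absurd (by simp [hb]) (mem_nbhd.1 hv).1
  disj k hk := by
    obtain rfl : k = 0 := by omega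
    simp [hb]
  cover v := ⟨0, by omega, by simp [ownPart, hb]⟩
  unique v k k' := by omega
  nonempty k h h' := by omega
  edge u v _ := Or.inr ⟨0, le_rfl, by omega, by simp [hb]⟩
  full k h h' := by omega
  bag_le k h := by omega

theorem compOf_subset {S C X : Finset V} (hN : nbhd G C ⊆ S) (hS : S ⊆ X) {u : V} (hu : u ∈ C) :
    compOf G X u ⊆ C := fun v hv => by
  refine (mem_compOf.1 hv).closed (C := (C : Set V)) hu fun x hx y (hy : y ∉ X) hxy => ?_
  by_contra hyC
  exact hy (hS (hN (mem_nbhd.2 ⟨hyC, x, hx, hxy⟩)))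

/-- Node `t` receives a bag between `S` and `S ∪ C`, where `(S, C)` is its block, and its children
receive the blocks of the components of `G - Ω` inside `C`. -/
theorem PartialTree.step (h : PartialTree G f A w t m par b B) (ht : t < m) (hm : m ≤ m')
    (hΩ : (b t).1 ⊆ Ω) (hΩ' : Ω ⊆ (b t).1 ∪ (b t).2) (hne : 0 < t → (Ω \ (b t).1).Nonempty)
    (hw : (f Ω : ℝ≥0∞) ≤ w) (hpar : ∀ k < m, par' k = par k) (hb : ∀ k < m, b' k = b k)
    (hB : ∀ k < t, B' k = B k) (hBt : B' t = Ω)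
    (hnew : ∀ k, m ≤ k → k < m' → par' k = t ∧ IsComp G Ω (b' k).2 ∧ (b' k).2 ⊆ (b t).2 ∧
      (b' k).1 = nbhd G (b' k).2 ∧ b' k ∈ fullBlocks G ∧ A (b' k) ≤ w)
    (hinj : ∀ k k', m ≤ k → k < m' → m ≤ k' → k' < m' → (b' k).2 = (b' k').2 → k = k')
    (hsurj : ∀ K, IsComp G Ω K → K ⊆ (b t).2 → ∃ k, m ≤ k ∧ k < m' ∧ (b' k).2 = K) :
    PartialTree G f A w (t + 1) m' par' b' B' := by
  have p1 : ∀ k < m, k ≠ t → ownPart (t + 1) b' B' k = ownPart t b B k := by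
    intro k hk hkt
    unfold ownPart
    rw [hb k hk]
    by_cases hlt : k < t
    · rw [if_pos hlt, if_pos (by omega), hB k hlt]
    · rw [if_neg hlt, if_neg (by omega)]
  have p2 : ownPart (t + 1) b' B' t = Ω \ (b t).1 := by
    unfold ownPart
    rw [if_pos (by omega), hBt, hb t ht]
  have p3 : ∀ k, m ≤ k → ownPart (t + 1) b' B' k = (b' k).2 := fun k hk => if_neg (by omega)
  have p4 : ownPart t b B t = (b t).2 := if_neg (lt_irrefl _)
  have p5 : Ω \ (b t).1 ⊆ (b t).2 := fun v hv => by
    obtain ⟨h1, h2⟩ := Finset.mem_sdiff.1 hv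
    exact (Finset.mem_union.1 (hΩ' h1)).resolve_left h2
  have hcompOf : ∀ v ∈ (b t).2, v ∉ Ω → ∃ k, m ≤ k ∧ k < m' ∧ v ∈ (b' k).2 := by
    intro v hv hvΩ
    obtain ⟨k, h1, h2, h3⟩ := hsurj _ (isComp_compOf hvΩ)
      (compOf_subset (h.nbhd_subset t ht) hΩ hv)
    exact ⟨k, h1, h2, h3 ▸ self_mem_compOf⟩
  -- The part of a new node or of node `t` lies in the old part of `t`.
  have p6 : ∀ v k, k < m' → v ∈ ownPart (t + 1) b' B' k → (k < m ∧ k ≠ t ∧ v ∈ ownPart t b B k) ∨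
      ((m ≤ k ∨ k = t) ∧ v ∈ ownPart t b B t) := by
    intro v k hk hv
    by_cases hkm : k < m
    · by_cases hkt : k = t
      · subst hkt
        rw [p2] at hv
        exact Or.inr ⟨Or.inr rfl, p4 ▸ p5 hv⟩
      · exact Or.inl ⟨hkm, hkt, p1 k hkm hkt ▸ hv⟩
    · rw [p3 k (by omega)] at hv
      exact Or.inr ⟨Or.inl (by omega), p4 ▸ (hnew k (by omega) hk).2.2.1 hv⟩
  refine ⟨by omega, by rw [hb 0 (by omega), h.root], fun k h0 hk => ?_, fun k h0 hk => ?_,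
    fun k hk => ?_, fun k hk => ?_,
    fun v => ?_, fun v k k' hk hk' hv hv' => ?_, fun k h0 hk => ?_, fun u v huv => ?_,
    fun k h0 hk => ?_, fun k hk => ?_⟩
  · by_cases hkm : k < m
    · rw [hpar k hkm]
      have := h.par_lt k h0 hkm
      omega
    · rw [(hnew k (by omega) hk).1]
      omega
  · by_cases hkm : k < m
    · rw [hpar k hkm, hb k hkm, hB _ (h.par_lt k h0 hkm).2]
      exact h.subset_par k h0 hkm
    · obtain ⟨h1, h2, -, h3, -⟩ := hnew k (by omega) hk
      rw [h1, h3, hBt]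
      exact h2.nbhd_subset
  · by_cases hkm : k < m
    · rw [hb k hkm]
      exact h.nbhd_subset k hkm
    · exact (hnew k (by omega) hk).2.2.2.1.ge
  · by_cases hkm : k < m
    · rw [hb k hkm]
      exact h.disj k hkm
    · rw [(hnew k (by omega) hk).2.2.2.1, Finset.disjoint_left]
      exact fun v hv => (mem_nbhd.1 hv).1
  · obtain ⟨k, hk, hv⟩ := h.cover v
    by_cases hkt : k = t
    · subst hkt
      rw [p4] at hv
      by_cases hvΩ : v ∈ Ω
      · exact ⟨k, by omega, p2 ▸ Finset.mem_sdiff.2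
          ⟨hvΩ, fun h' => Finset.disjoint_left.1 (h.disj k ht) h' hv⟩⟩
      · obtain ⟨k', h1, h2, h3⟩ := hcompOf v hv hvΩ
        exact ⟨k', h2, by rwa [p3 k' h1]⟩
    · exact ⟨k, by omega, by rwa [p1 k hk hkt]⟩
  · have hnot : ∀ k, m ≤ k → k < m' → v ∈ ownPart (t + 1) b' B' k → v ∉ Ω := by
      intro k h1 h2 hv
      rw [p3 k h1] at hv
      exact (hnew k h1 h2).2.1.notMem hv
    have hin : v ∈ ownPart (t + 1) b' B' t → v ∈ Ω := fun hv =>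
      (Finset.mem_sdiff.1 (p2 ▸ hv)).1
    rcases p6 v k hk hv with ⟨h1, h2, h3⟩ | ⟨h1, h3⟩ <;>
      rcases p6 v k' hk' hv' with ⟨h1', h2', h3'⟩ | ⟨h1', h3'⟩
    · exact h.unique v k k' h1 h1' h3 h3'
    · exact absurd (h.unique v k t h1 ht h3 h3') h2
    · exact absurd (h.unique v k' t h1' ht h3' h3) h2'
    · rcases h1 with h1 | rfl <;> rcases h1' with h1' | rfl
      · rw [p3 k h1] at hv
        rw [p3 k' h1'] at hv'
        refine hinj k k' h1 hk h1' hk' ?_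
        by_contra hne
        exact (hnew k h1 hk).2.1.disjoint (hnew k' h1' hk').2.1 hne hv hv'
      · exact absurd (hin hv') (hnot k h1 hk hv)
      · exact absurd (hin hv) (hnot k' h1' hk' hv')
      · rfl
  · by_cases hkm : k < m
    · by_cases hkt : k = t
      · subst hkt
        rw [p2]
        exact hne h0
      · rw [p1 k hkm hkt]
        exact h.nonempty k h0 hkm
    · rw [p3 k (by omega)]
      exact (hnew k (by omega) hk).2.1.nonempty
  · have key : ∀ u v, G.Adj u v → u ∈ (b t).2 → (∃ k < t + 1, u ∈ B' k ∧ v ∈ B' k) ∨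
        ∃ k, t + 1 ≤ k ∧ k < m' ∧ (u ∈ (b' k).2 ∨ v ∈ (b' k).2) := by
      intro u v huv hu
      by_cases huΩ : u ∈ Ω
      · by_cases hvΩ : v ∈ Ω
        · exact Or.inl ⟨t, by omega, hBt ▸ huΩ, hBt ▸ hvΩ⟩
        · have hv : v ∈ (b t).2 := by
            by_contra hv
            exact hvΩ (hΩ (h.nbhd_subset t ht (mem_nbhd.2 ⟨hv, u, hu, huv⟩)))
          obtain ⟨k, h1, h2, h3⟩ := hcompOf v hv hvΩ
          exact Or.inr ⟨k, by omega, h2, Or.inr h3⟩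
      · obtain ⟨k, h1, h2, h3⟩ := hcompOf u hu huΩ
        exact Or.inr ⟨k, by omega, h2, Or.inl h3⟩
    rcases h.edge u v huv with ⟨k, hk, h1, h2⟩ | ⟨k, h1, h2, h3⟩
    · exact Or.inl ⟨k, by omega, by rw [hB k hk]; exact ⟨h1, h2⟩⟩
    · rcases h1.eq_or_lt with rfl | h1
      · rcases h3 with h3 | h3
        · exact key u v huv h3
        · rcases key v u huv.symm h3 with ⟨k, k1, k2, k3⟩ | ⟨k, k1, k2, k3⟩
          · exact Or.inl ⟨k, k1, k3, k2⟩
          · exact Or.inr ⟨k, k1, k2, k3.symm⟩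
      · exact Or.inr ⟨k, h1, by omega, by rwa [hb k h2]⟩
  · by_cases hkm : k < m
    · rw [hb k hkm]
      exact h.full k h0 hkm
    · exact (hnew k (by omega) hk).2.2.2.2
  · rcases Nat.lt_succ_iff_lt_or_eq.1 hk with hk | rfl
    · rw [hB k hk]
      exact h.bag_le k hk
    · rwa [hBt]

/-- The nodes other than the root are responsible for disjoint nonempty sets of vertices. -/
theorem PartialTree.card_le (h : PartialTree G f A w t m par b B) : m ≤ Fintype.card V + 1 := by
  choose g hg using fun k : Fin (m - 1) => h.nonempty (k + 1) (by omega) (by omega)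
  have hinj : Function.Injective g := fun k k' he => by
    have := h.unique (g k) (k + 1) (k' + 1) (by omega) (by omega) (hg k) (he ▸ hg k')
    exact Fin.ext (by omega)
  have := Fintype.card_le_of_injective g hinj
  rw [Fintype.card_fin] at this
  omega

/-- When every node has its bag, the tree is a tree decomposition. -/
theorem PartialTree.isTreeDecomp (h : PartialTree G f A w m m par b B) (hm : 0 < m) :
    IsTreeDecomp G (parentGraph m par) fun k : Fin m => B k := by
  refine isTreeDecomp_of_parent hm (fun k h0 hk => (h.par_lt k h0 hk).1) (fun v => ?_)
    (fun u v huv => ?_) fun v k k' hv hv' htop htop' => ?_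
  · obtain ⟨k, hk, hv⟩ := h.cover v
    rw [ownPart, if_pos hk] at hv
    exact ⟨⟨k, hk⟩, (Finset.mem_sdiff.1 hv).1⟩
  · rcases h.edge u v huv with ⟨k, hk, h1⟩ | ⟨k, h1, h2, -⟩
    · exact ⟨⟨k, hk⟩, h1⟩
    · omega
  · have key : ∀ k : Fin m, v ∈ B k → (∀ s : Fin m, 0 < k.val → par k = s → v ∉ B s) →
        v ∈ ownPart m b B k := by
      intro k hv htop
      rw [ownPart, if_pos k.2, Finset.mem_sdiff]
      refine ⟨hv, fun hvS => ?_⟩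
      rcases Nat.eq_zero_or_pos k.val with h0 | h0
      · rw [h0, h.root] at hvS
        exact absurd hvS (Finset.notMem_empty v)
      · exact htop ⟨par k, (h.par_lt k h0 k.2).2⟩ h0 rfl (h.subset_par k h0 k.2 hvS)
    exact Fin.ext (h.unique v k k' k.2 k'.2 (key k hv htop) (key k' hv' htop'))

end Grow

section

variable {n : ℕ} {G : SimpleGraph (Fin n)} {E : Env} {σ τ : HState}
  {D P : List (Finset (Fin n))} {M : List (Finset (Fin n) × Finset (Fin n))}
  {f : Finset (Fin n) → ℝ≥0} {A : Finset (Fin n) × Finset (Fin n) → ℝ≥0∞} {w : ℝ≥0∞}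
  {a : Arr → ℕ → ℕ} {i j o t : ℕ} {r s u : Fin n} {Ω : Finset (Fin n)}
  {b : ℕ → Finset (Fin n) × Finset (Fin n)}

/-! ### The value -/

/-- Computes the value of the algorithm, and the separator `bi` that attains it. -/
def bestCmd : HCmd :=
  .vtop .best 0 ⨾
  .loop .i .io .nD (.ite (.eq (.ld .mins #.i) 1)
    (.vcopy .tmp 0 .zero 0 ⨾
      .loop .r .ro .n (.ite (.and (.eq (.ld .flag (#.io + #.r)) 1)
        (.not (.vle .tab (#.io + #.r) .tmp 0))) (.vcopy .tmp 0 .tab (#.io + #.r)) .skip) ⨾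
      .ite (.vle .tmp 0 .best 0) (.vcopy .best 0 .tmp 0 ⨾ .assign .bi #.io) .skip)
    .skip)

theorem run_bestCmd (hE : E.Suits n D P M) (hz : σ.v .zero 0 = 0)
    (hA : ∀ i r, IsIdx D σ.a i r → σ.v .tab (i * n + r) = A (blk G D i r))
    (hex : ∃ i < D.length, σ.a .mins i = 1) :
    (∃ i < D.length, σ.a .mins i = 1 ∧ (bestCmd.run E σ).r .bi = i * n ∧
      (bestCmd.run E σ).v .best 0 = ⨆ (r : Fin n) (_ : IsIdx D σ.a i r), A (blk G D i r)) ∧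
    ∀ i < D.length, σ.a .mins i = 1 →
      (bestCmd.run E σ).v .best 0 ≤ ⨆ (r : Fin n) (_ : IsIdx D σ.a i r), A (blk G D i r) := by
  have hb := hE.bound_n
  have hbD := hE.bound_D
  rw [bestCmd, run_seq, run_vtop (a := 0) rfl (by omega)]
  set val : ℕ → ℝ≥0∞ := fun i => ⨆ (r : Fin n) (_ : IsIdx D σ.a i r), A (blk G D i r) with hval
  have h := HCmd.loop_rule (σ := σ.setV .best 0 ⊤) (x := .i) (y := .io) (m := .nD)
    (p := .ite (.eq (.ld .mins #.i) 1)
      (.vcopy .tmp 0 .zero 0 ⨾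
        .loop .r .ro .n (.ite (.and (.eq (.ld .flag (#.io + #.r)) 1)
          (.not (.vle .tab (#.io + #.r) .tmp 0))) (.vcopy .tmp 0 .tab (#.io + #.r)) .skip) ⨾
        .ite (.vle .tmp 0 .best 0) (.vcopy .best 0 .tmp 0 ⨾ .assign .bi #.io) .skip)
      .skip) rfl
    (fun l τ => ((∃ i < l, i < D.length ∧ σ.a .mins i = 1 ∧ τ.r .bi = i * n ∧ τ.v .best 0 = val i) ∨
      τ.v .best 0 = ⊤ ∧ ∀ i < l, σ.a .mins i ≠ 1) ∧
      ∀ i < l, σ.a .mins i = 1 → τ.v .best 0 ≤ val i)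
    (fun _ _ _ _ h => h) ⟨Or.inr ⟨by simp, fun _ h => absurd h (Nat.not_lt_zero _)⟩,
      fun _ h => absurd h (Nat.not_lt_zero _)⟩ (by
      intro i hi τ hF hx hy ⟨h1, h2⟩
      rw [hE.par_nD] at hi
      rw [hE.par_n] at hy
      have ea : τ.a = σ.a := funext fun k => hF.a rfl
      have ez : τ.v .zero = σ.v .zero := hF.v rfl
      have et : τ.v .tab = σ.v .tab := hF.v rfl
      have hin := mul_add_self_le (n := n) hi
      by_cases hm : σ.a .mins i = 1
      · rw [run_ite_pos (by simp [hx, ea, hm]), run_seq, run_seq,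
          run_vcopy (a := 0) (b := 0) rfl rfl (by omega)]
        have hF1 := (HCmd.loop .r .ro .n (.ite (.and (.eq (.ld .flag (#.io + #.r)) 1)
          (.not (.vle .tab (#.io + #.r) .tmp 0))) (.vcopy .tmp 0 .tab (#.io + #.r)) .skip)).frame E
            (τ.setV .tmp 0 (τ.v .zero 0))
        have h3 := HCmd.loop_rule (σ := τ.setV .tmp 0 (τ.v .zero 0)) (x := .r) (y := .ro)
          (m := .n) (p := .ite (.and (.eq (.ld .flag (#.io + #.r)) 1)
            (.not (.vle .tab (#.io + #.r) .tmp 0))) (.vcopy .tmp 0 .tab (#.io + #.r)) .skip) rfl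
          (fun l τ => τ.v .tmp 0 =
            ⨆ (r : Fin n) (_ : r.val < l ∧ IsIdx D σ.a i r), A (blk G D i r))
          (fun _ _ _ _ h => h) (by simp [ez, hz]) (by
            intro l hl τ' hF' hx' hy' h
            rw [hE.par_n] at hl
            obtain ⟨r, rfl⟩ : ∃ r : Fin n, r.val = l := ⟨⟨l, hl⟩, rfl⟩
            have fa : τ'.a = σ.a := (funext fun k => hF'.a rfl : τ'.a = τ.a).trans ea
            have f1 : τ'.r .io = i * n := (hF'.r rfl).trans hy
            have f3 : τ'.v .tab = σ.v .tab := (hF'.v rfl).trans (by simp [et])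
            rw [iSup_lt_succ, ← h]
            by_cases hu : IsIdx D σ.a i r
            · rw [iSup_pos hu, ← hA i r hu]
              by_cases hle : σ.v .tab (i * n + r) ≤ τ'.v .tmp 0
              · rw [run_ite_neg (by simp [fa, f1, f3, hx', hle]), run_skip, max_eq_left hle]
              · rw [run_ite_pos (by simp [fa, f1, f3, hx', hu.2]; simpa using hle),
                  run_vcopy (a := 0) (b := i * n + r) rfl (by simp [f1, hx']) (by omega), setV_self,
                  Function.update_self, f3, max_eq_right (le_of_not_ge hle)]
            · have hfl : σ.a .flag (i * n + r) ≠ 1 := fun h => hu ⟨hi, h⟩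
              rw [run_ite_neg (by simp [fa, f1, hx', hfl]), run_skip, iSup_neg hu]
              exact (max_eq_left bot_le).symm)
        rw [hE.par_n] at h3
        replace h3 := h3.trans (show _ = val i from iSup_congr fun r => by simp)
        generalize (HCmd.loop .r .ro .n (.ite (.and (.eq (.ld .flag (#.io + #.r)) 1)
          (.not (.vle .tab (#.io + #.r) .tmp 0))) (.vcopy .tmp 0 .tab (#.io + #.r)) .skip)).run E
            (τ.setV .tmp 0 (τ.v .zero 0)) = τ₁ at h3 hF1 ⊢
        have g1 : τ₁.v .best = τ.v .best := hF1.v rfl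
        have g2 : τ₁.r .io = i * n := (hF1.r rfl).trans hy
        have g3 : τ₁.r .bi = τ.r .bi := hF1.r rfl
        by_cases hle : val i ≤ τ.v .best 0
        · rw [run_ite_pos (by simpa [h3, g1] using hle), run_seq,
            run_vcopy (a := 0) (b := 0) rfl rfl (by omega),
            run_assign (a := i * n) (by simp [g2]) (by omega)]
          refine ⟨Or.inl ⟨i, by omega, hi, hm, by simp, by simp [h3]⟩, fun j hj hjm => ?_⟩
          simp only [setR_v, setV_self, Function.update_self, h3]
          rcases Nat.lt_succ_iff_lt_or_eq.1 hj with hj | rfl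
          · exact hle.trans (h2 j hj hjm)
          · exact le_rfl
        · rw [run_ite_neg (by simpa [h3, g1] using hle), run_skip, g1, g3]
          refine ⟨Or.inl ?_, fun j hj hjm => ?_⟩
          · rcases h1 with ⟨k, h4, h5⟩ | ⟨h4, -⟩
            · exact ⟨k, by omega, h5⟩
            · exact absurd (h4 ▸ le_top) hle
          · rcases Nat.lt_succ_iff_lt_or_eq.1 hj with hj | rfl
            · exact h2 j hj hjm
            · exact le_of_not_ge hle
      · rw [run_ite_neg (by simp [hx, ea, hm]), run_skip]
        refine ⟨?_, fun j hj hjm => ?_⟩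
        · rcases h1 with ⟨k, h4, h5⟩ | ⟨h4, h5⟩
          · exact Or.inl ⟨k, by omega, h5⟩
          · refine Or.inr ⟨h4, fun j hj => ?_⟩
            rcases Nat.lt_succ_iff_lt_or_eq.1 hj with hj | rfl
            · exact h5 j hj
            · exact hm
        · rcases Nat.lt_succ_iff_lt_or_eq.1 hj with hj | rfl
          · exact h2 j hj hjm
          · exact absurd hjm hm)
  rw [hE.par_nD] at h
  obtain ⟨h1, h2⟩ := h
  refine ⟨?_, h2⟩
  rcases h1 with ⟨i, -, h1⟩ | ⟨-, h1⟩
  · exact ⟨i, h1⟩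
  · obtain ⟨i, hi, hm⟩ := hex
    exact absurd hm (h1 i hi)

/-- The value found by `bestCmd` is that of the algorithm. -/
theorem best_eq (hT : IsSepTable G D a) (hD : IsListing D (minSeps G)) {x : ℝ≥0∞}
    (h1 : ∃ i < D.length, a .mins i = 1 ∧
      x = ⨆ (r : Fin n) (_ : IsIdx D a i r), A (blk G D i r))
    (h2 : ∀ i < D.length, a .mins i = 1 → x ≤ ⨆ (r : Fin n) (_ : IsIdx D a i r), A (blk G D i r)) :
    x = ⨅ (S : Finset (Fin n)) (_ : S ∈ D ∧ ∀ S' ∈ D, ¬ (S' ⊂ S)),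
      ⨆ (C : Finset (Fin n)) (_ : IsFullComp G S C), A (S, C) := by
  have hmins : ∀ i < D.length, a .mins i = 1 ↔ ∀ S' ∈ D, ¬ (S' ⊂ D.getD i ∅) := fun i hi => by
    rw [(hT i hi).mins_eq, ← IsMinSep.minimal_iff (isListing_getD_mem hD hi)]
    exact forall_congr' fun S' => by rw [hD.2 S']; rfl
  have hval : ∀ i < D.length, (⨆ (C : Finset (Fin n)) (_ : IsFullComp G (D.getD i ∅) C),
      A (D.getD i ∅, C)) = ⨆ (r : Fin n) (_ : IsIdx D a i r), A (blk G D i r) := by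
    intro i hi
    refine le_antisymm (iSup₂_le fun C hC => ?_) (iSup₂_le fun r hr => ?_)
    · obtain ⟨v, hv⟩ := hC.1.nonempty
      obtain ⟨r, hr, -, hr'⟩ := exists_isIdx_of_mem hT hi hC hv
      rw [← hr']
      exact le_iSup₂_of_le (f := fun r (_ : IsIdx D a i r) => A (blk G D i r)) r hr le_rfl
    · exact le_iSup₂_of_le (f := fun (C : Finset (Fin n)) (_ : IsFullComp G (D.getD i ∅) C) =>
        A (D.getD i ∅, C)) _ ⟨hr.isComp hT, hr.nbhd_eq hT⟩ le_rfl
  refine le_antisymm (le_iInf₂ fun S hS => ?_) ?_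
  · obtain ⟨i, hi, rfl⟩ := isListing_exists_getD hD (d := ∅) ((hD.2 S).1 hS.1)
    rw [hval i hi]
    exact h2 i hi ((hmins i hi).2 hS.2)
  · obtain ⟨i, hi, hm, rfl⟩ := h1
    rw [← hval i hi]
    refine iInf₂_le (D.getD i ∅) ⟨?_, (hmins i hi).1 hm⟩
    exact (hD.2 _).2 (isListing_getD_mem hD hi)

theorem exists_mins (hT : IsSepTable G D a) (hD : IsListing D (minSeps G)) (hne : D ≠ []) :
    ∃ i < D.length, a .mins i = 1 := by
  obtain ⟨S, hS, hmin⟩ := D.toFinset.exists_minimal (by simpa using hne)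
  rw [List.mem_toFinset] at hS
  obtain ⟨i, hi, rfl⟩ := isListing_exists_getD hD (d := ∅) ((hD.2 S).1 hS)
  refine ⟨i, hi, ?_⟩
  rw [(hT i hi).mins_eq, ← IsMinSep.minimal_iff (isListing_getD_mem hD hi)]
  intro S' hS' hlt
  exact hlt.2 (hmin (List.mem_toFinset.2 ((hD.2 S').2 hS')) hlt.1)

variable {m : ℕ}

/-! ### The tree decomposition -/

/-- Writes the 0/1-vector with the entries `e` as the bag of the current node. -/
def bagCmd (e : HExpr) : HCmd := .loop .v .vo .n (.store .bag (#.q + #.v) e)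

/-- Appends to the queue, as children of the current node, the blocks `(eS, eR)` of all vertices `u`
that pass the test. -/
def pushCmd (c : HTest) (eS eR : HExpr) : HCmd :=
  .loop .u .uo .n (.ite c (.store .qS #.nodes eS ⨾ .store .qR #.nodes eR ⨾
    .store .par #.nodes #.t ⨾ .assign .nodes (#.nodes + 1)) .skip)

/-- Moves on to the next node; `q` is the address of its bag. -/
def nextCmd : HCmd := .assign .q (#.q + .par .n) ⨾ .assign .t (#.t + 1)

/-- Starts the tree: the bag of the root is the separator `bi`, and its children carry the full
blocks of this separator. -/
def rootCmd : HCmd :=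
  .assign .t 0 ⨾ .assign .q 0 ⨾ .assign .nodes 1 ⨾
  bagCmd (.ld .inp (.par .pD + #.bi + #.v)) ⨾
  pushCmd (.eq (.ld .flag (#.bi + #.u)) 1) #.bi #.u ⨾ nextCmd

/-- Gives the current node its bag and its children, as the array `choice` says. -/
def expandCmd : HCmd :=
  .assign .io (.ld .qS #.t) ⨾ .assign .r (.ld .qR #.t) ⨾
  .ite (.eq (.ld .choice (#.io + #.r)) 0)
    (bagCmd (.ld .inp (.par .pD + #.io + #.v) +
      (1 - ((.ld .labD (#.io + #.v) - #.r) + (#.r - .ld .labD (#.io + #.v))))))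
    (.assign .w (.ld .choice (#.io + #.r) - 1) ⨾
      bagCmd (.ld .inp (.par .pP + #.w + #.v)) ⨾
      pushCmd (.and (.eq (.ld .pf (#.w + #.u)) 1) (.eq (.ld .labD (#.io + #.u)) #.r))
        (.ld .tS (#.w + #.u)) (.ld .cR (#.w + #.u))) ⨾
  nextCmd

/-- Builds the tree. The blocks of the nodes without bags form a queue, and `n` rounds are enough,
as there are at most `n` nodes other than the root. -/
def treeCmd : HCmd :=
  rootCmd ⨾ .loop .s .so .n (.ite (.lt #.t #.nodes) expandCmd .skip)

theorem run_bagCmd (hE : E.Suits n D P M) {e : HExpr} (hb : t * n + n < E.bound)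
    (hq : σ.r .q = t * n) (he : ∀ v < n, ∀ τ : HState, (∀ x, x ≠ .v → x ≠ .vo → τ.r x = σ.r x) →
      (∀ k, k ≠ .bag → τ.a k = σ.a k) → τ.r .v = v → e.eval E τ = bit Ω v) :
    (∀ v < n, ((bagCmd e).run E σ).a .bag (t * n + v) = bit Ω v) ∧
      ∀ j < t * n, ((bagCmd e).run E σ).a .bag j = σ.a .bag j := by
  have hn := hE.n_pos
  have hbn := hE.bound_n
  obtain ⟨g1, g2⟩ := run_fill (σ := σ) (x := .v) (y := .vo) (m := .n) (k := .bag)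
    (ie := #.q + #.v) (e := e) (o := t * n) (g := bit Ω) rfl fun v hv τ hF hx hy => by
      rw [hE.par_n] at hv
      have e1 : τ.r .q = t * n := (hF.r rfl).trans hq
      have := bit_le Ω v
      refine ⟨by simp [e1, hx], he v hv τ (fun x h1 h2 => hF.r ?_) (fun k h1 => hF.a ?_) hx,
        by omega, by omega⟩
      · cases x <;> first | rfl | exact absurd rfl h1 | exact absurd rfl h2
      · cases k <;> first | rfl | exact absurd rfl h1
  rw [hE.par_n] at g1 g2
  exact ⟨g1, fun j hj => g2 j fun v _ => by omega⟩

/-- The blocks `(gS u, gR u)` for the vertices `u` in the list `L` have been appended to the queue,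
as children of node `t`. -/
structure Pushed (L : List (Fin n)) (gS gR : Fin n → ℕ) (m t : ℕ) (σ τ : HState) : Prop where
  nodes : τ.r .nodes = m + L.length
  new : ∀ k (hk : k < L.length), τ.a .qS (m + k) = gS L[k] ∧ τ.a .qR (m + k) = gR L[k] ∧
    τ.a .par (m + k) = t
  old : ∀ k < m, τ.a .qS k = σ.a .qS k ∧ τ.a .qR k = σ.a .qR k ∧ τ.a .par k = σ.a .par k

theorem run_pushCmd (hE : E.Suits n D P M) {c : HTest} {eS eR : HExpr} {Q : Fin n → Prop}
    {gS gR : Fin n → ℕ} (hm : σ.r .nodes = m) (ht : σ.r .t = t) (hb : m + n + 1 < E.bound)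
    (htb : t < E.bound)
    (he : ∀ (u : Fin n) (τ : HState), (∀ x, x ≠ .u → x ≠ .uo → x ≠ .nodes → τ.r x = σ.r x) →
      (∀ k, k ≠ .qS → k ≠ .qR → k ≠ .par → τ.a k = σ.a k) → τ.r .u = u →
      (c.Holds E τ ↔ Q u) ∧ (Q u → eS.eval E τ = gS u ∧ eR.eval E τ = gR u))
    (hg : ∀ u, Q u → gS u < E.bound ∧ gR u < E.bound)
    (hR : ∀ (τ : HState) k e, eR.eval E (τ.setA .qS k e) = eR.eval E τ) :
    ∃ L : List (Fin n), L.Nodup ∧ (∀ u, u ∈ L ↔ Q u) ∧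
      Pushed L gS gR m t σ ((pushCmd c eS eR).run E σ) := by
  have h := HCmd.loop_rule (σ := σ) (x := .u) (y := .uo) (m := .n)
    (p := .ite c (.store .qS #.nodes eS ⨾ .store .qR #.nodes eR ⨾
      .store .par #.nodes #.t ⨾ .assign .nodes (#.nodes + 1)) .skip) rfl
    (fun l τ => ∃ L : List (Fin n), L.Nodup ∧ L.length ≤ l ∧ (∀ u, u ∈ L ↔ u.val < l ∧ Q u) ∧
      Pushed L gS gR m t σ τ)
    (fun l τ k k' ⟨L, h1, h2, h3, h4⟩ => ⟨L, h1, h2, h3, h4.1, h4.2, h4.3⟩)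
    ⟨[], List.nodup_nil, le_rfl, by simp, by simpa using hm, fun _ h => absurd h (by simp),
      fun _ _ => ⟨rfl, rfl, rfl⟩⟩ (by
      rintro l hl τ hF hx hy ⟨L, h1, h2, h3, h4⟩
      rw [hE.par_n] at hl
      obtain ⟨u, rfl⟩ : ∃ u : Fin n, u.val = l := ⟨⟨l, hl⟩, rfl⟩
      obtain ⟨k1, k2⟩ := he u τ
        (fun x h1 h2 h3 => hF.r (by
          cases x <;> first | rfl | exact absurd rfl h1 | exact absurd rfl h2 | exact absurd rfl h3))
        (fun k h1 h2 h3 => hF.a (by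
          cases k <;> first | rfl | exact absurd rfl h1 | exact absurd rfl h2 | exact absurd rfl h3))
        hx
      have f1 : τ.r .t = t := (hF.r rfl).trans ht
      have hsucc : ∀ v : Fin n, v.val < u.val + 1 ∧ Q v ↔ (v.val < u.val ∧ Q v) ∨ (v = u ∧ Q u) := by
        intro v
        constructor
        · rintro ⟨h, hQ⟩
          rcases Nat.lt_succ_iff_lt_or_eq.1 h with h | h
          · exact Or.inl ⟨h, hQ⟩
          · obtain rfl := Fin.ext h
            exact Or.inr ⟨rfl, hQ⟩
        · rintro (⟨h, hQ⟩ | ⟨rfl, hQ⟩)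
          · exact ⟨by omega, hQ⟩
          · exact ⟨by omega, hQ⟩
      by_cases hQ : Q u
      · obtain ⟨e1, e2⟩ := k2 hQ
        obtain ⟨b1, b2⟩ := hg u hQ
        have hn := h4.nodes
        rw [run_ite_pos (k1.2 hQ), run_seq, run_seq, run_seq,
          run_store (a := m + L.length) (b := gS u) (by simp [hn]) e1 (by omega) b1,
          run_store (σ := τ.setA _ _ _) (a := m + L.length) (b := gR u) (by simp [hn])
            (by rw [hR, e2]) (by omega) b2,
          run_store (a := m + L.length) (b := t) (by simp [hn]) (by simp [f1]) (by omega) htb,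
          run_assign (a := m + L.length + 1) (by simp [hn]) (by omega)]
        refine ⟨L ++ [u], ?_, by simp; omega, fun v => ?_, by simp [add_assoc], fun k hk => ?_,
          fun k hk => ?_⟩
        · rw [List.nodup_append]
          refine ⟨h1, List.nodup_singleton _, fun p hp q hq he => ?_⟩
          rw [List.mem_singleton.1 hq] at he
          exact absurd ((h3 p).1 hp).1 (by rw [he]; omega)
        · rw [List.mem_append, List.mem_singleton, h3, hsucc, and_iff_left hQ]
        · simp only [setR_a, setA_self, ne_eq, reduceCtorEq, not_false_eq_true, setA_of_ne]
          rw [List.length_append, List.length_singleton] at hk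
          rcases Nat.lt_succ_iff_lt_or_eq.1 hk with hk | rfl
          · rw [List.getElem_append_left hk, Function.update_of_ne (by omega),
              Function.update_of_ne (by omega), Function.update_of_ne (by omega)]
            exact h4.new k hk
          · rw [Function.update_self, Function.update_self, Function.update_self]
            simp
        · simp only [setR_a, setA_self, ne_eq, reduceCtorEq, not_false_eq_true, setA_of_ne]
          rw [Function.update_of_ne (by omega),
              Function.update_of_ne (by omega), Function.update_of_ne (by omega)]
          exact h4.old k hk
      · rw [run_ite_neg (k1.not.2 hQ), run_skip]
        refine ⟨L, h1, by omega, fun v => ?_, h4⟩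
        rw [h3, hsucc]
        exact (or_iff_left fun h => hQ h.2).symm)
  rw [hE.par_n] at h
  obtain ⟨L, h1, -, h3, h4⟩ := h
  exact ⟨L, h1, fun u => (h3 u).trans (and_iff_right u.2), h4⟩

/-- The set of vertices whose 0/1-vector starts at index `o`. -/
def bitSet (n : ℕ) (a : ℕ → ℕ) (o : ℕ) : Finset (Fin n) := Finset.univ.filter fun v => a (o + v) = 1

theorem bitSet_eq {a : ℕ → ℕ} (h : ∀ v < n, a (o + v) = bit Ω v) : bitSet n a o = Ω := by
  ext v
  rw [bitSet, Finset.mem_filter, h v v.2, bit_eq_one_iff]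
  simp

/-- The state `τ` holds a partial tree of which the first `t` nodes have bags. -/
structure HoldsTree (G : SimpleGraph (Fin n)) (f : Finset (Fin n) → ℝ≥0)
    (A : Finset (Fin n) × Finset (Fin n) → ℝ≥0∞) (w : ℝ≥0∞) (D : List (Finset (Fin n)))
    (a : Arr → ℕ → ℕ) (b : ℕ → Finset (Fin n) × Finset (Fin n)) (t : ℕ) (τ : HState) : Prop where
  reg_t : τ.r .t = t
  reg_q : τ.r .q = t * n
  tree : PartialTree G f A w t (τ.r .nodes) (τ.a .par) b fun k => bitSet n (τ.a .bag) (k * n)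
  idx : ∀ k, 0 < k → k < τ.r .nodes → ∃ i r, IsIdx D a i r ∧ τ.a .qS k = i * n ∧ τ.a .qR k = r ∧
    b k = blk G D i r

/-- A node receives the bag `Ω`, and for each vertex `u` in the list `L` a child whose block has the
component of `G - Ω` that contains `u`. -/
theorem HoldsTree.step (h : HoldsTree G f A w D a b t σ) (ht : t < σ.r .nodes)
    (hT : IsSepTable G D a) (hD : IsListing D (minSeps G))
    (hΩ : (b t).1 ⊆ Ω) (hΩ' : Ω ⊆ (b t).1 ∪ (b t).2) (hne : 0 < t → (Ω \ (b t).1).Nonempty)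
    (hw : (f Ω : ℝ≥0∞) ≤ w) {L : List (Fin n)} {gS gR : Fin n → ℕ} (hL : L.Nodup)
    (hpush : Pushed L gS gR (σ.r .nodes) t σ τ)
    (hchild : ∀ u ∈ L, u ∉ Ω ∧ u ∈ (b t).2 ∧ ∃ i r, IsIdx D a i r ∧ gS u = i * n ∧ gR u = r ∧
      blk G D i r = (nbhd G (compOf G Ω u), compOf G Ω u) ∧ A (blk G D i r) ≤ w)
    (hinj : ∀ u ∈ L, ∀ v ∈ L, compOf G Ω u = compOf G Ω v → u = v)
    (hsurj : ∀ K, IsComp G Ω K → K ⊆ (b t).2 → ∃ u ∈ L, compOf G Ω u = K)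
    (hbag : ∀ v < n, τ.a .bag (t * n + v) = bit Ω v)
    (hold : ∀ j < t * n, τ.a .bag j = σ.a .bag j)
    (r1 : τ.r .t = t + 1) (r2 : τ.r .q = (t + 1) * n) :
    ∃ b', HoldsTree G f A w D a b' (t + 1) τ := by
  set m := σ.r .nodes with hm
  let b' : ℕ → Finset (Fin n) × Finset (Fin n) := fun k =>
    if hk : m ≤ k ∧ k - m < L.length then
      (nbhd G (compOf G Ω (L[k - m]'hk.2)), compOf G Ω (L[k - m]'hk.2)) else b k
  have hb1 : ∀ k < m, b' k = b k := fun k hk => dif_neg fun h => by omega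
  have hb2 : ∀ k (hk : k < L.length), b' (m + k) = (nbhd G (compOf G Ω L[k]), compOf G Ω L[k]) := by
    intro k hk
    have hk' : m ≤ m + k ∧ m + k - m < L.length := ⟨by omega, by omega⟩
    simp only [b', dif_pos hk', Nat.add_sub_cancel_left]
  have hn1 := hpush.nodes
  have hnew : ∀ k, m ≤ k → k < τ.r .nodes → ∃ l, ∃ hl : l < L.length, k = m + l := fun k h1 h2 =>
    ⟨k - m, by omega, by omega⟩
  refine ⟨b', r1, r2, ?_, fun k h0 hk => ?_⟩
  · refine h.tree.step (Ω := Ω) ht (by omega) hΩ hΩ' hne hw (fun k hk => (hpush.old k hk).2.2) hb1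
      (fun k hk => ?_) (bitSet_eq hbag) (fun k h1 h2 => ?_) (fun k k' h1 h2 h1' h2' he => ?_)
      fun K hK hKt => ?_
    · unfold bitSet
      refine Finset.filter_congr fun v _ => ?_
      rw [hold _ (mul_add_lt hk v.2 le_rfl)]
    · obtain ⟨l, hl, rfl⟩ := hnew k h1 h2
      obtain ⟨h3, h4, i, r, h5, -, -, h6, h7⟩ := hchild _ (List.getElem_mem hl)
      rw [hb2 l hl]
      exact ⟨(hpush.new l hl).2.2, isComp_compOf h3, compOf_subset (h.tree.nbhd_subset t ht) hΩ h4,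
        rfl, h6 ▸ h5.mem_fullBlocks hT hD, h6 ▸ h7⟩
    · obtain ⟨l, hl, rfl⟩ := hnew k h1 h2
      obtain ⟨l', hl', rfl⟩ := hnew k' h1' h2'
      rw [hb2 l hl, hb2 l' hl'] at he
      have := hinj _ (List.getElem_mem hl) _ (List.getElem_mem hl') he
      rw [(hL.getElem_inj_iff).1 this]
    · obtain ⟨u, hu, rfl⟩ := hsurj K hK hKt
      obtain ⟨l, hl, rfl⟩ := List.getElem_of_mem hu
      exact ⟨m + l, by omega, by omega, by rw [hb2 l hl]⟩
  · by_cases hkm : k < m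
    · obtain ⟨i, r, h1, h2, h3, h4⟩ := h.idx k h0 hkm
      obtain ⟨h5, h6, -⟩ := hpush.old k hkm
      exact ⟨i, r, h1, h5.trans h2, h6.trans h3, (hb1 k hkm).trans h4⟩
    · obtain ⟨l, hl, rfl⟩ := hnew k (by omega) hk
      obtain ⟨-, -, i, r, h5, h6, h7, h8, -⟩ := hchild _ (List.getElem_mem hl)
      obtain ⟨k1, k2, -⟩ := hpush.new l hl
      exact ⟨i, r, h5, k1.trans h6, k2.trans h7, (hb2 l hl).trans h8.symm⟩

theorem run_nextCmd (hE : E.Suits n D P M) (ht : σ.r .t = t) (hq : σ.r .q = t * n)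
    (hb : t * n + n < E.bound) :
    nextCmd.run E σ = (σ.setR .q ((t + 1) * n)).setR .t (t + 1) := by
  have := Nat.le_mul_of_pos_right (t + 1) hE.n_pos
  have h2 : (t + 1) * n = t * n + n := Nat.succ_mul t n
  rw [nextCmd, run_seq,
    run_assign (σ := σ) (a := (t + 1) * n) (by simp [hq, hE.par_n, h2]) (by omega),
    run_assign (a := t + 1) (by simp [ht]) (by omega)]

theorem Pushed.congr {L : List (Fin n)} {gS gR : Fin n → ℕ} {σ' τ' : HState}
    (h : Pushed L gS gR m t σ τ) (h1 : τ'.r .nodes = τ.r .nodes) (h2 : τ'.a = τ.a)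
    (h3 : σ'.a .qS = σ.a .qS) (h4 : σ'.a .qR = σ.a .qR) (h5 : σ'.a .par = σ.a .par) :
    Pushed L gS gR m t σ' τ' :=
  ⟨h1.trans h.1, by rw [h2]; exact h.2, by rw [h2, h3, h4, h5]; exact h.3⟩

theorem IsTable.sep_le (hA : IsTable G f A) (hf : Monotone f) (hw : w ≠ ⊤)
    {c : Finset (Fin n) × Finset (Fin n)} (hc : c ∈ fullBlocks G) (hle : A c ≤ w) :
    (f c.1 : ℝ≥0∞) ≤ w := by
  rcases hA.attained c hc with h | ⟨Ω, -, h1, -, h⟩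
  · rw [h, initVal] at hle
    split_ifs at hle
    · exact le_trans (by exact_mod_cast hf Finset.subset_union_left) hle
    · exact absurd (top_le_iff.1 hle) hw
  · rw [h] at hle
    exact le_trans (by exact_mod_cast hf h1.1) ((le_max_left _ _).trans hle)

theorem run_rootCmd (hE : E.Suits n D P M) (hI : IsInput E G D P M (σ.a .inp))
    (hT : IsSepTable G D σ.a) (hD : IsListing D (minSeps G)) (hf : Monotone f)
    (hA : IsTable G f A) (hw : w ≠ ⊤) (hi : i < D.length) (hm : σ.a .mins i = 1)
    (hbi : σ.r .bi = i * n) (hle : ∀ r, IsIdx D σ.a i r → A (blk G D i r) ≤ w) :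
    ∃ b, HoldsTree G f A w D σ.a b 1 (rootCmd.run E σ) := by
  have hb := hE.bound_n
  have hbD := hE.bound_D
  have hin := mul_add_self_le (n := n) hi
  have hmin := (hT i hi).mins_eq.1 hm
  simp only [rootCmd, run_seq]
  rw [run_assign (σ := σ) (a := 0) rfl (by omega),
    run_assign (σ := σ.setR .t 0) (a := 0) rfl (by omega),
    run_assign (σ := (σ.setR .t 0).setR .q 0) (a := 1) rfl (by omega)]
  obtain ⟨σ₀, hσ₀⟩ : ∃ σ₀, σ₀ = ((σ.setR .t 0).setR .q 0).setR .nodes 1 := ⟨_, rfl⟩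
  rw [← hσ₀]
  have e1 : σ₀.r .t = 0 := by simp [hσ₀]
  have e2 : σ₀.r .q = 0 * n := by simp [hσ₀]
  have e3 : σ₀.r .nodes = 1 := by simp [hσ₀]
  have e4 : σ₀.r .bi = i * n := by simp [hσ₀, hbi]
  have e5 : σ₀.a = σ.a := by rw [hσ₀]; rfl
  clear hσ₀
  obtain ⟨g1, g2⟩ := run_bagCmd (σ := σ₀) (Ω := D.getD i ∅) (t := 0) hE (by omega) e2
    (e := .ld .inp (.par .pD + #.bi + #.v)) fun v hv τ h1 h2 h3 => by
      have := (hI.sep i hi).eq_bit hv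
      simpa [h1, h2, h3, e4, e5] using this
  have hF1 := (bagCmd (.ld .inp (.par .pD + #.bi + #.v))).frame E σ₀
  generalize (bagCmd (.ld .inp (.par .pD + #.bi + #.v))).run E σ₀ = σ₁ at g1 g2 hF1 ⊢
  have f1 : σ₁.r .bi = i * n := (hF1.r rfl).trans e4
  have f2 : σ₁.a .flag = σ.a .flag := (hF1.a rfl).trans (by rw [e5])
  obtain ⟨L, hL, hQ, hpush⟩ := run_pushCmd (m := 1) (t := 0) hE
    (c := .eq (.ld .flag (#.bi + #.u)) 1) (eS := #.bi) (eR := #.u) (Q := fun u => IsIdx D σ.a i u)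
    (gS := fun _ => i * n) (gR := fun u => u) ((hF1.r rfl).trans e3) ((hF1.r rfl).trans e1)
    (by omega) (by omega) (fun u τ h1 h2 h3 => ⟨by simp [h1, h2, h3, f1, f2, IsIdx, hi],
      fun _ => by simp [h1, h3, f1]⟩) (fun u _ => ⟨by omega, by omega⟩) fun _ _ _ => rfl
  have hF2 := (pushCmd (.eq (.ld .flag (#.bi + #.u)) 1) #.bi #.u).frame E σ₁
  generalize (pushCmd (.eq (.ld .flag (#.bi + #.u)) 1) #.bi #.u).run E σ₁ = σ₂ at hpush hF2 ⊢
  rw [run_nextCmd (t := 0) hE ((hF2.r rfl).trans ((hF1.r rfl).trans e1))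
    ((hF2.r rfl).trans ((hF1.r rfl).trans e2)) (by omega)]
  have hS : IsMinSep G (D.getD i ∅) := isListing_getD_mem hD hi
  have hidx : ∀ C, IsComp G (D.getD i ∅) C → ∃ r, IsIdx D σ.a i r ∧ compOf G (D.getD i ∅) r = C := by
    intro C hC
    obtain ⟨v, hv⟩ := hC.nonempty
    obtain ⟨r, hr, -, hr'⟩ := exists_isIdx_of_mem hT hi ⟨hC, hmin C hC⟩ hv
    exact ⟨r, hr, congrArg Prod.snd hr'⟩
  refine HoldsTree.step (σ := σ₀) (t := 0) (b := fun _ => (∅, Finset.univ))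
    (Ω := D.getD i ∅) (L := L)
    (gS := fun _ => i * n) (gR := fun u => u)
    ⟨e1, e2, by rw [e3]; exact partialTree_zero rfl, fun k h0 hk => by omega⟩ (by omega) hT hD
    (Finset.empty_subset _) (by simp) (by omega) ?_ hL ?_ (fun u hu => ?_) (fun u hu v hv he => ?_)
    (fun K hK _ => ?_) ?_ (by omega) (by simp) (by simp)
  · obtain ⟨C, -, hC, -⟩ := isMinSep_iff.1 hS
    obtain ⟨r, hr, -⟩ := hidx C hC.1
    exact hA.sep_le hf hw (hr.mem_fullBlocks hT hD) (hle r hr)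
  · rw [e3]
    exact hpush.congr (by simp) (by simp) (hF1.a rfl).symm (hF1.a rfl).symm (hF1.a rfl).symm
  · have hu' := (hQ u).1 hu
    refine ⟨hu'.notMem hT, Finset.mem_univ _, i, u, hu', rfl, rfl, ?_, hle u hu'⟩
    exact Prod.ext (hu'.nbhd_eq hT).symm rfl
  · exact (((hQ u).1 hu).inj hT hD ((hQ v).1 hv) (Prod.ext rfl he)).2
  · obtain ⟨r, hr, h⟩ := hidx K hK
    exact ⟨r, (hQ r).2 hr, h⟩
  · intro v hv
    have : σ₂.a .bag = σ₁.a .bag := hF2.a rfl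
    simp only [setR_a, this]
    exact g1 v hv

theorem run_expandCmd (hE : E.Suits n D P M) (hI : IsInput E G D P M (σ.a .inp))
    (hT : IsSepTable G D a) (hQ : IsPmcTable G D P a) (hS : SameTables a σ.a)
    (hD : IsListing D (minSeps G)) (hP : IsListing P (pmcs G)) (hw : w ≠ ⊤) {tab : ℕ → ℝ≥0∞}
    (hatt : ∀ i r, IsIdx D a i r → tab (i * n + r) = A (blk G D i r) ∧
      IsAttained G f D P A tab (σ.a .choice) i r)
    (h : HoldsTree G f A w D a b t σ) (h0 : 0 < t) (ht : t < σ.r .nodes) :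
    ∃ b, HoldsTree G f A w D a b (t + 1) (expandCmd.run E σ) := by
  have hb := hE.bound_n
  have hbD := hE.bound_D
  have hbP := hE.bound_P
  have hcard := h.tree.card_le
  rw [Fintype.card_fin] at hcard
  have htn : t * n ≤ n * n := Nat.mul_le_mul_right _ (by omega)
  obtain ⟨i, r, hir, hqS, hqR, hbt⟩ := h.idx t h0 ht
  obtain ⟨hfull, hle⟩ := h.tree.full t h0 ht
  obtain ⟨htab, hch⟩ := hatt i r hir
  rw [hbt] at hle
  have hi := hir.1
  have hin := mul_add_self_le (n := n) hi
  simp only [expandCmd, run_seq]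
  rw [run_assign (σ := σ) (a := i * n) (by simp [h.reg_t, hqS]) (by omega),
    run_assign (σ := σ.setR .io (i * n)) (a := r) (by simp [h.reg_t, hqR]) (by omega)]
  obtain ⟨σ₀, hσ₀⟩ : ∃ σ₀, σ₀ = (σ.setR .io (i * n)).setR .r r := ⟨_, rfl⟩
  rw [← hσ₀]
  have e1 : σ₀.r .t = t := by simp [hσ₀, h.reg_t]
  have e2 : σ₀.r .q = t * n := by simp [hσ₀, h.reg_q]
  have e3 : σ₀.r .nodes = σ.r .nodes := by simp [hσ₀]
  have e4 : σ₀.r .io = i * n := by simp [hσ₀]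
  have e6 : σ₀.r .r = r := by simp [hσ₀]
  have e5 : σ₀.a = σ.a := by rw [hσ₀]; rfl
  clear hσ₀
  rcases hch with ⟨hc, hv⟩ | ⟨o, ho, hc, h1, h2, hv⟩
  · -- The block is inclusion-minimal, and node `t` is a leaf with bag `S ∪ C`.
    have hdisj : Disjoint (blk G D i r).1 (blk G D i r).2 := hbt ▸ h.tree.disj t ht
    have hbit : ∀ v < n, σ.a .inp (E.par .pD + i * n + v) +
        (1 - ((a .labD (i * n + v) - r) + (r - a .labD (i * n + v)))) =
          bit ((blk G D i r).1 ∪ (blk G D i r).2) v := by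
      intro v hv
      have k1 : σ.a .inp (E.par .pD + i * n + v) = bit (blk G D i r).1 v := (hI.sep i hi).eq_bit hv
      have k2 := hir.labD_eq_iff hT (v := ⟨v, hv⟩)
      have k3 := bit_eq_one_iff (X := (blk G D i r).1) (v := ⟨v, hv⟩)
      have k4 := bit_eq_one_iff (X := (blk G D i r).1 ∪ (blk G D i r).2) (v := ⟨v, hv⟩)
      have k5 := bit_le (blk G D i r).1 v
      have k6 := bit_le ((blk G D i r).1 ∪ (blk G D i r).2) v
      have k7 : (⟨v, hv⟩ : Fin n) ∈ (blk G D i r).1 → (⟨v, hv⟩ : Fin n) ∉ (blk G D i r).2 :=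
        fun h => Finset.disjoint_left.1 hdisj h
      rw [Finset.mem_union, ← k3, ← k2] at k4
      rw [← k3, ← k2] at k7
      dsimp only at k4 k7
      rw [k1]
      omega
    rw [run_ite_pos (by simp [e4, e5, e6, hc])]
    obtain ⟨g1, g2⟩ := run_bagCmd (σ := σ₀) (Ω := (blk G D i r).1 ∪ (blk G D i r).2) (t := t) hE
      (by omega) e2 (e := .ld .inp (.par .pD + #.io + #.v) +
      (1 - ((.ld .labD (#.io + #.v) - #.r) + (#.r - .ld .labD (#.io + #.v)))))
      fun v hv τ h1 h2 h3 => by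
        simpa [h1, h2, h3, e4, e5, e6, hS.labD] using hbit v hv
    have hF1 := (bagCmd (.ld .inp (.par .pD + #.io + #.v) +
      (1 - ((.ld .labD (#.io + #.v) - #.r) + (#.r - .ld .labD (#.io + #.v)))))).frame E σ₀
    generalize (bagCmd (.ld .inp (.par .pD + #.io + #.v) +
      (1 - ((.ld .labD (#.io + #.v) - #.r) + (#.r - .ld .labD (#.io + #.v)))))).run E σ₀ = σ₁
      at g1 g2 hF1 ⊢
    rw [run_nextCmd (t := t) hE ((hF1.r rfl).trans e1) ((hF1.r rfl).trans e2) (by omega)]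
    refine h.step (Ω := (blk G D i r).1 ∪ (blk G D i r).2) (L := []) (gS := fun _ => 0)
      (gR := fun _ => 0) ht hT hD (by rw [hbt]; exact Finset.subset_union_left) (by rw [hbt])
      (fun _ => ?_) ?_ List.nodup_nil ?_ (by simp) (by simp) (fun K hK hKt => ?_) ?_ ?_ (by simp)
      (by simp)
    · rw [hbt, Finset.union_sdiff_cancel_left hdisj]
      exact (hir.isComp hT).nonempty
    · rw [← htab, hv, initVal] at hle
      split_ifs at hle
      · exact hle
      · exact absurd (top_le_iff.1 hle) hw
    · refine ⟨by simp [hF1.r (x := .nodes) rfl, e3], fun k hk => absurd hk (by simp), fun k _ => ?_⟩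
      simp [hF1.a (k := .qS) rfl, hF1.a (k := .qR) rfl, hF1.a (k := .par) rfl, e5]
    · obtain ⟨v, hv⟩ := hK.nonempty
      rw [hbt] at hKt
      exact absurd (Finset.mem_union_right _ (hKt hv)) (hK.notMem hv)
    · simpa using g1
    · simpa [e5] using g2
  · -- Node `t` has the potential maximal clique that attains the entry as its bag.
    have hΩ : IsPMC G (P.getD o ∅) := isListing_getD_mem hP ho
    have hon := mul_add_self_le (n := n) ho
    rw [run_ite_neg (by simp [e4, e5, e6, hc]), run_seq, run_seq,
      run_assign (σ := σ₀) (a := o * n) (by simp [e4, e5, e6, hc]) (by omega)]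
    obtain ⟨g1, g2⟩ := run_bagCmd (σ := σ₀.setR .w (o * n)) (Ω := P.getD o ∅) (t := t) hE
      (by omega) (by simp [e2]) (e := .ld .inp (.par .pP + #.w + #.v)) fun v hv τ h1 h2 h3 => by
        simpa [h1, h2, h3, e5] using (hI.pmc o ho).eq_bit hv
    have hF1 := (bagCmd (.ld .inp (.par .pP + #.w + #.v))).frame E (σ₀.setR .w (o * n))
    generalize (bagCmd (.ld .inp (.par .pP + #.w + #.v))).run E (σ₀.setR .w (o * n)) = σ₁
      at g1 g2 hF1 ⊢
    have f1 : σ₁.r .w = o * n := (hF1.r rfl).trans (by simp)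
    have f2 : σ₁.r .io = i * n := (hF1.r rfl).trans (by simp [e4])
    have f3 : σ₁.r .r = r := (hF1.r rfl).trans (by simp [e6])
    have f4 : σ₁.r .nodes = σ.r .nodes := (hF1.r rfl).trans (by simp [e3])
    have f5 : σ₁.r .t = t := (hF1.r rfl).trans (by simp [e1])
    have f6 : σ₁.r .q = t * n := (hF1.r rfl).trans (by simp [e2])
    have fa : ∀ k, k ≠ .bag → σ₁.a k = σ.a k := fun k hk => (hF1.a (by
      cases k <;> first | rfl | exact absurd rfl hk)).trans (by simp [e5])
    have l1 : σ₁.a .pf = a .pf := (fa _ (by decide)).trans hS.pf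
    have l2 : σ₁.a .labD = a .labD := (fa _ (by decide)).trans hS.labD
    have l3 : σ₁.a .tS = a .tS := (fa _ (by decide)).trans hS.tS
    have l4 : σ₁.a .cR = a .cR := (fa _ (by decide)).trans hS.cR
    have hidx : ∀ u : Fin n, a .pf (o * n + u) = 1 → a .tS (o * n + u) < E.bound ∧
        a .cR (o * n + u) < E.bound := by
      intro u hu
      obtain ⟨j, s, k1, k2, k3, -⟩ := exists_child_idx hT hQ ho hu
      have := mul_add_lt k1.1 s.2 (le_refl (D.length * n))
      omega
    obtain ⟨L, hL, hQ', hpush⟩ := run_pushCmd (m := σ.r .nodes) (t := t) hE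
      (c := .and (.eq (.ld .pf (#.w + #.u)) 1) (.eq (.ld .labD (#.io + #.u)) #.r))
      (eS := .ld .tS (#.w + #.u)) (eR := .ld .cR (#.w + #.u)) (Q := fun u => IsChild a n i r o u)
      (gS := fun u => a .tS (o * n + u)) (gR := fun u => a .cR (o * n + u)) f4 f5
      (by omega) (by omega) (fun u τ h1 h2 h3 => ⟨by simp [h1, h2, h3, f1, f2, f3, l1, l2, IsChild],
        fun _ => by simp [h1, h2, h3, f1, l3, l4]⟩) (fun u hu => hidx u hu.1) fun _ _ _ => by simp
    have hF2 := (pushCmd (.and (.eq (.ld .pf (#.w + #.u)) 1) (.eq (.ld .labD (#.io + #.u)) #.r))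
      (.ld .tS (#.w + #.u)) (.ld .cR (#.w + #.u))).frame E σ₁
    generalize (pushCmd (.and (.eq (.ld .pf (#.w + #.u)) 1) (.eq (.ld .labD (#.io + #.u)) #.r))
      (.ld .tS (#.w + #.u)) (.ld .cR (#.w + #.u))).run E σ₁ = σ₂ at hpush hF2 ⊢
    rw [run_nextCmd (t := t) hE ((hF2.r rfl).trans f5) ((hF2.r rfl).trans f6) (by omega)]
    rw [← htab, hv, candidate_eq hT hP hQ ho hir h1 h2] at hle
    have hbag : σ₂.a .bag = σ₁.a .bag := hF2.a rfl
    refine h.step (Ω := P.getD o ∅) (L := L) (gS := fun u => a .tS (o * n + u))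
      (gR := fun u => a .cR (o * n + u)) ht hT hD (by rw [hbt]; exact h1.1) (by rw [hbt]; exact h2)
      (fun _ => ?_) ((le_max_left _ _).trans hle) hL
      (hpush.congr (by simp) (by simp) (fa _ (by decide)).symm (fa _ (by decide)).symm
        (fa _ (by decide)).symm)
      (fun u hu => ?_) (fun u hu v hv he => ?_) (fun K hK hKt => ?_) (by simpa [hbag] using g1)
      (by simpa [hbag, e5] using g2) (by simp) (by simp)
    · rw [hbt, Finset.sdiff_nonempty]
      exact h1.2
    · have hu' := (hQ' u).1 hu
      obtain ⟨j, s, k1, k2, k3, k4⟩ := exists_child_idx hT hQ ho hu'.1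
      refine ⟨((hQ o ho).entry u hu'.1).notMem, by rw [hbt]; exact (hir.labD_eq_iff hT).1 hu'.2,
        j, s, k1, k2, k3, k4, ?_⟩
      rw [k4]
      exact (le_iSup₂_of_le (f := fun (u : Fin n) (_ : IsChild a n i r o u) =>
        A (nbhd G (compOf G (P.getD o ∅) u), compOf G (P.getD o ∅) u)) u hu' le_rfl).trans
        ((le_max_right _ _).trans hle)
    · exact (hQ o ho).rep_unique u v ((hQ' u).1 hu).1 ((hQ' v).1 hv).1 he
    · obtain ⟨u, hu, rfl⟩ := (hQ o ho).exists_rep K hK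
      refine ⟨u, (hQ' u).2 ⟨hu, (hir.labD_eq_iff hT).2 ?_⟩, rfl⟩
      rw [hbt] at hKt
      exact hKt self_mem_compOf

theorem run_treeCmd (hE : E.Suits n D P M) (hI : IsInput E G D P M (σ.a .inp))
    (hT : IsSepTable G D σ.a) (hQ : IsPmcTable G D P σ.a) (hD : IsListing D (minSeps G))
    (hP : IsListing P (pmcs G)) (hf : Monotone f) (hA : IsTable G f A) (hw : w ≠ ⊤)
    {tab : ℕ → ℝ≥0∞} (hatt : ∀ i r, IsIdx D σ.a i r → tab (i * n + r) = A (blk G D i r) ∧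
      IsAttained G f D P A tab (σ.a .choice) i r)
    (hi : i < D.length) (hm : σ.a .mins i = 1) (hbi : σ.r .bi = i * n)
    (hle : ∀ r, IsIdx D σ.a i r → A (blk G D i r) ≤ w) :
    ∃ b, HoldsTree G f A w D σ.a b ((treeCmd.run E σ).r .nodes) (treeCmd.run E σ) := by
  obtain ⟨b, h0⟩ := run_rootCmd hE hI hT hD hf hA hw hi hm hbi hle
  rw [treeCmd, run_seq]
  have hF0 := rootCmd.frame E σ
  generalize rootCmd.run E σ = σ₁ at h0 hF0 ⊢
  have h := HCmd.loop_rule (E := E) (x := .s) (y := .so) (m := .n)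
    (p := .ite (.lt #.t #.nodes) expandCmd .skip) rfl
    (fun l τ => ∃ t b, HoldsTree G f A w D σ.a b t τ ∧ 0 < t ∧ (l < t ∨ t = τ.r .nodes))
    (fun _ _ _ _ ⟨t, b, h1, h2⟩ => ⟨t, b, ⟨h1.1, h1.2, h1.3, h1.4⟩, h2⟩)
    ⟨1, b, h0, by omega, Or.inl (by omega)⟩ (by
      rintro l hl τ hF hx hy ⟨t, b, h1, h2, h3⟩
      have ha : ∀ k, k ≠ .bag → k ≠ .qS → k ≠ .qR → k ≠ .par → τ.a k = σ.a k := by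
        intro k k1 k2 k3 k4
        have e1 : rootCmd.modA k = false := by
          cases k <;> first | rfl | contradiction
        have e2 : (HCmd.loop .s .so .n (.ite (.lt #.t #.nodes) expandCmd .skip)).modA k = false := by
          cases k <;> first | rfl | contradiction
        exact (hF.a e2).trans (hF0.a e1)
      have hS : SameTables σ.a τ.a := by
        constructor <;> exact ha _ (by decide) (by decide) (by decide) (by decide)
      have h4 := h1.tree.le
      rcases h4.eq_or_lt with h4 | h4
      · rw [run_ite_neg (by simp [h1.reg_t, h4]), run_skip]
        exact ⟨t, b, h1, h2, Or.inr h4⟩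
      · rw [run_ite_pos (by simp [h1.reg_t, h4])]
        obtain ⟨b', h5⟩ := run_expandCmd hE
          (by rw [ha .inp (by decide) (by decide) (by decide) (by decide)]; exact hI)
          hT hQ hS hD hP hw
          (by rw [ha .choice (by decide) (by decide) (by decide) (by decide)]; exact hatt) h1 h2 h4
        exact ⟨t + 1, b', h5, by omega, Or.inl (by omega)⟩)
  rw [hE.par_n] at h
  obtain ⟨t, b', h1, -, h2⟩ := h
  refine ⟨b', ?_⟩
  rcases h2 with h2 | h2
  · have h3 := h1.tree.card_le
    rw [Fintype.card_fin] at h3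
    have h4 := h1.tree.le
    exact (show t = _ from le_antisymm h4 (by omega)) ▸ h1
  · rwa [h2] at h1

/-! ### The whole program -/

/-- The case of a complete graph: a single bag with all vertices. -/
def completeCmd : HCmd :=
  .vcopy .best 0 .inp 0 ⨾ .assign .q 0 ⨾ .assign .nodes 1 ⨾ bagCmd 1 ⨾
  .assign .q (#.q + .par .n)

/-- Computes the value and the tree decomposition, from the table. -/
def resultCmd : HCmd :=
  .ite (.eq (.par .nD) 0) completeCmd (bestCmd ⨾ treeCmd) ⨾ .assign .bagEnd #.q

/-- The program between the input and the output: the tables of the separators and of the potential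
maximal cliques, the dynamic program, the list of blocks, and the tree decomposition. -/
def mainCmd : HCmd :=
  sepsCmd ⨾ trieCmd ⨾ pmcsCmd ⨾ initTabCmd ⨾ dpCmd ⨾ orderCmd ⨾ outCmd ⨾ resultCmd

/-- The state `τ` holds a tree decomposition whose bags have values at most `w`, and `w` itself. -/
structure HoldsDecomp (G : SimpleGraph (Fin n)) (f : Finset (Fin n) → ℝ≥0) (w : ℝ≥0∞) (τ : HState) :
    Prop where
  best : τ.v .best 0 = w
  nodes_le : τ.r .nodes ≤ n + 1
  bagEnd : τ.r .bagEnd = τ.r .nodes * n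
  isTreeDecomp : IsTreeDecomp G (parentGraph (τ.r .nodes) (τ.a .par))
    fun k => bitSet n (τ.a .bag) (k * n)
  bag_le : ∀ k < τ.r .nodes, (f (bitSet n (τ.a .bag) (k * n)) : ℝ≥0∞) ≤ w

theorem run_completeCmd (hE : E.Suits n D P M) (hP : IsListing P (pmcs G))
    (hV : IsInputVal f P M (σ.v .inp)) (hG : ∀ u v, u ≠ v → G.Adj u v) :
    (completeCmd.run E σ).v .best 0 = f Finset.univ ∧ (completeCmd.run E σ).r .nodes = 1 ∧
      (completeCmd.run E σ).r .q = n ∧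
      bitSet n ((completeCmd.run E σ).a .bag) 0 = Finset.univ := by
  have hb := hE.bound_n
  obtain ⟨Ω, hΩ⟩ := exists_isPMC G
  obtain ⟨o, ho, -⟩ := isListing_exists_getD hP (d := ∅) hΩ
  have h0 : 0 < P.length := by omega
  have huniv : P.getD 0 ∅ = Finset.univ := (isListing_getD_mem hP h0 : IsPMC G _).eq_univ hG
  simp only [completeCmd, run_seq]
  rw [run_vcopy (a := 0) (b := 0) rfl rfl (by omega), hV.pmc 0 h0, huniv,
    run_assign (σ := σ.setV .best 0 (f Finset.univ)) (a := 0) rfl (by omega),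
    run_assign (σ := (σ.setV .best 0 (f Finset.univ)).setR .q 0) (a := 1) rfl (by omega)]
  obtain ⟨σ₀, hσ₀⟩ : ∃ σ₀, σ₀ = ((σ.setV .best 0 (f Finset.univ)).setR .q 0).setR .nodes 1 :=
    ⟨_, rfl⟩
  rw [← hσ₀]
  have e1 : σ₀.r .q = 0 * n := by simp [hσ₀]
  have e2 : σ₀.r .nodes = 1 := by simp [hσ₀]
  have e3 : σ₀.v .best 0 = f Finset.univ := by simp [hσ₀]
  clear hσ₀
  obtain ⟨g1, -⟩ := run_bagCmd (σ := σ₀) (Ω := Finset.univ) (t := 0) hE (by omega) e1 (e := 1)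
    fun v hv τ _ _ _ => ((bit_eq_one_iff (v := ⟨v, hv⟩)).2 (Finset.mem_univ _)).symm
  have hF := (bagCmd 1).frame E σ₀
  generalize (bagCmd 1).run E σ₀ = σ₁ at g1 hF ⊢
  have f1 : σ₁.r .q = 0 * n := (hF.r rfl).trans e1
  rw [run_assign (a := n) (by simp [f1, hE.par_n]) (by omega)]
  refine ⟨?_, ?_, by simp, bitSet_eq fun v hv => ?_⟩
  · rw [setR_v, hF.v rfl, e3]
  · rw [setR_of_ne _ (by decide), hF.r rfl, e2]
  · simpa using g1 v hv

theorem isTreeDecomp_single {m : ℕ} {par : ℕ → ℕ} {B : ℕ → Finset (Fin n)} (hm : m = 1)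
    (hB : B 0 = Finset.univ) : IsTreeDecomp G (parentGraph m par) fun k => B k := by
  subst hm
  exact isTreeDecomp_of_parent one_pos (fun k h0 hk => by omega) (fun v => ⟨0, by simp [hB]⟩)
    (fun u v _ => ⟨0, by simp [hB]⟩) fun _ _ _ _ _ _ _ => Subsingleton.elim _ _

theorem run_resultCmd (hE : E.Suits n D P M) (hI : IsInput E G D P M (σ.a .inp))
    (hV : IsInputVal f P M (σ.v .inp))
    (hT : IsSepTable G D σ.a) (hQ : IsPmcTable G D P σ.a) (hD : IsListing D (minSeps G))
    (hP : IsListing P (pmcs G)) (hf : Monotone f) (hA : IsTable G f A) (hz : σ.v .zero 0 = 0)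
    (hatt : ∀ i r, IsIdx D σ.a i r → σ.v .tab (i * n + r) = A (blk G D i r) ∧
      IsAttained G f D P A (σ.v .tab) (σ.a .choice) i r)
    (hw : w = if D = [] then (f Finset.univ : ℝ≥0∞)
      else ⨅ (S : Finset (Fin n)) (_ : S ∈ D ∧ ∀ S' ∈ D, ¬ (S' ⊂ S)),
        ⨆ (C : Finset (Fin n)) (_ : IsFullComp G S C), A (S, C)) (hwt : w ≠ ⊤) :
    HoldsDecomp G f w (resultCmd.run E σ) := by
  have hb := hE.bound_n
  rw [resultCmd, run_seq]
  by_cases hne : D = []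
  · rw [if_pos hne] at hw
    have hG : ∀ u v, u ≠ v → G.Adj u v := fun u v huv => adj_of_forall_not_isMinSep (fun S hS => by
      have : S ∈ D := (hD.2 S).2 hS
      rw [hne] at this
      exact absurd this List.not_mem_nil) huv
    rw [run_ite_pos (by simp [hE.par_nD, hne])]
    obtain ⟨h1, h2, h3, h4⟩ := run_completeCmd hE hP hV hG
    generalize completeCmd.run E σ = σ₁ at h1 h2 h3 h4 ⊢
    rw [run_assign (a := n) (by simp [h3]) (by omega)]
    have hbag : ∀ k < 1, bitSet n (σ₁.a .bag) (k * n) = Finset.univ := fun k hk => by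
      obtain rfl : k = 0 := by omega
      rw [zero_mul, h4]
    have h4' : bitSet n (σ₁.a .bag) (0 * n) = Finset.univ := hbag 0 (by omega)
    refine ⟨by simp [h1, hw], by simp [h2], by simp [h2], ?_, fun k hk => ?_⟩
    · exact isTreeDecomp_single (B := fun k => bitSet n (σ₁.a .bag) (k * n)) (by simp [h2]) h4'
    · simp only [ne_eq, reduceCtorEq, not_false_eq_true, setR_of_ne, h2] at hk
      rw [setR_a, hbag k hk, hw]
  · rw [if_neg hne] at hw
    have hlen : D.length ≠ 0 := fun h => hne (List.length_eq_zero_iff.1 h)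
    rw [run_ite_neg (by simp [hE.par_nD, hlen]), run_seq]
    obtain ⟨h1, h2⟩ := run_bestCmd hE hz (fun i r hi => (hatt i r hi).1) (exists_mins hT hD hne)
    have hF := bestCmd.frame E σ
    generalize bestCmd.run E σ = σ₁ at h1 h2 hF ⊢
    have hbest : σ₁.v .best 0 = w := by
      obtain ⟨i, k1, k2, -, k3⟩ := h1
      rw [hw, best_eq hT hD ⟨i, k1, k2, k3⟩ h2]
    obtain ⟨i, k1, k2, k3, k4⟩ := h1
    have ea : σ₁.a = σ.a := funext fun k => hF.a rfl
    rw [← ea] at hT hQ hI hatt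
    obtain ⟨b, h3⟩ := run_treeCmd (w := w) hE hI hT hQ hD hP hf hA hwt hatt k1
      (by rw [ea]; exact k2) k3
      (fun r hr => by
        rw [← hbest, k4]
        rw [ea] at hr
        exact le_iSup₂_of_le (f := fun r (_ : IsIdx D σ.a i r) => A (blk G D i r)) r hr le_rfl)
    have hF2 := treeCmd.frame E σ₁
    generalize treeCmd.run E σ₁ = σ₂ at h3 hF2 ⊢
    have h5 := h3.tree.card_le
    rw [Fintype.card_fin] at h5
    have hlt : σ₂.r .nodes * n ≤ (n + 1) * n := Nat.mul_le_mul_right _ h5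
    have heq : (n + 1) * n = n * n + n := Nat.succ_mul n n
    have h0 : 0 < σ₂.r .nodes := by
      obtain ⟨k, hk, -⟩ := h3.tree.cover ⟨0, hE.n_pos⟩
      omega
    rw [run_assign (a := σ₂.r .nodes * n) (by simp [h3.reg_q]) (by omega)]
    refine ⟨?_, by simpa using h5, by simp, ?_, fun k hk => ?_⟩
    · rw [setR_v, hF2.v rfl, hbest]
    · simp only [setR_a]
      exact h3.tree.isTreeDecomp h0
    · simp only [ne_eq, reduceCtorEq, not_false_eq_true, setR_of_ne] at hk
      exact h3.tree.bag_le k hk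

/-- The state `τ` holds the list `L` of blocks and the values of these blocks in the table `A`. -/
structure HoldsBlocks (n : ℕ) (A : Finset (Fin n) × Finset (Fin n) → ℝ≥0∞)
    (L : List (Finset (Fin n) × Finset (Fin n))) (τ : HState) : Prop where
  nblk : τ.r .nblk = L.length
  obEnd : τ.r .obEnd = 2 * L.length * n
  entry : ∀ k (hk : k < L.length), bitSet n (τ.a .ob) (2 * k * n) = L[k].1 ∧
    bitSet n (τ.a .ob) ((2 * k + 1) * n) = L[k].2 ∧ τ.v .out k = A L[k]

theorem IsBits.bitSet_eq {X : Finset (Fin n)} {a : ℕ → ℕ} (h : IsBits X a o) : bitSet n a o = X :=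
  FTW.bitSet_eq fun _ hv => h.eq_bit hv

theorem exists_isBlockOrder (hE : E.Suits n D P M) (hD : IsListing D (minSeps G))
    (hT : IsSepTable G D σ.a) : ∃ L, IsBlockOrder G L := by
  obtain ⟨L, hL, -⟩ := run_orderCmd hE hT
  exact ⟨_, hL.isBlockOrder hD hT⟩

theorem run_mainCmd (hE : E.Suits n D P M) (hI : IsInput E G D P M (σ.a .inp))
    (hV : IsInputVal f P M (σ.v .inp)) (hD : IsListing D (minSeps G)) (hP : IsListing P (pmcs G))
    (hM : IsListing M (minFullBlocks G)) (hf : Monotone f) (hchild : ∀ q, σ.a .child q = 0)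
    (hchoice : ∀ q, σ.a .choice q = 0) (hzero : σ.v .zero 0 = 0) :
    ∃ L, IsBlockOrder G L ∧ L.length ≤ D.length * n ∧
      HoldsBlocks n (blockTable G f P L) L (mainCmd.run E σ) ∧
      HoldsDecomp G f (algorithmValue G f D P L) (mainCmd.run E σ) := by
  simp only [mainCmd, run_seq]
  have h1 := run_sepsCmd hE hI
  have hF1 := sepsCmd.frame E σ
  generalize sepsCmd.run E σ = σ₁ at h1 hF1 ⊢
  rw [← hF1.a (k := .inp) rfl] at hI
  rw [← hF1.v (k := .inp) rfl] at hV
  rw [← hF1.v (k := .zero) rfl] at hzero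
  replace hchild : ∀ q, σ₁.a .child q = 0 := fun q => by rw [hF1.a rfl]; exact hchild q
  replace hchoice : ∀ q, σ₁.a .choice q = 0 := fun q => by rw [hF1.a rfl]; exact hchoice q
  clear hF1
  obtain ⟨cnt, hcnt, h2⟩ := run_trieCmd hE hI hD.1 hchild
  have hF2 := trieCmd.frame E σ₁
  generalize trieCmd.run E σ₁ = σ₂ at h2 hF2 ⊢
  rw [← hF2.a (k := .inp) rfl] at hI
  rw [← hF2.v (k := .inp) rfl] at hV
  rw [← hF2.v (k := .zero) rfl] at hzero
  replace hchoice : ∀ q, σ₂.a .choice q = 0 := fun q => by rw [hF2.a rfl]; exact hchoice q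
  have hT2 : IsSepTable G D σ₂.a := fun i hi => by
    rw [hF2.a (k := .labD) rfl, hF2.a (k := .flag) rfl, hF2.a (k := .size) rfl,
      hF2.a (k := .mins) rfl]
    exact h1 i hi
  clear hF2 h1
  have h3 : IsPmcTable G D P (pmcsCmd.run E σ₂).a := run_pmcsCmd hE hD hP hI hcnt hT2 h2
  have hF3 := pmcsCmd.frame E σ₂
  generalize pmcsCmd.run E σ₂ = σ₃ at h3 hF3 ⊢
  rw [← hF3.a (k := .inp) rfl] at hI
  rw [← hF3.v (k := .inp) rfl] at hV
  rw [← hF3.v (k := .zero) rfl] at hzero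
  replace hchoice : ∀ q, σ₃.a .choice q = 0 := fun q => by rw [hF3.a rfl]; exact hchoice q
  have hT3 : IsSepTable G D σ₃.a := fun i hi => by
    rw [hF3.a (k := .labD) rfl, hF3.a (k := .flag) rfl, hF3.a (k := .size) rfl,
      hF3.a (k := .mins) rfl]
    exact hT2 i hi
  rw [← hF3.a (k := .child) rfl, ← hF3.a (k := .leaf) rfl] at h2
  clear hF3 hT2
  have h4 := run_initTabCmd hE hD hM hI hV hcnt hT3 h2
  have hF4 := initTabCmd.frame E σ₃
  generalize initTabCmd.run E σ₃ = σ₄ at h4 hF4 ⊢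
  have ea : σ₄.a = σ₃.a := funext fun k => hF4.a (by cases k <;> rfl)
  rw [← hF4.v (k := .inp) rfl] at hV
  rw [← hF4.v (k := .zero) rfl] at hzero
  rw [← ea] at hI hT3 h3 hchoice h4
  clear hF4 ea h2
  obtain ⟨L₀, hL₀⟩ := exists_isBlockOrder hE hD hT3
  have hW := isTable_blockTable (f := f) hP hL₀
  have h5 := run_dpCmd hE hD hP hV hT3 h3 hW h4 hchoice
  have hF5 := dpCmd.frame E σ₄
  generalize dpCmd.run E σ₄ = σ₅ at h5 hF5 ⊢
  have hS5 : SameTables σ₄.a σ₅.a := by constructor <;> exact hF5.a rfl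
  have hT5 := hS5.isSepTable hT3
  have hQ5 := hS5.isPmcTable h3
  rw [← hF5.a (k := .inp) rfl] at hI
  rw [← hF5.v (k := .inp) rfl] at hV
  rw [← hF5.v (k := .zero) rfl] at hzero
  replace h5 := fun i r (hi : IsIdx D σ₅.a i r) => h5 i r (hS5.isIdx_iff.1 hi)
  clear hF5 hS5 hT3 h3 hchoice h4
  obtain ⟨L, hL, hH⟩ := run_orderCmd hE hT5
  have hF6 := orderCmd.frame E σ₅
  generalize orderCmd.run E σ₅ = σ₆ at hH hF6 ⊢
  have hS6 : SameTables σ₅.a σ₆.a := by constructor <;> exact hF6.a rfl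
  have hT6 := hS6.isSepTable hT5
  have hQ6 := hS6.isPmcTable hQ5
  have ev : σ₆.v = σ₅.v := funext fun k => hF6.v rfl
  rw [← hF6.a (k := .inp) rfl] at hI
  rw [← ev] at hV hzero h5
  rw [← hF6.a (k := .choice) rfl] at h5
  replace h5 := fun i r (hi : IsIdx D σ₆.a i r) => h5 i r (hS6.isIdx_iff.1 hi)
  have hL6 : IsIdxList D σ₆.a (fun _ _ => True) L :=
    ⟨hL.nodup, fun i r => (hL.mem_iff i r).trans (and_congr_left' hS6.isIdx_iff.symm), by
      rw [hS6.size]; exact hL.sorted⟩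
  clear hF6 hS6 hT5 hQ5 hL
  have h7 := run_outCmd hE hI hT6 hL6 hH
  have hF7 := outCmd.frame E σ₆
  generalize outCmd.run E σ₆ = σ₇ at h7 hF7 ⊢
  have hS7 : SameTables σ₆.a σ₇.a := by constructor <;> exact hF7.a rfl
  have hT7 := hS7.isSepTable hT6
  have hQ7 := hS7.isPmcTable hQ6
  rw [← hF7.a (k := .inp) rfl] at hI
  rw [← hF7.v (k := .inp) rfl] at hV
  rw [← hF7.v (k := .zero) rfl] at hzero
  have hord := hL6.isBlockOrder hD hT6
  have halg := algorithmValue_eq (f := f) hD hP hord hW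
  have hle := algorithmValue_le_ftw hf hD hP hord
  have h8 := run_resultCmd hE hI hV hT7 hQ7 hD hP hf hW hzero
    (fun i r hi => by
      rw [hF7.v (k := .tab) rfl, hF7.a (k := .choice) rfl]
      exact h5 i r (hS7.isIdx_iff.1 hi)) halg (hle.trans_lt ENNReal.coe_lt_top).ne
  have hF8 := resultCmd.frame E σ₇
  refine ⟨_, hord, by simpa using hL6.length_le, ⟨?_, ?_, fun k hk => ?_⟩, h8⟩
  · rw [hF8.r rfl, hF7.r rfl, hH.length_eq, List.length_map]
  · rw [hF8.r rfl, h7.obEnd, List.length_map]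
  · rw [List.length_map] at hk
    rw [hF8.a (k := .ob) rfl, hF8.v (k := .out) rfl, h7.out k hk hk]
    simp only [List.getElem_map]
    have hidx := ((hL6.mem_iff L[k].1 L[k].2).1 (List.getElem_mem hk)).1
    refine ⟨(h7.sep k hk hk).bitSet_eq, (h7.comp k hk hk).bitSet_eq, ?_⟩
    rw [(h5 _ _ hidx).1]
    exact hW.unique (isTable_blockTable hP hord) _ (hidx.mem_fullBlocks hT6 hD)

theorem mainCmd_wf : mainCmd.wf = true := by decide

theorem mainCmd_nest : mainCmd.nest 0 0 0 0 = true := by decide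

end

/-! ### The input -/

section Input

variable {n : ℕ} {G : SimpleGraph (Fin n)} {E : Env}
  {D P : List (Finset (Fin n))} {M : List (Finset (Fin n) × Finset (Fin n))}
  {f : Finset (Fin n) → ℝ≥0}

theorem length_bits (S : Finset (Fin n)) : (bits S).length = n := List.length_ofFn

theorem getD_bits (S : Finset (Fin n)) (v : Fin n) :
    (v ∈ S → (bits S).getD v 0 = 1) ∧ (v ∉ S → (bits S).getD v 0 = 0) := by
  rw [List.getD_eq_getElem _ _ (by simp [length_bits])]
  constructor <;> intro h <;> simp [bits, h]

theorem length_flatMap_const {α β : Type*} {L : List α} {g : α → List β} {k : ℕ}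
    (h : ∀ x, (g x).length = k) : (L.flatMap g).length = L.length * k := by
  induction L with
  | nil => simp
  | cons x L ih => rw [List.flatMap_cons, List.length_append, ih, h, List.length_cons]; ring

theorem getD_flatMap {α β : Type*} {L : List α} {g : α → List β} {k : ℕ}
    (h : ∀ x, (g x).length = k) {i j : ℕ} (hi : i < L.length) (hj : j < k) (x : α) (d : β) :
    (L.flatMap g).getD (i * k + j) d = (g (L.getD i x)).getD j d := by
  induction L generalizing i with
  | nil => exact absurd hi (Nat.not_lt_zero _)
  | cons y L ih =>
    rw [List.flatMap_cons]
    cases i with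
    | zero => rw [zero_mul, zero_add, List.getD_append _ _ _ _ (by rw [h]; exact hj)]; rfl
    | succ i =>
      have hk : (i + 1) * k + j = k + (i * k + j) := by ring
      rw [List.getD_append_right _ _ _ _ (by rw [h, hk]; omega), h, hk, Nat.add_sub_cancel_left,
        ih (by simpa using hi)]
      rfl

theorem getD_middle {α : Type*} {L pre mid post : List α} (h : L = pre ++ (mid ++ post)) {o j : ℕ}
    (ho : o = pre.length) (hj : j < mid.length) (d : α) : L.getD (o + j) d = mid.getD j d := by
  rw [h, ho, List.getD_append_right _ _ _ _ (by omega), Nat.add_sub_cancel_left,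
    List.getD_append _ _ _ _ hj]

theorem length_adjBits : (adjBits G).length = n * n := by
  rw [adjBits, length_flatMap_const fun _ => length_bits _, List.length_finRange]

theorem length_blockBits (b : Finset (Fin n) × Finset (Fin n)) :
    (bits b.1 ++ bits b.2).length = n + n := by
  rw [List.length_append, length_bits, length_bits]

/-- The addresses of the parts of the input. -/
structure Env.Locates (E : Env) (n : ℕ) (D P : List (Finset (Fin n)))
    (M : List (Finset (Fin n) × Finset (Fin n))) : Prop where
  par_n : E.par .n = n
  par_nD : E.par .nD = D.length
  par_nP : E.par .nP = P.length
  par_nM : E.par .nM = M.length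
  par_pD : E.par .pD = n * n + 2
  par_pP : E.par .pP = E.par .pD + n * D.length + 1
  par_pM : E.par .pM = E.par .pP + n * P.length + 1

theorem length_inputWords (hE : E.Locates n D P M) :
    (inputWords G D P M).length = E.par .pM + n * M.length + n * M.length := by
  simp only [inputWords, List.length_append, List.length_singleton, length_adjBits,
    length_flatMap_const length_bits, length_flatMap_const length_blockBits, hE.par_pM, hE.par_pP,
    hE.par_pD]
  ring

section Parts

variable (hE : E.Locates n D P M) (d : ℕ)

include hE

theorem getD_inputWords_n : (inputWords G D P M).getD 0 d = n := rfl

theorem getD_inputWords_adj {j : ℕ} (hj : j < n * n) :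
    (inputWords G D P M).getD (1 + j) d = (adjBits G).getD j d :=
  getD_middle (pre := [n]) (post := [D.length] ++ D.flatMap bits ++ [P.length] ++ P.flatMap bits ++
    [M.length] ++ M.flatMap fun b => bits b.1 ++ bits b.2) (by simp [inputWords]) rfl
    (by rwa [length_adjBits]) d

theorem getD_inputWords_nD : (inputWords G D P M).getD (E.par .pD - 1) d = D.length := by
  have := getD_middle (L := inputWords G D P M) (pre := [n] ++ adjBits G) (mid := [D.length])
    (post := D.flatMap bits ++ [P.length] ++ P.flatMap bits ++
    [M.length] ++ M.flatMap fun b => bits b.1 ++ bits b.2) (by simp [inputWords]) (j := 0)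
    (o := E.par .pD - 1) (by simp [length_adjBits, hE.par_pD]) (by simp) d
  simpa using this

theorem getD_inputWords_D {j : ℕ} (hj : j < D.length * n) :
    (inputWords G D P M).getD (E.par .pD + j) d = (D.flatMap bits).getD j d :=
  getD_middle (pre := [n] ++ adjBits G ++ [D.length]) (post := [P.length] ++ P.flatMap bits ++
    [M.length] ++ M.flatMap fun b => bits b.1 ++ bits b.2) (by simp [inputWords])
    (by simp [length_adjBits, hE.par_pD]) (by rwa [length_flatMap_const length_bits]) d

theorem getD_inputWords_nP : (inputWords G D P M).getD (E.par .pP - 1) d = P.length := by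
  have := getD_middle (L := inputWords G D P M) (pre := [n] ++ adjBits G ++ [D.length] ++
    D.flatMap bits) (mid := [P.length]) (post := P.flatMap bits ++
    [M.length] ++ M.flatMap fun b => bits b.1 ++ bits b.2) (by simp [inputWords]) (j := 0)
    (o := E.par .pP - 1) (by
      simp only [List.length_append, List.length_singleton, length_adjBits,
        length_flatMap_const length_bits, hE.par_pP, hE.par_pD, Nat.add_sub_cancel]
      ring) (by simp) d
  simpa using this

theorem getD_inputWords_P {j : ℕ} (hj : j < P.length * n) :
    (inputWords G D P M).getD (E.par .pP + j) d = (P.flatMap bits).getD j d :=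
  getD_middle (pre := [n] ++ adjBits G ++ [D.length] ++ D.flatMap bits ++ [P.length])
    (post := [M.length] ++ M.flatMap fun b => bits b.1 ++ bits b.2) (by simp [inputWords])
    (by
      simp only [List.length_append, List.length_singleton, length_adjBits,
        length_flatMap_const length_bits, hE.par_pP, hE.par_pD]
      ring) (by rwa [length_flatMap_const length_bits]) d

theorem getD_inputWords_nM : (inputWords G D P M).getD (E.par .pM - 1) d = M.length := by
  have := getD_middle (L := inputWords G D P M) (pre := [n] ++ adjBits G ++ [D.length] ++
    D.flatMap bits ++ [P.length] ++ P.flatMap bits) (mid := [M.length])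
    (post := M.flatMap fun b => bits b.1 ++ bits b.2) (by simp [inputWords]) (j := 0)
    (o := E.par .pM - 1) (by
      simp only [List.length_append, List.length_singleton, length_adjBits,
        length_flatMap_const length_bits, hE.par_pM, hE.par_pP, hE.par_pD, Nat.add_sub_cancel]
      ring) (by simp) d
  simpa using this

theorem getD_inputWords_M {j : ℕ} (hj : j < M.length * (n + n)) :
    (inputWords G D P M).getD (E.par .pM + j) d =
      (M.flatMap fun b => bits b.1 ++ bits b.2).getD j d :=
  getD_middle (pre := [n] ++ adjBits G ++ [D.length] ++ D.flatMap bits ++ [P.length] ++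
    P.flatMap bits ++ [M.length]) (post := []) (by simp [inputWords])
    (by
      simp only [List.length_append, List.length_singleton, length_adjBits,
        length_flatMap_const length_bits, hE.par_pM, hE.par_pP, hE.par_pD]
      ring) (by rwa [length_flatMap_const length_blockBits]) d

end Parts

theorem isInput_inputWords (hE : E.Locates n D P M) :
    IsInput E G D P M fun i => (inputWords G D P M).getD i 0 := by
  have hlist : ∀ {L : List (Finset (Fin n))} {i : ℕ}, i < L.length → ∀ v : Fin n,
      i * n + v < L.length * n := fun hi v => mul_add_lt hi v.2 le_rfl
  refine ⟨fun u v => ?_, fun i hi v => ?_, fun i hi v => ?_, fun j hj v => ?_, fun j hj v => ?_⟩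
  · classical
    have huv : u * n + v < n * n := mul_add_lt u.2 v.2 le_rfl
    have hu : (List.finRange n).getD u u = u := by
      rw [List.getD_eq_getElem _ _ (by rw [List.length_finRange]; exact u.2)]
      simp
    rw [add_assoc, getD_inputWords_adj hE 0 huv, adjBits,
      getD_flatMap (fun _ => length_bits _) (by rw [List.length_finRange]; exact u.2) v.2 u, hu]
    have := getD_bits (Finset.univ.filter fun j => G.Adj u j) v
    simp only [Finset.mem_filter, Finset.mem_univ, true_and] at this
    by_cases h : G.Adj u v
    · exact iff_of_true (this.1 h) h
    · exact iff_of_false (fun h' => Nat.zero_ne_one ((this.2 h).symm.trans h')) h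
  · rw [add_assoc, getD_inputWords_D hE 0 (hlist hi v), getD_flatMap length_bits hi v.2 ∅]
    exact getD_bits _ v
  · rw [add_assoc, getD_inputWords_P hE 0 (hlist hi v), getD_flatMap length_bits hi v.2 ∅]
    exact getD_bits _ v
  · have h := mul_add_lt (b := M.length * (n + n)) (r := v.val) hj (by omega) le_rfl
    rw [add_assoc, ← mul_add, getD_inputWords_M hE 0 h,
      getD_flatMap length_blockBits hj (by omega) (∅, ∅), List.getD_append _ _ _ _ (by simp [length_bits])]
    exact getD_bits _ v
  · have h := mul_add_lt (b := M.length * (n + n)) (r := n + v.val) hj (by omega) le_rfl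
    rw [add_assoc, add_assoc, ← mul_add, getD_inputWords_M hE 0 h,
      getD_flatMap length_blockBits hj (by omega) (∅, ∅),
      List.getD_append_right _ _ _ _ (by simp [length_bits]), length_bits, Nat.add_sub_cancel_left]
    exact getD_bits _ v

theorem isInputVal_inputVals : IsInputVal f P M fun i => (inputVals f P M).getD i 0 := by
  refine ⟨fun o ho => ?_, fun j hj => ?_⟩
  · simp only [inputVals]
    rw [List.getD_append _ _ _ _ (by simpa), List.getD_eq_getElem _ _ (by simpa),
      List.getElem_map, List.getD_eq_getElem _ _ ho]
  · simp only [inputVals]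
    rw [List.getD_append_right _ _ _ _ (by simp), List.length_map, Nat.add_sub_cancel_left,
      List.getD_eq_getElem _ _ (by simpa), List.getElem_map, List.getD_eq_getElem _ _ hj]

theorem mem_bits_le {S : Finset (Fin n)} {x : ℕ} (h : x ∈ bits S) : x ≤ 1 := by
  simp only [bits, List.mem_ofFn] at h
  obtain ⟨i, rfl⟩ := h
  split_ifs <;> omega

theorem getD_inputWords_lt {W : ℕ} (h1 : 1 < W) (hn : n < W) (hD : D.length < W) (hP : P.length < W)
    (hM : M.length < W) (i : ℕ) : (inputWords G D P M).getD i 0 < W := by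
  have key : ∀ x ∈ inputWords G D P M, x < W := by
    intro x hx
    simp only [inputWords, adjBits, List.mem_append, List.mem_singleton, List.mem_flatMap] at hx
    rcases hx with ((((((rfl | ⟨_, _, h⟩) | rfl) | ⟨_, _, h⟩) | rfl) | ⟨_, _, h⟩) | rfl) |
      ⟨_, _, h | h⟩
    all_goals first | assumption | exact (mem_bits_le h).trans_lt h1
  by_cases hi : i < (inputWords G D P M).length
  · rw [List.getD_eq_getElem _ _ hi]
    exact key _ (List.getElem_mem hi)
  · rw [List.getD_eq_default _ _ (by omega)]
    omega

/-- Every separator has at most `n` full components. -/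
theorem length_minFullBlocks_le (hn : 0 < n) (hD : IsListing D (minSeps G))
    (hM : IsListing M (minFullBlocks G)) : M.length ≤ n * D.length := by
  have : Nonempty (Fin n) := ⟨⟨0, hn⟩⟩
  choose! g hg using fun (b : Finset (Fin n) × Finset (Fin n)) (hb : b ∈ fullBlocks G) =>
    hb.2.1.nonempty
  have hmem : ∀ b ∈ M.toFinset, b ∈ fullBlocks G := fun b hb =>
    ((hM.2 b).1 (List.mem_toFinset.1 hb)).1
  have hle := Finset.card_le_card_of_injOn (s := M.toFinset)
    (t := (Finset.univ : Finset (Fin n)) ×ˢ D.toFinset) (fun b => (g b, b.1))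
    (fun b hb => by
      have hb' := hmem b hb
      simpa using (hD.2 b.1).2 hb'.1) (by
      intro b hb b' hb' he
      have h1 := hmem b hb
      have h2 := hmem b' hb'
      obtain ⟨he1, he2⟩ := Prod.mk.inj he
      refine Prod.ext he2 ?_
      have h3 := h1.2.1.eq_compOf (hg b h1)
      have h4 := h2.2.1.eq_compOf (hg b' h2)
      rw [h3, h4, he1, he2])
  rw [Finset.card_product, Finset.card_univ, Fintype.card_fin, List.toFinset_card_of_nodup hM.1,
    List.toFinset_card_of_nodup hD.1] at hle
  exact hle

end Input

/-! ### The machine program -/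

section Machine

local infixr:20 " ;; " => Program.seq

/-- The parameters for lists of the given lengths. -/
def inputEnv (n nD nP nM : ℕ) : Env where
  par
    | .n => n
    | .nD => nD
    | .nP => nP
    | .nM => nM
    | .pD => n * n + 2
    | .pP => n * n + 2 + n * nD + 1
    | .pM => n * n + 2 + n * nD + 1 + n * nP + 1
  bound := 16 * (n * nD * n + n * nP * n * n)

/-- Reads the parameters of the input. The length of the input is put into register `14`, to
become the base address of the arrays. -/
def lengthsProg : Program :=
  .assign 7 (.load (.const 0)) ;;
  mulProg 0 (.reg 7) (.reg 7) ;;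
  .assign 11 (.add (.reg 0) (.const 2)) ;;
  .assign 8 (.load (.sub (.reg 11) (.const 1))) ;;
  mulProg 1 (.reg 7) (.reg 8) ;;
  .assign 12 (.add (.add (.reg 11) (.reg 1)) (.const 1)) ;;
  .assign 9 (.load (.sub (.reg 12) (.const 1))) ;;
  mulProg 2 (.reg 7) (.reg 9) ;;
  .assign 13 (.add (.add (.reg 12) (.reg 2)) (.const 1)) ;;
  .assign 10 (.load (.sub (.reg 13) (.const 1))) ;;
  mulProg 3 (.reg 7) (.reg 10) ;;
  .assign 14 (.add (.add (.reg 13) (.reg 3)) (.reg 3))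

/-- Computes the bound on the stored numbers, and the number of values in the input. -/
def boundProg : Program :=
  mulProg 4 (.reg 1) (.reg 7) ;;
  mulProg 5 (.reg 2) (.reg 7) ;;
  mulProg 6 (.reg 5) (.reg 7) ;;
  .assign 6 (.add (.reg 4) (.reg 6)) ;;
  .assign 6 (.add (.reg 6) (.reg 6)) ;;
  .assign 6 (.add (.reg 6) (.reg 6)) ;;
  .assign 6 (.add (.reg 6) (.reg 6)) ;;
  .assign 15 (.add (.reg 6) (.reg 6)) ;;
  .assign 0 (.add (.reg 9) (.reg 10))

/-- The quantities that occur in the running time are at most `T`. -/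
structure Sizes (n nD nP nM T : ℕ) : Prop where
  n_pos : 0 < n
  n_le : n ≤ n * n
  nn_le : n * n ≤ T
  nD_le : nD ≤ n * nD
  nnD_le : n * nD ≤ n * nD * n
  nP_pos : 0 < nP
  nP_le : nP ≤ n * nP
  nnP_le : n * nP ≤ n * nP * n
  nnnP_le : n * nP * n ≤ n * nP * n * n
  nM_le : nM ≤ n * nM
  nnM_le : n * nM ≤ n * nD * n
  sum_eq : n * nD * n + n * nP * n * n = T

theorem sizes {n nD nP nM T : ℕ} (hn : 0 < n) (hP : 0 < nP) (hM : nM ≤ n * nD)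
    (hT : T = n ^ 2 * nD + n ^ 3 * nP) : Sizes n nD nP nM T where
  n_pos := hn
  n_le := Nat.le_mul_of_pos_left _ hn
  nn_le := by
    calc n * n = n ^ 2 * 1 := by ring
      _ ≤ n ^ 3 * nP := Nat.mul_le_mul (Nat.pow_le_pow_right hn (by omega)) hP
      _ ≤ T := by omega
  nD_le := Nat.le_mul_of_pos_left _ hn
  nnD_le := Nat.le_mul_of_pos_right _ hn
  nP_pos := hP
  nP_le := Nat.le_mul_of_pos_left _ hn
  nnP_le := Nat.le_mul_of_pos_right _ hn
  nnnP_le := Nat.le_mul_of_pos_right _ hn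
  nM_le := Nat.le_mul_of_pos_left _ hn
  nnM_le := by
    calc n * nM ≤ n * (n * nD) := Nat.mul_le_mul_left _ hM
      _ = n * nD * n := by ring
  sum_eq := by rw [hT]; ring

variable {n nD nP nM T W : ℕ}

theorem exec_lengthsProg (h : Sizes n nD nP nM T) (hW : 1000 * T ≤ W) (s : State)
    (h0 : s.mem 0 = n) (h1 : s.mem (n * n + 2 - 1) = nD)
    (h2 : s.mem (n * n + 2 + n * nD + 1 - 1) = nP)
    (h3 : s.mem (n * n + 2 + n * nD + 1 + n * nP + 1 - 1) = nM) :
    ∃ k s', Exec W lengthsProg s k s' ∧ k ≤ 500 * T ∧ s'.mem = s.mem ∧ s'.val = s.val ∧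
      s'.reg 14 = n * n + 2 + n * nD + 1 + n * nP + 1 + n * nM + n * nM ∧
      (∀ p : Par, s'.reg p.code = (inputEnv n nD nP nM).par p) ∧ s'.reg 1 = n * nD ∧
      s'.reg 2 = n * nP ∧ ∀ z, 16 < z → s'.reg z = s.reg z := by
  cases h
  obtain ⟨k1, s1, e1, c1, m1, v1, r1, f1⟩ := sets_assign (W := W) (s := s) (x := 7)
    (e := .load (.const 0)) (v := n) (by simp [Expr.eval, h0]) (by omega)
  obtain ⟨k2, s2, e2, c2, m2, v2, r2, f2⟩ := sets_mul (W := W) (s := s1) (dst := 0) (x := 7) (y := 7)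
    (a := n) (b := n) r1 r1 (by omega)
    (by omega)
  obtain ⟨k3, s3, e3, c3, m3, v3, r3, f3⟩ := sets_assign (W := W) (s := s2) (x := 11)
    (e := .add (.reg 0) (.const 2)) (v := n * n + 2) (by simp [Expr.eval, r2]) (by omega)
  obtain ⟨k4, s4, e4, c4, m4, v4, r4, f4⟩ := sets_assign (W := W) (s := s3) (x := 8)
    (e := .load (.sub (.reg 11) (.const 1))) (v := nD)
    (by simp only [Expr.eval, r3, m1, m2, m3, h1]) (by omega)
  obtain ⟨k5, s5, e5, c5, m5, v5, r5, f5⟩ := sets_mul (W := W) (s := s4) (dst := 1) (x := 7) (y := 8)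
    (a := n) (b := nD) (by simp [f4, f3, f2, r1]) r4 (by omega) (by omega)
  obtain ⟨k6, s6, e6, c6, m6, v6, r6, f6⟩ := sets_assign (W := W) (s := s5) (x := 12)
    (e := .add (.add (.reg 11) (.reg 1)) (.const 1)) (v := n * n + 2 + n * nD + 1)
    (by simp [Expr.eval, r5, f5, f4, r3]) (by omega)
  obtain ⟨k7, s7, e7, c7, m7, v7, r7, f7⟩ := sets_assign (W := W) (s := s6) (x := 9)
    (e := .load (.sub (.reg 12) (.const 1))) (v := nP)
    (by simp only [Expr.eval, r6, m1, m2, m3, m4, m5, m6, h2]) (by omega)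
  obtain ⟨k8, s8, e8, c8, m8, v8, r8, f8⟩ := sets_mul (W := W) (s := s7) (dst := 2) (x := 7) (y := 9)
    (a := n) (b := nP) (by simp [f7, f6, f5, f4, f3, f2, r1]) r7 (by omega) (by omega)
  obtain ⟨k9, s9, e9, c9, m9, v9, r9, f9⟩ := sets_assign (W := W) (s := s8) (x := 13)
    (e := .add (.add (.reg 12) (.reg 2)) (.const 1)) (v := n * n + 2 + n * nD + 1 + n * nP + 1)
    (by simp [Expr.eval, r8, f8, f7, r6]) (by omega)
  obtain ⟨k10, s10, e10, c10, m10, v10, r10, f10⟩ := sets_assign (W := W) (s := s9) (x := 10)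
    (e := .load (.sub (.reg 13) (.const 1))) (v := nM)
    (by simp only [Expr.eval, r9, m1, m2, m3, m4, m5, m6, m7, m8, m9, h3]) (by omega)
  obtain ⟨k11, s11, e11, c11, m11, v11, r11, f11⟩ := sets_mul (W := W) (s := s10) (dst := 3) (x := 7)
    (y := 10) (a := n) (b := nM) (by simp [f10, f9, f8, f7, f6, f5, f4, f3, f2, r1]) r10 (by omega)
    (by omega)
  obtain ⟨k12, s12, e12, c12, m12, v12, r12, f12⟩ := sets_assign (W := W) (s := s11) (x := 14)
    (e := .add (.add (.reg 13) (.reg 3)) (.reg 3))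
    (v := n * n + 2 + n * nD + 1 + n * nP + 1 + n * nM + n * nM)
    (by simp [Expr.eval, r11, f11, f10, r9]) (by omega)
  have g7 : s11.reg 7 = n := by simp [f11, f10, f9, f8, f7, f6, f5, f4, f3, f2, r1]
  simp only [Expr.cost] at c1 c3 c4 c6 c7 c9 c10 c12
  clear h0 h1 h2 h3 r1 r2
  refine ⟨_, s12, .seq e1 (.seq e2 (.seq e3 (.seq e4 (.seq e5 (.seq e6 (.seq e7 (.seq e8 (.seq e9
    (.seq e10 (.seq e11 e12)))))))))), by omega, ?_, ?_, r12, ?_, ?_, ?_, ?_⟩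
  · rw [m12, m11, m10, m9, m8, m7, m6, m5, m4, m3, m2, m1]
  · rw [v12, v11, v10, v9, v8, v7, v6, v5, v4, v3, v2, v1]
  · intro p
    cases p
    · exact (f12 7 (by decide) (by decide)).trans g7
    · exact (f12 8 (by decide) (by decide)).trans (by simp [f11, f10, f9, f8, f7, f6, f5, r4]; rfl)
    · exact (f12 9 (by decide) (by decide)).trans (by simp [f11, f10, f9, f8, r7]; rfl)
    · exact (f12 10 (by decide) (by decide)).trans (by simp [f11, r10]; rfl)
    · exact (f12 11 (by decide) (by decide)).trans
        (by simp [f11, f10, f9, f8, f7, f6, f5, f4, r3]; rfl)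
    · exact (f12 12 (by decide) (by decide)).trans (by simp [f11, f10, f9, f8, f7, r6]; rfl)
    · exact (f12 13 (by decide) (by decide)).trans (by simp [f11, f10, r9]; rfl)
  · simp [f12, f11, f10, f9, f8, f7, f6, r5]
  · simp [f12, f11, f10, f9, r8]
  · intro z hz
    rw [f12, f11, f10, f9, f8, f7, f6, f5, f4, f3, f2, f1] <;> omega

theorem exec_boundProg (h : Sizes n nD nP nM T) (hW : 1000 * T ≤ W) (s : State)
    (h1 : s.reg 1 = n * nD) (h2 : s.reg 2 = n * nP) (h7 : s.reg 7 = n) (h9 : s.reg 9 = nP)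
    (h10 : s.reg 10 = nM) :
    ∃ k s', Exec W boundProg s k s' ∧ k ≤ 500 * T ∧ s'.mem = s.mem ∧ s'.val = s.val ∧
      s'.reg 15 = 16 * T ∧ s'.reg 0 = nP + nM ∧
      (∀ z, 7 ≤ z → z ≤ 14 → s'.reg z = s.reg z) ∧ ∀ z, 16 < z → s'.reg z = s.reg z := by
  have b12 := h.sum_eq
  cases h
  obtain ⟨k13, s13, e13, c13, m13, v13, r13, f13⟩ := sets_mul (W := W) (s := s) (dst := 4) (x := 1)
    (y := 7) (a := n * nD) (b := n) h1 h7 (by omega) (by omega)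
  obtain ⟨k14, s14, e14, c14, m14, v14, r14, f14⟩ := sets_mul (W := W) (s := s13) (dst := 5) (x := 2)
    (y := 7) (a := n * nP) (b := n) (by simp [f13, h2]) (by simp [f13, h7]) (by omega) (by omega)
  obtain ⟨k15, s15, e15, c15, m15, v15, r15, f15⟩ := sets_mul (W := W) (s := s14) (dst := 6) (x := 5)
    (y := 7) (a := n * nP * n) (b := n) r14 (by simp [f14, f13, h7]) (by omega) (by omega)
  obtain ⟨k16, s16, e16, c16, m16, v16, r16, f16⟩ := sets_assign (W := W) (s := s15) (x := 6)
    (e := .add (.reg 4) (.reg 6)) (v := T)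
    (by simp [Expr.eval, r15, f15, f14, r13, b12]) (by omega)
  obtain ⟨k17, s17, e17, c17, m17, v17, r17, f17⟩ := sets_assign (W := W) (s := s16) (x := 6)
    (e := .add (.reg 6) (.reg 6)) (v := 2 * T)
    (by simp only [Expr.eval, r16]; omega) (by omega)
  obtain ⟨k18, s18, e18, c18, m18, v18, r18, f18⟩ := sets_assign (W := W) (s := s17) (x := 6)
    (e := .add (.reg 6) (.reg 6)) (v := 4 * T)
    (by simp only [Expr.eval, r17]; omega) (by omega)
  obtain ⟨k19, s19, e19, c19, m19, v19, r19, f19⟩ := sets_assign (W := W) (s := s18) (x := 6)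
    (e := .add (.reg 6) (.reg 6)) (v := 8 * T)
    (by simp only [Expr.eval, r18]; omega) (by omega)
  obtain ⟨k20, s20, e20, c20, m20, v20, r20, f20⟩ := sets_assign (W := W) (s := s19) (x := 15)
    (e := .add (.reg 6) (.reg 6)) (v := 16 * T)
    (by simp only [Expr.eval, r19]; omega) (by omega)
  have hf : ∀ z, z ≠ 16 → z ≠ 4 → z ≠ 5 → z ≠ 6 → z ≠ 15 → s20.reg z = s.reg z := by
    intro z h1 h3 h4 h5 h6
    rw [f20 z h1 h6, f19 z h1 h5, f18 z h1 h5, f17 z h1 h5, f16 z h1 h5, f15 z h1 h5, f14 z h1 h4,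
      f13 z h1 h3]
  obtain ⟨k21, s21, e21, c21, m21, v21, r21, f21⟩ := sets_assign (W := W) (s := s20) (x := 0)
    (e := .add (.reg 9) (.reg 10)) (v := nP + nM)
    (by simp [Expr.eval, hf, h9, h10]) (by omega)
  simp only [Expr.cost] at c16 c17 c18 c19 c20 c21
  refine ⟨_, s21, .seq e13 (.seq e14 (.seq e15 (.seq e16 (.seq e17 (.seq e18
    (.seq e19 (.seq e20 e21))))))), by omega, ?_, ?_, ?_, r21, fun z hz hz' => ?_, fun z hz => ?_⟩
  · rw [m21, m20, m19, m18, m17, m16, m15, m14, m13]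
  · rw [v21, v20, v19, v18, v17, v16, v15, v14, v13]
  · rw [f21 15 (by decide) (by decide), r20]
  · rw [f21, hf] <;> omega
  · rw [f21, hf] <;> omega

/-- The state of the program with the input `words` and `vals`. -/
def inputState (words : ℕ → ℕ) (vals : ℕ → ℝ≥0∞) : HState where
  r _ := 0
  a k := if k = .inp then words else fun _ => 0
  v k := if k = .inp then vals else fun _ => 0

/-- Computes the parameters and copies the input to the arrays `inp`. -/
def preludeProg : Program :=
  lengthsProg ;; boundProg ;;
  copyProg moveMem (.const 0) (.reg 14) (.reg 14) 1 32 ;;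
  copyProg moveVal (.const 0) (.reg 14) (.reg 0) 1 32

theorem exec_preludeProg (h : Sizes n nD nP nM T) (hW : 1000 * T ≤ W) {words : ℕ → ℕ}
    {vals : ℕ → ℝ≥0∞} (h0 : words 0 = n) (h1 : words (n * n + 2 - 1) = nD)
    (h2 : words (n * n + 2 + n * nD + 1 - 1) = nP)
    (h3 : words (n * n + 2 + n * nD + 1 + n * nP + 1 - 1) = nM) (hw : ∀ i, words i < W) {B : ℕ}
    (hB : B = n * n + 2 + n * nD + 1 + n * nP + 1 + n * nM + n * nM)
    (h4 : ∀ i, B ≤ i → words i = 0) (h5 : ∀ i, nP + nM ≤ i → vals i = 0) :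
    ∃ k s', Exec W preludeProg ⟨fun _ => 0, words, vals⟩ k s' ∧ k ≤ 2000 * T ∧
      s'.Holds (inputEnv n nD nP nM) B ∧ s'.view B = inputState words vals := by
  obtain ⟨k0, s0, e0, c0, m0, v0, q1, q2, q3, q4, q5⟩ :=
    exec_lengthsProg h hW ⟨fun _ => 0, words, vals⟩ h0 h1 h2 h3
  obtain ⟨k1, s1, e1, c1, m1, v1, p1, r0, p2, p3⟩ :=
    exec_boundProg h hW s0 q3 q4 (q2 .n) (q2 .nP) (q2 .nM)
  have hs : s1.Holds (inputEnv n nD nP nM) B := by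
    refine ⟨?_, ?_, fun p => ?_⟩
    · rw [p2 14 (by decide) (by decide), q1, hB]
    · rw [p1, ← h.sum_eq]
      rfl
    · have := p.code_le
      rw [p2 _ (by omega) (by omega), q2]
  have r1 : ∀ z, 16 < z → s1.reg z = 0 := fun z hz => (p3 z hz).trans (q5 z hz)
  rw [m0] at m1
  rw [v0] at v1
  clear q1 q2 q3 q4 q5 p1 p2 p3
  cases h
  dsimp only at m1 v1
  have hb := hs.base
  obtain ⟨k2, s2, e2, c2, v2, r2, g2, g2'⟩ := exec_copyMem (W := W) (s := s1) (src := .const 0)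
    (dst := .reg 14) (y := 14) (sk := 1) (dk := 32) (p₀ := 0) (q₀ := B) (by decide) (by decide)
    (fun _ _ => rfl) (fun ρ hρ => (hρ 14 (by decide)).trans hb) (by omega) (by omega) (by omega)
    (fun j hj j' _ => by omega) (fun j _ => by rw [m1]; exact hw _)
  obtain ⟨k3, s3, e3, c3, m3, r3, g3, g3'⟩ := exec_copyVal (W := W) (s := s2) (src := .const 0)
    (dst := .reg 14) (y := 0) (sk := 1) (dk := 32) (p₀ := 0) (q₀ := B) (by decide) (by decide)
    (fun _ _ => rfl) (fun ρ hρ => (hρ 14 (by decide)).trans ((r2 14 (by decide)).trans hb))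
    (by rw [r2 0 (by decide)]; omega) (by rw [r2 0 (by decide)]; omega)
    (by rw [r2 0 (by decide)]; omega) (fun j hj j' _ => by
      rw [r2 0 (by decide)] at hj
      omega)
  rw [r2 0 (by decide), r0] at c3 g3 g3'
  rw [hb] at c2 g2 g2'
  have hreg : ∀ x, x < 16 ∨ 18 < x → s3.reg x = s1.reg x := fun x hx => (r3 x hx).trans (r2 x hx)
  simp only [Expr.cost] at c2 c3
  refine ⟨_, s3, .seq e0 (.seq e1 (.seq e2 e3)), by omega, ⟨?_, ?_, fun p => ?_⟩,
    HState.ext ?_ ?_ ?_⟩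
  · rw [hreg 14 (by decide), hb]
  · rw [hreg 15 (by decide), hs.bound]
  · have := p.code_le
    rw [hreg _ (by omega), hs.par]
  · funext x
    have := x.code_ge
    simp only [State.view, inputState]
    rw [hreg _ (by omega), r1 _ (by omega)]
  · funext k i
    simp only [State.view, inputState, m3]
    have hk := k.code_lt
    by_cases hki : k = .inp ∧ i < B
    · obtain ⟨rfl, hi⟩ := hki
      have := g2 i hi
      rw [m1] at this
      simpa [Arr.code, Arr.ctorIdx] using this
    · rw [g2', m1, h4 _ (by omega)]
      · split_ifs with hk
        · exact (h4 i (by have : ¬ i < B := fun h => hki ⟨hk, h⟩; omega)).symm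
        · rfl
      · intro j hj he
        have hc : k.code = (Arr.inp).code := by
          have : (Arr.inp).code = 0 := rfl
          omega
        have := Arr.code_inj hc
        subst this
        have : (Arr.inp).code = 0 := rfl
        exact hki ⟨rfl, by omega⟩
  · funext k i
    simp only [State.view, inputState]
    have hk := k.code_lt
    by_cases hki : k = .inp ∧ i < nP + nM
    · obtain ⟨rfl, hi⟩ := hki
      have := g3 i hi
      rw [v2, v1] at this
      simpa [VArr.code, VArr.ctorIdx] using this
    · rw [g3', v2, v1, h5 _ (by omega)]
      · split_ifs with hk
        · exact (h5 i (by have : ¬ i < nP + nM := fun h => hki ⟨hk, h⟩; omega)).symm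
        · rfl
      · intro j hj he
        have hc : k.code = (VArr.inp).code := by
          have : (VArr.inp).code = 0 := rfl
          omega
        have := VArr.code_inj hc
        subst this
        have : (VArr.inp).code = 0 := rfl
        exact hki ⟨rfl, by omega⟩

end Machine

/-- The numbers in arrays stay below the word bound. -/
theorem HCmd.run_lt {E : Env} {W : ℕ} (hW : E.bound ≤ W) (p : HCmd) {σ : HState}
    (h : ∀ k i, σ.a k i < W) (k : Arr) (i : ℕ) : (p.run E σ).a k i < W := by
  induction p generalizing σ k i with
  | skip => exact h k i
  | assign x e =>
    simp only [run]
    split_ifs <;> exact h k i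
  | store l j e =>
    simp only [run]
    split_ifs with hc
    · by_cases hk : k = l
      · subst hk
        by_cases hi : i = j.eval E σ
        · simpa [HState.setA, hi] using hc.2.trans_le hW
        · simpa [HState.setA, hi] using h k i
      · simpa [HState.setA, hk] using h k i
    · exact h k i
  | vcopy l j l' e =>
    simp only [run]
    split_ifs <;> exact h k i
  | vtop l j =>
    simp only [run]
    split_ifs <;> exact h k i
  | seq p q ihp ihq => exact ihq (fun k i => ihp h k i) k i
  | ite t p q ihp ihq =>
    simp only [run]
    split_ifs
    exacts [ihp h k i, ihq h k i]
  | loop x y m p ih =>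
    simp only [run]
    induction E.par m generalizing k i with
    | zero => exact h k i
    | succ j ih' => exact ih (fun k i => ih' k i) k i

section Machine

local infixr:20 " ;; " => Program.seq

/-- Moves the results out of the interleaved arrays, to the places where the output is read. -/
def epilogueProg : Program :=
  .assign 0 (.reg Reg.nodes.code) ;;
  .assign 4 (.reg Reg.nblk.code) ;;
  .assign 7 (.reg Reg.bagEnd.code) ;;
  .assign 8 (.reg Reg.obEnd.code) ;;
  .assign 1 (.add (.reg 14) (Expr.mul32 (.reg 15))) ;;
  .assign 2 (.add (.reg 1) (.reg 15)) ;;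
  .assign 5 (.add (.reg 2) (.reg 15)) ;;
  .assign 6 (.add (.reg 5) (.reg 15)) ;;
  .assign 3 (.add (.reg 14) (.const VArr.best.code)) ;;
  copyProg moveMem (.add (.reg 14) (.const Arr.par.code)) (.reg 1) (.reg 0) 32 1 ;;
  copyProg moveMem (.add (.reg 14) (.const Arr.bag.code)) (.reg 2) (.reg 7) 32 1 ;;
  copyProg moveMem (.add (.reg 14) (.const Arr.ob.code)) (.reg 5) (.reg 8) 32 1 ;;
  copyProg moveVal (.add (.reg 14) (.const VArr.out.code)) (.reg 6) (.reg 4) 32 1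

/-- The output registers of `s` and the arrays they refer to hold the results in `τ`. -/
structure Exports (τ : HState) (s : State) : Prop where
  nodes : s.reg 0 = τ.r .nodes
  nblk : s.reg 4 = τ.r .nblk
  par : ∀ j < τ.r .nodes, s.mem (s.reg 1 + j) = τ.a .par j
  bag : ∀ j < τ.r .bagEnd, s.mem (s.reg 2 + j) = τ.a .bag j
  ob : ∀ j < τ.r .obEnd, s.mem (s.reg 5 + j) = τ.a .ob j
  best : s.val (s.reg 3) = τ.v .best 0
  out : ∀ j < τ.r .nblk, s.val (s.reg 6 + j) = τ.v .out j

/-- The results go beyond the address `B + 32 V`, which the interleaved arrays do not reach. -/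
theorem exec_epilogueProg {E : Env} {B V W : ℕ} {s : State} (hs : s.Holds E B) (hV : E.bound = V)
    (hW : B + 36 * V + 32 < W) (hlt : ∀ k i, (s.view B).a k i < W)
    (h0 : (s.view B).r .nodes ≤ V) (h4 : (s.view B).r .nblk ≤ V)
    (h7 : (s.view B).r .bagEnd ≤ V) (h8 : (s.view B).r .obEnd ≤ V) :
    ∃ k s', Exec W epilogueProg s k s' ∧ k ≤ 84 * V + 500 ∧ Exports (s.view B) s' := by
  have hb := hs.base
  have hv := hs.bound.trans hV
  obtain ⟨m0, hm0⟩ : ∃ m, m = (s.view B).r .nodes := ⟨_, rfl⟩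
  obtain ⟨m4, hm4⟩ : ∃ m, m = (s.view B).r .nblk := ⟨_, rfl⟩
  obtain ⟨m7, hm7⟩ : ∃ m, m = (s.view B).r .bagEnd := ⟨_, rfl⟩
  obtain ⟨m8, hm8⟩ : ∃ m, m = (s.view B).r .obEnd := ⟨_, rfl⟩
  rw [← hm0] at h0
  rw [← hm4] at h4
  rw [← hm7] at h7
  rw [← hm8] at h8
  have hc (x : Reg) : x.code ≠ 16 ∧ x.code ≠ 0 ∧ x.code ≠ 4 ∧ x.code ≠ 7 := by
    have := x.code_ge
    omega
  obtain ⟨k1, s1, e1, c1, a1, v1, r1, f1⟩ := sets_assign (W := W) (s := s) (x := 0)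
    (e := .reg Reg.nodes.code) (v := m0) hm0.symm (by omega)
  obtain ⟨k2, s2, e2, c2, a2, v2, r2, f2⟩ := sets_assign (W := W) (s := s1) (x := 4)
    (e := .reg Reg.nblk.code) (v := m4)
    (by simp only [Expr.eval, ne_eq, hc, not_false_eq_true, f1, hm4]; rfl) (by omega)
  obtain ⟨k3, s3, e3, c3, a3, v3, r3, f3⟩ := sets_assign (W := W) (s := s2) (x := 7)
    (e := .reg Reg.bagEnd.code) (v := m7)
    (by simp only [Expr.eval, ne_eq, hc, not_false_eq_true, f2, f1, hm7]; rfl) (by omega)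
  obtain ⟨k4, s4, e4, c4, a4, v4, r4, f4⟩ := sets_assign (W := W) (s := s3) (x := 8)
    (e := .reg Reg.obEnd.code) (v := m8)
    (by simp only [Expr.eval, ne_eq, hc, not_false_eq_true, f3, f2, f1, hm8]; rfl) (by omega)
  obtain ⟨k5, s5, e5, c5, a5, v5, r5, f5⟩ := sets_assign (W := W) (s := s4) (x := 1)
    (e := .add (.reg 14) (Expr.mul32 (.reg 15))) (v := B + 32 * V)
    (by simp [Expr.eval, Expr.eval_mul32, f4, f3, f2, f1, hb, hv]) (by omega)
  obtain ⟨k6, s6, e6, c6, a6, v6, r6, f6⟩ := sets_assign (W := W) (s := s5) (x := 2)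
    (e := .add (.reg 1) (.reg 15)) (v := B + 33 * V)
    (by simp [Expr.eval, f5, f4, f3, f2, f1, r5, hv]; omega) (by omega)
  obtain ⟨k7, s7, e7, c7, a7, v7, r7, f7⟩ := sets_assign (W := W) (s := s6) (x := 5)
    (e := .add (.reg 2) (.reg 15)) (v := B + 34 * V)
    (by simp [Expr.eval, f6, f5, f4, f3, f2, f1, r6, hv]; omega) (by omega)
  obtain ⟨k8, s8, e8, c8, a8, v8, r8, f8⟩ := sets_assign (W := W) (s := s7) (x := 6)
    (e := .add (.reg 5) (.reg 15)) (v := B + 35 * V)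
    (by simp [Expr.eval, f7, f6, f5, f4, f3, f2, f1, r7, hv]; omega) (by omega)
  have hbc := VArr.code_lt .best
  obtain ⟨k9, s9, e9, c9, a9, v9, r9, f9⟩ := sets_assign (W := W) (s := s8) (x := 3)
    (e := .add (.reg 14) (.const VArr.best.code)) (v := B + VArr.best.code)
    (by simp [Expr.eval, f8, f7, f6, f5, f4, f3, f2, f1, hb]) (by omega)
  have am : s9.mem = s.mem := by rw [a9, a8, a7, a6, a5, a4, a3, a2, a1]
  have av : s9.val = s.val := by rw [v9, v8, v7, v6, v5, v4, v3, v2, v1]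
  have g0 : s9.reg 0 = m0 := by simp [f9, f8, f7, f6, f5, f4, f3, f2, r1]
  have g4 : s9.reg 4 = m4 := by simp [f9, f8, f7, f6, f5, f4, f3, r2]
  have g7 : s9.reg 7 = m7 := by simp [f9, f8, f7, f6, f5, f4, r3]
  have g8 : s9.reg 8 = m8 := by simp [f9, f8, f7, f6, f5, r4]
  have g1 : s9.reg 1 = B + 32 * V := by simp [f9, f8, f7, f6, r5]
  have g2 : s9.reg 2 = B + 33 * V := by simp [f9, f8, f7, r6]
  have g5 : s9.reg 5 = B + 34 * V := by simp [f9, f8, r7]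
  have g6 : s9.reg 6 = B + 35 * V := by simp [f9, r8]
  have g14 : s9.reg 14 = B := by simp [f9, f8, f7, f6, f5, f4, f3, f2, f1, hb]
  clear f1 f2 f3 f4 f5 f6 f7 f8 f9 r1 r2 r3 r4 r5 r6 r7 r8 a1 a2 a3 a4 a5 a6 a7 a8 a9 v1 v2 v3 v4
    v5 v6 v7 v8 v9 hb hv
  have hcp := Arr.code_lt .par
  have hcb := Arr.code_lt .bag
  have hco := Arr.code_lt .ob
  have hcv := VArr.code_lt .out
  have hsrc (k j : ℕ) : B + k + 32 * j = B + (32 * j + k) := by omega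
  obtain ⟨k10, s10, e10, c10, a10, f10, d10, d10'⟩ := exec_copyMem (W := W) (s := s9)
    (src := .add (.reg 14) (.const Arr.par.code)) (dst := .reg 1) (y := 0) (sk := 32) (dk := 1)
    (p₀ := B + Arr.par.code) (q₀ := B + 32 * V) (by decide) (by decide)
    (fun ρ hρ => by simp [Expr.eval, hρ, g14]) (fun ρ hρ => by simp [Expr.eval, hρ, g1])
    (by omega) (by omega) (by omega)
    (fun j hj j' _ => by omega) (fun j _ => by rw [hsrc, am]; exact hlt .par j)
  obtain ⟨k11, s11, e11, c11, a11, f11, d11, d11'⟩ := exec_copyMem (W := W) (s := s10)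
    (src := .add (.reg 14) (.const Arr.bag.code)) (dst := .reg 2) (y := 7) (sk := 32) (dk := 1)
    (p₀ := B + Arr.bag.code) (q₀ := B + 33 * V) (by decide) (by decide)
    (fun ρ hρ => by simp [Expr.eval, hρ, f10, g14]) (fun ρ hρ => by simp [Expr.eval, hρ, f10, g2])
    (by rw [f10 7 (by decide)]; omega) (by rw [f10 7 (by decide)]; omega)
    (by rw [f10 7 (by decide)]; omega)
    (fun j hj j' _ => by
      rw [f10 7 (by decide)] at hj
      omega)
    (fun j hj => by
      rw [f10 7 (by decide)] at hj
      rw [d10' _ fun j' _ => by omega, hsrc, am]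
      exact hlt .bag j)
  have f11' : ∀ x, x < 16 → s11.reg x = s9.reg x := fun x hx =>
    (f11 x (Or.inl hx)).trans (f10 x (Or.inl hx))
  obtain ⟨k12, s12, e12, c12, a12, f12, d12, d12'⟩ := exec_copyMem (W := W) (s := s11)
    (src := .add (.reg 14) (.const Arr.ob.code)) (dst := .reg 5) (y := 8) (sk := 32) (dk := 1)
    (p₀ := B + Arr.ob.code) (q₀ := B + 34 * V) (by decide) (by decide)
    (fun ρ hρ => by simp [Expr.eval, hρ, f11', g14]) (fun ρ hρ => by simp [Expr.eval, hρ, f11', g5])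
    (by rw [f11' 8 (by decide)]; omega) (by rw [f11' 8 (by decide)]; omega)
    (by rw [f11' 8 (by decide)]; omega)
    (fun j hj j' _ => by
      rw [f11' 8 (by decide)] at hj
      omega)
    (fun j hj => by
      rw [f11' 8 (by decide)] at hj
      rw [d11' _ fun j' _ => by omega, d10' _ fun j' _ => by omega, hsrc, am]
      exact hlt .ob j)
  have f12' : ∀ x, x < 16 → s12.reg x = s9.reg x := fun x hx =>
    (f12 x (Or.inl hx)).trans (f11' x hx)
  obtain ⟨k13, s13, e13, c13, a13, f13, d13, d13'⟩ := exec_copyVal (W := W) (s := s12)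
    (src := .add (.reg 14) (.const VArr.out.code)) (dst := .reg 6) (y := 4) (sk := 32) (dk := 1)
    (p₀ := B + VArr.out.code) (q₀ := B + 35 * V) (by decide) (by decide)
    (fun ρ hρ => by simp [Expr.eval, hρ, f12', g14]) (fun ρ hρ => by simp [Expr.eval, hρ, f12', g6])
    (by rw [f12' 4 (by decide)]; omega) (by rw [f12' 4 (by decide)]; omega)
    (by rw [f12' 4 (by decide)]; omega)
    (fun j hj j' _ => by
      rw [f12' 4 (by decide)] at hj
      omega)
  have f13' : ∀ x, x < 16 → s13.reg x = s9.reg x := fun x hx =>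
    (f13 x (Or.inl hx)).trans (f12' x hx)
  rw [g0] at c10 d10 d10'
  rw [f10 7 (by decide), g7] at c11 d11 d11'
  rw [f11' 8 (by decide), g8] at c12 d12 d12'
  rw [f12' 4 (by decide), g4] at c13 d13 d13'
  have val12 : s12.val = s.val := by rw [a12, a11, a10, av]
  simp only [Expr.cost, Expr.mul32] at c1 c2 c3 c4 c5 c6 c7 c8 c9 c10 c11 c12 c13
  refine ⟨_, s13, .seq e1 (.seq e2 (.seq e3 (.seq e4 (.seq e5 (.seq e6 (.seq e7 (.seq e8 (.seq e9
    (.seq e10 (.seq e11 (.seq e12 e13))))))))))), by omega,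
    ⟨?_, ?_, fun j hj => ?_, fun j hj => ?_, fun j hj => ?_, ?_, fun j hj => ?_⟩⟩
  · rw [f13' 0 (by decide), g0, hm0]
  · rw [f13' 4 (by decide), g4, hm4]
  · rw [← hm0] at hj
    have := d10 j hj
    rw [f13' 1 (by decide), g1, a13, d12' _ fun j' _ => by omega, d11' _ fun j' _ => by omega]
    rw [one_mul, hsrc, am] at this
    exact this
  · rw [← hm7] at hj
    have := d11 j hj
    rw [one_mul, d10' _ fun j' _ => by omega, hsrc, am] at this
    rw [f13' 2 (by decide), g2, a13, d12' _ fun j' _ => by omega]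
    exact this
  · rw [← hm8] at hj
    have := d12 j hj
    rw [one_mul, d11' _ fun j' _ => by omega, d10' _ fun j' _ => by omega, hsrc, am] at this
    rw [f13' 5 (by decide), g5, a13]
    exact this
  · rw [f13' 3 (by decide), r9, d13' _ fun j' _ => by omega, val12]
    simp only [State.view]
    rw [mul_zero, zero_add]
  · rw [← hm4] at hj
    have := d13 j hj
    rw [one_mul, hsrc, val12] at this
    rw [f13' 6 (by decide), g6]
    exact this

end Machine

section Output

variable {n : ℕ} {G : SimpleGraph (Fin n)} {f : Finset (Fin n) → ℝ≥0} {s : State} {τ : HState}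

theorem bitSet_congr {a b : ℕ → ℕ} {o o' : ℕ} (h : ∀ v < n, a (o + v) = b (o' + v)) :
    bitSet n a o = bitSet n b o' :=
  Finset.filter_congr fun v _ => by rw [h v v.2]

theorem Exports.readSet_bag (h : Exports τ s) (hend : τ.r .bagEnd = τ.r .nodes * n) {k : ℕ}
    (hk : k < τ.r .nodes) : readSet n s (s.reg 2 + k * n) = bitSet n (τ.a .bag) (k * n) :=
  bitSet_congr (a := s.mem) fun v hv => by
    rw [add_assoc, h.bag]
    rw [hend]
    exact mul_add_lt hk hv le_rfl

theorem Exports.readSet_ob (h : Exports τ s) {l : ℕ} (hend : τ.r .obEnd = l * n) {k : ℕ}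
    (hk : k < l) : readSet n s (s.reg 5 + k * n) = bitSet n (τ.a .ob) (k * n) :=
  bitSet_congr (a := s.mem) fun v hv => by
    rw [add_assoc, h.ob]
    rw [hend]
    exact mul_add_lt hk hv le_rfl

theorem Exports.isTreeDecomp (h : Exports τ s) {w : ℝ≥0∞} (hτ : HoldsDecomp G f w τ) :
    IsTreeDecomp G (outTree s) (outBags n s) ∧ (width f (outBags n s) : ℝ≥0∞) ≤ w := by
  have hbag (k : ℕ) (hk : k < τ.r .nodes) := h.readSet_bag hτ.bagEnd hk
  have hT := hτ.isTreeDecomp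
  have hw := hτ.bag_le
  have hpar := h.par
  unfold outTree outBags width
  rw [← h.nodes] at hT hw hbag hpar
  refine ⟨?_, ?_⟩
  · convert hT using 2 with i
    · refine congrArg SimpleGraph.fromRel (funext fun i => funext fun j => ?_)
      rw [hpar i i.2]
    · exact hbag i i.2
  · cases w using ENNReal.recTopCoe with
    | top => exact le_top
    | coe w =>
      refine ENNReal.coe_le_coe.2 (Finset.sup_le fun t _ => ENNReal.coe_le_coe.1 ?_)
      exact (congrArg (fun X => (f X : ℝ≥0∞)) (hbag t t.2)).trans_le (hw t t.2)

theorem Exports.outBlocks_eq (h : Exports τ s)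
    {A : Finset (Fin n) × Finset (Fin n) → ℝ≥0∞} {L : List (Finset (Fin n) × Finset (Fin n))}
    (hτ : HoldsBlocks n A L τ) : outBlocks n s = L ∧ outBlockValues s = L.map A := by
  have hl : s.reg 4 = L.length := h.nblk.trans hτ.nblk
  constructor
  · refine List.ext_getElem (by simp [outBlocks, hl]) fun k h1 h2 => ?_
    simp only [outBlocks, List.getElem_map, List.getElem_range]
    rw [h.readSet_ob hτ.obEnd (by omega), h.readSet_ob hτ.obEnd (by omega), (hτ.entry k h2).1,
      (hτ.entry k h2).2.1]
  · refine List.ext_getElem (by simp [outBlockValues, hl]) fun k h1 h2 => ?_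
    simp only [outBlockValues, List.getElem_map, List.getElem_range]
    rw [List.length_map] at h2
    rw [h.out k (by rw [hτ.nblk]; exact h2), (hτ.entry k h2).2.2]

end Output

section Run

variable {n : ℕ} {G : SimpleGraph (Fin n)} {f : Finset (Fin n) → ℝ≥0}
  {D P : List (Finset (Fin n))} {M : List (Finset (Fin n) × Finset (Fin n))} {T W : ℕ}

/-- The program for the random access machine. -/
def program : Program := .seq preludeProg (.seq mainCmd.compile epilogueProg)

theorem Sizes.bound_inputEnv {nD nP nM : ℕ} (h : Sizes n nD nP nM T) :
    (inputEnv n nD nP nM).bound = 16 * T := by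
  rw [← h.sum_eq]
  rfl

theorem suits_inputEnv (h : Sizes n D.length P.length M.length T) :
    (inputEnv n D.length P.length M.length).Suits n D P M where
  n_pos := h.n_pos
  par_n := rfl
  par_nD := rfl
  par_nP := rfl
  par_nM := rfl
  bound_n := by
    rw [h.bound_inputEnv]
    have := h.n_pos
    have := h.n_le
    have := h.nn_le
    omega
  bound_D := by
    rw [h.bound_inputEnv]
    have h1 : n * (D.length * n) = n * D.length * n := (mul_assoc _ _ _).symm
    have h2 : D.length * n = n * D.length := mul_comm _ _
    cases h
    omega
  bound_P := by
    rw [h.bound_inputEnv]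
    have h2 : P.length * n = n * P.length := mul_comm _ _
    cases h
    omega

theorem fits_inputEnv {nD nP nM B : ℕ} (h : Sizes n nD nP nM T) (hW : 1000 * T ≤ W)
    (hB : B = n * n + 2 + n * nD + 1 + n * nP + 1 + n * nM + n * nM) :
    (inputEnv n nD nP nM).Fits B W := by
  have hb := h.bound_inputEnv
  have h3 : n * n * n ≤ n * nP * n * n := by
    calc n * n * n = n * 1 * n * n := by ring
      _ ≤ n * nP * n * n := by gcongr; exact h.nP_pos
  cases h
  have p2 : (n * n + 2) * n = n * n * n + 2 * n := by ring
  have p3 : (n * n + 2 + n * nD + 1) * n = n * n * n + 3 * n + n * nD * n := by ring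
  have p4 : (n * n + 2 + n * nD + 1 + n * nP + 1) * n =
    n * n * n + 4 * n + n * nD * n + n * nP * n := by ring
  refine ⟨by omega, fun m => ?_, fun m => ?_⟩
  · cases m <;> simp only [inputEnv] <;> omega
  · cases m <;> simp only [inputEnv]
    · omega
    · rw [mul_comm]; omega
    · rw [mul_comm]; omega
    · rw [mul_comm]; omega
    · rw [p2]; omega
    · rw [p3]; omega
    · rw [p4]; omega

/-- The whole program, with the states at its end as the machine and the array language see them. -/
theorem exec_program (hn : 0 < n) (hf : Monotone f) (hD : IsListing D (minSeps G))
    (hP : IsListing P (pmcs G)) (hM : IsListing M (minFullBlocks G))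
    (hT : T = n ^ 2 * D.length + n ^ 3 * P.length) (hW : 1000 * T ≤ W) :
    0 < T ∧ ∃ k s L τ, Exec W program (initState G f D P M) k s ∧
      k ≤ (4000 + mainCmd.cost fun _ => 1) * T ∧ IsBlockOrder G L ∧
      HoldsBlocks n (blockTable G f P L) L τ ∧ HoldsDecomp G f (algorithmValue G f D P L) τ ∧
      Exports τ s := by
  have hP0 : 0 < P.length := by
    obtain ⟨Ω, hΩ⟩ := exists_isPMC G
    exact List.length_pos_of_mem ((hP.2 Ω).2 hΩ)
  have hM' := length_minFullBlocks_le hn hD hM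
  have hS := sizes hn hP0 hM' hT
  have hT0 : 0 < T := (Nat.mul_pos hn hn).trans_le hS.nn_le
  refine ⟨hT0, ?_⟩
  obtain ⟨B, hB⟩ : ∃ B, B = n * n + 2 + n * D.length + 1 + n * P.length + 1 + n * M.length +
    n * M.length := ⟨_, rfl⟩
  have hL : (inputEnv n D.length P.length M.length).Locates n D P M :=
    ⟨rfl, rfl, rfl, rfl, rfl, rfl, rfl⟩
  have hb := hS.bound_inputEnv
  have hE := suits_inputEnv hS
  have hF := fits_inputEnv hS hW hB
  have hword (i : ℕ) : (inputWords G D P M).getD i 0 < W := by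
    cases hS
    exact getD_inputWords_lt (by omega) (by omega) (by omega) (by omega) (by omega) i
  obtain ⟨k₁, s₁, e₁, c₁, hs₁, v₁⟩ := exec_preludeProg hS hW
    (words := fun i => (inputWords G D P M).getD i 0) (vals := fun i => (inputVals f P M).getD i 0)
    (getD_inputWords_n hL 0) (getD_inputWords_nD hL 0) (getD_inputWords_nP hL 0)
    (getD_inputWords_nM hL 0) hword hB
    (fun i hi => List.getD_eq_default _ _ (by rw [length_inputWords hL]; exact hB ▸ hi))
    (fun i hi => List.getD_eq_default _ _ (by simpa [inputVals] using hi))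
  obtain ⟨k₂, s₂, e₂, c₂, hs₂, v₂⟩ := mainCmd.exec_compile hF mainCmd_wf s₁ hs₁
  rw [v₁] at v₂
  have c₂' := c₂.trans (mainCmd.cost_le (N := (inputEnv n D.length P.length M.length).par) hn hP0
    hM' hT mainCmd_nest)
  obtain ⟨L, hord, hlen, hblk, hdec⟩ := run_mainCmd (f := f)
    (σ := inputState (fun i => (inputWords G D P M).getD i 0) fun i => (inputVals f P M).getD i 0) hE
    (isInput_inputWords hL) isInputVal_inputVals hD hP hM hf (fun _ => rfl) (fun _ => rfl) rfl
  have hlt := mainCmd.run_lt (E := inputEnv n D.length P.length M.length) (W := W)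
    (σ := inputState (fun i => (inputWords G D P M).getD i 0) fun i => (inputVals f P M).getD i 0)
    (by omega) (fun k i => by
      simp only [inputState]
      split_ifs
      exacts [hword i, show 0 < W by omega])
  rw [← v₂] at hblk hdec hlt
  have hlen' : L.length * n ≤ D.length * n * n := Nat.mul_le_mul_right _ hlen
  have q1 : D.length * n = n * D.length := mul_comm _ _
  have q2 : D.length * n * n = n * D.length * n := by ring
  have q3 : 2 * L.length * n = 2 * (L.length * n) := mul_assoc _ _ _
  have q4 : (s₂.view B).r .nodes * n ≤ (n + 1) * n := Nat.mul_le_mul_right _ hdec.nodes_le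
  have q5 : (n + 1) * n = n * n + n := Nat.succ_mul n n
  have hno := hdec.nodes_le
  have hbe := hdec.bagEnd
  have hoe := hblk.obEnd
  have hnb := hblk.nblk
  obtain ⟨c, hc⟩ : ∃ c, c = mainCmd.cost fun _ => 1 := ⟨_, rfl⟩
  rw [← hc] at c₂' ⊢
  cases hS
  obtain ⟨k₃, s₃, e₃, c₃, hX⟩ := exec_epilogueProg (W := W) hs₂ hb (by omega) hlt (by omega)
    (by omega) (by omega) (by omega)
  refine ⟨_, s₃, L, _, .seq e₁ (.seq e₂ e₃), ?_, hord, hblk, hdec, hX⟩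
  -- `4000 * T` covers the prelude and the epilogue, which copy a number of cells linear in `T`.
  rw [add_mul]
  omega

theorem IsListing.ncard_eq {α : Type*} {L : List α} {s : Set α} (h : IsListing L s) :
    s.ncard = L.length := by
  classical
  rw [← List.toFinset_card_of_nodup h.1, ← Set.ncard_coe_finset]
  congr 1
  ext x
  simp [h.2]

end Run

end FTW

end

open FTW

theorem mainTheorem3 :
    ∃ (p : Program) (c : ℕ), ∀ (n : ℕ) (_ : 0 < n) (G : SimpleGraph (Fin n))
      (f : Finset (Fin n) → ℝ≥0) (_ : Monotone f)
      (D P : List (Finset (Fin n))) (M : List (Finset (Fin n) × Finset (Fin n)))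
      (_ : IsListing D (minSeps G)) (_ : IsListing P (pmcs G))
      (_ : IsListing M (minFullBlocks G))
      (T : ℕ) (_ : T = n ^ 2 * (minSeps G).ncard + n ^ 3 * (pmcs G).ncard),
      (∀ L, IsBlockOrder G L → algorithmValue G f D P L = (ftw f G : ℝ≥0∞)) ∧
      ∃ (k : ℕ) (s : State),
        Exec (c * T ^ c) p (initState G f D P M) k s ∧
        k ≤ c * T ∧
        IsBlockOrder G (outBlocks n s) ∧
        outBlockValues s = (outBlocks n s).map (blockTable G f P (outBlocks n s)) ∧
        outValue s = algorithmValue G f D P (outBlocks n s) ∧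
        outValue s = (ftw f G : ℝ≥0∞) ∧
        IsTreeDecomp G (outTree s) (outBags n s) ∧
        width f (outBags n s) = ftw f G := by
  obtain ⟨c, hc⟩ : ∃ c, c = 4000 + mainCmd.cost fun _ => 1 := ⟨_, rfl⟩
  refine ⟨program, c, fun n hn G f hf D P M hD hP hM T hT => ?_⟩
  rw [hD.ncard_eq, hP.ncard_eq] at hT
  have hT0 : 0 < T := (exec_program hn hf hD hP hM hT le_rfl).1
  -- The exponent of the word bound is not needed: all addresses are below `1000 * T`.
  have hW : 1000 * T ≤ c * T ^ c :=
    Nat.mul_le_mul (by omega) (Nat.le_self_pow (by omega) T)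
  obtain ⟨-, k, s, L, τ, hexec, hk, hL, hblk, hdec, hX⟩ := exec_program hn hf hD hP hM hT hW
  obtain ⟨hout, hval⟩ := hX.outBlocks_eq hblk
  obtain ⟨htree, hwidth⟩ := hX.isTreeDecomp hdec
  have hle := algorithmValue_le_ftw hf hD hP hL
  have hge : (ftw f G : ℝ≥0∞) ≤ width f (outBags n s) := ENNReal.coe_le_coe.2 (ftw_le_width htree)
  have hopt : algorithmValue G f D P L = (ftw f G : ℝ≥0∞) := le_antisymm hle (hge.trans hwidth)
  have hbest : outValue s = algorithmValue G f D P L := hX.best.trans hdec.best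
  -- The value does not depend on the order, as the table solves the same recursion for all orders.
  refine ⟨fun L' hL' => ?_, k, s, hexec, hc ▸ hk, hout.symm ▸ hL, by rw [hval, hout],
    by rw [hout, hbest], hbest.trans hopt, htree, ?_⟩
  · rw [← hopt, algorithmValue_eq hD hP hL' (isTable_blockTable hP hL),
      algorithmValue_eq hD hP hL (isTable_blockTable hP hL)]
  · exact ENNReal.coe_injective (le_antisymm (hwidth.trans hle) hge)
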